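/- Let $p$ be a prime, let $n \ge 1$ and $0 \le d \le h$ be integers. For an $\mathbb{F}_p$-algebra $R$ let $W_n(R)$ be the ring of $p$-typical Witt vectors of length $n$, let $I_{n+1,R} \subset W_{n+1}(R)$ be the image of the Verschiebung $V \colon W_n(R) \to W_{n+1}(R)$, which is a $W_n(R)$-module because $pR = 0$, let $\sigma \colon W_n(R) \to W_n(R)$ be the ring homomorphism induced by the Frobenius of $R$, and let $\sigma_1 \colon I_{n+1,R} \to W_n(R)$ be the $\sigma$-linear bijection inverse to $V$. A truncated display of level $n$ over $R$ is a triple $(L,T,\Psi)$ of finitely generated projective $W_n(R)$-modules $L$, $T$ and a $\sigma$-linear automorphism $\Psi$ of $L \oplus T$ (a $\sigma$-linear map with bijective linearization). Put $F(l+t) = p\Psi(l) + \Psi(t)$ on $L \oplus T$ and $F_1(l + t \otimes \omega) = \Psi(l) + \sigma_1(\omega)\Psi(t)$ on $L \oplus (T \otimes_{W_n(R)} I_{n+1,R})$. A morphism $(L,T,\Psi) \to (L',T',\Psi')$ is a matrix $\begin{pmatrix} A & B \\ C & D\end{pmatrix}$ with $A \in \mathrm{Hom}(L,L')$, $B \in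 \mathrm{Hom}(T,L')$, $C \in \mathrm{Hom}(L,T' \otimes I_{n+1,R})$, $D \in \mathrm{Hom}(T,T')$, such that the induced maps $L\oplus T \to L' \oplus T'$ and $L \oplus (T \otimes I_{n+1,R}) \to L' \oplus (T' \otimes I_{n+1,R})$ commute with $F, F'$ and with $F_1, F_1'$. Let $\mathcal{D}isp_n^{h,d}$ be the stack over affine $\mathbb{F}_p$-schemes whose fibre over $\mathrm{Spec}\, R$ is the groupoid of truncated displays of level $n$ over $R$ such that $L \oplus T$ has constant rank $h$ and $T$ has constant rank $d$, with scalar extension as pull-back. Let $X_n^{h,d}(R) = \mathrm{GL}_h(W_n(R))$, and let $G_n^{h,d}(R)$ be the group of invertible block matrices $g = \begin{pmatrix} A & B \\ C & D\end{pmatrix}$ with $A$, $B$, $D$ matrices over $W_n(R)$ of sizes $(h-d)\times(h-d)$, $(h-d)\times d$, $d \times d$, and $C$ a $d \times (h-d)$ matrix with entries in $I_{n+1,R}$. Put $\sigma_1(g) = \begin{pmatrix} \sigma(A) & p\,\sigma(B) \\ \sigma_1(C) & \sigma(D)\end{pmatrix}$. The group functor $G_n^{h,d}$ acts on $X_n^{h,d}$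 by $g \cdot \Psi = g \Psi \sigma_1(g)^{-1}$, where the first factor $g$ is read as a matrix over $W_n(R)$ through $I_{n+1,R} \to W_n(R)$. Let $[X_n^{h,d}/G_n^{h,d}]$ be the quotient stack: its objects over $\mathrm{Spec}\, R$ are the étale $G_n^{h,d}$-torsors $P \to \mathrm{Spec}\, R$ with an equivariant map $P \to X_n^{h,d}$. To $\Psi \in X_n^{h,d}(R)$ let $\pi_n^{h,d}$ assign the truncated display $(W_n(R)^{h-d}, W_n(R)^d, x \mapsto \Psi\cdot\sigma(x))$; every $g \in G_n^{h,d}(R)$ defines an isomorphism $\pi_n^{h,d}(\Psi) \to \pi_n^{h,d}(g \cdot \Psi)$. Theorem. The functor $\pi_n^{h,d}$ induces an isomorphism of stacks over affine $\mathbb{F}_p$-schemes $$[X_n^{h,d}/G_n^{h,d}] \cong \mathcal{D}isp_n^{h,d}.$$ That is, there is an equivalence of categories over affine $\mathbb{F}_p$-schemes $[X_n^{h,d}/G_n^{h,d}] \to \mathcal{D}isp_n^{h,d}$ whose composition with the canonical functor from the quotient prestack (objects $\Psi \in X_n^{h,d}(R)$, morphisms given by elements of $G_n^{h,d}$) to $[X_n^{h,d}/G_n^{h,d}]$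 is isomorphic to the functor given by $\Psi \mapsto \pi_n^{h,d}(\Psi)$ on objects and by $g$ on morphisms. -/

import Mathlib

open CategoryTheory TensorProduct
open scoped Matrix

universe u

attribute [-instance] CommAlgCat.instCommRingObjForgetAlgHomCarrier
  CommAlgCat.instAlgebraObjForgetAlgHomCarrier

namespace Disp

/-! ### Truncated Witt vectors -/

section Witt

variable (p n : ℕ) [Fact p.Prime]

/-- `W p n R = W_n(R)`, the ring of `p`-typical Witt vectors of length `n`. -/
abbrev W (R : Type*) := TruncatedWittVector p n R

variable {R S T : Type*} [CommRing R] [CommRing S] [CommRing T]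

/-- `W_n(f) : W_n(R) → W_n(S)`, applying `f` to all components. -/
noncomputable def mapW (f : R →+* S) : W p n R →+* W p n S :=
  RingHom.liftOfRightInverse (WittVector.truncate n) TruncatedWittVector.out
    TruncatedWittVector.truncateFun_out
    ⟨(WittVector.truncate n).comp (WittVector.map f), fun x hx => by
      rw [WittVector.mem_ker_truncate] at hx
      rw [RingHom.mem_ker]
      ext i
      simp [hx i i.2]⟩

@[simp] theorem mapW_truncate (f : R →+* S) (x : WittVector p R) :
    mapW p n f (WittVector.truncate n x) = WittVector.truncate n (WittVector.map f x) :=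
  RingHom.liftOfRightInverse_comp_apply _ _ _ _ x

@[simp] theorem coeff_mapW (f : R →+* S) (x : W p n R) (i : Fin n) :
    (mapW p n f x).coeff i = f (x.coeff i) := by
  obtain ⟨x, rfl⟩ := WittVector.truncate_surjective p n R x
  simp

theorem mapW_comp (g : S →+* T) (f : R →+* S) (x : W p n R) :
    mapW p n (g.comp f) x = mapW p n g (mapW p n f x) := by
  ext i; simp

theorem mapW_id (x : W p n R) : mapW p n (RingHom.id R) x = x := by
  ext i; simp

/-- The Verschiebung `V : W_n(R) → W_{n+1}(R)`, `(x₀, …, xₙ₋₁) ↦ (0, x₀, …, xₙ₋₁)`. -/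
noncomputable def V : W p n R →+ W p (n + 1) R where
  toFun x := TruncatedWittVector.mk p (Fin.cons 0 x.coeff)
  map_zero' := by
    ext i; refine Fin.cases ?_ (fun i => ?_) i <;> simp
  map_add' x y := by
    obtain ⟨x, rfl⟩ := WittVector.truncate_surjective p n R x
    obtain ⟨y, rfl⟩ := WittVector.truncate_surjective p n R y
    have key : ∀ z : WittVector p R,
        (TruncatedWittVector.mk p (Fin.cons 0 (WittVector.truncate n z).coeff) : W p (n + 1) R) =
          WittVector.truncate (n + 1) (WittVector.verschiebung z) := by
      intro z
      ext i; refine Fin.cases ?_ (fun i => ?_) i <;> simp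
    rw [← map_add, key, key, key, map_add, map_add]

theorem V_truncate (z : WittVector p R) :
    V p n (WittVector.truncate n z) = WittVector.truncate (n + 1) (WittVector.verschiebung z) := by
  ext i; refine Fin.cases ?_ (fun i => ?_) i <;> simp [V]

@[simp] theorem coeff_V_zero (x : W p n R) : (V p n x).coeff 0 = 0 := by simp [V]

@[simp] theorem coeff_V_succ (x : W p n R) (i : Fin n) :
    (V p n x).coeff i.succ = x.coeff i := by simp [V]

theorem V_injective : Function.Injective (V p n : W p n R → W p (n + 1) R) := by
  intro x y h
  ext i
  rw [← coeff_V_succ, h, coeff_V_succ]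

theorem mapW_V (f : R →+* S) (x : W p n R) :
    mapW p (n + 1) f (V p n x) = V p n (mapW p n f x) := by
  ext i; refine Fin.cases ?_ (fun i => ?_) i <;> simp

/-- The truncation `W_{n+1}(R) → W_n(R)`. -/
noncomputable abbrev trunc : W p (n + 1) R →+* W p n R := TruncatedWittVector.truncate (Nat.le_succ n)

theorem mapW_trunc (f : R →+* S) (x : W p (n + 1) R) :
    mapW p n f (trunc p n x) = trunc p n (mapW p (n + 1) f x) := by
  ext i; simp

/-- The Frobenius `x ↦ x ^ p` of an `𝔽_p`-algebra (which may be zero). -/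
def frob (R : Type*) [CommRing R] [Algebra (ZMod p) R] : R →+* R where
  toFun x := x ^ p
  map_one' := one_pow p
  map_mul' x y := mul_pow x y p
  map_zero' := zero_pow (Fact.out : p.Prime).ne_zero
  map_add' x y := by
    obtain ⟨r, hr⟩ := exists_add_pow_prime_eq (Fact.out : p.Prime) x y
    have h0 : (p : R) = 0 := by
      rw [← map_natCast (algebraMap (ZMod p) R) p, ZMod.natCast_self, map_zero]
    rw [hr, h0]; ring

variable (R) in
/-- The Frobenius `σ : W_n(R) → W_n(R)` induced by the Frobenius of `R`. -/
noncomputable def σ [Algebra (ZMod p) R] : W p n R →+* W p n R := mapW p n (frob p R)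

theorem mapW_σ [Algebra (ZMod p) R] [Algebra (ZMod p) S] (f : R →+* S) (x : W p n R) :
    mapW p n f (σ p n R x) = σ p n S (mapW p n f x) := by
  ext i; simp [σ, frob]

theorem σ_truncate [Algebra (ZMod p) R] (x : WittVector p R) :
    σ p n R (WittVector.truncate n x) = WittVector.truncate n (WittVector.frobenius x) := by
  rcases subsingleton_or_nontrivial R with h | h
  · ext i; exact Subsingleton.elim _ _
  · have : CharP R p := charP_of_injective_algebraMap (algebraMap (ZMod p) R).injective p
    ext i; simp [σ, frob, WittVector.coeff_frobenius_charP]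

theorem mul_V [Algebra (ZMod p) R] (b : W p (n + 1) R) (c : W p n R) :
    b * V p n c = V p n (σ p n R (trunc p n b) * c) := by
  obtain ⟨b, rfl⟩ := WittVector.truncate_surjective p (n + 1) R b
  obtain ⟨c, rfl⟩ := WittVector.truncate_surjective p n R c
  rw [TruncatedWittVector.truncate_wittVector_truncate, σ_truncate, V_truncate, ← map_mul,
    ← map_mul, V_truncate, mul_comm b, ← WittVector.verschiebung_mul_frobenius, mul_comm c]

theorem σ_trunc_V [Algebra (ZMod p) R] (c : W p n R) :
    σ p n R (trunc p n (V p n c)) = p * c := by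
  obtain ⟨c, rfl⟩ := WittVector.truncate_surjective p n R c
  rw [V_truncate, TruncatedWittVector.truncate_wittVector_truncate, σ_truncate,
    WittVector.frobenius_verschiebung, map_mul, map_natCast, mul_comm]

/-! ### The ideal `I_{n+1,R}` as a `W_n(R)`-module -/

variable (R) in
/-- `I p n R = I_{n+1,R} ⊆ W_{n+1}(R)`, the image of the Verschiebung `W_n(R) → W_{n+1}(R)`. -/
def I [Algebra (ZMod p) R] : Ideal (W p (n + 1) R) where
  carrier := Set.range (V p n)
  add_mem' := by
    rintro _ _ ⟨x, rfl⟩ ⟨y, rfl⟩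
    exact ⟨x + y, map_add _ _ _⟩
  zero_mem' := ⟨0, map_zero _⟩
  smul_mem' := by
    rintro b _ ⟨c, rfl⟩
    exact ⟨_, (mul_V p n b c).symm⟩

variable [Algebra (ZMod p) R] [Algebra (ZMod p) S] [Algebra (ZMod p) T]

/-- `V` as an additive bijection `W_n(R) → I_{n+1,R}`. -/
noncomputable def VEquiv : W p n R ≃+ I p n R :=
  AddEquiv.ofBijective
    ({ toFun := fun x => ⟨V p n x, x, rfl⟩
       map_zero' := Subtype.ext (map_zero _)
       map_add' := fun _ _ => Subtype.ext (map_add _ _ _) } : W p n R →+ I p n R)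
    ⟨fun _ _ h => V_injective p n (congrArg Subtype.val h), by
      rintro ⟨_, x, rfl⟩; exact ⟨x, rfl⟩⟩

@[simp] theorem coe_VEquiv (x : W p n R) : (VEquiv p n x : W p (n + 1) R) = V p n x := rfl

/-- `σ₁ : I_{n+1,R} → W_n(R)`, the inverse of the Verschiebung. -/
noncomputable def σ₁ : I p n R ≃+ W p n R := (VEquiv p n).symm

@[simp] theorem V_σ₁ (x : I p n R) : V p n (σ₁ p n x) = x :=
  congrArg Subtype.val ((VEquiv p n).apply_symm_apply x)

/-- As `R` has characteristic `p`, the kernel of `W_{n+1}(R) → W_n(R)` annihilates `I_{n+1,R}`. -/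
theorem mul_eq_mul_of_trunc_eq {b b' : W p (n + 1) R} (h : trunc p n b = trunc p n b')
    (x : I p n R) : b * (x : W p (n + 1) R) = b' * x := by
  rw [← V_σ₁, mul_V, mul_V, h]

/-- A lift of `a ∈ W_n(R)` to `W_{n+1}(R)`. -/
noncomputable def liftW (a : W p n R) : W p (n + 1) R :=
  (TruncatedWittVector.truncate_surjective (Nat.le_succ n) a).choose

@[simp] theorem trunc_liftW (a : W p n R) : trunc p n (liftW p n a) = a :=
  (TruncatedWittVector.truncate_surjective (Nat.le_succ n) a).choose_spec

/-- The `W_n(R)`-module structure of `I_{n+1,R}`: multiply by any lift to `W_{n+1}(R)`. -/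
noncomputable instance : SMul (W p n R) (I p n R) where
  smul a x := ⟨liftW p n a * x, (I p n R).mul_mem_left _ x.2⟩

theorem coe_smul_of_trunc_eq {a : W p n R} {b : W p (n + 1) R} (h : trunc p n b = a)
    (x : I p n R) : ((a • x : I p n R) : W p (n + 1) R) = b * x :=
  mul_eq_mul_of_trunc_eq p n (by rw [trunc_liftW, h]) x

noncomputable instance : Module (W p n R) (I p n R) where
  one_smul x := Subtype.ext <| by
    rw [coe_smul_of_trunc_eq p n (map_one _), one_mul]
  mul_smul a b x := Subtype.ext <| by
    rw [coe_smul_of_trunc_eq p n (b := liftW p n a * liftW p n b) (by simp),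
      coe_smul_of_trunc_eq p n (trunc_liftW p n a), coe_smul_of_trunc_eq p n (trunc_liftW p n b),
      mul_assoc]
  smul_zero a := Subtype.ext <| by
    rw [coe_smul_of_trunc_eq p n (trunc_liftW p n a)]; simp
  smul_add a x y := Subtype.ext <| by
    simp only [coe_smul_of_trunc_eq p n (trunc_liftW p n a), Submodule.coe_add, mul_add]
  add_smul a b x := Subtype.ext <| by
    rw [coe_smul_of_trunc_eq p n (b := liftW p n a + liftW p n b) (by simp), Submodule.coe_add,
      coe_smul_of_trunc_eq p n (trunc_liftW p n a), coe_smul_of_trunc_eq p n (trunc_liftW p n b),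
      add_mul]
  zero_smul x := Subtype.ext <| by
    rw [coe_smul_of_trunc_eq p n (map_zero _)]; simp

theorem σ₁_smul (a : W p n R) (x : I p n R) : σ₁ p n (a • x) = σ p n R a * σ₁ p n x := by
  apply V_injective p n
  rw [V_σ₁, coe_smul_of_trunc_eq p n (trunc_liftW p n a), ← V_σ₁, mul_V, trunc_liftW]

/-- The `W_n(R)`-linear map `I_{n+1,R} → W_n(R)` induced by the truncation. -/
noncomputable def toW : I p n R →ₗ[W p n R] W p n R where
  toFun x := trunc p n x
  map_add' x y := by simp
  map_smul' a x := by
    rw [coe_smul_of_trunc_eq p n (trunc_liftW p n a)]; simp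

theorem σ_toW (x : I p n R) : σ p n R (toW p n x) = p * σ₁ p n x := by
  rw [← σ_trunc_V, V_σ₁]; rfl

theorem toW_smul_comm (x y : I p n R) : toW p n x • y = toW p n y • x := Subtype.ext <| by
  rw [coe_smul_of_trunc_eq p n (a := toW p n x) (b := (x : W p (n + 1) R)) rfl,
    coe_smul_of_trunc_eq p n (a := toW p n y) (b := (y : W p (n + 1) R)) rfl, mul_comm]

/-- The map `I_{n+1,R} → I_{n+1,S}` induced by `f : R → S`. -/
noncomputable def mapI (f : R →+* S) : I p n R →ₛₗ[mapW p n f] I p n S where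
  toFun x := ⟨mapW p (n + 1) f x, mapW p n f (σ₁ p n x), by rw [← mapW_V, V_σ₁]⟩
  map_add' x y := Subtype.ext <| by simp
  map_smul' a x := Subtype.ext <| by
    rw [coe_smul_of_trunc_eq p n (b := mapW p (n + 1) f (liftW p n a))
      (by rw [← mapW_trunc, trunc_liftW])]
    simp [coe_smul_of_trunc_eq p n (trunc_liftW p n a)]

@[simp] theorem coe_mapI (f : R →+* S) (x : I p n R) :
    (mapI p n f x : W p (n + 1) S) = mapW p (n + 1) f x := rfl

theorem σ₁_mapI (f : R →+* S) (x : I p n R) :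
    σ₁ p n (mapI p n f x) = mapW p n f (σ₁ p n x) := by
  apply V_injective p n
  rw [V_σ₁, ← mapW_V, V_σ₁, coe_mapI]

theorem toW_mapI (f : R →+* S) (x : I p n R) :
    toW p n (mapI p n f x) = mapW p n f (toW p n x) :=
  (mapW_trunc p n f _).symm

end Witt

/-! ### Truncated displays -/

section Display

/-- The linearization `S ⊗_{τ,R} M → N`, `s ⊗ m ↦ s • f m`, of a `τ`-linear map `f : M → N` is
bijective. -/
def LinearizationBijective {R S M N : Type*} [CommRing R] [CommRing S] [AddCommGroup M]
    [AddCommGroup N] [Module R M] [Module S N] {τ : R →+* S} (f : M →ₛₗ[τ] N) : Prop :=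
  letI : Algebra R S := τ.toAlgebra
  letI : Module R N := Module.compHom N τ
  letI : IsScalarTower R S N := ⟨fun r s x => mul_smul (τ r) s x⟩
  IsBaseChange S ({ toFun := f, map_add' := f.map_add, map_smul' := f.map_smulₛₗ } : M →ₗ[R] N)

variable (p n : ℕ) [Fact p.Prime]

/-- A truncated display of level `n` over an `𝔽_p`-algebra `R`. -/
structure Display (R : Type u) [CommRing R] [Algebra (ZMod p) R] where
  /-- The module `L`. -/
  L : Type u
  /-- The module `T`. -/
  T : Type u
  [addCommGroupL : AddCommGroup L]
  [moduleL : Module (W p n R) L]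
  [finiteL : Module.Finite (W p n R) L]
  [projectiveL : Module.Projective (W p n R) L]
  [addCommGroupT : AddCommGroup T]
  [moduleT : Module (W p n R) T]
  [finiteT : Module.Finite (W p n R) T]
  [projectiveT : Module.Projective (W p n R) T]
  /-- The `σ`-linear automorphism `Ψ` of `L ⊕ T`: a `σ`-linear map whose linearization
  `W_n(R) ⊗_{σ} (L ⊕ T) → L ⊕ T` is bijective. -/
  Ψ : (L × T) →ₛₗ[σ p n R] (L × T)
  bijective_Ψ : LinearizationBijective Ψ

attribute [instance] Display.addCommGroupL Display.moduleL Display.finiteL Display.projectiveL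
  Display.addCommGroupT Display.moduleT Display.finiteT Display.projectiveT

variable {p n}

section TensorI

variable {R S : Type u} [CommRing R] [Algebra (ZMod p) R] [CommRing S] [Algebra (ZMod p) S]

/-- The map `T ⊗ I_{n+1,R} → T`, `t ⊗ ω ↦ ω t`. -/
noncomputable def evalT (T : Type*) [AddCommGroup T] [Module (W p n R) T] :
    T ⊗[W p n R] I p n R →ₗ[W p n R] T :=
  TensorProduct.rid (W p n R) T ∘ₗ LinearMap.lTensor T (toW p n)

@[simp] theorem evalT_tmul (T : Type*) [AddCommGroup T] [Module (W p n R) T] (t : T)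
    (ω : I p n R) : evalT T (t ⊗ₜ[W p n R] ω) = toW p n ω • t := by simp [evalT]

/-- For a `σ`-linear map `g : T → M`, the `σ`-linear map `T ⊗ I_{n+1,R} → M`,
`t ⊗ ω ↦ σ₁(ω) g(t)`. -/
noncomputable def σ₁Lift {T M : Type*} [AddCommGroup T] [Module (W p n R) T] [AddCommGroup M]
    [Module (W p n R) M] (g : T →ₛₗ[σ p n R] M) : T ⊗[W p n R] I p n R →ₛₗ[σ p n R] M :=
  TensorProduct.lift (LinearMap.mk₂'ₛₗ (σ p n R) (σ p n R) (fun t ω => σ₁ p n ω • g t)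
    (fun t t' ω => by rw [map_add, smul_add])
    (fun a t ω => by rw [map_smulₛₗ, smul_comm])
    (fun t ω ω' => by rw [map_add, add_smul])
    (fun a t ω => by rw [σ₁_smul, mul_smul]))

@[simp] theorem σ₁Lift_tmul {T M : Type*} [AddCommGroup T] [Module (W p n R) T] [AddCommGroup M]
    [Module (W p n R) M] (g : T →ₛₗ[σ p n R] M) (t : T) (ω : I p n R) :
    σ₁Lift g (t ⊗ₜ[W p n R] ω) = σ₁ p n ω • g t := rfl

end TensorI

namespace Display

section Maps

variable {R : Type u} [CommRing R] [Algebra (ZMod p) R] (X : Display p n R)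

/-- The domain `L ⊕ (T ⊗ I_{n+1,R})` of `F₁`. -/
abbrev Q : Type u := X.L × (X.T ⊗[W p n R] I p n R)

/-- `F : L ⊕ T → L ⊕ T`, `l + t ↦ p Ψ(l) + Ψ(t)`. -/
noncomputable def F : (X.L × X.T) →ₛₗ[σ p n R] (X.L × X.T) :=
  (p : W p n R) • X.Ψ.comp (LinearMap.inl _ _ _ ∘ₗ LinearMap.fst _ _ _) +
    X.Ψ.comp (LinearMap.inr _ _ _ ∘ₗ LinearMap.snd _ _ _)

theorem F_apply (x : X.L × X.T) : X.F x = (p : W p n R) • X.Ψ (x.1, 0) + X.Ψ (0, x.2) := rfl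

/-- `F₁ : L ⊕ (T ⊗ I_{n+1,R}) → L ⊕ T`, `l + (t ⊗ ω) ↦ Ψ(l) + σ₁(ω) Ψ(t)`. -/
noncomputable def F₁ : X.Q →ₛₗ[σ p n R] (X.L × X.T) :=
  X.Ψ.comp (LinearMap.inl _ _ _ ∘ₗ LinearMap.fst _ _ _) +
    (σ₁Lift (X.Ψ.comp (LinearMap.inr _ _ _))).comp (LinearMap.snd _ _ _)

theorem F₁_apply (x : X.Q) :
    X.F₁ x = X.Ψ (x.1, 0) + σ₁Lift (X.Ψ.comp (LinearMap.inr _ _ _)) x.2 := rfl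

end Maps

end Display

/-! ### Morphisms of truncated displays

Morphisms are defined along a homomorphism of base rings `f : R → S`; their entries are
`W_n(f)`-linear. For `f = id` these are the morphisms of truncated displays over `R`. -/

/-- The category of `𝔽_p`-algebras. -/
abbrev Alg (p : ℕ) [Fact p.Prime] := CommAlgCat.{u} (ZMod p)

/-- `W_n(f)` for a morphism `f` of `𝔽_p`-algebras. -/
noncomputable abbrev Wm (n : ℕ) {R S : Alg.{u} p} (f : R ⟶ S) : W p n R →+* W p n S :=
  mapW p n (f.hom : R →+* S)

/-- Data of a matrix `(A, B; C, D)` of maps between the constituents of two displays. -/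
@[ext]
structure DMatrix {R S : Alg.{u} p} (f : R ⟶ S) (X : Display p n R) (Y : Display p n S) where
  /-- The entry `L → L'`. -/
  A : X.L →ₛₗ[Wm n f] Y.L
  /-- The entry `T → L'`. -/
  B : X.T →ₛₗ[Wm n f] Y.L
  /-- The entry `L → T' ⊗ I`. -/
  C : X.L →ₛₗ[Wm n f] Y.T ⊗[W p n S] I p n S
  /-- The entry `T → T'`. -/
  D : X.T →ₛₗ[Wm n f] Y.T

namespace DMatrix

variable {R S U : Alg.{u} p} {f : R ⟶ S} {g : S ⟶ U} {X : Display p n R} {Y : Display p n S}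
  {Z : Display p n U}

/-- The action `L ⊕ T → L' ⊕ T'` of a matrix. -/
noncomputable def onP (m : DMatrix f X Y) : (X.L × X.T) →ₛₗ[Wm n f] (Y.L × Y.T) where
  toFun x := (m.A x.1 + m.B x.2, evalT Y.T (m.C x.1) + m.D x.2)
  map_add' x y := by ext <;> simp <;> abel
  map_smul' a x := by ext <;> simp [smul_add]

/-- The map `T ⊗ I_{n+1,R} → T' ⊗ I_{n+1,S}` induced by the entry `D`. -/
noncomputable def DI (m : DMatrix f X Y) :
    X.T ⊗[W p n R] I p n R →ₛₗ[Wm n f] Y.T ⊗[W p n S] I p n S :=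
  TensorProduct.map m.D (mapI p n (f.hom : R →+* S))

/-- The action `L ⊕ (T ⊗ I_{n+1,R}) → L' ⊕ (T' ⊗ I_{n+1,S})` of a matrix. On `T ⊗ I_{n+1,R}` it is
`t ⊗ ω ↦ ω B(t) + D(t) ⊗ ω`. -/
noncomputable def onQ (m : DMatrix f X Y) : X.Q →ₛₗ[Wm n f] Y.Q where
  toFun x := (m.A x.1 + m.B (evalT X.T x.2), m.C x.1 + m.DI x.2)
  map_add' x y := by ext <;> simp <;> abel
  map_smul' a x := by ext <;> simp [smul_add]

theorem onP_apply (m : DMatrix f X Y) (x : X.L × X.T) :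
    m.onP x = (m.A x.1 + m.B x.2, evalT Y.T (m.C x.1) + m.D x.2) := rfl

theorem onQ_apply (m : DMatrix f X Y) (x : X.Q) :
    m.onQ x = (m.A x.1 + m.B (evalT X.T x.2), m.C x.1 + m.DI x.2) := rfl

theorem A_eq (m : DMatrix f X Y) (l : X.L) : m.A l = (m.onP (l, 0)).1 := by simp [onP_apply]

theorem B_eq (m : DMatrix f X Y) (t : X.T) : m.B t = (m.onP (0, t)).1 := by simp [onP_apply]

theorem D_eq (m : DMatrix f X Y) (t : X.T) : m.D t = (m.onP (0, t)).2 := by simp [onP_apply]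

@[simp] theorem DI_tmul (m : DMatrix f X Y) (t : X.T) (ω : I p n R) :
    m.DI (t ⊗ₜ ω) = m.D t ⊗ₜ mapI p n (f.hom : R →+* S) ω := rfl

/-- The identity matrix. -/
noncomputable def id (X : Display p n R) : DMatrix (𝟙 R) X X where
  A := { toFun := fun x => x, map_add' := fun _ _ => rfl
         map_smul' := fun a x => congrArg (· • x) (mapW_id p n a).symm }
  B := 0
  C := 0
  D := { toFun := fun x => x, map_add' := fun _ _ => rfl
         map_smul' := fun a x => congrArg (· • x) (mapW_id p n a).symm }

/-- The matrix product. -/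
noncomputable def comp (m : DMatrix f X Y) (m' : DMatrix g Y Z) : DMatrix (f ≫ g) X Z where
  A :=
    { toFun := fun l => m'.A (m.A l) + m'.B (evalT Y.T (m.C l))
      map_add' := fun x y => by simp only [map_add]; abel
      map_smul' := fun a x => by
        simp only [map_smulₛₗ, ← smul_add, RingHom.id_apply]
        exact congrArg (· • _) (mapW_comp p n _ _ a).symm }
  B :=
    { toFun := fun t => m'.A (m.B t) + m'.B (m.D t)
      map_add' := fun x y => by simp only [map_add]; abel
      map_smul' := fun a x => by
        simp only [map_smulₛₗ, ← smul_add]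
        exact congrArg (· • _) (mapW_comp p n _ _ a).symm }
  C :=
    { toFun := fun l => m'.C (m.A l) + m'.DI (m.C l)
      map_add' := fun x y => by simp only [map_add]; abel
      map_smul' := fun a x => by
        simp only [map_smulₛₗ, ← smul_add]
        exact congrArg (· • _) (mapW_comp p n _ _ a).symm }
  D :=
    { toFun := fun t => evalT Z.T (m'.C (m.B t)) + m'.D (m.D t)
      map_add' := fun x y => by simp only [map_add]; abel
      map_smul' := fun a x => by
        simp only [map_smulₛₗ, ← smul_add, RingHom.id_apply]
        exact congrArg (· • _) (mapW_comp p n _ _ a).symm }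

theorem evalT_DI (m : DMatrix f X Y) (z : X.T ⊗[W p n R] I p n R) :
    evalT Y.T (m.DI z) = m.D (evalT X.T z) := by
  induction z with
  | zero => simp
  | add x y hx hy => simp only [map_add, hx, hy]
  | tmul t ω => simp [toW_mapI]

theorem evalT_tmul_comm {R : Type u} [CommRing R] [Algebra (ZMod p) R] (X : Display p n R)
    (z : X.T ⊗[W p n R] I p n R) (ω : I p n R) :
    evalT X.T z ⊗ₜ[W p n R] ω = toW p n ω • z := by
  induction z with
  | zero => simp
  | add x y hx hy => simp only [map_add, TensorProduct.add_tmul, hx, hy, smul_add]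
  | tmul t ω' =>
    rw [evalT_tmul, TensorProduct.smul_tmul, toW_smul_comm, TensorProduct.tmul_smul]

theorem onP_id (x : X.L × X.T) : (DMatrix.id X).onP x = x := by
  ext <;> simp [onP_apply, DMatrix.id]

theorem DI_id (z : X.T ⊗[W p n R] I p n R) : (DMatrix.id X).DI z = z := by
  induction z with
  | zero => simp
  | add x y hx hy => simp only [map_add, hx, hy]
  | tmul t ω =>
    rw [DI_tmul]
    exact congrArg (t ⊗ₜ[W p n R] ·) (Subtype.ext (mapW_id p (n + 1) _))

theorem onQ_id (x : X.Q) : (DMatrix.id X).onQ x = x := by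
  refine Prod.ext ?_ ?_
  · simp [onQ_apply, DMatrix.id]
  · rw [onQ_apply, DI_id]; simp [DMatrix.id]

theorem onP_comp (m : DMatrix f X Y) (m' : DMatrix g Y Z) (x : X.L × X.T) :
    (m.comp m').onP x = m'.onP (m.onP x) := by
  refine Prod.ext ?_ ?_
  · simp [onP_apply, DMatrix.comp]; abel
  · simp [onP_apply, DMatrix.comp, evalT_DI]; abel

theorem DI_comp (m : DMatrix f X Y) (m' : DMatrix g Y Z) (z : X.T ⊗[W p n R] I p n R) :
    (m.comp m').DI z = m'.C (m.B (evalT X.T z)) + m'.DI (m.DI z) := by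
  induction z with
  | zero => simp
  | add x y hx hy => simp only [map_add, hx, hy]; abel
  | tmul t ω =>
    have e : mapI p n ((f ≫ g).hom : R →+* U) ω
        = mapI p n (g.hom : S →+* U) (mapI p n (f.hom : R →+* S) ω) :=
      Subtype.ext (mapW_comp p (n + 1) _ _ _)
    have e2 : (m.comp m').D t = evalT Z.T (m'.C (m.B t)) + m'.D (m.D t) := rfl
    rw [DI_tmul, DI_tmul, DI_tmul, e, e2, TensorProduct.add_tmul, evalT_tmul_comm, evalT_tmul,
      map_smulₛₗ, map_smulₛₗ, toW_mapI, toW_mapI]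

theorem onQ_comp (m : DMatrix f X Y) (m' : DMatrix g Y Z) (x : X.Q) :
    (m.comp m').onQ x = m'.onQ (m.onQ x) := by
  refine Prod.ext ?_ ?_
  · simp [onQ_apply, DMatrix.comp, evalT_DI]; abel
  · rw [onQ_apply, DI_comp]; simp [onQ_apply, DMatrix.comp]; abel

/-- A matrix is determined by its two actions. -/
theorem ext_of_actions {f' : R ⟶ S} (hf : f = f') (m : DMatrix f X Y) (m' : DMatrix f' X Y)
    (hP : ∀ x, m.onP x = m'.onP x) (hQ : ∀ x, m.onQ x = m'.onQ x) : HEq m m' := by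
  subst hf
  obtain ⟨A, B, C, D⟩ := m
  obtain ⟨A', B', C', D'⟩ := m'
  have hA : A = A' := by
    ext l; simpa [onP_apply] using congrArg Prod.fst (hP (l, 0))
  have hB : B = B' := by
    ext t; simpa [onP_apply] using congrArg Prod.fst (hP (0, t))
  have hC : C = C' := by
    ext l; simpa [onQ_apply] using congrArg Prod.snd (hQ (l, 0))
  have hD : D = D' := by
    ext t; simpa [onP_apply] using congrArg Prod.snd (hP (0, t))
  subst hA hB hC hD
  rfl

end DMatrix

/-- For a matrix commuting with `F`, compatibility with `F₁` only has to be checked on `L`. -/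
theorem DMatrix.comm_F₁_of {R S : Alg.{u} p} {f : R ⟶ S} {X : Display p n R} {Y : Display p n S}
    (m : DMatrix f X Y) (hF : ∀ x, m.onP (X.F x) = Y.F (m.onP x))
    (hL : ∀ l, m.onP (X.F₁ (l, 0)) = Y.F₁ (m.onQ (l, 0))) (x : X.Q) :
    m.onP (X.F₁ x) = Y.F₁ (m.onQ x) := by
  obtain ⟨l, z⟩ := x
  have hz : m.onP (X.F₁ (0, z)) = Y.F₁ (m.onQ (0, z)) := by
    induction z with
    | zero => rw [Prod.mk_zero_zero]; simp
    | add z z' h h' =>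
      rw [← add_zero (0 : X.L), ← Prod.mk_add_mk]
      simp only [map_add, h, h']
    | tmul t ω =>
      have e1 : X.F₁ (0, t ⊗ₜ ω) = σ₁ p n ω • X.F (0, t) := by
        rw [Display.F₁_apply, Display.F_apply, σ₁Lift_tmul]
        simp [Prod.mk_zero_zero]
      have e2 : Y.F₁ (m.onQ (0, t ⊗ₜ ω)) = mapW p n (f.hom : R →+* S) (σ₁ p n ω) •
          Y.F (m.onP (0, t)) := by
        rw [DMatrix.onQ_apply, DMatrix.onP_apply, Display.F₁_apply, Display.F_apply]
        have e3 : Y.Ψ (mapW p n (f.hom : R →+* S) (toW p n ω) • m.B t, 0) =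
            mapW p n (f.hom : R →+* S) (σ₁ p n ω) • (p : W p n S) • Y.Ψ (m.B t, 0) := by
          rw [← smul_zero (mapW p n (f.hom : R →+* S) (toW p n ω)), ← Prod.smul_mk, map_smulₛₗ,
            smul_zero, ← mapW_σ, σ_toW, map_mul, map_natCast, mul_comm, mul_smul]
        simp [e3, σ₁_mapI]
      rw [e1, e2, map_smulₛₗ, hF]
  have e : ((l, z) : X.Q) = (l, 0) + (0, z) := by simp
  rw [e]
  simp only [map_add, hL, hz]

variable (p n)

/-- The total space of truncated displays of level `n`: pairs of an `𝔽_p`-algebra and a truncated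
display of level `n` over it. -/
structure TDisplay where
  /-- The base ring. -/
  R : Alg.{u} p
  /-- The display. -/
  X : Display p n R

variable {p n}

/-- A morphism of truncated displays along a ring homomorphism: a matrix whose actions commute with
`F` and with `F₁`. -/
@[ext]
structure TDisplay.Hom (X Y : TDisplay.{u} p n) where
  /-- The homomorphism of base rings. -/
  base : X.R ⟶ Y.R
  /-- The matrix. -/
  mat : DMatrix base X.X Y.X
  comm_F : ∀ x, mat.onP (X.X.F x) = Y.X.F (mat.onP x)
  comm_F₁ : ∀ x, mat.onP (X.X.F₁ x) = Y.X.F₁ (mat.onQ x)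

theorem TDisplay.Hom.ext' {X Y : TDisplay.{u} p n} {m m' : TDisplay.Hom X Y}
    (hf : m.base = m'.base) (hP : ∀ x, m.mat.onP x = m'.mat.onP x)
    (hQ : ∀ x, m.mat.onQ x = m'.mat.onQ x) : m = m' :=
  TDisplay.Hom.ext hf (DMatrix.ext_of_actions hf _ _ hP hQ)

noncomputable instance : Category (TDisplay.{u} p n) where
  Hom := TDisplay.Hom
  id X :=
    { base := 𝟙 X.R
      mat := DMatrix.id X.X
      comm_F := fun x => by rw [DMatrix.onP_id, DMatrix.onP_id]
      comm_F₁ := fun x => by rw [DMatrix.onP_id, DMatrix.onQ_id] }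
  comp m m' :=
    { base := m.base ≫ m'.base
      mat := m.mat.comp m'.mat
      comm_F := fun x => by
        rw [DMatrix.onP_comp, DMatrix.onP_comp, m.comm_F, m'.comm_F]
      comm_F₁ := fun x => by
        rw [DMatrix.onP_comp, DMatrix.onQ_comp, m.comm_F₁, m'.comm_F₁] }
  id_comp m := TDisplay.Hom.ext' (Category.id_comp _)
    (fun x => by rw [DMatrix.onP_comp, DMatrix.onP_id])
    (fun x => by rw [DMatrix.onQ_comp, DMatrix.onQ_id])
  comp_id m := TDisplay.Hom.ext' (Category.comp_id _)
    (fun x => by rw [DMatrix.onP_comp, DMatrix.onP_id])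
    (fun x => by rw [DMatrix.onQ_comp, DMatrix.onQ_id])
  assoc m m' m'' := TDisplay.Hom.ext' (Category.assoc _ _ _)
    (fun x => by simp only [DMatrix.onP_comp])
    (fun x => by simp only [DMatrix.onQ_comp])

/-- The projection from displays to base rings. -/
@[simps]
noncomputable def TDisplay.proj : TDisplay.{u} p n ⥤ Alg.{u} p where
  obj X := X.R
  map m := m.base

theorem TDisplay.base_eq {X Y : TDisplay.{u} p n} {f : X.R ⟶ Y.R} {m : X ⟶ Y}
    (h : TDisplay.proj.IsHomLift f m) : m.base = f :=
  (@IsHomLift.eq_of_isHomLift _ _ _ _ TDisplay.proj X Y f m h).symm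

theorem TDisplay.isHomLift {X Y : TDisplay.{u} p n} (m : X ⟶ Y) :
    TDisplay.proj.IsHomLift m.base m :=
  inferInstanceAs (TDisplay.proj.IsHomLift (TDisplay.proj.map m) m)

end Display

/-! ### Sheaves for the étale topology on affine `𝔽_p`-schemes -/

section Sheaf

variable {p : ℕ} [Fact p.Prime]

/-- A finite étale covering family `(Spec B_i → Spec A)_i` of affine `𝔽_p`-schemes: the maps are
étale and jointly surjective. -/
structure EtaleCover (A : Alg.{u} p) where
  /-- The index set. -/
  ι : Type
  [finite : Finite ι]
  /-- The members of the cover. -/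
  B : ι → Alg.{u} p
  /-- The structure maps. -/
  f : ∀ i, A ⟶ B i
  etale : ∀ i, ((f i).hom : A →+* B i).Etale
  surjective : ∀ 𝔮 : PrimeSpectrum A, ∃ i, 𝔮 ∈ Set.range (PrimeSpectrum.comap ((f i).hom : A →+* B i))

attribute [instance] EtaleCover.finite

/-- A family of sections over the members of a cover is compatible if any two of them agree
wherever both are defined. -/
def EtaleCover.Compatible {A : Alg.{u} p} (U : EtaleCover A) (P : Alg.{u} p ⥤ Type u)
    (x : ∀ i, P.obj (U.B i)) : Prop :=
  ∀ (i j : U.ι) (E : Alg.{u} p) (a : U.B i ⟶ E) (b : U.B j ⟶ E),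
    U.f i ≫ a = U.f j ≫ b → P.map a (x i) = P.map b (x j)

/-- A functor on `𝔽_p`-algebras, i.e. a presheaf on affine `𝔽_p`-schemes, is an étale sheaf if
compatible families glue uniquely. -/
def IsEtaleSheaf (P : Alg.{u} p ⥤ Type u) : Prop :=
  ∀ (A : Alg.{u} p) (U : EtaleCover A) (x : ∀ i, P.obj (U.B i)), U.Compatible P x →
    ∃! y : P.obj A, ∀ i, P.map (U.f i) y = x i

/-- The structure sheaf is an étale sheaf. -/
theorem existsUnique_glue {A : Alg.{u} p} (U : EtaleCover A) (x : ∀ i, U.B i)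
    (hx : ∀ (i j : U.ι) (E : Alg.{u} p) (a : U.B i ⟶ E) (b : U.B j ⟶ E),
      U.f i ≫ a = U.f j ≫ b → a (x i) = b (x j)) :
    ∃! y : A, ∀ i, U.f i y = x i := by
  classical
  have := Fintype.ofFinite U.ι
  let alg (i : U.ι) : Algebra A (U.B i) := ((U.f i).hom : A →+* U.B i).toAlgebra
  have (i : U.ι) : IsScalarTower (ZMod p) A (U.B i) :=
    IsScalarTower.of_algebraMap_eq fun r => ((U.f i).hom.commutes r).symm
  have (i : U.ι) : Algebra.Etale A (U.B i) := U.etale i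
  have (i : U.ι) : Module.Flat A (U.B i) := inferInstance
  have : Module.FaithfullyFlat A (∀ i, U.B i) := by
    refine Module.FaithfullyFlat.of_comap_surjective fun 𝔮 => ?_
    obtain ⟨i, 𝔯, h⟩ := U.surjective 𝔮
    exact ⟨PrimeSpectrum.comap (Pi.evalRingHom _ i) 𝔯, h⟩
  have hker : Algebra.TensorProduct.includeLeftSubRight A (∀ i, U.B i) x = 0 := by
    have hz : ∀ i j, (x i) ⊗ₜ[A] (1 : U.B j) = (1 : U.B i) ⊗ₜ[A] (x j) := by
      intro i j
      have := hx i j (CommAlgCat.of (ZMod p) (U.B i ⊗[A] U.B j))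
        (CommAlgCat.ofHom (Algebra.TensorProduct.includeLeft (R := A) (S := ZMod p)))
        (CommAlgCat.ofHom ((Algebra.TensorProduct.includeRight (R := A)).restrictScalars (ZMod p)))
        (by
          ext a
          exact ((Algebra.TensorProduct.includeLeft (R := A) (S := A) (A := U.B i)
            (B := U.B j)).commutes a).trans ((Algebra.TensorProduct.includeRight (R := A)
            (A := U.B i) (B := U.B j)).commutes a).symm)
      exact this
    have hsum : ∀ y : ∀ i, U.B i, y = ∑ i, LinearMap.single A (fun i => U.B i) i (y i) := by
      intro y
      exact (Finset.univ_sum_single y).symm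
    rw [Algebra.TensorProduct.includeLeftSubRight_apply, sub_eq_zero]
    conv_lhs => rw [hsum x, hsum 1]
    conv_rhs => rw [hsum x, hsum 1]
    simp only [TensorProduct.sum_tmul, TensorProduct.tmul_sum]
    refine Finset.sum_congr rfl fun j _ => ?_
    refine Finset.sum_congr rfl fun i _ => ?_
    exact congrArg (TensorProduct.map (LinearMap.single A (fun i => U.B i) i)
      (LinearMap.single A (fun i => U.B i) j)) (hz i j)
  obtain ⟨y, hy⟩ := (Algebra.IsEffective.of_faithfullyFlat (R := A) (S := ∀ i, U.B i) x).1 hker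
  refine ⟨y, fun i => congrFun hy i, fun z hz => ?_⟩
  apply FaithfulSMul.algebraMap_injective A (∀ i, U.B i)
  funext i
  exact (hz i).trans (congrFun hy i).symm

end Sheaf

/-! ### Quotient stacks

Stacks over affine `𝔽_p`-schemes are viewed as categories over the category of affine
`𝔽_p`-schemes, i.e. over the opposite of the category of `𝔽_p`-algebras. -/

section QuotientStack

variable {p : ℕ} [Fact p.Prime]

/-- A functor in groups `G` on affine `𝔽_p`-schemes acting on a functor `X` from the left. -/
structure GSpace (p : ℕ) [Fact p.Prime] where
  /-- The group. -/
  G : Alg.{u} p ⥤ GrpCat.{u}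
  /-- The space. -/
  X : Alg.{u} p ⥤ Type u
  [action : ∀ A, MulAction (G.obj A) (X.obj A)]
  map_smul : ∀ {A B : Alg.{u} p} (f : A ⟶ B) (g : G.obj A) (x : X.obj A),
    X.map f (g • x) = G.map f g • X.map f x

attribute [instance] GSpace.action

/-- An object of `[X/G]` over `Spec R`: a `G`-torsor `P → Spec R` for the étale topology
together with a `G`-equivariant map `P → X`. -/
structure QuotientObj (𝒢 : GSpace.{u} p) where
  /-- The base ring. -/
  R : Alg.{u} p
  /-- The torsor. -/
  P : Alg.{u} p ⥤ Type u
  isSheaf : IsEtaleSheaf P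
  /-- The structure map `P → Spec R`. -/
  π : ∀ {A : Alg.{u} p}, P.obj A → (R ⟶ A)
  π_map : ∀ {A B : Alg.{u} p} (a : A ⟶ B) (x : P.obj A), π (P.map a x) = π x ≫ a
  [action : ∀ A, MulAction (𝒢.G.obj A) (P.obj A)]
  map_smul : ∀ {A B : Alg.{u} p} (a : A ⟶ B) (g : 𝒢.G.obj A) (x : P.obj A),
    P.map a (g • x) = 𝒢.G.map a g • P.map a x
  π_smul : ∀ {A : Alg.{u} p} (g : 𝒢.G.obj A) (x : P.obj A), π (g • x) = π x
  /-- `G` acts simply transitively on the fibres of `P → Spec R`. -/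
  existsUnique_smul : ∀ {A : Alg.{u} p} (x y : P.obj A), π x = π y →
    ∃! g : 𝒢.G.obj A, g • x = y
  /-- `P → Spec R` has sections étale locally. -/
  locally_nonempty : ∃ U : EtaleCover R, ∀ i, ∃ x : P.obj (U.B i), π x = U.f i
  /-- The equivariant map `P → X`. -/
  φ : ∀ {A : Alg.{u} p}, P.obj A → 𝒢.X.obj A
  φ_map : ∀ {A B : Alg.{u} p} (a : A ⟶ B) (x : P.obj A), φ (P.map a x) = 𝒢.X.map a (φ x)
  φ_smul : ∀ {A : Alg.{u} p} (g : 𝒢.G.obj A) (x : P.obj A), φ (g • x) = g • φ x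

attribute [instance] QuotientObj.action

namespace QuotientObj

variable {𝒢 : GSpace.{u} p}

/-- A morphism in `[X/G]`: a morphism of the base schemes together with a `G`-equivariant map of
the torsors over it, compatible with the maps to `X`. -/
@[ext]
structure Hom (P Q : QuotientObj 𝒢) where
  /-- The morphism `Spec P.R → Spec Q.R`. -/
  base : Q.R ⟶ P.R
  /-- The map of torsors. -/
  map : ∀ (A : Alg.{u} p), P.P.obj A → Q.P.obj A
  naturality : ∀ {A B : Alg.{u} p} (a : A ⟶ B) (x : P.P.obj A),
    map B (P.P.map a x) = Q.P.map a (map A x)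
  map_smul : ∀ {A : Alg.{u} p} (g : 𝒢.G.obj A) (x : P.P.obj A), map A (g • x) = g • map A x
  π_map : ∀ {A : Alg.{u} p} (x : P.P.obj A), Q.π (map A x) = base ≫ P.π x
  φ_map : ∀ {A : Alg.{u} p} (x : P.P.obj A), Q.φ (map A x) = P.φ x

instance : Category (QuotientObj 𝒢) where
  Hom := Hom
  id P :=
    { base := 𝟙 P.R
      map := fun _ x => x
      naturality := fun _ _ => rfl
      map_smul := fun _ _ => rfl
      π_map := fun _ => (Category.id_comp _).symm
      φ_map := fun _ => rfl }
  comp m m' :=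
    { base := m'.base ≫ m.base
      map := fun A x => m'.map A (m.map A x)
      naturality := fun a x => by rw [m.naturality, m'.naturality]
      map_smul := fun g x => by rw [m.map_smul, m'.map_smul]
      π_map := fun x => by rw [m'.π_map, m.π_map, Category.assoc]
      φ_map := fun x => by rw [m'.φ_map, m.φ_map] }
  id_comp m := Hom.ext (Category.comp_id _) rfl
  comp_id m := Hom.ext (Category.id_comp _) rfl
  assoc m m' m'' := Hom.ext (Category.assoc _ _ _).symm rfl

/-- The projection `[X/G] → Aff`. -/
@[simps]
def proj (𝒢 : GSpace.{u} p) : QuotientObj 𝒢 ⥤ (Alg.{u} p)ᵒᵖ where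
  obj P := Opposite.op P.R
  map m := m.base.op

end QuotientObj

/-- The quotient stack `[X/G]`. -/
def quotientStack (𝒢 : GSpace.{u} p) : BasedCategory.{u + 1, u + 1} (Alg.{u} p)ᵒᵖ :=
  BasedCategory.ofFunctor (QuotientObj.proj 𝒢)

/-- An object of the quotient prestack over `Spec R`: an element of `X(R)`. -/
structure PrequotientObj (𝒢 : GSpace.{u} p) where
  /-- The base ring. -/
  R : Alg.{u} p
  /-- The point of `X`. -/
  x : 𝒢.X.obj R

namespace PrequotientObj

variable {𝒢 : GSpace.{u} p}

/-- A morphism of the quotient prestack from `y ∈ X(S)` to `x ∈ X(R)` along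
`f : Spec S → Spec R`: an element `g ∈ G(S)` with `g • f^*x = y`. -/
@[ext]
structure Hom (y x : PrequotientObj 𝒢) where
  /-- The morphism of base schemes. -/
  base : x.R ⟶ y.R
  /-- The group element. -/
  g : 𝒢.G.obj y.R
  smul_eq : g • 𝒢.X.map base x.x = y.x

instance : Category (PrequotientObj 𝒢) where
  Hom := Hom
  id x := { base := 𝟙 x.R, g := 1, smul_eq := by simp }
  comp {z y x} m m' :=
    { base := m'.base ≫ m.base
      g := m.g * 𝒢.G.map m.base m'.g
      smul_eq := by
        rw [mul_smul, ← m.smul_eq, ← m'.smul_eq, 𝒢.map_smul, Functor.map_comp_apply] }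
  id_comp m := Hom.ext (Category.comp_id _) (by simp)
  comp_id m := Hom.ext (Category.id_comp _) (by simp)
  assoc m m' m'' := Hom.ext (Category.assoc _ _ _).symm (by simp [mul_assoc])

/-- The projection to affine schemes. -/
@[simps]
def proj (𝒢 : GSpace.{u} p) : PrequotientObj 𝒢 ⥤ (Alg.{u} p)ᵒᵖ where
  obj x := Opposite.op x.R
  map m := m.base.op

/-- The trivial torsor `G × Spec R` with the equivariant map `(g, a) ↦ g • a^*x` to `X`. -/
def trivialTorsor (hG : IsEtaleSheaf (𝒢.G ⋙ forget GrpCat.{u})) (x : PrequotientObj 𝒢) :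
    QuotientObj 𝒢 where
  R := x.R
  P :=
    { obj := fun A => 𝒢.G.obj A × (x.R ⟶ A)
      map := fun a => TypeCat.ofHom fun y => (𝒢.G.map a y.1, y.2 ≫ a)
      map_id := fun A => by ext y <;> simp
      map_comp := fun a b => by ext y <;> simp }
  isSheaf := by
    intro A U y hy
    obtain ⟨g, hg, hg'⟩ := hG A U (fun i => (y i).1)
      (fun i j E a b h => congrArg Prod.fst (hy i j E a b h))
    have key : ∀ r : x.R, ∃! s : A, ∀ i, U.f i s = (y i).2 r := fun r =>
      existsUnique_glue U _ (fun i j E a b h =>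
        congrArg (fun q : x.R ⟶ E => q r) (congrArg Prod.snd (hy i j E a b h)))
    choose s hs hs' using key
    have sep : ∀ a b : A, (∀ i, U.f i a = U.f i b) → a = b := fun a b h =>
      (existsUnique_glue U (fun i => U.f i b) (fun i j E c d e =>
        congrArg (fun q : A ⟶ E => q b) e)).unique h (fun _ => rfl)
    let k : x.R ⟶ A := CommAlgCat.ofHom
      { toFun := s
        map_one' := sep _ _ fun i => by rw [hs, map_one, map_one]
        map_mul' := fun a b => sep _ _ fun i => by rw [hs, map_mul, map_mul, hs, hs]
        map_zero' := sep _ _ fun i => by rw [hs, map_zero, map_zero]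
        map_add' := fun a b => sep _ _ fun i => by rw [hs, map_add, map_add, hs, hs]
        commutes' := fun r => sep _ _ fun i => by
          rw [hs]
          exact ((y i).2.hom.commutes r).trans ((U.f i).hom.commutes r).symm }
    refine ⟨(g, k), fun i => Prod.ext (hg i) ?_, ?_⟩
    · ext r
      exact hs r i
    · rintro ⟨g₁, k₁⟩ h
      refine Prod.ext (hg' g₁ fun i => congrArg Prod.fst (h i)) ?_
      ext r
      exact hs' r _ fun i => congrArg (fun q : x.R ⟶ U.B i => q r) (congrArg Prod.snd (h i))
  π y := y.2
  π_map _ _ := rfl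
  action A :=
    { smul := fun g y => (g * y.1, y.2)
      one_smul := fun y => Prod.ext (one_mul _) rfl
      mul_smul := fun g g' y => Prod.ext (mul_assoc _ _ _) rfl }
  map_smul a g y := Prod.ext (map_mul (𝒢.G.map a).hom g y.1) rfl
  π_smul _ _ := rfl
  existsUnique_smul := by
    rintro A ⟨g, a⟩ ⟨g', a'⟩ h
    refine ⟨g' * g⁻¹, Prod.ext (inv_mul_cancel_right g' g) h, fun k hk => ?_⟩
    exact eq_mul_inv_of_mul_eq (congrArg Prod.fst hk)
  locally_nonempty := by
    refine ⟨⟨Unit, fun _ => x.R, fun _ => 𝟙 x.R, fun _ => .of_bijective Function.bijective_id,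
      fun 𝔮 => ⟨(), 𝔮, rfl⟩⟩, fun _ => ⟨(1, 𝟙 x.R), rfl⟩⟩
  φ y := y.1 • 𝒢.X.map y.2 x.x
  φ_map a y := by
    rw [𝒢.map_smul, ← Functor.map_comp_apply]; rfl
  φ_smul g y := mul_smul g y.1 _

end PrequotientObj

/-- The quotient prestack. -/
def prequotient (𝒢 : GSpace.{u} p) : BasedCategory.{u, u + 1} (Alg.{u} p)ᵒᵖ :=
  BasedCategory.ofFunctor (PrequotientObj.proj 𝒢)

/-- The canonical morphism from the quotient prestack to `[X/G]`. It sends `x ∈ X(R)` to the trivial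
torsor, and `g ∈ G(S)` to right multiplication by `g`. Restricted to `X` it is the canonical map
`X → [X/G]`. -/
def prequotientToQuotient (𝒢 : GSpace.{u} p) (hG : IsEtaleSheaf (𝒢.G ⋙ forget GrpCat.{u})) :
    BasedFunctor (prequotient 𝒢) (quotientStack 𝒢) where
  obj x := PrequotientObj.trivialTorsor hG x
  map {y x} m :=
    { base := m.base
      map := fun A z => (z.1 * 𝒢.G.map z.2 m.g, m.base ≫ z.2)
      naturality := fun a z => Prod.ext
        (by
          change 𝒢.G.map a z.1 * 𝒢.G.map (z.2 ≫ a) m.g = 𝒢.G.map a (z.1 * 𝒢.G.map z.2 m.g)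
          rw [map_mul, Functor.map_comp_apply])
        (Category.assoc _ _ _).symm
      map_smul := fun g z => Prod.ext (mul_assoc g z.1 _) rfl
      π_map := fun z => rfl
      φ_map := fun z => by
        change (z.1 * 𝒢.G.map z.2 m.g) • 𝒢.X.map (m.base ≫ z.2) x.x = z.1 • 𝒢.X.map z.2 y.x
        rw [mul_smul, ← m.smul_eq, 𝒢.map_smul, Functor.map_comp_apply] }
  map_id x := QuotientObj.Hom.ext rfl (by
    funext A z
    refine Prod.ext ?_ (Category.id_comp _)
    change z.1 * 𝒢.G.map z.2 1 = z.1
    rw [map_one, mul_one])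
  map_comp {z y x} m m' := QuotientObj.Hom.ext rfl (by
    funext A w
    refine Prod.ext ?_ (Category.assoc _ _ _)
    change w.1 * 𝒢.G.map w.2 (m.g * 𝒢.G.map m.base m'.g) =
      w.1 * 𝒢.G.map w.2 m.g * 𝒢.G.map (m.base ≫ w.2) m'.g
    rw [map_mul, Functor.map_comp_apply, mul_assoc])
  w := rfl

end QuotientStack

/-! ### The group `G_n^{h,d}` acting on `X_n^{h,d}` -/

section BlockMatrix

variable (p n c d : ℕ) [Fact p.Prime]

/-- Block matrices `(A, B; C, D)` with `A`, `B`, `D` over `W_n(R)` of sizes `c × c`, `c × d`,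
`d × d`, and `C` of size `d × c` with entries in `I_{n+1,R}`. -/
@[ext]
structure BlockMat (R : Type u) [CommRing R] [Algebra (ZMod p) R] where
  /-- The upper left block. -/
  A : Matrix (Fin c) (Fin c) (W p n R)
  /-- The upper right block. -/
  B : Matrix (Fin c) (Fin d) (W p n R)
  /-- The lower left block. -/
  C : Matrix (Fin d) (Fin c) (I p n R)
  /-- The lower right block. -/
  D : Matrix (Fin d) (Fin d) (W p n R)

namespace BlockMat

variable {p n c d}
variable {R S U : Type u} [CommRing R] [Algebra (ZMod p) R] [CommRing S] [Algebra (ZMod p) S]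
  [CommRing U] [Algebra (ZMod p) U]

/-- Matrix multiplication; products of an entry of `W_n(R)` and an entry of `I_{n+1,R}` are formed
in the module `I_{n+1,R}` in the lower left block, and in `W_n(R)` in the diagonal blocks. -/
noncomputable instance : Mul (BlockMat p n c d R) where
  mul M N :=
    { A := M.A * N.A + M.B * N.C.map (toW p n)
      B := M.A * N.B + M.B * N.D
      C := Matrix.of fun i j => ∑ k, N.A k j • M.C i k + ∑ k, M.D i k • N.C k j
      D := M.C.map (toW p n) * N.B + M.D * N.D }

noncomputable instance : One (BlockMat p n c d R) where
  one := { A := 1, B := 0, C := 0, D := 1 }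

/-- The block matrix over `W_n(R)` obtained by mapping the entries of `C` to `W_n(R)`. -/
noncomputable def toMat (M : BlockMat p n c d R) : Matrix (Fin c ⊕ Fin d) (Fin c ⊕ Fin d) (W p n R) :=
  Matrix.fromBlocks M.A M.B (M.C.map (toW p n)) M.D

/-- `σ₁(A, B; C, D) = (σ(A), p σ(B); σ₁(C), σ(D))`. -/
noncomputable def σ₁Mat (M : BlockMat p n c d R) :
    Matrix (Fin c ⊕ Fin d) (Fin c ⊕ Fin d) (W p n R) :=
  Matrix.fromBlocks (M.A.map (σ p n R)) ((p : W p n R) • M.B.map (σ p n R)) (M.C.map (σ₁ p n))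
    (M.D.map (σ p n R))

theorem mul_C_apply (M N : BlockMat p n c d R) (i : Fin d) (j : Fin c) :
    (M * N).C i j = ∑ k, N.A k j • M.C i k + ∑ k, M.D i k • N.C k j := rfl

theorem toMat_mul (M N : BlockMat p n c d R) : (M * N).toMat = M.toMat * N.toMat := by
  rw [toMat, toMat, toMat, Matrix.fromBlocks_multiply]
  congr 1
  ext1 i j
  rw [Matrix.map_apply, mul_C_apply]
  simp [Matrix.mul_apply, mul_comm]

theorem σ_toW_map {k l : Type*} (C : Matrix k l (I p n R)) :
    (C.map (toW p n)).map (σ p n R) = (p : W p n R) • C.map (σ₁ p n) := by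
  ext1 i j
  simp [σ_toW]

theorem σ₁Mat_mul (M N : BlockMat p n c d R) : (M * N).σ₁Mat = M.σ₁Mat * N.σ₁Mat := by
  have hA : ((M * N).A).map (σ p n R) = M.A.map (σ p n R) * N.A.map (σ p n R) +
      ((p : W p n R) • M.B.map (σ p n R)) * N.C.map (σ₁ p n) := by
    change (M.A * N.A + M.B * N.C.map (toW p n)).map (σ p n R) = _
    rw [Matrix.map_add _ (map_add _), Matrix.map_mul, Matrix.map_mul, σ_toW_map, Matrix.mul_smul,
      Matrix.smul_mul]
  have hB : (p : W p n R) • ((M * N).B).map (σ p n R) =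
      M.A.map (σ p n R) * ((p : W p n R) • N.B.map (σ p n R)) +
        ((p : W p n R) • M.B.map (σ p n R)) * N.D.map (σ p n R) := by
    change (p : W p n R) • (M.A * N.B + M.B * N.D).map (σ p n R) = _
    rw [Matrix.map_add _ (map_add _), Matrix.map_mul, Matrix.map_mul, Matrix.mul_smul,
      Matrix.smul_mul, smul_add]
  have hC : ((M * N).C).map (σ₁ p n) =
      M.C.map (σ₁ p n) * N.A.map (σ p n R) + M.D.map (σ p n R) * N.C.map (σ₁ p n) := by
    ext1 i j
    rw [Matrix.map_apply, mul_C_apply, map_add, map_sum, map_sum, Matrix.add_apply,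
      Matrix.mul_apply, Matrix.mul_apply]
    simp only [σ₁_smul, Matrix.map_apply]
    congr 1
    exact Finset.sum_congr rfl fun k _ => mul_comm _ _
  have hD : ((M * N).D).map (σ p n R) =
      M.C.map (σ₁ p n) * ((p : W p n R) • N.B.map (σ p n R)) +
        M.D.map (σ p n R) * N.D.map (σ p n R) := by
    change (M.C.map (toW p n) * N.B + M.D * N.D).map (σ p n R) = _
    rw [Matrix.map_add _ (map_add _), Matrix.map_mul, Matrix.map_mul, σ_toW_map, Matrix.mul_smul,
      Matrix.smul_mul]
  rw [σ₁Mat, σ₁Mat, σ₁Mat, Matrix.fromBlocks_multiply, hA, hB, hC, hD]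

theorem toMat_one : (1 : BlockMat p n c d R).toMat = 1 := by
  rw [← Matrix.fromBlocks_one]
  change Matrix.fromBlocks 1 0 ((0 : Matrix _ _ (I p n R)).map (toW p n)) 1 = _
  rw [Matrix.map_zero _ (map_zero _)]

theorem σ₁Mat_one : (1 : BlockMat p n c d R).σ₁Mat = 1 := by
  rw [← Matrix.fromBlocks_one]
  change Matrix.fromBlocks (Matrix.map 1 (σ p n R)) ((p : W p n R) • Matrix.map 0 (σ p n R))
    ((0 : Matrix _ _ (I p n R)).map (σ₁ p n)) (Matrix.map 1 (σ p n R)) = _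
  rw [Matrix.map_zero _ (map_zero _), Matrix.map_zero _ (map_zero _), smul_zero,
    Matrix.map_one _ (map_zero _) (map_one _), Matrix.map_one _ (map_zero _) (map_one _)]

theorem ext_of_mats {M N : BlockMat p n c d R} (h : M.toMat = N.toMat)
    (h₁ : M.σ₁Mat = N.σ₁Mat) : M = N := by
  obtain ⟨hA, hB, -, hD⟩ := Matrix.fromBlocks_inj.1 h
  obtain ⟨-, -, hC, -⟩ := Matrix.fromBlocks_inj.1 h₁
  refine BlockMat.ext hA hB ?_ hD
  ext1 i j
  exact (σ₁ p n).injective (congrFun (congrFun hC i) j)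

noncomputable instance : Monoid (BlockMat p n c d R) where
  mul_assoc M N O := ext_of_mats (by simp only [toMat_mul, Matrix.mul_assoc])
    (by simp only [σ₁Mat_mul, Matrix.mul_assoc])
  one_mul M := ext_of_mats (by rw [toMat_mul, toMat_one, Matrix.one_mul])
    (by rw [σ₁Mat_mul, σ₁Mat_one, Matrix.one_mul])
  mul_one M := ext_of_mats (by rw [toMat_mul, toMat_one, Matrix.mul_one])
    (by rw [σ₁Mat_mul, σ₁Mat_one, Matrix.mul_one])

/-- `toMat` as a monoid homomorphism. -/
noncomputable def toMatHom :
    BlockMat p n c d R →* Matrix (Fin c ⊕ Fin d) (Fin c ⊕ Fin d) (W p n R) where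
  toFun := toMat
  map_one' := toMat_one
  map_mul' := toMat_mul

/-- `σ₁Mat` as a monoid homomorphism. -/
noncomputable def σ₁MatHom :
    BlockMat p n c d R →* Matrix (Fin c ⊕ Fin d) (Fin c ⊕ Fin d) (W p n R) where
  toFun := σ₁Mat
  map_one' := σ₁Mat_one
  map_mul' := σ₁Mat_mul

/-- Apply `f : R → S` to the entries of a block matrix. -/
noncomputable def mapMat (f : R →+* S) (M : BlockMat p n c d R) : BlockMat p n c d S where
  A := M.A.map (mapW p n f)
  B := M.B.map (mapW p n f)
  C := M.C.map (mapI p n f)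
  D := M.D.map (mapW p n f)

theorem toMat_mapMat (f : R →+* S) (M : BlockMat p n c d R) :
    (M.mapMat f).toMat = M.toMat.map (mapW p n f) := by
  rw [toMat, toMat, Matrix.fromBlocks_map]
  congr 1
  ext1 i j
  exact toW_mapI p n f (M.C i j)

theorem σ₁Mat_mapMat (f : R →+* S) (M : BlockMat p n c d R) :
    (M.mapMat f).σ₁Mat = M.σ₁Mat.map (mapW p n f) := by
  rw [σ₁Mat, σ₁Mat, Matrix.fromBlocks_map]
  congr 1
  · ext1 i j; exact (mapW_σ p n f (M.A i j)).symm
  · ext1 i j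
    change (p : W p n S) * σ p n S (mapW p n f (M.B i j)) =
      mapW p n f ((p : W p n R) * σ p n R (M.B i j))
    rw [map_mul, map_natCast, mapW_σ]
  · ext1 i j; exact σ₁_mapI p n f (M.C i j)
  · ext1 i j; exact (mapW_σ p n f (M.D i j)).symm

theorem mapMat_id (M : BlockMat p n c d R) : M.mapMat (RingHom.id R) = M := by
  refine BlockMat.ext ?_ ?_ ?_ ?_ <;> ext1 i j
  · exact mapW_id p n _
  · exact mapW_id p n _
  · exact Subtype.ext (mapW_id p (n + 1) _)
  · exact mapW_id p n _

theorem mapMat_comp (g : S →+* U) (f : R →+* S) (M : BlockMat p n c d R) :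
    M.mapMat (g.comp f) = (M.mapMat f).mapMat g := by
  refine BlockMat.ext ?_ ?_ ?_ ?_ <;> ext1 i j
  · exact mapW_comp p n _ _ _
  · exact mapW_comp p n _ _ _
  · exact Subtype.ext (mapW_comp p (n + 1) _ _ _)
  · exact mapW_comp p n _ _ _

/-- `mapMat` as a monoid homomorphism. -/
noncomputable def mapMatHom (f : R →+* S) : BlockMat p n c d R →* BlockMat p n c d S where
  toFun := mapMat f
  map_one' := ext_of_mats
    (by rw [toMat_mapMat, toMat_one, toMat_one, Matrix.map_one _ (map_zero _) (map_one _)])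
    (by rw [σ₁Mat_mapMat, σ₁Mat_one, σ₁Mat_one, Matrix.map_one _ (map_zero _) (map_one _)])
  map_mul' M N := ext_of_mats (by simp only [toMat_mapMat, toMat_mul, Matrix.map_mul])
    (by simp only [σ₁Mat_mapMat, σ₁Mat_mul, Matrix.map_mul])

end BlockMat

/-- The group functor `G_n^{h,d}`, where `h = c + d`: invertible block matrices. -/
noncomputable def Gfun : Alg.{u} p ⥤ GrpCat.{u} where
  obj R := GrpCat.of (BlockMat p n c d R)ˣ
  map f := GrpCat.ofHom (Units.map (BlockMat.mapMatHom (f.hom : _ →+* _)))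
  map_id R := by
    exact GrpCat.hom_ext (MonoidHom.ext fun M => Units.ext (BlockMat.mapMat_id M.1))
  map_comp f g := by
    exact GrpCat.hom_ext (MonoidHom.ext fun M => Units.ext (BlockMat.mapMat_comp _ _ M.1))

/-- The functor `X_n^{h,d}`, `R ↦ GL_h(W_n(R))`, where `h = c + d`. -/
noncomputable def Xfun : Alg.{u} p ⥤ Type u where
  obj R := GL (Fin c ⊕ Fin d) (W p n R)
  map f := TypeCat.ofHom (Matrix.GeneralLinearGroup.map (Wm n f))
  map_id R := by
    refine ConcreteCategory.hom_ext _ _ fun Ψ => Units.ext ?_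
    ext1 i j
    exact mapW_id p n _
  map_comp f g := by
    refine ConcreteCategory.hom_ext _ _ fun Ψ => Units.ext ?_
    ext1 i j
    exact mapW_comp p n _ _ _

/-- The action of `G_n^{h,d}` on `X_n^{h,d}` by `g • Ψ = g Ψ σ₁(g)⁻¹`. -/
noncomputable def displayGSpace : GSpace.{u} p where
  G := Gfun p n c d
  X := Xfun p n c d
  action R :=
    { smul := fun (g : (BlockMat p n c d R)ˣ) (Ψ : GL (Fin c ⊕ Fin d) (W p n R)) =>
        (Units.map BlockMat.toMatHom g * Ψ * (Units.map BlockMat.σ₁MatHom g)⁻¹ :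
          GL (Fin c ⊕ Fin d) (W p n R))
      one_smul := fun (Ψ : GL (Fin c ⊕ Fin d) (W p n R)) => by
        change Units.map BlockMat.toMatHom 1 * Ψ * (Units.map BlockMat.σ₁MatHom 1)⁻¹ = Ψ
        rw [map_one, map_one, inv_one, one_mul, mul_one]
      mul_smul := fun (g g' : (BlockMat p n c d R)ˣ) (Ψ : GL (Fin c ⊕ Fin d) (W p n R)) => by
        change Units.map BlockMat.toMatHom (g * g') * Ψ * (Units.map BlockMat.σ₁MatHom (g * g'))⁻¹ =
          Units.map BlockMat.toMatHom g * (Units.map BlockMat.toMatHom g' * Ψ *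
            (Units.map BlockMat.σ₁MatHom g')⁻¹) * (Units.map BlockMat.σ₁MatHom g)⁻¹
        rw [map_mul, map_mul, mul_inv_rev]
        simp only [mul_assoc] }
  map_smul {R S} f (g : (BlockMat p n c d R)ˣ) (Ψ : GL (Fin c ⊕ Fin d) (W p n R)) := by
    have h₁ : Matrix.GeneralLinearGroup.map (Wm n f) (Units.map BlockMat.toMatHom g) =
        Units.map BlockMat.toMatHom (Units.map (BlockMat.mapMatHom (f.hom : R →+* S)) g) :=
      Units.ext (BlockMat.toMat_mapMat _ _).symm
    have h₂ : Matrix.GeneralLinearGroup.map (Wm n f) (Units.map BlockMat.σ₁MatHom g) =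
        Units.map BlockMat.σ₁MatHom (Units.map (BlockMat.mapMatHom (f.hom : R →+* S)) g) :=
      Units.ext (BlockMat.σ₁Mat_mapMat _ _).symm
    change Matrix.GeneralLinearGroup.map (Wm n f) (Units.map BlockMat.toMatHom g * Ψ *
      (Units.map BlockMat.σ₁MatHom g)⁻¹) = _
    rw [map_mul, map_mul, map_inv, h₁, h₂]
    rfl

end BlockMatrix

section GSheaf

variable {p n c d : ℕ} [Fact p.Prime] {A : Alg.{u} p} (U : EtaleCover A)

theorem separated_glue {a b : A} (h : ∀ i, U.f i a = U.f i b) : a = b :=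
  (existsUnique_glue U (fun i => U.f i b) (fun _ _ E _ _ e =>
    congrArg (fun q : A ⟶ E => q b) e)).unique h (fun _ => rfl)

theorem separated_W {a b : W p n A} (h : ∀ i, Wm n (U.f i) a = Wm n (U.f i) b) : a = b := by
  ext k
  refine separated_glue U fun i => ?_
  have := congrArg (fun q => TruncatedWittVector.coeff k q) (h i)
  simpa using this

theorem glue_W (x : ∀ i, W p n (U.B i))
    (hx : ∀ (i j : U.ι) (E : Alg.{u} p) (a : U.B i ⟶ E) (b : U.B j ⟶ E),
      U.f i ≫ a = U.f j ≫ b → Wm n a (x i) = Wm n b (x j)) :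
    ∃ y : W p n A, ∀ i, Wm n (U.f i) y = x i := by
  have key : ∀ k : Fin n, ∃ y : A, ∀ i, U.f i y = (x i).coeff k := fun k =>
    (existsUnique_glue U (fun i => (x i).coeff k) (fun i j E a b h => by
      have := congrArg (fun q => TruncatedWittVector.coeff k q) (hx i j E a b h)
      simpa using this)).exists
  choose y hy using key
  refine ⟨TruncatedWittVector.mk p y, fun i => ?_⟩
  ext k
  rw [coeff_mapW]
  exact (congrArg _ (TruncatedWittVector.coeff_mk y k)).trans (hy k i)

theorem glue_I (x : ∀ i, I p n (U.B i))
    (hx : ∀ (i j : U.ι) (E : Alg.{u} p) (a : U.B i ⟶ E) (b : U.B j ⟶ E),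
      U.f i ≫ a = U.f j ≫ b →
        mapI p n (a.hom : U.B i →+* E) (x i) = mapI p n (b.hom : U.B j →+* E) (x j)) :
    ∃ y : I p n A, ∀ i, mapI p n ((U.f i).hom : A →+* U.B i) y = x i := by
  obtain ⟨y, hy⟩ := glue_W U (fun i => σ₁ p n (x i)) (fun i j E a b h => by
    have := congrArg (σ₁ p n) (hx i j E a b h)
    rwa [σ₁_mapI, σ₁_mapI] at this)
  refine ⟨(σ₁ p n).symm y, fun i => (σ₁ p n).injective ?_⟩
  rw [σ₁_mapI, AddEquiv.apply_symm_apply]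
  exact hy i

theorem separated_I {a b : I p n A}
    (h : ∀ i, mapI p n ((U.f i).hom : A →+* U.B i) a = mapI p n ((U.f i).hom : A →+* U.B i) b) :
    a = b := by
  refine (σ₁ p n).injective (separated_W U fun i => ?_)
  have := congrArg (σ₁ p n) (h i)
  rwa [σ₁_mapI, σ₁_mapI] at this

theorem separated_BlockMat {M N : BlockMat p n c d A}
    (h : ∀ i, M.mapMat ((U.f i).hom : A →+* U.B i) = N.mapMat ((U.f i).hom : A →+* U.B i)) :
    M = N := by
  refine BlockMat.ext ?_ ?_ ?_ ?_ <;> ext1 k l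
  · exact separated_W U fun i => congrFun (congrFun (congrArg BlockMat.A (h i)) k) l
  · exact separated_W U fun i => congrFun (congrFun (congrArg BlockMat.B (h i)) k) l
  · exact separated_I U fun i => congrFun (congrFun (congrArg BlockMat.C (h i)) k) l
  · exact separated_W U fun i => congrFun (congrFun (congrArg BlockMat.D (h i)) k) l

theorem glue_BlockMat (x : ∀ i, BlockMat p n c d (U.B i))
    (hx : ∀ (i j : U.ι) (E : Alg.{u} p) (a : U.B i ⟶ E) (b : U.B j ⟶ E),
      U.f i ≫ a = U.f j ≫ b →
        (x i).mapMat (a.hom : U.B i →+* E) = (x j).mapMat (b.hom : U.B j →+* E)) :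
    ∃ y : BlockMat p n c d A, ∀ i, y.mapMat ((U.f i).hom : A →+* U.B i) = x i := by
  choose yA hA using fun k l => glue_W U (fun i => (x i).A k l) (fun i j E a b h =>
    congrFun (congrFun (congrArg BlockMat.A (hx i j E a b h)) k) l)
  choose yB hB using fun k l => glue_W U (fun i => (x i).B k l) (fun i j E a b h =>
    congrFun (congrFun (congrArg BlockMat.B (hx i j E a b h)) k) l)
  choose yC hC using fun k l => glue_I U (fun i => (x i).C k l) (fun i j E a b h =>
    congrFun (congrFun (congrArg BlockMat.C (hx i j E a b h)) k) l)
  choose yD hD using fun k l => glue_W U (fun i => (x i).D k l) (fun i j E a b h =>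
    congrFun (congrFun (congrArg BlockMat.D (hx i j E a b h)) k) l)
  refine ⟨⟨Matrix.of yA, Matrix.of yB, Matrix.of yC, Matrix.of yD⟩, fun i => ?_⟩
  refine BlockMat.ext ?_ ?_ ?_ ?_ <;> ext1 k l
  · exact hA k l i
  · exact hB k l i
  · exact hC k l i
  · exact hD k l i

variable (p n c d) in
/-- `G_n^{h,d}` is an étale sheaf. -/
theorem isEtaleSheaf_Gfun : IsEtaleSheaf (Gfun.{u} p n c d ⋙ forget GrpCat.{u}) := by
  intro A U (x : ∀ i, (BlockMat p n c d (U.B i))ˣ) hx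
  have hx' : ∀ (i j : U.ι) (E : Alg.{u} p) (a : U.B i ⟶ E) (b : U.B j ⟶ E),
      U.f i ≫ a = U.f j ≫ b →
      Units.map (BlockMat.mapMatHom (a.hom : U.B i →+* E)) (x i) =
        Units.map (BlockMat.mapMatHom (b.hom : U.B j →+* E)) (x j) := hx
  obtain ⟨y, hy⟩ := glue_BlockMat U (fun i => (x i).1) (fun i j E a b h =>
    congrArg Units.val (hx' i j E a b h))
  obtain ⟨z, hz⟩ := glue_BlockMat U (fun i => (x i)⁻¹.1) (fun i j E a b h =>
    congrArg (fun q : (BlockMat p n c d E)ˣ => q⁻¹.1) (hx' i j E a b h))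
  have one : ∀ i, (1 : BlockMat p n c d A).mapMat ((U.f i).hom : A →+* U.B i) = 1 :=
    fun i => map_one (BlockMat.mapMatHom _)
  have mul : ∀ i (M N : BlockMat p n c d A), (M * N).mapMat ((U.f i).hom : A →+* U.B i) =
      M.mapMat ((U.f i).hom : A →+* U.B i) * N.mapMat ((U.f i).hom : A →+* U.B i) :=
    fun i => map_mul (BlockMat.mapMatHom _)
  let w : (BlockMat p n c d A)ˣ := ⟨y, z,
    separated_BlockMat U fun i => by rw [mul, hy, hz, one]; exact (x i).mul_inv,
    separated_BlockMat U fun i => by rw [mul, hy, hz, one]; exact (x i).inv_mul⟩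
  refine ⟨w, fun i => Units.ext (hy i), ?_⟩
  intro (v : (BlockMat p n c d A)ˣ) hv
  have hv' : ∀ i, Units.map (BlockMat.mapMatHom ((U.f i).hom : A →+* U.B i)) v = x i := hv
  exact Units.ext (separated_BlockMat U fun i =>
    (congrArg Units.val (hv' i)).trans (hy i).symm)

end GSheaf

/-! ### The truncated display attached to an invertible matrix -/

section Std

variable {p n c d : ℕ} [Fact p.Prime]

section Module

variable {K : Type*} [CommRing K]

/-- The decomposition `K^{c+d} ≃ K^c ⊕ K^d`. -/
abbrev splitEquiv (K : Type*) [CommRing K] (c d : ℕ) :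
    (Fin c ⊕ Fin d → K) ≃ₗ[K] (Fin c → K) × (Fin d → K) :=
  LinearEquiv.sumArrowLequivProdArrow (Fin c) (Fin d) K K

theorem splitEquiv_symm (x : (Fin c → K) × (Fin d → K)) :
    (splitEquiv K c d).symm x = Sum.elim x.1 x.2 := by
  ext i; cases i <;> rfl

theorem linearizationBijective_of_basis {K' M N ι : Type*} [CommRing K'] [AddCommGroup M]
    [AddCommGroup N] [Module K M] [Module K' N] {τ : K →+* K'} (f : M →ₛₗ[τ] N)
    (b : Module.Basis ι K M) (b' : Module.Basis ι K' N) (h : ∀ i, f (b i) = b' i) :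
    LinearizationBijective f := by
  let _ : Algebra K K' := τ.toAlgebra
  let _ : Module K N := Module.compHom N τ
  have _ : IsScalarTower K K' N := ⟨fun r s x => mul_smul (τ r) s x⟩
  let f' : M →ₗ[K] N := { toFun := f, map_add' := f.map_add, map_smul' := f.map_smulₛₗ }
  let e : K' ⊗[K] M ≃ₗ[K'] N := (b.baseChange K').equiv b' (Equiv.refl _)
  have he : ∀ x, e (1 ⊗ₜ x) = f' x := by
    have : ((e.toLinearMap.restrictScalars K) ∘ₗ TensorProduct.mk K K' M 1) = f' := by
      refine b.ext fun i => ?_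
      have : e (b.baseChange K' i) = b' i := Module.Basis.equiv_apply _ _ _ _
      rw [Module.Basis.baseChange_apply] at this
      exact this.trans (h i).symm
    exact fun x => LinearMap.congr_fun this x
  exact IsBaseChange.of_equiv e he

end Module

section Fibre

variable {R : Type u} [CommRing R] [Algebra (ZMod p) R]

/-- The `σ`-linear map `x ↦ Ψ · σ(x)` on `W_n(R)^c ⊕ W_n(R)^d`. -/
noncomputable def stdΨ (Ψ : Matrix (Fin c ⊕ Fin d) (Fin c ⊕ Fin d) (W p n R)) :
    ((Fin c → W p n R) × (Fin d → W p n R)) →ₛₗ[σ p n R]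
      ((Fin c → W p n R) × (Fin d → W p n R)) where
  toFun x := splitEquiv _ c d (Ψ *ᵥ fun i => σ p n R (Sum.elim x.1 x.2 i))
  map_add' x y := by
    rw [← map_add, ← Matrix.mulVec_add]
    congr 2
    ext1 i; cases i <;> simp
  map_smul' a x := by
    rw [← map_smul, ← Matrix.mulVec_smul]
    congr 2
    ext1 i; cases i <;> simp

theorem stdΨ_apply (Ψ : Matrix (Fin c ⊕ Fin d) (Fin c ⊕ Fin d) (W p n R))
    (x : (Fin c → W p n R) × (Fin d → W p n R)) :
    stdΨ Ψ x = splitEquiv _ c d (Ψ *ᵥ fun i => σ p n R (Sum.elim x.1 x.2 i)) := rfl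

/-- Multiplication by an invertible matrix as a linear equivalence. -/
noncomputable def glEquiv (Ψ : GL (Fin c ⊕ Fin d) (W p n R)) :
    (Fin c ⊕ Fin d → W p n R) ≃ₗ[W p n R] (Fin c ⊕ Fin d → W p n R) :=
  LinearEquiv.ofLinearMap (Matrix.mulVecLin Ψ.1) (Matrix.mulVecLin Ψ⁻¹.1)
    (by rw [← Matrix.mulVecLin_mul, Ψ.mul_inv, Matrix.mulVecLin_one])
    (by rw [← Matrix.mulVecLin_mul, Ψ.inv_mul, Matrix.mulVecLin_one])

/-- The truncated display `(W_n(R)^c, W_n(R)^d, Ψ)` attached to `Ψ ∈ GL_{c+d}(W_n(R))`. -/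
noncomputable abbrev std (Ψ : GL (Fin c ⊕ Fin d) (W p n R)) : Display p n R where
  L := Fin c → W p n R
  T := Fin d → W p n R
  Ψ := stdΨ Ψ.1
  bijective_Ψ := by
    refine linearizationBijective_of_basis _
      ((Pi.basisFun (W p n R) (Fin c ⊕ Fin d)).map (splitEquiv _ c d))
      (((Pi.basisFun (W p n R) (Fin c ⊕ Fin d)).map (glEquiv Ψ)).map (splitEquiv _ c d))
      fun i => ?_
    simp only [Module.Basis.map_apply, stdΨ_apply]
    congr 1
    change Ψ.1 *ᵥ _ = Ψ.1 *ᵥ _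
    congr 1
    ext1 j
    rw [← splitEquiv_symm, LinearEquiv.symm_apply_apply, Pi.basisFun_apply]
    by_cases h : j = i
    · subst h; simp
    · simp [h]

/-- Coordinates on `W_n(R)^d ⊗ I_{n+1,R}`. -/
noncomputable def coordI (d : ℕ) :
    (Fin d → W p n R) ⊗[W p n R] I p n R ≃ₗ[W p n R] (Fin d → I p n R) :=
  TensorProduct.comm _ _ _ ≪≫ₗ
    TensorProduct.piScalarRight (W p n R) (W p n R) (I p n R) (Fin d)

@[simp] theorem coordI_tmul (t : Fin d → W p n R) (ω : I p n R) (i : Fin d) :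
    coordI d (t ⊗ₜ[W p n R] ω) i = t i • ω := by
  simp [coordI]

theorem evalT_apply (z : (Fin d → W p n R) ⊗[W p n R] I p n R) (i : Fin d) :
    evalT (Fin d → W p n R) z i = toW p n (coordI d z i) := by
  induction z with
  | zero => rw [LinearMap.map_zero, LinearEquiv.map_zero, Pi.zero_apply, Pi.zero_apply, map_zero]
  | add x y hx hy =>
    rw [LinearMap.map_add, LinearEquiv.map_add, Pi.add_apply, Pi.add_apply, map_add, hx, hy]
  | tmul t ω => simp [mul_comm]

/-- `(l, t) ↦ (p σ(l), σ(t))`. -/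
noncomputable def coordF (x : (Fin c → W p n R) × (Fin d → W p n R)) : Fin c ⊕ Fin d → W p n R :=
  Sum.elim (fun i => (p : W p n R) * σ p n R (x.1 i)) (fun i => σ p n R (x.2 i))

/-- `(l, z) ↦ (σ(l), σ₁(z))`. -/
noncomputable def coordF₁ (x : (Fin c → W p n R) × ((Fin d → W p n R) ⊗[W p n R] I p n R)) :
    Fin c ⊕ Fin d → W p n R :=
  Sum.elim (fun i => σ p n R (x.1 i)) (fun i => σ₁ p n (coordI d x.2 i))

theorem std_F (Ψ : GL (Fin c ⊕ Fin d) (W p n R)) (x : (Fin c → W p n R) × (Fin d → W p n R)) :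
    (std Ψ).F x = splitEquiv _ c d (Ψ.1 *ᵥ coordF x) := by
  refine (Display.F_apply (std Ψ) x).trans ?_
  change (p : W p n R) • stdΨ Ψ.1 (x.1, 0) + stdΨ Ψ.1 (0, x.2) = _
  rw [stdΨ_apply, stdΨ_apply, ← map_smul, ← map_add, ← Matrix.mulVec_smul, ← Matrix.mulVec_add]
  congr 2
  ext1 i; cases i <;> simp [coordF]

theorem std_σ₁Lift (Ψ : GL (Fin c ⊕ Fin d) (W p n R))
    (z : (Fin d → W p n R) ⊗[W p n R] I p n R) :
    σ₁Lift ((std Ψ).Ψ.comp (LinearMap.inr (W p n R) (Fin c → W p n R) (Fin d → W p n R))) z =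
      splitEquiv _ c d (Ψ.1 *ᵥ Sum.elim (0 : Fin c → W p n R) fun i => σ₁ p n (coordI d z i)) := by
  induction z with
  | zero =>
    have e : (Sum.elim (0 : Fin c → W p n R) fun i => σ₁ p n (coordI d 0 i)) = 0 := by
      ext1 i
      rw [LinearEquiv.map_zero]
      cases i <;> simp
    rw [LinearMap.map_zero, e, Matrix.mulVec_zero, LinearEquiv.map_zero]
  | add x y hx hy =>
    rw [LinearMap.map_add, hx, hy, ← map_add, ← Matrix.mulVec_add]
    congr 2
    ext1 i
    rw [LinearEquiv.map_add]
    cases i <;> simp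
  | tmul t ω =>
    rw [σ₁Lift_tmul]
    change σ₁ p n ω • stdΨ Ψ.1 (0, t) = _
    rw [stdΨ_apply, ← map_smul, ← Matrix.mulVec_smul]
    congr 2
    ext1 i; cases i <;> simp [σ₁_smul, mul_comm]

theorem std_F₁ (Ψ : GL (Fin c ⊕ Fin d) (W p n R))
    (x : (Fin c → W p n R) × ((Fin d → W p n R) ⊗[W p n R] I p n R)) :
    (std Ψ).F₁ x = splitEquiv _ c d (Ψ.1 *ᵥ coordF₁ x) := by
  refine (Display.F₁_apply (std Ψ) x).trans ?_
  have := std_σ₁Lift Ψ x.2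
  refine (congrArg₂ (· + ·) (stdΨ_apply Ψ.1 (x.1, 0)) this).trans ?_
  rw [← map_add, ← Matrix.mulVec_add]
  congr 2
  ext1 i; cases i <;> simp [coordF₁]

end Fibre

section Morphism

variable {R S : Alg.{u} p} (f : R ⟶ S) (g : BlockMat p n c d S)
  (Ψ : GL (Fin c ⊕ Fin d) (W p n R)) (Ψ' : GL (Fin c ⊕ Fin d) (W p n S))

/-- `x ↦ M · f(x)` for a matrix `M` over `W_n(S)`. -/
noncomputable def mulVecSemi {k l : ℕ} (M : Matrix (Fin k) (Fin l) (W p n S)) :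
    (Fin l → W p n R) →ₛₗ[Wm n f] (Fin k → W p n S) where
  toFun x := M *ᵥ fun i => Wm n f (x i)
  map_add' x y := by
    rw [← Matrix.mulVec_add]
    congr 1
    ext1 i; simp
  map_smul' a x := by
    rw [← Matrix.mulVec_smul]
    congr 1
    ext1 i; simp

/-- The matrix `g = (A, B; C, D)` as a matrix of semilinear maps from `(W_n(R)^c, W_n(R)^d, Ψ)` to
`(W_n(S)^c, W_n(S)^d, Ψ')`. -/
noncomputable def stdMat : DMatrix f (std Ψ) (std Ψ') where
  A := mulVecSemi f g.A
  B := mulVecSemi f g.B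
  C :=
    { toFun := fun l => (coordI d).symm fun i => ∑ j, Wm n f (l j) • g.C i j
      map_add' := fun x y => by
        rw [← map_add]
        congr 1
        ext1 i
        simp only [Pi.add_apply, map_add, add_smul, Finset.sum_add_distrib]
      map_smul' := fun a x => by
        rw [← map_smul]
        congr 1
        ext1 i
        simp only [Pi.smul_apply, smul_eq_mul, map_mul, mul_smul, Finset.smul_sum] }
  D := mulVecSemi f g.D

theorem coordI_stdMat_C (l : Fin c → W p n R) (i : Fin d) :
    coordI d ((stdMat f g Ψ Ψ').C l) i = ∑ j, Wm n f (l j) • g.C i j :=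
  congrFun ((coordI d).apply_symm_apply _) i

theorem coordI_stdMat_DI (z : (Fin d → W p n R) ⊗[W p n R] I p n R) (i : Fin d) :
    coordI d ((stdMat f g Ψ Ψ').DI z) i =
      ∑ j, g.D i j • mapI p n (f.hom : R →+* S) (coordI d z j) := by
  induction z with
  | zero =>
    rw [LinearMap.map_zero, LinearEquiv.map_zero, LinearEquiv.map_zero, Pi.zero_apply]
    symm
    refine Finset.sum_eq_zero fun j _ => ?_
    rw [Pi.zero_apply, LinearMap.map_zero, smul_zero]
  | add x y hx hy =>
    rw [LinearMap.map_add, LinearEquiv.map_add, LinearEquiv.map_add, Pi.add_apply, hx, hy,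
      ← Finset.sum_add_distrib]
    refine Finset.sum_congr rfl fun j _ => ?_
    rw [Pi.add_apply, map_add, smul_add]
  | tmul t ω =>
    refine (coordI_tmul ((mulVecSemi f g.D) t) _ i).trans ?_
    change (∑ j, g.D i j * Wm n f (t j)) • _ = _
    rw [Finset.sum_smul]
    refine Finset.sum_congr rfl fun j _ => ?_
    rw [coordI_tmul, map_smulₛₗ, mul_smul]

theorem stdMat_onP (x : (Fin c → W p n R) × (Fin d → W p n R)) :
    (stdMat f g Ψ Ψ').onP x =
      splitEquiv _ c d (g.toMat *ᵥ fun i => Wm n f (Sum.elim x.1 x.2 i)) := by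
  refine (DMatrix.onP_apply (stdMat f g Ψ Ψ') x).trans ?_
  rw [BlockMat.toMat, Matrix.fromBlocks_mulVec]
  refine Prod.ext rfl ?_
  funext i
  change evalT (Fin d → W p n S) _ i + _ = (_ + _ : W p n S)
  congr 1
  rw [evalT_apply, coordI_stdMat_C, map_sum]
  refine Finset.sum_congr rfl fun j _ => ?_
  rw [map_smul, smul_eq_mul, mul_comm]
  rfl

theorem coordF_onP (x : (Fin c → W p n R) × (Fin d → W p n R)) :
    coordF ((stdMat f g Ψ Ψ').onP x) = g.σ₁Mat *ᵥ fun i => Wm n f (coordF x i) := by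
  rw [stdMat_onP, BlockMat.toMat, BlockMat.σ₁Mat, Matrix.fromBlocks_mulVec,
    Matrix.fromBlocks_mulVec]
  ext1 i
  cases i with
  | inl i =>
    simp [coordF, Matrix.mulVec, dotProduct, mul_add, Finset.mul_sum, ← mapW_σ]
    congr 1 <;> exact Finset.sum_congr rfl fun j _ => by ring
  | inr i =>
    simp [coordF, Matrix.mulVec, dotProduct, ← mapW_σ, σ_toW]
    exact Finset.sum_congr rfl fun j _ => by ring

theorem coordF₁_onQ (x : (Fin c → W p n R) × ((Fin d → W p n R) ⊗[W p n R] I p n R)) :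
    coordF₁ ((stdMat f g Ψ Ψ').onQ x) = g.σ₁Mat *ᵥ fun i => Wm n f (coordF₁ x i) := by
  have e : (stdMat f g Ψ Ψ').onQ x = (mulVecSemi f g.A x.1 + mulVecSemi f g.B (evalT _ x.2),
    (stdMat f g Ψ Ψ').C x.1 + (stdMat f g Ψ Ψ').DI x.2) := rfl
  rw [e, BlockMat.σ₁Mat, Matrix.fromBlocks_mulVec]
  ext1 i
  cases i with
  | inl i =>
    have e' : ∀ j, σ p n S (Wm n f (evalT (Fin d → W p n R) x.2 j)) =
        p * Wm n f (σ₁ p n (coordI d x.2 j)) := fun j => by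
      rw [evalT_apply, ← mapW_σ, σ_toW, map_mul, map_natCast]
    simp only [coordF₁, mulVecSemi, Sum.elim_inl, LinearMap.coe_mk, AddHom.coe_mk, Pi.add_apply,
      Matrix.mulVec, dotProduct, map_add, map_sum, map_mul, e', Matrix.map_apply,
      Matrix.smul_apply, Function.comp_apply, Sum.elim_inr, smul_eq_mul, ← mapW_σ]
    congr 1
    exact Finset.sum_congr rfl fun j _ => by ring
  | inr i =>
    have e₁ := coordI_stdMat_C f g Ψ Ψ' x.1 i
    have e₂ := coordI_stdMat_DI f g Ψ Ψ' x.2 i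
    simp only [coordF₁, Sum.elim_inr, map_add, Pi.add_apply]
    refine (congrArg₂ (fun a b => σ₁ p n a + σ₁ p n b) e₁ e₂).trans ?_
    simp only [map_sum, σ₁_smul, σ₁_mapI, Matrix.mulVec, dotProduct, Matrix.map_apply,
      Function.comp_apply, Sum.elim_inl, Sum.elim_inr, mapW_σ]
    congr 1
    exact Finset.sum_congr rfl fun j _ => mul_comm _ _

/-- If `Ψ' = g f(Ψ) σ₁(g)⁻¹`, the matrix `g` defines a morphism of truncated displays. -/
noncomputable def stdHom
    (h : Ψ'.1 * g.σ₁Mat = g.toMat * Ψ.1.map (Wm n f)) :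
    (⟨R, std Ψ⟩ : TDisplay.{u} p n) ⟶ ⟨S, std Ψ'⟩ where
  base := f
  mat := stdMat f g Ψ Ψ'
  comm_F x := by
    have hv : (fun i => Wm n f ((Ψ.1 *ᵥ coordF x) i)) =
        Ψ.1.map (Wm n f) *ᵥ fun i => Wm n f (coordF x i) := by
      funext i; exact RingHom.map_mulVec (Wm n f) _ _ i
    refine (congrArg _ (std_F Ψ x)).trans ?_
    refine (stdMat_onP f g Ψ Ψ' _).trans ?_
    refine Eq.trans ?_ (std_F Ψ' _).symm
    rw [coordF_onP, ← splitEquiv_symm, LinearEquiv.symm_apply_apply, hv, Matrix.mulVec_mulVec,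
      Matrix.mulVec_mulVec, h]
  comm_F₁ x := by
    have hv : (fun i => Wm n f ((Ψ.1 *ᵥ coordF₁ x) i)) =
        Ψ.1.map (Wm n f) *ᵥ fun i => Wm n f (coordF₁ x i) := by
      funext i; exact RingHom.map_mulVec (Wm n f) _ _ i
    refine (congrArg _ (std_F₁ Ψ x)).trans ?_
    refine (stdMat_onP f g Ψ Ψ' _).trans ?_
    refine Eq.trans ?_ (std_F₁ Ψ' _).symm
    rw [coordF₁_onQ, ← splitEquiv_symm, LinearEquiv.symm_apply_apply, hv, Matrix.mulVec_mulVec,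
      Matrix.mulVec_mulVec, h]

end Morphism

section Cocartesian

variable {R S : Alg.{u} p} (f : R ⟶ S) {U : Alg.{u} p} (k : S ⟶ U)

theorem stdMat_onQ_fst (g : BlockMat p n c d S) (Ψ : GL (Fin c ⊕ Fin d) (W p n R))
    (Ψ' : GL (Fin c ⊕ Fin d) (W p n S))
    (x : (Fin c → W p n R) × ((Fin d → W p n R) ⊗[W p n R] I p n R)) :
    ((stdMat f g Ψ Ψ').onQ x).1 = ((stdMat f g Ψ Ψ').onP (x.1, evalT _ x.2)).1 := rfl

theorem stdMat_onQ_snd (g : BlockMat p n c d S) (Ψ : GL (Fin c ⊕ Fin d) (W p n R))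
    (Ψ' : GL (Fin c ⊕ Fin d) (W p n S))
    (x : (Fin c → W p n R) × ((Fin d → W p n R) ⊗[W p n R] I p n R)) :
    evalT _ ((stdMat f g Ψ Ψ').onQ x).2 = ((stdMat f g Ψ Ψ').onP (x.1, evalT _ x.2)).2 := by
  rw [DMatrix.onQ_apply, DMatrix.onP_apply, LinearMap.map_add, DMatrix.evalT_DI]

theorem Q_ext {x y : (Fin c → W p n R) × ((Fin d → W p n R) ⊗[W p n R] I p n R)}
    (h : x.1 = y.1) (h' : coordF₁ x = coordF₁ y) : x = y := by
  refine Prod.ext h ((coordI d).injective ?_)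
  funext i
  exact (σ₁ p n).injective (congrFun h' (Sum.inr i))

theorem stdHom_comp (g : BlockMat p n c d S) (g' : BlockMat p n c d U)
    (Ψ : GL (Fin c ⊕ Fin d) (W p n R)) (Ψ' : GL (Fin c ⊕ Fin d) (W p n S))
    (Ψ'' : GL (Fin c ⊕ Fin d) (W p n U)) (h₁ h₂ h₃) :
    stdHom f g Ψ Ψ' h₁ ≫ stdHom k g' Ψ' Ψ'' h₂ =
      stdHom (f ≫ k) (g' * g.mapMat (k.hom : S →+* U)) Ψ Ψ'' h₃ := by
  have hW : ∀ M : Matrix (Fin c ⊕ Fin d) (Fin c ⊕ Fin d) (W p n S),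
      ∀ v : Fin c ⊕ Fin d → W p n R, (fun i => Wm n k ((M *ᵥ fun i => Wm n f (v i)) i)) =
        M.map (Wm n k) *ᵥ fun i => Wm n (f ≫ k) (v i) := by
    intro M v
    funext i
    refine (RingHom.map_mulVec (Wm n k) M _ i).trans ?_
    refine congrFun (congrArg _ (funext fun j => ?_)) i
    exact (mapW_comp p n _ _ _).symm
  have hP : ∀ x : (Fin c → W p n R) × (Fin d → W p n R),
      ((stdMat f g Ψ Ψ').comp (stdMat k g' Ψ' Ψ'')).onP x =
        (stdMat (f ≫ k) (g' * g.mapMat (k.hom : S →+* U)) Ψ Ψ'').onP x := by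
    intro x
    rw [DMatrix.onP_comp, stdMat_onP, stdMat_onP, stdMat_onP, ← splitEquiv_symm,
      LinearEquiv.symm_apply_apply, hW, Matrix.mulVec_mulVec, BlockMat.toMat_mul,
      BlockMat.toMat_mapMat]
  have hQ : ∀ x : (Fin c → W p n R) × ((Fin d → W p n R) ⊗[W p n R] I p n R),
      ((stdMat f g Ψ Ψ').comp (stdMat k g' Ψ' Ψ'')).onQ x =
        (stdMat (f ≫ k) (g' * g.mapMat (k.hom : S →+* U)) Ψ Ψ'').onQ x := by
    intro x
    refine Q_ext ?_ ?_
    · rw [stdMat_onQ_fst, ← hP, DMatrix.onQ_comp, DMatrix.onP_comp, stdMat_onQ_fst]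
      congr 2
      exact Prod.ext (stdMat_onQ_fst f g Ψ Ψ' x) (stdMat_onQ_snd f g Ψ Ψ' x)
    · rw [DMatrix.onQ_comp, coordF₁_onQ, coordF₁_onQ, coordF₁_onQ, hW, Matrix.mulVec_mulVec,
        BlockMat.σ₁Mat_mul, BlockMat.σ₁Mat_mapMat]
  exact TDisplay.Hom.ext rfl (DMatrix.ext_of_actions rfl _ _ hP hQ)

theorem stdHom_one (Ψ : GL (Fin c ⊕ Fin d) (W p n R)) (h) :
    stdHom (𝟙 R) 1 Ψ Ψ h = 𝟙 (⟨R, std Ψ⟩ : TDisplay.{u} p n) := by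
  have hP : ∀ x : (Fin c → W p n R) × (Fin d → W p n R),
      (stdMat (𝟙 R) 1 Ψ Ψ).onP x = x := by
    intro x
    have e : (fun i => Wm n (𝟙 R) (Sum.elim x.1 x.2 i)) = Sum.elim x.1 x.2 :=
      funext fun i => mapW_id p n (Sum.elim x.1 x.2 i)
    rw [stdMat_onP, BlockMat.toMat_one, Matrix.one_mulVec, e]
    rfl
  have hQ : ∀ x : (Fin c → W p n R) × ((Fin d → W p n R) ⊗[W p n R] I p n R),
      (stdMat (𝟙 R) 1 Ψ Ψ).onQ x = x := by
    intro x
    refine Q_ext ?_ ?_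
    · rw [stdMat_onQ_fst, hP]
    · rw [coordF₁_onQ, BlockMat.σ₁Mat_one, Matrix.one_mulVec]
      exact funext fun i => mapW_id p n (coordF₁ x i)
  exact TDisplay.Hom.ext rfl (DMatrix.ext_of_actions rfl (stdMat (𝟙 R) 1 Ψ Ψ)
    (DMatrix.id (std Ψ)) (fun x => (hP x).trans (DMatrix.onP_id x).symm)
    (fun x => (hQ x).trans (DMatrix.onQ_id x).symm))

/-- The semilinear map on `W_n(S)^l` with prescribed values on the standard basis. -/
noncomputable def extendSemi {l : ℕ} {M : Type*} [AddCommGroup M] [Module (W p n U) M]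
    (v : Fin l → M) : (Fin l → W p n S) →ₛₗ[Wm n k] M where
  toFun x := ∑ i, Wm n k (x i) • v i
  map_add' x y := by simp [add_smul, Finset.sum_add_distrib]
  map_smul' a x := by simp [mul_smul, Finset.smul_sum]

theorem extendSemi_map {l : ℕ} {M : Type*} [AddCommGroup M] [Module (W p n U) M]
    (φ : (Fin l → W p n R) →ₛₗ[Wm n (f ≫ k)] M) (x : Fin l → W p n R) :
    extendSemi k (fun i => φ (Pi.single i 1)) (fun i => Wm n f (x i)) = φ x := by
  have hx : x = ∑ i, x i • (Pi.single i 1 : Fin l → W p n R) := by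
    ext1 j
    simp [Finset.sum_apply, Pi.single_apply]
  have hφ := congrArg φ hx
  rw [map_sum φ] at hφ
  rw [hφ]
  change ∑ i, Wm n k (Wm n f (x i)) • φ (Pi.single i 1) = _
  refine Finset.sum_congr rfl fun i _ => ?_
  exact (congrArg (fun a : W p n U => a • φ (Pi.single i 1))
    (mapW_comp p n _ _ (x i)).symm).trans (φ.map_smulₛₗ (x i) _).symm

theorem semi_ext {l : ℕ} {M : Type*} [AddCommGroup M] [Module (W p n U) M]
    (φ φ' : (Fin l → W p n S) →ₛₗ[Wm n k] M)
    (h : ∀ x : Fin l → W p n R, φ (fun i => Wm n f (x i)) = φ' (fun i => Wm n f (x i))) :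
    φ = φ' := by
  have hb : ∀ i, φ (Pi.single i 1) = φ' (Pi.single i 1) := by
    intro i
    have e : (Pi.single i 1 : Fin l → W p n S) =
        fun j => Wm n f ((Pi.single i 1 : Fin l → W p n R) j) := by
      funext j
      rw [Pi.single_apply, Pi.single_apply]; split_ifs <;> simp
    rw [e]
    exact h _
  refine LinearMap.ext fun x => ?_
  have hx : x = ∑ i, x i • (Pi.single i 1 : Fin l → W p n S) := by
    ext1 j
    simp [Finset.sum_apply, Pi.single_apply]
  rw [hx, map_sum, map_sum]
  refine Finset.sum_congr rfl fun i _ => ?_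
  rw [LinearMap.map_smulₛₗ, LinearMap.map_smulₛₗ, hb]

theorem addHom_ext_std {M : Type*} [AddCommGroup M] [Module (W p n U) M]
    {τ : W p n S →+* W p n U} (φ φ' : (Fin c → W p n S) × (Fin d → W p n S) →+ M)
    (h₁ : ∀ a x, φ (a • x) = τ a • φ x) (h₂ : ∀ a x, φ' (a • x) = τ a • φ' x)
    (h : ∀ x : (Fin c → W p n R) × (Fin d → W p n R),
      φ (fun i => Wm n f (x.1 i), fun i => Wm n f (x.2 i)) =
      φ' (fun i => Wm n f (x.1 i), fun i => Wm n f (x.2 i))) (x) : φ x = φ' x := by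
  have hb : ∀ i, φ (splitEquiv _ c d (Pi.single i 1)) = φ' (splitEquiv _ c d (Pi.single i 1)) := by
    intro i
    have e : splitEquiv (W p n S) c d (Pi.single i 1) =
        (fun j => Wm n f ((splitEquiv (W p n R) c d (Pi.single i 1)).1 j),
          fun j => Wm n f ((splitEquiv (W p n R) c d (Pi.single i 1)).2 j)) := by
      refine Prod.ext (funext fun j => ?_) (funext fun j => ?_)
      · change (Pi.single i 1 : _ → W p n S) (Sum.inl j) =
          Wm n f ((Pi.single i 1 : _ → W p n R) (Sum.inl j))
        rw [Pi.single_apply, Pi.single_apply]; split_ifs <;> simp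
      · change (Pi.single i 1 : _ → W p n S) (Sum.inr j) =
          Wm n f ((Pi.single i 1 : _ → W p n R) (Sum.inr j))
        rw [Pi.single_apply, Pi.single_apply]; split_ifs <;> simp
    rw [e]
    exact h _
  obtain ⟨y, rfl⟩ := (splitEquiv (W p n S) c d).surjective x
  have hy : y = ∑ i, y i • (Pi.single i 1 : Fin c ⊕ Fin d → W p n S) := by
    ext1 j
    simp [Finset.sum_apply, Pi.single_apply]
  rw [hy, map_sum, map_sum, map_sum]
  refine Finset.sum_congr rfl fun i _ => ?_
  rw [map_smul, h₁, h₂, hb]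

/-- Scalar extension of `(W_n(R)^c, W_n(R)^d, Ψ)` along `f : R → S`. -/
noncomputable def stdBaseChange (Ψ : GL (Fin c ⊕ Fin d) (W p n R)) :
    (⟨R, std Ψ⟩ : TDisplay.{u} p n) ⟶ ⟨S, std (Matrix.GeneralLinearGroup.map (Wm n f) Ψ)⟩ :=
  stdHom f 1 Ψ (Matrix.GeneralLinearGroup.map (Wm n f) Ψ) (by
    rw [BlockMat.σ₁Mat_one, BlockMat.toMat_one, mul_one, one_mul]; rfl)

theorem stdBaseChange_onP (Ψ : GL (Fin c ⊕ Fin d) (W p n R))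
    (x : (Fin c → W p n R) × (Fin d → W p n R)) :
    (stdBaseChange f Ψ).mat.onP x = (fun i => Wm n f (x.1 i), fun i => Wm n f (x.2 i)) := by
  refine (stdMat_onP f 1 Ψ _ x).trans ?_
  rw [BlockMat.toMat_one, Matrix.one_mulVec]
  rfl

theorem stdBaseChange_C (Ψ : GL (Fin c ⊕ Fin d) (W p n R)) (l : Fin c → W p n R) :
    (stdBaseChange f Ψ).mat.C l = 0 := by
  apply (coordI d).injective
  funext i
  refine (coordI_stdMat_C f 1 Ψ _ l i).trans ?_
  rw [LinearEquiv.map_zero, Pi.zero_apply]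
  exact Finset.sum_eq_zero fun j _ => smul_zero _

theorem stdBaseChange_A (Ψ : GL (Fin c ⊕ Fin d) (W p n R)) (l : Fin c → W p n R) :
    (stdBaseChange f Ψ).mat.A l = fun i => Wm n f (l i) :=
  Matrix.one_mulVec _

theorem stdBaseChange_B (Ψ : GL (Fin c ⊕ Fin d) (W p n R)) (t : Fin d → W p n R) :
    (stdBaseChange f Ψ).mat.B t = 0 :=
  Matrix.zero_mulVec fun i => Wm n f (t i)

theorem stdBaseChange_D (Ψ : GL (Fin c ⊕ Fin d) (W p n R)) (t : Fin d → W p n R) :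
    (stdBaseChange f Ψ).mat.D t = fun i => Wm n f (t i) :=
  Matrix.one_mulVec _

theorem stdBaseChange_onQ (Ψ : GL (Fin c ⊕ Fin d) (W p n R)) (l : Fin c → W p n R) :
    (stdBaseChange f Ψ).mat.onQ (l, 0) = (fun i => Wm n f (l i), 0) := by
  rw [DMatrix.onQ_apply]
  refine Prod.ext ?_ ?_
  · change (stdBaseChange f Ψ).mat.A l + (stdBaseChange f Ψ).mat.B (evalT _ 0) = _
    rw [LinearMap.map_zero, LinearMap.map_zero, add_zero, stdBaseChange_A]
  · change (stdBaseChange f Ψ).mat.C l + (stdBaseChange f Ψ).mat.DI 0 = 0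
    rw [LinearMap.map_zero, stdBaseChange_C, add_zero]

theorem stdBaseChange_exists (Ψ : GL (Fin c ⊕ Fin d) (W p n R)) (Y : Display p n U)
    (mat : DMatrix (f ≫ k) (std Ψ) Y)
    (cF : ∀ x, mat.onP ((std Ψ).F x) = Y.F (mat.onP x))
    (cF₁ : ∀ x, mat.onP ((std Ψ).F₁ x) = Y.F₁ (mat.onQ x)) :
    ∃ χ : DMatrix k (std (Matrix.GeneralLinearGroup.map (Wm n f) Ψ)) Y,
      (stdBaseChange f Ψ).mat.comp χ = mat ∧
      (∀ x, χ.onP ((std (Matrix.GeneralLinearGroup.map (Wm n f) Ψ)).F x) = Y.F (χ.onP x)) ∧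
      (∀ x, χ.onP ((std (Matrix.GeneralLinearGroup.map (Wm n f) Ψ)).F₁ x) =
        Y.F₁ (χ.onQ x)) := by
  set Ψ' := Matrix.GeneralLinearGroup.map (Wm n f) Ψ with hΨ'
  let χ : DMatrix k (std Ψ') Y :=
    { A := extendSemi k fun i => mat.A (Pi.single i 1)
      B := extendSemi k fun i => mat.B (Pi.single i 1)
      C := extendSemi k fun i => mat.C (Pi.single i 1)
      D := extendSemi k fun i => mat.D (Pi.single i 1) }
  have hcomp : (stdBaseChange f Ψ).mat.comp χ = mat := by
    refine DMatrix.ext ?_ ?_ ?_ ?_ <;> refine LinearMap.ext fun x => ?_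
    · change χ.A ((stdBaseChange f Ψ).mat.A x) +
        χ.B (evalT _ ((stdBaseChange f Ψ).mat.C x)) = mat.A x
      rw [stdBaseChange_C, LinearMap.map_zero, LinearMap.map_zero, add_zero, stdBaseChange_A]
      exact extendSemi_map f k mat.A x
    · change χ.A ((stdBaseChange f Ψ).mat.B x) + χ.B ((stdBaseChange f Ψ).mat.D x) = mat.B x
      rw [stdBaseChange_B, LinearMap.map_zero, zero_add, stdBaseChange_D]
      exact extendSemi_map f k mat.B x
    · change χ.C ((stdBaseChange f Ψ).mat.A x) + χ.DI ((stdBaseChange f Ψ).mat.C x) = mat.C x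
      rw [stdBaseChange_C, LinearMap.map_zero, add_zero, stdBaseChange_A]
      exact extendSemi_map f k mat.C x
    · change evalT _ (χ.C ((stdBaseChange f Ψ).mat.B x)) +
        χ.D ((stdBaseChange f Ψ).mat.D x) = mat.D x
      rw [stdBaseChange_B, LinearMap.map_zero, LinearMap.map_zero, zero_add, stdBaseChange_D]
      exact extendSemi_map f k mat.D x
  have hP : ∀ x, χ.onP ((stdBaseChange f Ψ).mat.onP x) = mat.onP x := fun x =>
    (DMatrix.onP_comp _ _ x).symm.trans (congrArg (fun q => DMatrix.onP q x) hcomp)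
  have hQ : ∀ x, χ.onQ ((stdBaseChange f Ψ).mat.onQ x) = mat.onQ x := fun x =>
    (DMatrix.onQ_comp _ _ x).symm.trans (congrArg (fun q => DMatrix.onQ q x) hcomp)
  have hτ : ∀ a, σ p n U (Wm n k a) = Wm n k (σ p n S a) := fun a => (mapW_σ p n _ a).symm
  have hF : ∀ x, χ.onP ((std Ψ').F x) = Y.F (χ.onP x) := by
    refine addHom_ext_std f (τ := (Wm n k).comp (σ p n S))
      (χ.onP.toAddMonoidHom.comp (std Ψ').F.toAddMonoidHom)
      (Y.F.toAddMonoidHom.comp χ.onP.toAddMonoidHom) ?_ ?_ ?_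
    · intro a x
      change χ.onP ((std Ψ').F (a • x)) = Wm n k (σ p n S a) • χ.onP ((std Ψ').F x)
      rw [LinearMap.map_smulₛₗ, LinearMap.map_smulₛₗ]
    · intro a x
      change Y.F (χ.onP (a • x)) = Wm n k (σ p n S a) • Y.F (χ.onP x)
      rw [LinearMap.map_smulₛₗ, LinearMap.map_smulₛₗ, hτ]
    · intro x
      rw [← stdBaseChange_onP f Ψ x]
      change χ.onP ((std Ψ').F ((stdBaseChange f Ψ).mat.onP x)) =
        Y.F (χ.onP ((stdBaseChange f Ψ).mat.onP x))
      rw [hP, ← cF, ← hP]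
      exact congrArg _ ((stdBaseChange f Ψ).comm_F x).symm
  have hL : ∀ l, χ.onP ((std Ψ').F₁ (l, 0)) = Y.F₁ (χ.onQ (l, 0)) := by
    intro l
    let ι : (Fin c → W p n S) × (Fin d → W p n S) →ₗ[W p n S]
        (Fin c → W p n S) × ((Fin d → W p n S) ⊗[W p n S] I p n S) :=
      LinearMap.inl _ _ _ ∘ₗ LinearMap.fst _ _ _
    refine addHom_ext_std f (τ := (Wm n k).comp (σ p n S))
      ((χ.onP.toAddMonoidHom.comp (std Ψ').F₁.toAddMonoidHom).comp ι.toAddMonoidHom)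
      ((Y.F₁.toAddMonoidHom.comp χ.onQ.toAddMonoidHom).comp ι.toAddMonoidHom)
      ?_ ?_ ?_ (l, 0)
    · intro a x
      change χ.onP ((std Ψ').F₁ (ι (a • x))) =
        Wm n k (σ p n S a) • χ.onP ((std Ψ').F₁ (ι x))
      rw [LinearMap.map_smul, LinearMap.map_smulₛₗ, LinearMap.map_smulₛₗ]
    · intro a x
      change Y.F₁ (χ.onQ (ι (a • x))) = Wm n k (σ p n S a) • Y.F₁ (χ.onQ (ι x))
      rw [LinearMap.map_smul, LinearMap.map_smulₛₗ, LinearMap.map_smulₛₗ, hτ]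
    · intro x
      change χ.onP ((std Ψ').F₁ ((fun i => Wm n f (x.1 i)), 0)) =
        Y.F₁ (χ.onQ ((fun i => Wm n f (x.1 i)), 0))
      rw [← stdBaseChange_onQ f Ψ x.1, hQ, ← cF₁, ← hP]
      exact congrArg _ ((stdBaseChange f Ψ).comm_F₁ (x.1, 0)).symm
  exact ⟨χ, hcomp, hF, χ.comm_F₁_of hF hL⟩

theorem stdBaseChange_unique (Ψ : GL (Fin c ⊕ Fin d) (W p n R)) (Y : Display p n U)
    (χ χ' : DMatrix k (std (Matrix.GeneralLinearGroup.map (Wm n f) Ψ)) Y)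
    (h : (stdBaseChange f Ψ).mat.comp χ = (stdBaseChange f Ψ).mat.comp χ') : χ = χ' := by
  have key : ∀ (m : DMatrix k (std (Matrix.GeneralLinearGroup.map (Wm n f) Ψ)) Y),
      (∀ l : Fin c → W p n R, ((stdBaseChange f Ψ).mat.comp m).A l =
        m.A (fun i => Wm n f (l i))) ∧
      (∀ t : Fin d → W p n R, ((stdBaseChange f Ψ).mat.comp m).B t =
        m.B (fun i => Wm n f (t i))) ∧
      (∀ l : Fin c → W p n R, ((stdBaseChange f Ψ).mat.comp m).C l =
        m.C (fun i => Wm n f (l i))) ∧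
      (∀ t : Fin d → W p n R, ((stdBaseChange f Ψ).mat.comp m).D t =
        m.D (fun i => Wm n f (t i))) := by
    intro m
    refine ⟨fun l => ?_, fun t => ?_, fun l => ?_, fun t => ?_⟩
    · change m.A ((stdBaseChange f Ψ).mat.A l) +
        m.B (evalT _ ((stdBaseChange f Ψ).mat.C l)) = _
      rw [stdBaseChange_C, LinearMap.map_zero, LinearMap.map_zero, add_zero, stdBaseChange_A]
    · change m.A ((stdBaseChange f Ψ).mat.B t) + m.B ((stdBaseChange f Ψ).mat.D t) = _
      rw [stdBaseChange_B, LinearMap.map_zero, zero_add, stdBaseChange_D]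
    · change m.C ((stdBaseChange f Ψ).mat.A l) + m.DI ((stdBaseChange f Ψ).mat.C l) = _
      rw [stdBaseChange_C, LinearMap.map_zero, add_zero, stdBaseChange_A]
    · change evalT _ (m.C ((stdBaseChange f Ψ).mat.B t)) +
        m.D ((stdBaseChange f Ψ).mat.D t) = _
      rw [stdBaseChange_B, LinearMap.map_zero, LinearMap.map_zero, zero_add, stdBaseChange_D]
  obtain ⟨a, b, c', d'⟩ := key χ
  obtain ⟨a', b', c'', d''⟩ := key χ'
  rw [h] at a b c' d'
  exact DMatrix.ext (semi_ext f k _ _ fun x => (a x).symm.trans (a' x))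
    (semi_ext f k _ _ fun x => (b x).symm.trans (b' x))
    (semi_ext f k _ _ fun x => (c' x).symm.trans (c'' x))
    (semi_ext f k _ _ fun x => (d' x).symm.trans (d'' x))

theorem stdBaseChange_isStronglyCocartesian (Ψ : GL (Fin c ⊕ Fin d) (W p n R)) :
    TDisplay.proj.IsStronglyCocartesian f (stdBaseChange f Ψ) := by
  have lift : TDisplay.proj.IsHomLift f (stdBaseChange f Ψ) :=
    TDisplay.isHomLift (stdBaseChange f Ψ)
  refine ⟨?_⟩
  intro Y (k : S ⟶ Y.R) m hm
  have hbase : m.base = f ≫ k := TDisplay.base_eq hm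
  clear hm
  obtain ⟨base, mat, cF, cF₁⟩ := m
  change base = f ≫ k at hbase
  subst hbase
  obtain ⟨χ, hχ, hF, hF₁⟩ := stdBaseChange_exists f k Ψ Y.X mat cF cF₁
  let X' : TDisplay.{u} p n := ⟨S, std (Matrix.GeneralLinearGroup.map (Wm n f) Ψ)⟩
  let χ₀ : X' ⟶ Y := { base := k, mat := χ, comm_F := hF, comm_F₁ := hF₁ }
  refine ⟨χ₀, ⟨TDisplay.isHomLift χ₀,
    TDisplay.Hom.ext rfl (heq_of_eq hχ)⟩, ?_⟩
  rintro χ' ⟨hl, hcomp⟩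
  have hbase : χ'.base = k := TDisplay.base_eq hl
  clear hl
  obtain ⟨base, mat', cF', cF₁'⟩ := χ'
  change base = k at hbase
  subst hbase
  have h' : (stdBaseChange f Ψ).mat.comp mat' = mat :=
    eq_of_heq (TDisplay.Hom.ext_iff.1 hcomp).2
  exact TDisplay.Hom.ext rfl
    (heq_of_eq (stdBaseChange_unique f base Ψ Y.X mat' χ (h'.trans hχ.symm)))

end Cocartesian

end Std

/-! ### The stack of truncated displays -/

section DispStack

variable (p n : ℕ) [Fact p.Prime]

/-- An object of `Disp_n^{h,d}`: a truncated display over an `𝔽_p`-algebra `R` of height `h` and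
dimension `d`, i.e. `L ⊕ T` has constant rank `h` and `T` has constant rank `d` over `W_n(R)`. -/
structure DispObj (h d : ℕ) where
  /-- The truncated display. -/
  X : TDisplay.{u} p n
  rank_height : ∀ 𝔮 : PrimeSpectrum (W p n X.R),
    Module.rankAtStalk (X.X.L × X.X.T) 𝔮 = h
  rank_dim : ∀ 𝔮 : PrimeSpectrum (W p n X.R), Module.rankAtStalk X.X.T 𝔮 = d

namespace DispObj

variable {p n} {h d : ℕ}

/-- The arrows of `Disp_n^{h,d}` are those morphisms of displays over ring homomorphisms `R → S`
that exhibit the target as the scalar extension of the source along `R → S`. Being a category over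
affine schemes, they are directed from the target to the source. For `R = S` and the identity they
are the isomorphisms of truncated displays over `R`. -/
noncomputable instance : Category (DispObj.{u} p n h d) where
  Hom Y X := { m : X.X ⟶ Y.X // TDisplay.proj.IsStronglyCocartesian (TDisplay.proj.map m) m }
  id X := ⟨𝟙 X.X, by
    have : TDisplay.proj.IsStronglyCocartesian (TDisplay.proj.map (𝟙 X.X)) (𝟙 X.X) :=
      inferInstance
    exact this⟩
  comp m m' := ⟨m'.1 ≫ m.1, by
    have := m.2
    have := m'.2
    rw [Functor.map_comp]
    infer_instance⟩
  id_comp m := Subtype.ext (Category.comp_id _)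
  comp_id m := Subtype.ext (Category.id_comp _)
  assoc m m' m'' := Subtype.ext (Category.assoc _ _ _).symm

variable (p n h d) in
/-- The projection `Disp_n^{h,d} → Aff`. -/
@[simps]
noncomputable def proj : DispObj.{u} p n h d ⥤ (Alg.{u} p)ᵒᵖ where
  obj X := Opposite.op X.X.R
  map m := (TDisplay.proj.map m.1).op

end DispObj

/-- The stack `Disp_n^{h,d}` of truncated displays of level `n`, height `h` and dimension `d`. -/
noncomputable def dispStack (h d : ℕ) : BasedCategory.{u, u + 1} (Alg.{u} p)ᵒᵖ :=
  BasedCategory.ofFunctor (DispObj.proj p n h d)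

end DispStack

section StdFunctor

variable {p n c d : ℕ} [Fact p.Prime]

theorem stdHom_one_isIso {S : Alg.{u} p} (g : (BlockMat p n c d S)ˣ)
    (Ψ Ψ' : GL (Fin c ⊕ Fin d) (W p n S))
    (h : Ψ'.1 * g.1.σ₁Mat = g.1.toMat * Ψ.1.map (Wm n (𝟙 S))) :
    IsIso (stdHom (𝟙 S) g.1 Ψ Ψ' h) := by
  have id_map : ∀ M : Matrix (Fin c ⊕ Fin d) (Fin c ⊕ Fin d) (W p n S),
      M.map (Wm n (𝟙 S)) = M := fun M => by
    ext1 i j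
    exact mapW_id p n (M i j)
  have id_mapMat : ∀ M : BlockMat p n c d S, M.mapMat ((𝟙 S : S ⟶ S).hom : S →+* S) = M :=
    fun M => BlockMat.mapMat_id M
  have toMat_inv : g⁻¹.1.toMat * g.1.toMat = 1 := by
    rw [← BlockMat.toMat_mul, Units.inv_mul, BlockMat.toMat_one]
  have σ₁_inv : g.1.σ₁Mat * g⁻¹.1.σ₁Mat = 1 := by
    rw [← BlockMat.σ₁Mat_mul, Units.mul_inv, BlockMat.σ₁Mat_one]
  have h' : Ψ.1 * g⁻¹.1.σ₁Mat = g⁻¹.1.toMat * Ψ'.1.map (Wm n (𝟙 S)) := by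
    rw [id_map] at h ⊢
    calc Ψ.1 * g⁻¹.1.σ₁Mat
        = (g⁻¹.1.toMat * g.1.toMat) * Ψ.1 * g⁻¹.1.σ₁Mat := by rw [toMat_inv, one_mul]
      _ = g⁻¹.1.toMat * (g.1.toMat * Ψ.1) * g⁻¹.1.σ₁Mat := by simp only [mul_assoc]
      _ = g⁻¹.1.toMat * Ψ'.1 * (g.1.σ₁Mat * g⁻¹.1.σ₁Mat) := by
        rw [← h]; simp only [mul_assoc]
      _ = _ := by rw [σ₁_inv, mul_one]
  have h₁ : ∀ Ψ₀ : GL (Fin c ⊕ Fin d) (W p n S),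
      Ψ₀.1 * (1 : BlockMat p n c d S).σ₁Mat =
        (1 : BlockMat p n c d S).toMat * Ψ₀.1.map (Wm n (𝟙 S)) := fun Ψ₀ => by
    rw [id_map, BlockMat.σ₁Mat_one, BlockMat.toMat_one, one_mul, mul_one]
  refine ⟨stdHom (𝟙 S) g⁻¹.1 Ψ' Ψ h', ?_, ?_⟩
  · have e : g⁻¹.1 * g.1.mapMat ((𝟙 S : S ⟶ S).hom : S →+* S) = 1 := by
      rw [id_mapMat, Units.inv_mul]
    have hc : Ψ.1 * (g⁻¹.1 * g.1.mapMat ((𝟙 S : S ⟶ S).hom : S →+* S)).σ₁Mat =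
        (g⁻¹.1 * g.1.mapMat ((𝟙 S : S ⟶ S).hom : S →+* S)).toMat *
          Ψ.1.map (Wm n (𝟙 S ≫ 𝟙 S)) := by
      rw [e, Category.comp_id]; exact h₁ Ψ
    refine (stdHom_comp (𝟙 S) (𝟙 S) g.1 g⁻¹.1 Ψ Ψ' Ψ h h' hc).trans ?_
    rw [← stdHom_one Ψ (h₁ Ψ)]
    congr 1
  · have e : g.1 * g⁻¹.1.mapMat ((𝟙 S : S ⟶ S).hom : S →+* S) = 1 := by
      rw [id_mapMat, Units.mul_inv]
    have hc : Ψ'.1 * (g.1 * g⁻¹.1.mapMat ((𝟙 S : S ⟶ S).hom : S →+* S)).σ₁Mat =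
        (g.1 * g⁻¹.1.mapMat ((𝟙 S : S ⟶ S).hom : S →+* S)).toMat *
          Ψ'.1.map (Wm n (𝟙 S ≫ 𝟙 S)) := by
      rw [e, Category.comp_id]; exact h₁ Ψ'
    refine (stdHom_comp (𝟙 S) (𝟙 S) g⁻¹.1 g.1 Ψ' Ψ Ψ' h' h hc).trans ?_
    rw [← stdHom_one Ψ' (h₁ Ψ')]
    congr 1

/-- An invertible `g` exhibits the display of `g f(Ψ) σ₁(g)⁻¹` as the scalar extension of the
display of `Ψ`. -/
theorem stdHom_isStronglyCocartesian {R S : Alg.{u} p} (f : R ⟶ S) (g : (BlockMat p n c d S)ˣ)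
    (Ψ : GL (Fin c ⊕ Fin d) (W p n R)) (Ψ' : GL (Fin c ⊕ Fin d) (W p n S))
    (h : Ψ'.1 * g.1.σ₁Mat = g.1.toMat * Ψ.1.map (Wm n f)) :
    TDisplay.proj.IsStronglyCocartesian f (stdHom f g.1 Ψ Ψ' h) := by
  have id_map : ∀ M : Matrix (Fin c ⊕ Fin d) (Fin c ⊕ Fin d) (W p n S),
      M.map (Wm n (𝟙 S)) = M := fun M => by
    ext1 i j
    exact mapW_id p n (M i j)
  have h₂ : Ψ'.1 * g.1.σ₁Mat =
      g.1.toMat * (Matrix.GeneralLinearGroup.map (Wm n f) Ψ).1.map (Wm n (𝟙 S)) := by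
    rw [id_map]; exact h
  have e : g.1 * (1 : BlockMat p n c d S).mapMat ((𝟙 S : S ⟶ S).hom : S →+* S) = g.1 := by
    rw [show (1 : BlockMat p n c d S).mapMat ((𝟙 S : S ⟶ S).hom : S →+* S) = 1 from
      BlockMat.mapMat_id 1, mul_one]
  have hc : Ψ'.1 * (g.1 * (1 : BlockMat p n c d S).mapMat ((𝟙 S : S ⟶ S).hom : S →+* S)).σ₁Mat =
      (g.1 * (1 : BlockMat p n c d S).mapMat ((𝟙 S : S ⟶ S).hom : S →+* S)).toMat *
        Ψ.1.map (Wm n (f ≫ 𝟙 S)) := by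
    rw [e, Category.comp_id]; exact h
  have fac : stdBaseChange f Ψ ≫ stdHom (𝟙 S) g.1 _ Ψ' h₂ = stdHom f g.1 Ψ Ψ' h := by
    refine (stdHom_comp f (𝟙 S) 1 g.1 Ψ _ Ψ' _ h₂ hc).trans ?_
    congr 1
  have i₁ := stdBaseChange_isStronglyCocartesian f Ψ
  have i₂ := stdHom_one_isIso g _ Ψ' h₂
  have i₃ : TDisplay.proj.IsHomLift (𝟙 S) (stdHom (𝟙 S) g.1 _ Ψ' h₂) :=
    TDisplay.isHomLift (stdHom (𝟙 S) g.1 _ Ψ' h₂)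
  have i₄ : TDisplay.proj.IsStronglyCocartesian (𝟙 S) (stdHom (𝟙 S) g.1 _ Ψ' h₂) :=
    inferInstance
  have i₅ : TDisplay.proj.IsStronglyCocartesian (f ≫ 𝟙 S)
    (stdBaseChange f Ψ ≫ stdHom (𝟙 S) g.1 _ Ψ' h₂) := inferInstance
  rwa [fac, Category.comp_id] at i₅

theorem rankAtStalk_fun {K : Type u} [CommRing K] (l : ℕ) (𝔮 : PrimeSpectrum K) :
    Module.rankAtStalk (Fin l → K) 𝔮 = l := by
  have := 𝔮.nontrivial
  rw [Module.rankAtStalk_eq_finrank_of_free]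
  simp

theorem displayGSpace_hom_eq {y x : PrequotientObj (displayGSpace.{u} p n c d)}
    (m : PrequotientObj.Hom y x) (g : (BlockMat p n c d y.R)ˣ) (hg : m.g = g)
    (Ψ : GL (Fin c ⊕ Fin d) (W p n x.R)) (Ψ' : GL (Fin c ⊕ Fin d) (W p n y.R))
    (hx : x.x = Ψ) (hy : y.x = Ψ') :
    Ψ'.1 * g.1.σ₁Mat = g.1.toMat * Ψ.1.map (Wm n m.base) := by
  have h := m.smul_eq
  rw [hg, hx, hy] at h
  have h' : Units.map BlockMat.toMatHom g * Matrix.GeneralLinearGroup.map (Wm n m.base) Ψ *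
      (Units.map BlockMat.σ₁MatHom g)⁻¹ = Ψ' := h
  have h'' : Units.map BlockMat.toMatHom g * Matrix.GeneralLinearGroup.map (Wm n m.base) Ψ =
      Ψ' * Units.map BlockMat.σ₁MatHom g := mul_inv_eq_iff_eq_mul.1 h'
  exact (congrArg Units.val h'').symm

variable (p n) in
/-- The functor from the quotient prestack of `X_n^{h,d}` by `G_n^{h,d}` to `Disp_n^{h,d}`. It sends
`Ψ ∈ GL_h(W_n(R))` to `(W_n(R)^{h-d}, W_n(R)^d, x ↦ Ψ · σ(x))`, and
`g` with `g f(Ψ) σ₁(g)⁻¹ = Ψ'` to the morphism of displays with matrix `g`. -/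
noncomputable def stdFunctor (h d : ℕ) (hd : d ≤ h) :
    BasedFunctor (prequotient (displayGSpace.{u} p n (h - d) d)) (dispStack p n h d) where
  obj x :=
    { X := ⟨x.R, std (c := h - d) (d := d) x.x⟩
      rank_height := fun 𝔮 => by
        change Module.rankAtStalk ((Fin (h - d) → W p n x.R) × (Fin d → W p n x.R)) 𝔮 = h
        rw [Module.rankAtStalk_prod, Pi.add_apply, rankAtStalk_fun, rankAtStalk_fun]
        exact Nat.sub_add_cancel hd
      rank_dim := fun 𝔮 => rankAtStalk_fun d 𝔮 }
  map {y x} m :=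
    ⟨stdHom m.base (Units.val (α := BlockMat p n (h - d) d y.R) m.g) x.x y.x
      (displayGSpace_hom_eq m m.g rfl x.x y.x rfl rfl),
      stdHom_isStronglyCocartesian m.base _ _ _ _⟩
  map_id x := Subtype.ext
    (stdHom_one _ (displayGSpace_hom_eq (𝟙 x : x ⟶ x) 1 rfl x.x x.x rfl rfl))
  map_comp {z y x} m m' := Subtype.ext
    (stdHom_comp m'.base m.base _ _ x.x y.x z.x
      (displayGSpace_hom_eq m' m'.g rfl x.x y.x rfl rfl)
      (displayGSpace_hom_eq m m.g rfl y.x z.x rfl rfl)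
      (displayGSpace_hom_eq (m ≫ m') (m ≫ m').g rfl x.x z.x rfl rfl)).symm
  w := rfl

end StdFunctor

end Disp

/-! A trivialization over `A` of a display `X` is a base change of `X` to the display of a matrix
`Ψ` over `W_n(A)`. The functor of trivializations, with the group acting by change of coordinates
and with the map that remembers `Ψ`, is an object of `[X/G]`. This defines `torsorFunctor`, from
displays to torsors, and Φ is its inverse. What has to be shown is that `torsorFunctor` is fully
faithful, that it is essentially surjective over each base, and that it sends the display of a
matrix to the trivial torsor (`exists_standard_iso`). The rest is formal (`exists_based_inverse`,
`exists_based_iso_of_inverse`).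

The action is simply transitive because the isomorphisms from the display of `Ψ` to that of `Ψ'` are
exactly the group elements carrying `Ψ` to `Ψ'` (`exists_unit_eq_stdHom`). Trivializations exist
locally because `W_n(R) → R` has nilpotent kernel: an element of `W_n(R)` becomes a unit once its
residue does, so `L` and `T` are free Zariski locally on `Spec R` (`locallyNonempty`). The sheaf
property and full faithfulness follow from the gluing of morphisms (`exists_glue_hom`). Elements of
projective modules are described by their coordinates in a dual basis, and `W_n` is a sheaf
component by component. A glued morphism is again a base change, because this property depends only
on the diagonal entries of the matrix after reduction along `W_n(R) → R`
(`of_isResidualBaseChange`), where ordinary faithfully flat descent applies.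

Essential surjectivity is effective descent for displays (`exists_display_of_torsor`). A section of
the torsor over an étale surjective `R → B` gives a cocycle of block matrices. No flatness of
`W_n(R) → W_n(B)` is used. Instead, the residues of the two diagonal blocks descend to projective
`R`-modules (`Cocycle.exists_descent`), which lift to projective `W_n(R)`-modules `L` and `T`
(`exists_projective_lift`). To map `L` and `T` into the vectors that descend for the full cocycle,
one climbs the filtration by powers of the Verschiebung. On a graded piece a matrix acts through a
Frobenius power of its residue, and the obstruction is a 1-cocycle with values in a twisted vector
bundle on an affine scheme, hence a coboundary (`exists_eq_sub`,
`TriangularTwist.exists_invariant`).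

The two resulting columns form an invertible block matrix over `B`, and changing the section by it
makes the cocycle block diagonal (`exists_diagonalization`, `exists_normalized_section`). On block
diagonal matrices `σ₁` is just `σ` entrywise, so `Ψ` descends to a `σ`-linear automorphism of `L ⊕
T` (`exists_descent_stdΨ`). The display so obtained has a torsor of trivializations with the same
cocycle as the given torsor, and torsors with equal cocycles are isomorphic
(`exists_hom_of_cocycle`, `QuotientObj.Hom.isIso`). -/

namespace Disp

/-! ### Semilinear base change -/

namespace LinearizationBijective

section Basic

variable {R S M N : Type*} [CommRing R] [CommRing S] [AddCommGroup M] [AddCommGroup N]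
  [Module R M] [Module S N] {τ : R →+* S} {u : M →ₛₗ[τ] N}

/-- Scalar extensions are handled as semilinear maps throughout, because several ring homomorphisms
between the same rings occur together, such as `σ` and the identity of `W_n(R)`. Algebra instances
are created only locally inside the proofs. -/
theorem induction (hu : LinearizationBijective u) {motive : N → Prop} (zero : motive 0)
    (add : ∀ x y, motive x → motive y → motive (x + y))
    (smul : ∀ (a : S) x, motive x → motive (a • x)) (map : ∀ x, motive (u x)) (y : N) :
    motive y := by
  let _ : Algebra R S := τ.toAlgebra
  let _ : Module R N := Module.compHom N τ
  have _ : IsScalarTower R S N := ⟨fun r s x => mul_smul (τ r) s x⟩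
  exact IsBaseChange.inductionOn (S := S)
    (f := { toFun := u, map_add' := u.map_add, map_smul' := u.map_smulₛₗ }) hu y motive zero map
    smul add

theorem span_range (hu : LinearizationBijective u) : Submodule.span S (Set.range u) = ⊤ := by
  refine eq_top_iff.2 fun y _ => ?_
  exact hu.induction (motive := (· ∈ Submodule.span S (Set.range u))) (Submodule.zero_mem _)
    (fun _ _ => Submodule.add_mem _) (fun a _ => Submodule.smul_mem _ a)
    (fun x => Submodule.subset_span (Set.mem_range_self x)) y

variable {T O : Type*} [CommRing T] [AddCommGroup O] [Module T O] {τ' : S →+* T} {τ'' : R →+* T}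

/-- The maps are only additive, with equivariance as a hypothesis. Composites such as `χ ∘ F` and `F
∘ χ`, which run through `σ` and `W_n(k)` in different orders, can thus be compared along one ring
homomorphism. -/
theorem addHom_ext (hu : LinearizationBijective u) {w w' : N →+ O}
    (hw : ∀ (a : S) x, w (a • x) = τ' a • w x) (hw' : ∀ (a : S) x, w' (a • x) = τ' a • w' x)
    (h : ∀ x, w (u x) = w' (u x)) (y : N) : w y = w' y :=
  hu.induction (motive := fun y => w y = w' y) (by simp) (fun x y hx hy => by simp [hx, hy])
    (fun a x hx => by rw [hw, hw', hx]) h y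

theorem ext (hu : LinearizationBijective u) {w w' : N →ₛₗ[τ'] O}
    (h : ∀ x, w (u x) = w' (u x)) : w = w' :=
  LinearMap.ext (hu.addHom_ext (w := w.toAddMonoidHom) (w' := w'.toAddMonoidHom)
    (τ' := τ') w.map_smulₛₗ w'.map_smulₛₗ h)

theorem exists_lift (hu : LinearizationBijective u) [t : RingHomCompTriple τ τ' τ'']
    (v : M →ₛₗ[τ''] O) : ∃ w : N →ₛₗ[τ'] O, ∀ x, w (u x) = v x := by
  let _ : Algebra R S := τ.toAlgebra
  let _ : Module R N := Module.compHom N τ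
  have _ : IsScalarTower R S N := ⟨fun r s x => mul_smul (τ r) s x⟩
  let _ : Module S O := Module.compHom O τ'
  let _ : Module R O := Module.compHom O τ''
  have _ : IsScalarTower R S O := ⟨fun r s x => by
    change τ' (τ r * s) • x = τ'' r • τ' s • x
    rw [map_mul, mul_smul, ← t.comp_apply]⟩
  let v' : M →ₗ[R] O := { toFun := v, map_add' := v.map_add, map_smul' := v.map_smulₛₗ }
  let w := IsBaseChange.lift hu v'
  exact ⟨{ toFun := w, map_add' := w.map_add, map_smul' := w.map_smul },
    fun x => IsBaseChange.lift_eq hu v' x⟩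

theorem comp [t : RingHomCompTriple τ τ' τ''] (hu : LinearizationBijective u) {v : N →ₛₗ[τ'] O}
    (hv : LinearizationBijective v) : LinearizationBijective (v.comp u : M →ₛₗ[τ''] O) := by
  let _ : Algebra R S := τ.toAlgebra
  let _ : Algebra S T := τ'.toAlgebra
  let _ : Algebra R T := τ''.toAlgebra
  have _ : IsScalarTower R S T := IsScalarTower.of_algebraMap_eq fun r => t.comp_apply.symm
  let _ : Module R N := Module.compHom N τ
  have _ : IsScalarTower R S N := ⟨fun r s x => mul_smul (τ r) s x⟩
  let _ : Module S O := Module.compHom O τ'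
  have _ : IsScalarTower S T O := ⟨fun r s x => mul_smul (τ' r) s x⟩
  let _ : Module R O := Module.compHom O τ''
  have _ : IsScalarTower R T O := ⟨fun r s x => mul_smul (τ'' r) s x⟩
  have _ : IsScalarTower R S O := ⟨fun r s x => by
    change τ' (τ r * s) • x = τ'' r • τ' s • x
    rw [map_mul, mul_smul, ← t.comp_apply]⟩
  let u' : M →ₗ[R] N := { toFun := u, map_add' := u.map_add, map_smul' := u.map_smulₛₗ }
  let v' : N →ₗ[S] O := { toFun := v, map_add' := v.map_add, map_smul' := v.map_smulₛₗ }
  have hu' : IsBaseChange S u' := hu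
  have hv' : IsBaseChange T v' := hv
  have h : IsBaseChange T (v'.restrictScalars R ∘ₗ u') := IsBaseChange.comp hu' hv'
  exact h

theorem of_comp [t : RingHomCompTriple τ τ' τ''] (hu : LinearizationBijective u)
    {v : N →ₛₗ[τ'] O} (hv : LinearizationBijective (v.comp u : M →ₛₗ[τ''] O)) :
    LinearizationBijective v := by
  let _ : Algebra R S := τ.toAlgebra
  let _ : Algebra S T := τ'.toAlgebra
  let _ : Algebra R T := τ''.toAlgebra
  have _ : IsScalarTower R S T := IsScalarTower.of_algebraMap_eq fun r => t.comp_apply.symm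
  let _ : Module R N := Module.compHom N τ
  have _ : IsScalarTower R S N := ⟨fun r s x => mul_smul (τ r) s x⟩
  let _ : Module S O := Module.compHom O τ'
  have _ : IsScalarTower S T O := ⟨fun r s x => mul_smul (τ' r) s x⟩
  let _ : Module R O := Module.compHom O τ''
  have _ : IsScalarTower R T O := ⟨fun r s x => mul_smul (τ'' r) s x⟩
  have _ : IsScalarTower R S O := ⟨fun r s x => by
    change τ' (τ r * s) • x = τ'' r • τ' s • x
    rw [map_mul, mul_smul, ← t.comp_apply]⟩
  let u' : M →ₗ[R] N := { toFun := u, map_add' := u.map_add, map_smul' := u.map_smulₛₗ }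
  let v' : N →ₗ[S] O := { toFun := v, map_add' := v.map_add, map_smul' := v.map_smulₛₗ }
  have hu' : IsBaseChange S u' := hu
  have hv' : IsBaseChange T (v'.restrictScalars R ∘ₗ u') := hv
  exact hu'.of_comp hv'

theorem of_equiv : letI : Algebra R S := τ.toAlgebra
    ∀ e : S ⊗[R] M ≃ₗ[S] N, (∀ x, e (1 ⊗ₜ x) = u x) → LinearizationBijective u := by
  intro e he
  let _ : Algebra R S := τ.toAlgebra
  let _ : Module R N := Module.compHom N τ
  have _ : IsScalarTower R S N := ⟨fun r s x => mul_smul (τ r) s x⟩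
  exact IsBaseChange.of_equiv e he

theorem equiv (hu : LinearizationBijective u) :
    letI : Algebra R S := τ.toAlgebra
    ∃ e : S ⊗[R] M ≃ₗ[S] N, ∀ a x, e (a ⊗ₜ x) = a • u x := by
  let _ : Algebra R S := τ.toAlgebra
  let _ : Module R N := Module.compHom N τ
  have _ : IsScalarTower R S N := ⟨fun r s x => mul_smul (τ r) s x⟩
  exact ⟨IsBaseChange.equiv hu, fun a x => IsBaseChange.equiv_tmul hu a x⟩

theorem of_unique_lift {O' : Type*} [AddCommGroup O'] [Module S O'] {v : M →ₛₗ[τ] O'}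
    (hu : LinearizationBijective u) (e : N →ₗ[S] O') (he : Function.Bijective e)
    (h : ∀ x, e (u x) = v x) : LinearizationBijective v := by
  let _ : Algebra R S := τ.toAlgebra
  obtain ⟨e', he'⟩ := hu.equiv
  refine of_equiv (e'.trans (LinearEquiv.ofBijective e he)) fun x => ?_
  change e (e' (1 ⊗ₜ x)) = v x
  rw [he', one_smul, h]

/-- The map between two extensions of scalars of the same module is bijective. -/
theorem bijective_of_comp {O' : Type*} [AddCommGroup O'] [Module S O'] {v : M →ₛₗ[τ] O'}
    (hu : LinearizationBijective u) (hv : LinearizationBijective v) (e : N →ₗ[S] O')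
    (h : ∀ x, e (u x) = v x) : Function.Bijective e := by
  obtain ⟨e', he'⟩ := hv.exists_lift (τ' := RingHom.id S) u
  refine Function.bijective_iff_has_inverse.2 ⟨e', fun x => ?_, fun x => ?_⟩
  · exact LinearMap.congr_fun (hu.ext (w := e' ∘ₗ e) (w' := LinearMap.id)
      fun x => by simp [h, he']) x
  · exact LinearMap.congr_fun (hv.ext (w := e ∘ₗ e') (w' := LinearMap.id)
      fun x => by simp [h, he']) x

theorem finite (hu : LinearizationBijective u) [Module.Finite R M] : Module.Finite S N := by
  let _ : Algebra R S := τ.toAlgebra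
  obtain ⟨e, -⟩ := hu.equiv
  exact Module.Finite.equiv e

theorem projective (hu : LinearizationBijective u) [Module.Projective R M] :
    Module.Projective S N := by
  let _ : Algebra R S := τ.toAlgebra
  obtain ⟨e, -⟩ := hu.equiv
  exact Module.Projective.of_equiv e

theorem prod {M₂ N₂ : Type*} [AddCommGroup M₂] [AddCommGroup N₂]
    [Module R M₂] [Module S N₂] {v : M₂ →ₛₗ[τ] N₂} (hu : LinearizationBijective u)
    (hv : LinearizationBijective v) {w : M × M₂ →ₛₗ[τ] N × N₂} (hw : ∀ x, w x = (u x.1, v x.2)) :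
    LinearizationBijective w := by
  let _ : Algebra R S := τ.toAlgebra
  obtain ⟨e, he⟩ := hu.equiv
  obtain ⟨e', he'⟩ := hv.equiv
  refine of_equiv ((TensorProduct.prodRight R S S M M₂).trans (e.prodCongr e'))
    fun x => ?_
  change (e (1 ⊗ₜ x.1), e' (1 ⊗ₜ x.2)) = w x
  rw [hw, he, he', one_smul, one_smul]

theorem bijective (hu : LinearizationBijective u) (hτ : Function.Bijective τ) :
    Function.Bijective u := by
  let e := RingEquiv.ofBijective τ hτ
  have _ : RingHomCompTriple τ (e.symm : S →+* R) (RingHom.id R) :=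
    ⟨RingHom.ext fun x => e.symm_apply_apply x⟩
  have _ : RingHomCompTriple (e.symm : S →+* R) τ (RingHom.id S) :=
    ⟨RingHom.ext fun x => e.apply_symm_apply x⟩
  -- The inverse is the extension of the identity of `M` along the inverse of `τ`.
  obtain ⟨w, hw⟩ := hu.exists_lift (τ' := (e.symm : S →+* R)) (LinearMap.id : M →ₗ[R] M)
  refine Function.bijective_iff_has_inverse.2 ⟨w, hw, fun y => ?_⟩
  exact LinearMap.congr_fun (hu.ext (w := (u.comp w : N →ₗ[S] N)) (w' := LinearMap.id)
    fun x => congrArg u (hw x)) y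

end Basic

section Exists

variable {R S : Type u} [CommRing R] [CommRing S] (τ : R →+* S) (M : Type u) [AddCommGroup M]
  [Module R M]

theorem exists_extension : ∃ (N : Type u) (_ : AddCommGroup N) (_ : Module S N)
    (u : M →ₛₗ[τ] N), LinearizationBijective u := by
  let _ : Algebra R S := τ.toAlgebra
  let u : M →ₛₗ[τ] S ⊗[R] M :=
    { toFun := fun x => 1 ⊗ₜ x
      map_add' := fun x y => TensorProduct.tmul_add _ _ _
      map_smul' := fun a x => by
        rw [TensorProduct.tmul_smul, TensorProduct.smul_tmul', TensorProduct.smul_tmul']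
        rfl }
  refine ⟨S ⊗[R] M, inferInstance, inferInstance, u, ?_⟩
  exact of_equiv (LinearEquiv.refl S (S ⊗[R] M)) fun x => rfl

theorem of_bijective {R S M N : Type u} [CommRing R] [CommRing S] [AddCommGroup M]
    [AddCommGroup N] [Module R M] [Module S N] {τ : R →+* S} {u : M →ₛₗ[τ] N}
    (hτ : Function.Bijective τ) (h : Function.Bijective u) :
    LinearizationBijective u := by
  obtain ⟨N', _, _, u', hu'⟩ := exists_extension τ M
  obtain ⟨e, he⟩ := hu'.exists_lift (τ' := RingHom.id S) u
  refine hu'.of_unique_lift e ?_ he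
  obtain ⟨v, hv, hv'⟩ := Function.bijective_iff_has_inverse.1 (hu'.bijective hτ)
  have : (e : N' → N) = u ∘ v := funext fun x => by
    rw [Function.comp_apply, ← he, hv']
  rw [this]
  exact h.comp (Function.bijective_iff_has_inverse.2 ⟨u', hv', hv⟩)

end Exists

end LinearizationBijective

/-! ### Scalar extension of displays -/

section ScalarExtension

variable {p n : ℕ} [Fact p.Prime]

instance Wm_compTriple {R S U : Alg.{u} p} (f : R ⟶ S) (g : S ⟶ U) :
    RingHomCompTriple (Wm n f) (Wm n g) (Wm n (f ≫ g)) :=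
  ⟨RingHom.ext fun x => (mapW_comp p n _ _ x).symm⟩

variable {R S U : Alg.{u} p} {f : R ⟶ S} {X : Display p n R} {X' : Display p n S}

/-- The diagonal matrix `(a, 0; 0, b)`. -/
noncomputable def DMatrix.diag (a : X.L →ₛₗ[Wm n f] X'.L) (b : X.T →ₛₗ[Wm n f] X'.T) :
    DMatrix f X X' where
  A := a
  B := 0
  C := 0
  D := b

section

variable (a : X.L →ₛₗ[Wm n f] X'.L) (b : X.T →ₛₗ[Wm n f] X'.T)

theorem DMatrix.diag_onP (x : X.L × X.T) : (DMatrix.diag a b).onP x = (a x.1, b x.2) := by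
  simp [DMatrix.onP_apply, DMatrix.diag]

theorem DMatrix.diag_onQ_inl (l : X.L) : (DMatrix.diag a b).onQ (l, 0) = (a l, 0) := by
  simp [DMatrix.onQ_apply, DMatrix.diag]

variable (h : ∀ x, X'.Ψ (a x.1, b x.2) = (a (X.Ψ x).1, b (X.Ψ x).2))

include h in
theorem DMatrix.diag_comm_F (x : X.L × X.T) :
    (DMatrix.diag a b).onP (X.F x) = X'.F ((DMatrix.diag a b).onP x) := by
  have h₁ := h (x.1, 0)
  have h₂ := h (0, x.2)
  simp only [map_zero] at h₁ h₂
  rw [Display.F_apply, Display.F_apply, map_add, map_smulₛₗ, map_natCast, DMatrix.diag_onP,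
    DMatrix.diag_onP, DMatrix.diag_onP, h₁, h₂]

include h in
theorem DMatrix.diag_comm_F₁ (x : X.Q) :
    (DMatrix.diag a b).onP (X.F₁ x) = X'.F₁ ((DMatrix.diag a b).onQ x) := by
  refine DMatrix.comm_F₁_of _ (DMatrix.diag_comm_F a b h) (fun l => ?_) x
  have h₁ := h (l, 0)
  simp only [map_zero] at h₁
  rw [DMatrix.diag_onQ_inl, Display.F₁_apply, Display.F₁_apply, map_zero, map_zero, add_zero,
    add_zero, DMatrix.diag_onP, h₁]

/-- A diagonal matrix compatible with `Ψ` is a morphism of displays. -/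
noncomputable def diagHom : (⟨R, X⟩ : TDisplay.{u} p n) ⟶ ⟨S, X'⟩ where
  base := f
  mat := DMatrix.diag a b
  comm_F := DMatrix.diag_comm_F a b h
  comm_F₁ := DMatrix.diag_comm_F₁ a b h

variable {a b} (ha : LinearizationBijective a) (hb : LinearizationBijective b)

-- The product with a diagonal matrix has entries `χ.A ∘ a`, `χ.B ∘ b`, `χ.C ∘ a`, `χ.D ∘ b`, so
-- each entry of `χ` is found separately from the universal property of `a` or `b`. Compatibility
-- with `F` and `F₁` is checked on the images of `a` and `b`. For `F₁` only the summand `L` matters,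
-- which is essential because `T ⊗ I_{n+1}` need not commute with scalar extension.
include ha hb h in
theorem DMatrix.diag_exists {k : S ⟶ U} {Y : Display p n U} (mat : DMatrix (f ≫ k) X Y)
    (cF : ∀ x, mat.onP (X.F x) = Y.F (mat.onP x))
    (cF₁ : ∀ x, mat.onP (X.F₁ x) = Y.F₁ (mat.onQ x)) :
    ∃ χ : DMatrix k X' Y, (DMatrix.diag a b).comp χ = mat ∧
      (∀ x, χ.onP (X'.F x) = Y.F (χ.onP x)) ∧ (∀ x, χ.onP (X'.F₁ x) = Y.F₁ (χ.onQ x)) := by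
  obtain ⟨A, hA⟩ := ha.exists_lift (τ' := Wm n k) mat.A
  obtain ⟨B, hB⟩ := hb.exists_lift (τ' := Wm n k) mat.B
  obtain ⟨C, hC⟩ := ha.exists_lift (τ' := Wm n k) mat.C
  obtain ⟨D, hD⟩ := hb.exists_lift (τ' := Wm n k) mat.D
  let χ : DMatrix k X' Y := ⟨A, B, C, D⟩
  have hcomp : (DMatrix.diag a b).comp χ = mat := by
    refine DMatrix.ext ?_ ?_ ?_ ?_ <;> refine LinearMap.ext fun x => ?_
    · change A (a x) + B (evalT _ 0) = mat.A x
      rw [map_zero, map_zero, add_zero, hA]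
    · change A 0 + B (b x) = mat.B x
      rw [map_zero, zero_add, hB]
    · change C (a x) + χ.DI 0 = mat.C x
      rw [map_zero, add_zero, hC]
    · change evalT _ (C 0) + D (b x) = mat.D x
      rw [map_zero, map_zero, zero_add, hD]
  have hP : ∀ x, χ.onP ((DMatrix.diag a b).onP x) = mat.onP x := fun x =>
    (DMatrix.onP_comp _ _ x).symm.trans (congrArg (fun q => DMatrix.onP q x) hcomp)
  have hQ : ∀ x, χ.onQ ((DMatrix.diag a b).onQ x) = mat.onQ x := fun x =>
    (DMatrix.onQ_comp _ _ x).symm.trans (congrArg (fun q => DMatrix.onQ q x) hcomp)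
  have hτ : ∀ c, σ p n U (Wm n k c) = Wm n k (σ p n S c) := fun c => (mapW_σ p n _ c).symm
  have hab : LinearizationBijective (DMatrix.diag a b).onP :=
    ha.prod hb (DMatrix.diag_onP a b)
  have hF : ∀ x, χ.onP (X'.F x) = Y.F (χ.onP x) := by
    refine hab.addHom_ext (w := χ.onP.toAddMonoidHom.comp X'.F.toAddMonoidHom)
      (w' := Y.F.toAddMonoidHom.comp χ.onP.toAddMonoidHom) (τ' := (Wm n k).comp (σ p n S)) ?_ ?_ ?_
    · intro c x
      change χ.onP (X'.F (c • x)) = Wm n k (σ p n S c) • χ.onP (X'.F x)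
      rw [map_smulₛₗ, map_smulₛₗ]
    · intro c x
      change Y.F (χ.onP (c • x)) = Wm n k (σ p n S c) • Y.F (χ.onP x)
      rw [map_smulₛₗ, map_smulₛₗ, hτ]
    · intro x
      change χ.onP (X'.F ((DMatrix.diag a b).onP x)) = Y.F (χ.onP ((DMatrix.diag a b).onP x))
      rw [hP, ← cF, ← hP, DMatrix.diag_comm_F a b h]
  have hL : ∀ l, χ.onP (X'.F₁ (l, 0)) = Y.F₁ (χ.onQ (l, 0)) := by
    let ι : X'.L →ₗ[W p n S] X'.Q := LinearMap.inl _ _ _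
    refine ha.addHom_ext (w := (χ.onP.toAddMonoidHom.comp X'.F₁.toAddMonoidHom).comp
        ι.toAddMonoidHom)
      (w' := (Y.F₁.toAddMonoidHom.comp χ.onQ.toAddMonoidHom).comp ι.toAddMonoidHom)
      (τ' := (Wm n k).comp (σ p n S)) ?_ ?_ ?_
    · intro c x
      change χ.onP (X'.F₁ (ι (c • x))) = Wm n k (σ p n S c) • χ.onP (X'.F₁ (ι x))
      rw [map_smul, map_smulₛₗ, map_smulₛₗ]
    · intro c x
      change Y.F₁ (χ.onQ (ι (c • x))) = Wm n k (σ p n S c) • Y.F₁ (χ.onQ (ι x))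
      rw [map_smul, map_smulₛₗ, map_smulₛₗ, hτ]
    · intro x
      change χ.onP (X'.F₁ (a x, 0)) = Y.F₁ (χ.onQ (a x, 0))
      rw [← DMatrix.diag_onQ_inl a b, hQ, ← cF₁, ← hP, DMatrix.diag_comm_F₁ a b h]
  exact ⟨χ, hcomp, hF, χ.comm_F₁_of hF hL⟩

include ha hb in
theorem DMatrix.diag_unique {k : S ⟶ U} {Y : Display p n U} (χ χ' : DMatrix k X' Y)
    (e : (DMatrix.diag a b).comp χ = (DMatrix.diag a b).comp χ') : χ = χ' := by
  have key : ∀ (m : DMatrix k X' Y),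
      (∀ l, ((DMatrix.diag a b).comp m).A l = m.A (a l)) ∧
      (∀ t, ((DMatrix.diag a b).comp m).B t = m.B (b t)) ∧
      (∀ l, ((DMatrix.diag a b).comp m).C l = m.C (a l)) ∧
      (∀ t, ((DMatrix.diag a b).comp m).D t = m.D (b t)) := by
    intro m
    refine ⟨fun x => ?_, fun x => ?_, fun x => ?_, fun x => ?_⟩
    · change m.A (a x) + m.B (evalT _ 0) = _
      rw [map_zero, map_zero, add_zero]
    · change m.A 0 + m.B (b x) = _
      rw [map_zero, zero_add]
    · change m.C (a x) + m.DI 0 = _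
      rw [map_zero, add_zero]
    · change evalT _ (m.C 0) + m.D (b x) = _
      rw [map_zero, map_zero, zero_add]
  obtain ⟨i₁, i₂, i₃, i₄⟩ := key χ
  obtain ⟨j₁, j₂, j₃, j₄⟩ := key χ'
  rw [e] at i₁ i₂ i₃ i₄
  exact DMatrix.ext (ha.ext fun x => (i₁ x).symm.trans (j₁ x))
    (hb.ext fun x => (i₂ x).symm.trans (j₂ x)) (ha.ext fun x => (i₃ x).symm.trans (j₃ x))
    (hb.ext fun x => (i₄ x).symm.trans (j₄ x))

include ha hb in
theorem diagHom_isStronglyCocartesian :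
    TDisplay.proj.IsStronglyCocartesian f (diagHom a b h) := by
  have lift : TDisplay.proj.IsHomLift f (diagHom a b h) := TDisplay.isHomLift (diagHom a b h)
  refine ⟨?_⟩
  intro Y (k : S ⟶ Y.R) m hm
  have hbase : m.base = f ≫ k := TDisplay.base_eq hm
  clear hm
  obtain ⟨base, mat, cF, cF₁⟩ := m
  change base = f ≫ k at hbase
  subst hbase
  obtain ⟨χ, hχ, hF, hF₁⟩ := DMatrix.diag_exists h ha hb mat cF cF₁
  let χ₀ : (⟨S, X'⟩ : TDisplay.{u} p n) ⟶ Y :=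
    { base := k, mat := χ, comm_F := hF, comm_F₁ := hF₁ }
  refine ⟨χ₀, ⟨TDisplay.isHomLift χ₀, TDisplay.Hom.ext rfl (heq_of_eq hχ)⟩, ?_⟩
  rintro χ' ⟨hl, hcomp⟩
  have hbase : χ'.base = k := TDisplay.base_eq hl
  clear hl
  obtain ⟨base, mat', cF', cF₁'⟩ := χ'
  change base = k at hbase
  subst hbase
  have h' : (DMatrix.diag a b).comp mat' = mat := eq_of_heq (TDisplay.Hom.ext_iff.1 hcomp).2
  exact TDisplay.Hom.ext rfl
    (heq_of_eq (DMatrix.diag_unique ha hb mat' χ (h'.trans hχ.symm)))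

end

/-- Along base changes of `L` and `T`, the `σ`-linear automorphism `Ψ` extends. -/
theorem exists_extend_Ψ {L' T' : Type u} [AddCommGroup L'] [Module (W p n S) L']
    [AddCommGroup T'] [Module (W p n S) T'] {a : X.L →ₛₗ[Wm n f] L'} {b : X.T →ₛₗ[Wm n f] T'}
    (ha : LinearizationBijective a) (hb : LinearizationBijective b) :
    ∃ Ψ' : (L' × T') →ₛₗ[σ p n S] (L' × T'), LinearizationBijective Ψ' ∧
      ∀ x, Ψ' (a x.1, b x.2) = (a (X.Ψ x).1, b (X.Ψ x).2) := by
  let u : (X.L × X.T) →ₛₗ[Wm n f] (L' × T') :=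
    { toFun := fun x => (a x.1, b x.2)
      map_add' := fun x y => by simp
      map_smul' := fun c x => by simp }
  have hu : LinearizationBijective u := ha.prod hb fun _ => rfl
  -- Both `Ψ` followed by base change and base change followed by `Ψ'` are semilinear along the same
  -- homomorphism, as `σ` commutes with `W_n(f)`. Cancelling `u` on the right then gives bijectivity
  -- for `Ψ'`.
  have t₁ : RingHomCompTriple (σ p n R) (Wm n f) ((Wm n f).comp (σ p n R)) := ⟨rfl⟩
  have t₂ : RingHomCompTriple (Wm n f) (σ p n S) ((Wm n f).comp (σ p n R)) :=
    ⟨RingHom.ext fun x => (mapW_σ p n _ x).symm⟩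
  obtain ⟨Ψ', hΨ'⟩ := hu.exists_lift (τ' := σ p n S)
    (u.comp X.Ψ : (X.L × X.T) →ₛₗ[(Wm n f).comp (σ p n R)] (L' × T'))
  refine ⟨Ψ', hu.of_comp (τ'' := (Wm n f).comp (σ p n R)) ?_, hΨ'⟩
  have e : (Ψ'.comp u : (X.L × X.T) →ₛₗ[(Wm n f).comp (σ p n R)] (L' × T')) = u.comp X.Ψ :=
    LinearMap.ext hΨ'
  rw [e]
  exact X.bijective_Ψ.comp hu

variable (f X) in
/-- Displays admit scalar extensions. -/
theorem exists_scalarExtension : ∃ (X' : Display p n S) (a : X.L →ₛₗ[Wm n f] X'.L)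
    (b : X.T →ₛₗ[Wm n f] X'.T), LinearizationBijective a ∧ LinearizationBijective b ∧
      ∀ x, X'.Ψ (a x.1, b x.2) = (a (X.Ψ x).1, b (X.Ψ x).2) := by
  obtain ⟨L', _, _, a, ha⟩ := LinearizationBijective.exists_extension (Wm n f) X.L
  obtain ⟨T', _, _, b, hb⟩ := LinearizationBijective.exists_extension (Wm n f) X.T
  obtain ⟨Ψ', hΨ, h⟩ := exists_extend_Ψ ha hb
  have := ha.finite
  have := hb.finite
  have := ha.projective
  have := hb.projective
  exact ⟨⟨L', T', Ψ', hΨ⟩, a, b, ha, hb, h⟩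

end ScalarExtension

/-! ### The filtration of truncated Witt vectors by powers of the Verschiebung -/

section Filtration

variable {p n : ℕ} [Fact p.Prime] {R S : Type u} [CommRing R] [CommRing S]

variable (p n R) in
/-- The ideal of truncated Witt vectors whose first `k` components vanish. -/
noncomputable def vfil (k : ℕ) : Ideal (W p n R) :=
  (RingHom.ker (WittVector.truncate (p := p) (R := R) k)).map (WittVector.truncate n)

/-- Elements of the filtration are written as truncations of `V^k y`, so that the identities for the
Verschiebung on untruncated Witt vectors become available. -/
theorem exists_lift_of_coeff_eq_zero {k : ℕ} {x : W p n R}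
    (h : ∀ i : Fin n, i.1 < k → x.coeff i = 0) :
    ∃ y : WittVector p R, WittVector.truncate n (WittVector.verschiebung^[k] y) = x := by
  refine ⟨x.out.shift k, ?_⟩
  rw [← WittVector.eq_iterate_verschiebung]
  · exact TruncatedWittVector.truncateFun_out x
  · intro i hi
    by_cases hn : i < n
    · have := TruncatedWittVector.coeff_out x ⟨i, hn⟩
      exact this.trans (h ⟨i, hn⟩ hi)
    · simp [TruncatedWittVector.out, hn]

theorem mem_vfil {k : ℕ} {x : W p n R} :
    x ∈ vfil p n R k ↔ ∀ i : Fin n, i.1 < k → x.coeff i = 0 := by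
  constructor
  · intro hx i hi
    obtain ⟨y, hy, rfl⟩ := (Ideal.mem_map_iff_of_surjective _
      (WittVector.truncate_surjective p n R)).1 hx
    rw [WittVector.coeff_truncate]
    exact (WittVector.mem_ker_truncate k y).1 hy i hi
  · intro h
    obtain ⟨y, rfl⟩ := exists_lift_of_coeff_eq_zero h
    refine Ideal.mem_map_of_mem _ ((WittVector.mem_ker_truncate k _).2 fun i hi => ?_)
    exact WittVector.iterate_verschiebung_coeff_eq_zero y hi

theorem vfil_self : vfil p n R n = ⊥ := by
  refine eq_bot_iff.2 fun x hx => ?_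
  rw [mem_vfil] at hx
  rw [Ideal.mem_bot]
  ext i
  simp [hx i i.2]

theorem mem_vfil_succ {k : ℕ} {x : W p n R} :
    x ∈ vfil p n R (k + 1) ↔ x ∈ vfil p n R k ∧ ∀ i : Fin n, i.1 = k → x.coeff i = 0 := by
  simp only [mem_vfil, Nat.lt_succ_iff_lt_or_eq]
  exact ⟨fun h => ⟨fun i hi => h i (.inl hi), fun i hi => h i (.inr hi)⟩,
    fun h i hi => hi.elim (h.1 i) (h.2 i)⟩

theorem vfil_antitone {k l : ℕ} (h : k ≤ l) : vfil p n R l ≤ vfil p n R k := by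
  intro x hx
  rw [mem_vfil] at hx ⊢
  exact fun i hi => hx i (hi.trans_le h)

theorem coeff_iterate_verschiebung {k : ℕ} (y : WittVector p R) (i : Fin n) (hi : i.1 = k) :
    (WittVector.truncate n (WittVector.verschiebung^[k] y)).coeff i = y.coeff 0 := by
  rw [WittVector.coeff_truncate, hi]
  simpa using WittVector.iterate_verschiebung_coeff y k 0

/-- `V^k` is additive, and the zeroth component of a sum of Witt vectors is the sum of the zeroth
components. Thus the graded pieces of the filtration are additive groups of the base ring. -/
theorem coeff_add_of_mem_vfil {k : ℕ} {x y : W p n R} (hx : x ∈ vfil p n R k)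
    (hy : y ∈ vfil p n R k) (i : Fin n) (hi : i.1 = k) :
    (x + y).coeff i = x.coeff i + y.coeff i := by
  obtain ⟨x, rfl⟩ := exists_lift_of_coeff_eq_zero (mem_vfil.1 hx)
  obtain ⟨y, rfl⟩ := exists_lift_of_coeff_eq_zero (mem_vfil.1 hy)
  have : ∀ x y : WittVector p R, WittVector.verschiebung^[k] x + WittVector.verschiebung^[k] y =
      WittVector.verschiebung^[k] (x + y) := fun x y => (iterate_map_add _ k x y).symm
  rw [← map_add, this, coeff_iterate_verschiebung _ i hi, coeff_iterate_verschiebung _ i hi,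
    coeff_iterate_verschiebung _ i hi, WittVector.add_coeff_zero]

variable [NeZero n]

/-- From `a · V^k x = V^k (F^k a · x)`, where `F` raises components to the `p`-th power in
characteristic `p`. This is the origin of the Frobenius twists on the graded pieces. -/
theorem coeff_mul_of_mem_vfil [Algebra (ZMod p) R] {k : ℕ} (a : W p n R) {x : W p n R}
    (hx : x ∈ vfil p n R k) (i : Fin n) (hi : i.1 = k) :
    (a * x).coeff i = a.coeff 0 ^ p ^ k * x.coeff i := by
  rcases subsingleton_or_nontrivial R with h | h
  · exact Subsingleton.elim _ _
  have : CharP R p := charP_of_injective_algebraMap (algebraMap (ZMod p) R).injective p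
  obtain ⟨x, rfl⟩ := exists_lift_of_coeff_eq_zero (mem_vfil.1 hx)
  obtain ⟨a, rfl⟩ := WittVector.truncate_surjective p n R a
  rw [← map_mul, mul_comm a, WittVector.iterate_verschiebung_mul_left,
    coeff_iterate_verschiebung _ i hi, coeff_iterate_verschiebung _ i hi,
    WittVector.mul_coeff_zero, WittVector.iterate_frobenius_coeff, WittVector.coeff_truncate,
    mul_comm]
  rfl

variable (p n R) in
/-- The reduction `W_n(R) → R`, `(x₀, …, xₙ₋₁) ↦ x₀`. -/
noncomputable def res : W p n R →+* R where
  toFun x := x.coeff 0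
  map_one' := by
    rw [← map_one (WittVector.truncate (p := p) (R := R) n), WittVector.coeff_truncate]
    exact WittVector.one_coeff_zero p R
  map_zero' := by
    rw [← map_zero (WittVector.truncate (p := p) (R := R) n), WittVector.coeff_truncate]
    exact WittVector.zero_coeff p R _
  map_add' x y := by
    obtain ⟨x, rfl⟩ := WittVector.truncate_surjective p n R x
    obtain ⟨y, rfl⟩ := WittVector.truncate_surjective p n R y
    rw [← map_add, WittVector.coeff_truncate, WittVector.coeff_truncate, WittVector.coeff_truncate]
    exact WittVector.add_coeff_zero x y
  map_mul' x y := by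
    obtain ⟨x, rfl⟩ := WittVector.truncate_surjective p n R x
    obtain ⟨y, rfl⟩ := WittVector.truncate_surjective p n R y
    rw [← map_mul, WittVector.coeff_truncate, WittVector.coeff_truncate, WittVector.coeff_truncate]
    exact WittVector.mul_coeff_zero x y

theorem res_apply (x : W p n R) : res p n R x = x.coeff 0 := rfl

theorem res_surjective : Function.Surjective (res p n R) := fun r =>
  ⟨TruncatedWittVector.mk p fun _ => r,
    TruncatedWittVector.coeff_mk (p := p) (fun _ : Fin n => r) 0⟩

theorem res_mapW (f : R →+* S) (x : W p n R) : res p n S (mapW p n f x) = f (res p n R x) :=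
  coeff_mapW p n f x 0

theorem ker_res : RingHom.ker (res p n R) = vfil p n R 1 := by
  ext x
  rw [RingHom.mem_ker, mem_vfil, res_apply]
  refine ⟨fun h i hi => ?_, fun h => h 0 (by simp)⟩
  have : i = 0 := Fin.ext (by simpa using hi)
  rw [this, h]

theorem res_toW [Algebra (ZMod p) R] (x : I p n R) : res p n R (toW p n x) = 0 := by
  obtain ⟨x, hx⟩ := x
  obtain ⟨y, rfl⟩ := hx
  change (trunc p n (V p n y)).coeff 0 = 0
  rw [TruncatedWittVector.coeff_truncate]
  exact coeff_V_zero p n y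

variable [Algebra (ZMod p) R]

/-- The leading component is multiplied by the `p^k`-th power of the residue of `a`, which is zero.
Hence the kernel of the reduction is nilpotent. -/
theorem mul_mem_vfil_succ {k : ℕ} {a x : W p n R} (ha : a ∈ RingHom.ker (res p n R))
    (hx : x ∈ vfil p n R k) : a * x ∈ vfil p n R (k + 1) := by
  refine mem_vfil_succ.2 ⟨Ideal.mul_mem_left _ _ hx, fun i hi => ?_⟩
  rw [coeff_mul_of_mem_vfil a hx i hi, ← res_apply, (RingHom.mem_ker).1 ha,
    zero_pow (pow_pos (Fact.out : p.Prime).pos k).ne', zero_mul]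

theorem ker_res_pow_le (k : ℕ) : RingHom.ker (res p n R) ^ k ≤ vfil p n R k := by
  induction k with
  | zero =>
    intro x _
    exact mem_vfil.2 fun i hi => absurd hi (Nat.not_lt_zero _)
  | succ k ih =>
    rw [pow_succ', Ideal.mul_le]
    exact fun a ha x hx => mul_mem_vfil_succ ha (ih hx)

theorem ker_res_pow : RingHom.ker (res p n R) ^ n = ⊥ :=
  eq_bot_iff.2 ((ker_res_pow_le n).trans vfil_self.le)

theorem isNilpotent_of_mem_ker_res {x : W p n R} (hx : x ∈ RingHom.ker (res p n R)) :
    IsNilpotent x := by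
  have := Ideal.pow_mem_pow hx n
  rw [ker_res_pow] at this
  exact ⟨n, this⟩

theorem ker_res_le_jacobson : RingHom.ker (res p n R) ≤ Ideal.jacobson ⊥ :=
  fun _ hx => Ideal.radical_le_jacobson (isNilpotent_of_mem_ker_res hx)

theorem isUnit_of_isUnit_res {x : W p n R} (hx : IsUnit (res p n R x)) : IsUnit x := by
  obtain ⟨r, hr⟩ := hx.exists_right_inv
  obtain ⟨y, rfl⟩ := res_surjective (p := p) (n := n) r
  have h : IsNilpotent (1 - x * y) := isNilpotent_of_mem_ker_res (by
    rw [RingHom.mem_ker, map_sub, map_mul, hr, map_one, sub_self])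
  have := h.isUnit_one_sub
  rw [sub_sub_cancel] at this
  exact isUnit_of_mul_isUnit_left this

end Filtration

/-! ### Nakayama's lemma for the reduction modulo the Verschiebung -/

section Nakayama

variable {A K M N N₀ : Type*} [CommRing A] [CommRing K] [AddCommGroup M] [Module A M]
  [AddCommGroup N] [Module A N] [AddCommGroup N₀] [Module K N₀] {ε : A →+* K}

theorem LinearizationBijective.surjective {ρ : N →ₛₗ[ε] N₀} (hρ : LinearizationBijective ρ)
    (hε : Function.Surjective ε) : Function.Surjective ρ := by
  intro y
  refine hρ.induction (motive := fun y => ∃ x, ρ x = y) ⟨0, map_zero _⟩ ?_ ?_ (fun x => ⟨x, rfl⟩) y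
  · rintro _ _ ⟨x, rfl⟩ ⟨y, rfl⟩
    exact ⟨x + y, map_add _ _ _⟩
  · rintro a _ ⟨x, rfl⟩
    obtain ⟨a, rfl⟩ := hε a
    exact ⟨a • x, map_smulₛₗ _ _ _⟩

/-- Write `N` as a direct summand of a free module. Each coordinate form of `N` extends to a form on
the reduction, so all coordinates of an element killed by `ρ` lie in the kernel of `ε`. -/
theorem LinearizationBijective.mem_ker_smul_top [Module.Finite A N] [Module.Projective A N]
    {ρ : N →ₛₗ[ε] N₀} (hρ : LinearizationBijective ρ) {y : N} (hy : ρ y = 0) :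
    y ∈ RingHom.ker ε • (⊤ : Submodule A N) := by
  obtain ⟨k, f, g, -, -, hfg⟩ := Module.Finite.exists_comp_eq_id_of_projective A N
  have key : ∀ j, ε (g y j) = 0 := by
    intro j
    let εl : A →ₛₗ[ε] K := ε.toSemilinearMap
    obtain ⟨w, hw⟩ := hρ.exists_lift (τ' := RingHom.id K)
      (εl.comp (LinearMap.proj j ∘ₗ g) : N →ₛₗ[ε] K)
    have := hw y
    rw [hy, map_zero] at this
    exact this.symm
  have hy' : f (g y) = y := LinearMap.congr_fun hfg y
  rw [← hy', pi_eq_sum_univ' (g y), map_sum]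
  refine Submodule.sum_mem _ fun j _ => ?_
  rw [map_smul]
  exact Submodule.smul_mem_smul (key j) trivial

theorem surjective_of_ker_smul_top {J : Ideal A} (hJ : J ≤ Ideal.jacobson ⊥) [Module.Finite A N]
    (φ : M →ₗ[A] N) (h : ∀ y, ∃ x, y - φ x ∈ J • (⊤ : Submodule A N)) :
    Function.Surjective φ := by
  rw [← LinearMap.range_eq_top]
  refine top_le_iff.1 (Submodule.le_of_le_smul_of_le_jacobson_bot Module.Finite.fg_top hJ ?_)
  intro y _
  obtain ⟨x, hx⟩ := h y
  rw [← add_sub_cancel (φ x) y]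
  exact Submodule.add_mem_sup ⟨x, rfl⟩ hx

/-- A linear map between finite projective modules is bijective if its reduction is. -/
theorem bijective_of_linearizationBijective_comp [Module.Finite A M] [Module.Projective A M]
    [Module.Finite A N] [Module.Projective A N] (hε : Function.Surjective ε)
    (hJ : RingHom.ker ε ≤ Ideal.jacobson ⊥) {ρ : N →ₛₗ[ε] N₀} (hρ : LinearizationBijective ρ)
    (φ : M →ₗ[A] N) (hφ : LinearizationBijective (ρ.comp φ : M →ₛₗ[ε] N₀)) :
    Function.Bijective φ := by
  have hs : Function.Surjective φ := by
    refine surjective_of_ker_smul_top hJ φ fun y => ?_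
    obtain ⟨x, hx⟩ := hφ.surjective hε (ρ y)
    exact ⟨x, hρ.mem_ker_smul_top (by rw [map_sub, ← hx]; exact sub_self _)⟩
  -- Injectivity comes from a second use of Nakayama: a section `s` of `φ` is itself surjective,
  -- because `x - s (φ x)` dies in the reduction. So `φ` is inverse to `s`.
  obtain ⟨s, hs'⟩ := Module.projective_lifting_property φ LinearMap.id hs
  have hs' : ∀ y, φ (s y) = y := LinearMap.congr_fun hs'
  have hss : Function.Surjective s := by
    refine surjective_of_ker_smul_top hJ s fun x => ⟨φ x, hφ.mem_ker_smul_top ?_⟩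
    change ρ (φ (x - s (φ x))) = 0
    rw [map_sub, hs', sub_self, map_zero]
  refine ⟨fun x y hxy => ?_, hs⟩
  obtain ⟨x, rfl⟩ := hss x
  obtain ⟨y, rfl⟩ := hss y
  rw [hs', hs'] at hxy
  rw [hxy]

end Nakayama

/-! ### Strongly cocartesian morphisms of displays -/

theorem LinearizationBijective.congr {R S M N : Type*} [CommRing R] [CommRing S] [AddCommGroup M]
    [AddCommGroup N] [Module R M] [Module S N] {τ τ' : R →+* S} {u : M →ₛₗ[τ] N}
    {u' : M →ₛₗ[τ'] N} (hu : LinearizationBijective u) (hτ : τ = τ') (h : ∀ x, u x = u' x) :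
    LinearizationBijective u' := by
  subst hτ
  rwa [← LinearMap.ext h]

section BaseChange

variable {p n : ℕ} [Fact p.Prime] {X Y Z : TDisplay.{u} p n}

/-- A morphism of displays exhibits its target as scalar extension of its source. -/
def TDisplay.IsBaseChange (m : X ⟶ Y) : Prop :=
  TDisplay.proj.IsStronglyCocartesian (TDisplay.proj.map m) m

namespace TDisplay.IsBaseChange

variable {m : X ⟶ Y}

theorem of_isStronglyCocartesian {f : X.R ⟶ Y.R} (h : TDisplay.proj.IsStronglyCocartesian f m) :
    TDisplay.IsBaseChange m := by
  have hf : m.base = f := TDisplay.base_eq h.toIsHomLift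
  subst hf
  exact h

theorem existsUnique (h : TDisplay.IsBaseChange m) (m' : X ⟶ Z) (k : Y.R ⟶ Z.R)
    (hk : m'.base = m.base ≫ k) : ∃! χ : Y ⟶ Z, χ.base = k ∧ m ≫ χ = m' := by
  have hl : TDisplay.proj.IsHomLift m'.base m' := TDisplay.isHomLift m'
  rw [hk] at hl
  obtain ⟨χ, ⟨h₁, h₂⟩, h₃⟩ := @Functor.IsStronglyCocartesian.universal_property' _ _ _ _
    TDisplay.proj _ _ _ _ _ m h Z k m' hl
  refine ⟨χ, ⟨TDisplay.base_eq h₁, h₂⟩, ?_⟩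
  rintro χ' ⟨rfl, h₂'⟩
  exact h₃ χ' ⟨TDisplay.isHomLift χ', h₂'⟩

theorem hom_ext (h : TDisplay.IsBaseChange m) {χ χ' : Y ⟶ Z} (hb : χ.base = χ'.base)
    (e : m ≫ χ = m ≫ χ') : χ = χ' :=
  (h.existsUnique (m ≫ χ') χ'.base rfl).unique ⟨hb, e⟩ ⟨rfl, rfl⟩

theorem comp (h : TDisplay.IsBaseChange m) {m' : Y ⟶ Z} (h' : TDisplay.IsBaseChange m') :
    TDisplay.IsBaseChange (m ≫ m') :=
  @Functor.IsStronglyCocartesian.comp _ _ _ _ TDisplay.proj _ _ _ _ _ _ _ _ m m' h h'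

theorem of_comp (h : TDisplay.IsBaseChange m) {m' : Y ⟶ Z}
    (h' : TDisplay.IsBaseChange (m ≫ m')) : TDisplay.IsBaseChange m' :=
  @Functor.IsStronglyCocartesian.of_comp _ _ _ _ TDisplay.proj _ _ _ _ _ _ _ _ m m' h h'
    (TDisplay.isHomLift m')

theorem of_isIso (m : X ⟶ Y) [IsIso m] : TDisplay.IsBaseChange m :=
  @Functor.IsStronglyCocartesian.of_isIso _ _ _ _ TDisplay.proj _ _ _ _ _ m
    (TDisplay.isHomLift m) _

theorem isIso {S : Alg.{u} p} {X Y : Display p n S} {m : (⟨S, X⟩ : TDisplay.{u} p n) ⟶ ⟨S, Y⟩}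
    (h : TDisplay.IsBaseChange m) (hm : m.base = 𝟙 S) : IsIso m := by
  have h' : IsIso (TDisplay.proj.map m) := by
    change IsIso m.base
    rw [hm]
    exact inferInstanceAs (IsIso (𝟙 S))
  exact @Functor.IsStronglyCocartesian.isIso_of_base_isIso _ _ _ _ TDisplay.proj _ _ _ _ _ m h h'

end TDisplay.IsBaseChange

end BaseChange

/-! ### Reduction of displays and their morphisms along `W_n(R) → R`. -/

section Residual

variable {p n : ℕ} [Fact p.Prime]

section Identity

variable {S : Alg.{u} p} {M N : Type u} [AddCommGroup M] [Module (W p n S) M] [AddCommGroup N]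
  [Module (W p n S) N]

theorem Wm_id : Wm n (𝟙 S) = RingHom.id (W p n S) := RingHom.ext fun x => mapW_id p n x

/-- A `W_n(id)`-semilinear map as a linear map. -/
noncomputable def toLin (a : M →ₛₗ[Wm n (𝟙 S)] N) : M →ₗ[W p n S] N where
  toFun := a
  map_add' := a.map_add
  map_smul' c x := (a.map_smulₛₗ c x).trans (congrArg (· • a x) (mapW_id p n c))

@[simp] theorem toLin_apply (a : M →ₛₗ[Wm n (𝟙 S)] N) (x : M) : toLin a x = a x := rfl

/-- A linear map as a `W_n(id)`-semilinear map. -/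
noncomputable def ofLin (a : M →ₗ[W p n S] N) : M →ₛₗ[Wm n (𝟙 S)] N where
  toFun := a
  map_add' := a.map_add
  map_smul' c x := (a.map_smul c x).trans (congrArg (· • a x) (mapW_id p n c).symm)

theorem map_evalT (g : M →ₗ[W p n S] N) (z : M ⊗[W p n S] I p n S) :
    g (evalT M z) = evalT N (LinearMap.rTensor (I p n S) g z) := by
  induction z with
  | zero => simp
  | add x y hx hy => simp only [map_add, hx, hy]
  | tmul t ω => simp

/-- This rests on the symmetry `toW x • y = toW y • x` of the module `I_{n+1}`. It computes the
action on `T ⊗ I_{n+1}` of a `D`-entry that factors through `T ⊗ I_{n+1}`, as happens for the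
inverse of a block matrix. -/
theorem rTensor_evalT (g : N →ₗ[W p n S] M ⊗[W p n S] I p n S) (z : N ⊗[W p n S] I p n S) :
    LinearMap.rTensor (I p n S) (evalT M ∘ₗ g) z = g (evalT N z) := by
  induction z with
  | zero => simp
  | add x y hx hy => simp only [map_add, hx, hy]
  | tmul t ω =>
    rw [LinearMap.rTensor_tmul, LinearMap.comp_apply, evalT_tmul, map_smul]
    induction g t with
    | zero => simp
    | add x y hx hy => simp only [map_add, TensorProduct.add_tmul, hx, hy, smul_add]
    | tmul t ω' =>
      rw [evalT_tmul, TensorProduct.smul_tmul, toW_smul_comm, TensorProduct.tmul_smul]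

theorem DMatrix.DI_id_eq {X Y : Display p n S} (m : DMatrix (𝟙 S) X Y)
    (z : X.T ⊗[W p n S] I p n S) : m.DI z = LinearMap.rTensor (I p n S) (toLin m.D) z := by
  induction z with
  | zero => simp
  | add x y hx hy => simp only [map_add, hx, hy]
  | tmul t ω =>
    rw [DMatrix.DI_tmul, LinearMap.rTensor_tmul]
    exact congrArg (m.D t ⊗ₜ[W p n S] ·) (Subtype.ext (mapW_id p (n + 1) _))

/-- The type of a matrix depends on the base homomorphism, and composites such as `𝟙 ≫ 𝟙` are not
literally the identity. Equality of matrices is therefore heterogeneous. -/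
theorem DMatrix.heq_of_entries {R : Alg.{u} p} {f f' : R ⟶ S} {X : Display p n R}
    {Y : Display p n S} (hf : f = f') (m : DMatrix f X Y) (m' : DMatrix f' X Y)
    (hA : ∀ x, m.A x = m'.A x) (hB : ∀ x, m.B x = m'.B x) (hC : ∀ x, m.C x = m'.C x)
    (hD : ∀ x, m.D x = m'.D x) : HEq m m' := by
  subst hf
  exact heq_of_eq (DMatrix.ext (LinearMap.ext hA) (LinearMap.ext hB) (LinearMap.ext hC)
    (LinearMap.ext hD))

end Identity

variable [NeZero n]

theorem res_evalT {S : Alg.{u} p} {N N₀ : Type*} [AddCommGroup N] [Module (W p n S) N]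
    [AddCommGroup N₀] [Module S N₀] (ρ : N →ₛₗ[res p n S] N₀) (z : N ⊗[W p n S] I p n S) :
    ρ (evalT N z) = 0 := by
  induction z with
  | zero => simp
  | add x y hx hy => simp only [map_add, hx, hy, add_zero]
  | tmul t ω => rw [evalT_tmul, map_smulₛₗ, res_toW, zero_smul]

instance res_compTriple {R S : Alg.{u} p} (f : R ⟶ S) :
    RingHomCompTriple (Wm n f) (res p n S) ((res p n S).comp (Wm n f)) := ⟨rfl⟩

theorem res_map_evalT {R S : Alg.{u} p} {f : R ⟶ S} {M N N₀ : Type*} [AddCommGroup M]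
    [Module (W p n R) M] [AddCommGroup N] [Module (W p n S) N] [AddCommGroup N₀] [Module S N₀]
    (ρ : N →ₛₗ[res p n S] N₀) (g : M →ₛₗ[Wm n f] N) (z : M ⊗[W p n R] I p n R) :
    ρ (g (evalT M z)) = 0 := by
  induction z with
  | zero => simp
  | add x y hx hy => simp only [map_add, hx, hy, add_zero]
  | tmul t ω =>
    have : Wm n f (toW p n ω) = toW p n (mapI p n (f.hom : R →+* S) ω) :=
      (toW_mapI p n _ ω).symm
    rw [evalT_tmul, map_smulₛₗ, this, map_smulₛₗ, res_toW, zero_smul]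

/-- A semilinear map over `W_n(R) → W_n(S)` whose reduction is a base change along `R → S`. -/
def IsResidualBaseChange {R S : Alg.{u} p} {f : R ⟶ S} {M N : Type u} [AddCommGroup M]
    [Module (W p n R) M] [AddCommGroup N] [Module (W p n S) N] (a : M →ₛₗ[Wm n f] N) : Prop :=
  ∃ (N₀ : Type u) (_ : AddCommGroup N₀) (_ : Module S N₀) (ρ : N →ₛₗ[res p n S] N₀),
    LinearizationBijective ρ ∧
      LinearizationBijective (ρ.comp a : M →ₛₗ[(res p n S).comp (Wm n f)] N₀)

section

variable {R S : Alg.{u} p} {f : R ⟶ S} {M N : Type u} [AddCommGroup M]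
    [Module (W p n R) M] [AddCommGroup N] [Module (W p n S) N] {a : M →ₛₗ[Wm n f] N}

theorem LinearizationBijective.isResidualBaseChange (ha : LinearizationBijective a) :
    IsResidualBaseChange a := by
  obtain ⟨N₀, _, _, ρ, hρ⟩ := LinearizationBijective.exists_extension (res p n S) N
  exact ⟨N₀, _, _, ρ, hρ, ha.comp hρ⟩

/-- The choice of a reduction in the definition is immaterial, since two reductions of `N` differ by
a linear bijection. -/
theorem IsResidualBaseChange.comp_linearizationBijective (ha : IsResidualBaseChange a)
    {N₁ : Type u} [AddCommGroup N₁] [Module S N₁] {ρ : N →ₛₗ[res p n S] N₁}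
    (hρ : LinearizationBijective ρ) :
    LinearizationBijective (ρ.comp a : M →ₛₗ[(res p n S).comp (Wm n f)] N₁) := by
  obtain ⟨N₀, _, _, ρ₀, hρ₀, h⟩ := ha
  obtain ⟨e, he⟩ := hρ₀.exists_lift (τ' := RingHom.id S) ρ
  exact h.of_unique_lift e (hρ₀.bijective_of_comp hρ e he) fun x => he (a x)

end

section Inverse

variable {S : Alg.{u} p} {X Y : Display p n S}

/-- The inverse of a linear map over `W_n(S)` whose reduction is bijective. -/
theorem IsResidualBaseChange.exists_inverse {M N : Type u} [AddCommGroup M]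
    [Module (W p n S) M] [AddCommGroup N] [Module (W p n S) N] [Module.Finite (W p n S) M]
    [Module.Projective (W p n S) M] [Module.Finite (W p n S) N] [Module.Projective (W p n S) N]
    {a : M →ₛₗ[Wm n (𝟙 S)] N} (ha : IsResidualBaseChange a) (b : M →ₗ[W p n S] N)
    (h : ∀ (N₀ : Type u) [AddCommGroup N₀] [Module S N₀] (ρ : N →ₛₗ[res p n S] N₀) (x : M),
      ρ (b x) = ρ (a x)) :
    ∃ c : N →ₗ[W p n S] M, (∀ x, c (b x) = x) ∧ ∀ x, b (c x) = x := by
  obtain ⟨N₀, _, _, ρ, hρ, hρa⟩ := ha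
  have hb : LinearizationBijective (ρ.comp b : M →ₛₗ[res p n S] N₀) :=
    hρa.congr (by rw [Wm_id, RingHom.comp_id]) fun x => (h N₀ ρ x).symm
  have := bijective_of_linearizationBijective_comp res_surjective ker_res_le_jacobson hρ b hb
  let e := LinearEquiv.ofBijective b this
  exact ⟨e.symm.toLinearMap, e.symm_apply_apply, e.apply_symm_apply⟩

/-- Inversion by the Schur complement. `D` is invertible because its reduction is, and `A - B D⁻¹ C`
is invertible because the correction passes through `I_{n+1}` and so vanishes in the reduction. With
`E` the inverse of the complement, the inverse matrix has entries `E`, `-E B D⁻¹`, `-D⁻¹ C E` and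
`D⁻¹ + D⁻¹ C E B D⁻¹`. -/
theorem DMatrix.exists_inverse (m : DMatrix (𝟙 S) X Y) (hA : IsResidualBaseChange m.A)
    (hD : IsResidualBaseChange m.D) : ∃ m' : DMatrix (𝟙 S) Y X,
      HEq (m.comp m') (DMatrix.id X) ∧ HEq (m'.comp m) (DMatrix.id Y) := by
  obtain ⟨D', hD₁, hD₂⟩ := hD.exists_inverse (toLin m.D) fun _ _ _ _ _ => rfl
  let ev : Y.T ⊗[W p n S] I p n S →ₗ[W p n S] Y.T := evalT Y.T
  obtain ⟨E, hE₁, hE₂⟩ := hA.exists_inverse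
    (toLin m.A - toLin m.B ∘ₗ D' ∘ₗ ev ∘ₗ toLin m.C) (by
      intro N₀ _ _ ρ x
      have : toLin m.B (D' (ev (toLin m.C x))) = evalT Y.L (LinearMap.rTensor (I p n S)
          (toLin m.B ∘ₗ D') (m.C x)) := map_evalT (toLin m.B ∘ₗ D') (m.C x)
      rw [LinearMap.sub_apply, LinearMap.comp_apply, LinearMap.comp_apply, LinearMap.comp_apply,
        this, map_sub, res_evalT, sub_zero, toLin_apply])
  let D'I := LinearMap.rTensor (I p n S) D'
  have hDI₁ : ∀ z, D'I (m.DI z) = z := fun z => by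
    rw [DMatrix.DI_id_eq, ← LinearMap.comp_apply, ← LinearMap.rTensor_comp,
      show D' ∘ₗ toLin m.D = LinearMap.id from LinearMap.ext hD₁, LinearMap.rTensor_id]
    rfl
  have hDI₂ : ∀ z, m.DI (D'I z) = z := fun z => by
    rw [DMatrix.DI_id_eq, ← LinearMap.comp_apply, ← LinearMap.rTensor_comp,
      show toLin m.D ∘ₗ D' = LinearMap.id from LinearMap.ext hD₂, LinearMap.rTensor_id]
    rfl
  have evD : ∀ z, evalT X.T (D'I z) = D' (evalT Y.T z) := fun z => (map_evalT D' z).symm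
  let G : Y.T →ₗ[W p n S] X.L := E ∘ₗ toLin m.B ∘ₗ D'
  let K : Y.L →ₗ[W p n S] X.T ⊗[W p n S] I p n S := D'I ∘ₗ toLin m.C ∘ₗ E
  let H : Y.T →ₗ[W p n S] X.T ⊗[W p n S] I p n S := D'I ∘ₗ toLin m.C ∘ₗ G
  let m' : DMatrix (𝟙 S) Y X :=
    { A := ofLin E
      B := ofLin (-G)
      C := ofLin (-K)
      D := ofLin (D' + evalT X.T ∘ₗ H) }
  have hE₁' : ∀ x, E (m.A x) = x + E (m.B (D' (evalT Y.T (m.C x)))) := fun x => by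
    have := hE₁ x
    rw [LinearMap.sub_apply, map_sub, sub_eq_iff_eq_add] at this
    exact this
  have hE₂' : ∀ x, m.A (E x) = x + m.B (D' (evalT Y.T (m.C (E x)))) := fun x => by
    have := hE₂ x
    rw [LinearMap.sub_apply, sub_eq_iff_eq_add] at this
    exact this
  have hD₁' : ∀ x, D' (m.D x) = x := hD₁
  have hD₂' : ∀ x, m.D (D' x) = x := hD₂
  have eG : ∀ x, G x = E (m.B (D' x)) := fun _ => rfl
  have eK : ∀ x, K x = D'I (m.C (E x)) := fun _ => rfl
  have eH : ∀ x, H x = D'I (m.C (G x)) := fun _ => rfl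
  -- On `T ⊗ I_{n+1}` the second summand of the new `D`-entry acts as `H` after evaluation.
  have m'DI : ∀ z, m'.DI z = D'I z + H (evalT Y.T z) := fun z => by
    rw [DMatrix.DI_id_eq, ← rTensor_evalT, ← LinearMap.add_apply, ← LinearMap.rTensor_add]
    rfl
  refine ⟨m', DMatrix.heq_of_entries (Category.comp_id _) _ _ (fun x => ?_) (fun x => ?_)
    (fun x => ?_) (fun x => ?_), DMatrix.heq_of_entries (Category.comp_id _) _ _ (fun x => ?_)
    (fun x => ?_) (fun x => ?_) (fun x => ?_)⟩
  · change E (m.A x) + -G (evalT Y.T (m.C x)) = x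
    rw [eG, hE₁', add_neg_cancel_right]
  · change E (m.B x) + -G (m.D x) = 0
    rw [eG, hD₁', add_neg_cancel]
  · change -K (m.A x) + m'.DI (m.C x) = 0
    rw [m'DI, eK, eH, eG, hE₁', map_add, map_add]
    abel
  · change evalT X.T (-K (m.B x)) + (D' (m.D x) + evalT X.T (H (m.D x))) = x
    rw [map_neg, hD₁', eK, eH, eG, hD₁']
    abel
  · change m.A (E x) + m.B (evalT X.T (-K x)) = x
    rw [eK, map_neg, map_neg, evD, hE₂', add_neg_cancel_right]
  · change m.A (-G x) + m.B (D' x + evalT X.T (H x)) = 0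
    rw [map_neg, map_add, eH, evD, eG, hE₂']
    abel
  · change m.C (E x) + m.DI (-K x) = 0
    rw [map_neg, eK, hDI₂, add_neg_cancel]
  · change evalT Y.T (m.C (-G x)) + m.D (D' x + evalT X.T (H x)) = x
    rw [map_neg, map_neg, map_add, hD₂', eH, evD, hD₂']
    abel

theorem TDisplay.isIso_of_isResidualBaseChange
    (m : (⟨S, X⟩ : TDisplay.{u} p n) ⟶ ⟨S, Y⟩) (hb : m.base = 𝟙 S)
    (hA : IsResidualBaseChange m.mat.A) (hD : IsResidualBaseChange m.mat.D) : IsIso m := by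
  obtain ⟨base, mat, cF, cF₁⟩ := m
  change base = 𝟙 S at hb
  subst hb
  obtain ⟨mat', h, h'⟩ := mat.exists_inverse hA hD
  -- The two composites lie over `𝟙 S ≫ 𝟙 S`, so the heterogeneous equality with the identity matrix
  -- is first turned into equality of the actions.
  have onP_heq : ∀ {Z : Display p n S} (N : DMatrix (𝟙 S ≫ 𝟙 S) Z Z) (_ : HEq N (DMatrix.id Z)),
      ∀ x, N.onP x = x := by
    rw [Category.comp_id]
    intro Z N hN x
    rw [eq_of_heq hN, DMatrix.onP_id]
  have onQ_heq : ∀ {Z : Display p n S} (N : DMatrix (𝟙 S ≫ 𝟙 S) Z Z) (_ : HEq N (DMatrix.id Z)),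
      ∀ x, N.onQ x = x := by
    rw [Category.comp_id]
    intro Z N hN x
    rw [eq_of_heq hN, DMatrix.onQ_id]
  have hP : ∀ x, mat'.onP (mat.onP x) = x := fun x => by
    rw [← DMatrix.onP_comp, onP_heq _ h]
  have hP' : ∀ x, mat.onP (mat'.onP x) = x := fun x => by
    rw [← DMatrix.onP_comp, onP_heq _ h']
  have hQ : ∀ x, mat'.onQ (mat.onQ x) = x := fun x => by
    rw [← DMatrix.onQ_comp, onQ_heq _ h]
  have hQ' : ∀ x, mat.onQ (mat'.onQ x) = x := fun x => by
    rw [← DMatrix.onQ_comp, onQ_heq _ h']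
  -- The inverse matrix commutes with `F` and `F₁` because the given one does and both of its
  -- actions are bijective.
  let ψ : (⟨S, Y⟩ : TDisplay.{u} p n) ⟶ ⟨S, X⟩ :=
    { base := 𝟙 S
      mat := mat'
      comm_F := fun x => by
        conv_lhs => rw [← hP' x, ← cF, hP]
      comm_F₁ := fun x => by
        conv_lhs => rw [← hQ' x, ← cF₁, hP] }
  exact ⟨ψ, TDisplay.Hom.ext (Category.comp_id _) h, TDisplay.Hom.ext (Category.comp_id _) h'⟩

end Inverse

section Comp

variable {X Y Z : TDisplay.{u} p n} {m : X ⟶ Y} {m' : Y ⟶ Z} {m'' : X ⟶ Z}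
  {N₀ : Type*} [AddCommGroup N₀] [Module Z.R N₀]

/-- Off-diagonal contributions to the diagonal entries of a product pass through `T ⊗ I_{n+1}`,
which is killed by the reduction. Residually, diagonal entries just compose. -/
theorem TDisplay.res_comp_A (h : m ≫ m' = m'') (ρ : Z.X.L →ₛₗ[res p n Z.R] N₀) (x : X.X.L) :
    ρ (m''.mat.A x) = ρ (m'.mat.A (m.mat.A x)) := by
  subst h
  change ρ (m'.mat.A (m.mat.A x) + m'.mat.B (evalT _ (m.mat.C x))) = _
  rw [map_add, res_map_evalT ρ m'.mat.B, add_zero]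

theorem TDisplay.res_comp_D (h : m ≫ m' = m'') (ρ : Z.X.T →ₛₗ[res p n Z.R] N₀) (x : X.X.T) :
    ρ (m''.mat.D x) = ρ (m'.mat.D (m.mat.D x)) := by
  subst h
  change ρ (evalT _ (m'.mat.C (m.mat.B x)) + m'.mat.D (m.mat.D x)) = _
  rw [map_add, res_evalT, zero_add]

end Comp

end Residual

/-! ### The criterion for base changes -/

section Residual

variable {p n : ℕ} [Fact p.Prime] [NeZero n]

section

variable {R S U : Alg.{u} p} {f : R ⟶ S} {k : S ⟶ U} {l : R ⟶ U} {M N O : Type u}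
  [AddCommGroup M] [Module (W p n R) M] [AddCommGroup N] [Module (W p n S) N] [AddCommGroup O]
  [Module (W p n U) O]

instance res_compTriple' : RingHomCompTriple (res p n S) (k.hom : S →+* U)
    ((res p n U).comp (Wm n k)) := ⟨RingHom.ext fun x => (res_mapW _ x).symm⟩

/-- The semilinear map `a'' ` agrees residually with the composition of `a` and `a'`. -/
def IsResidualComp (a : M →ₛₗ[Wm n f] N) (a' : N →ₛₗ[Wm n k] O) (a'' : M →ₛₗ[Wm n l] O) : Prop :=
  ∀ {N₀ : Type u} [AddCommGroup N₀] [Module U N₀] (ρ : O →ₛₗ[res p n U] N₀) (x : M),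
    ρ (a'' x) = ρ (a' (a x))

variable {a : M →ₛₗ[Wm n f] N} {a' : N →ₛₗ[Wm n k] O} {a'' : M →ₛₗ[Wm n l] O}

/-- `a'` induces a map `w` between the reductions, semilinear over the base rings themselves. The
statement carries its own `RingHomCompTriple`, because `l = f ≫ k` is only a propositional equality.
-/
theorem IsResidualComp.exists_reduction (ha : IsResidualComp a a' a'') (hl : l = f ≫ k)
    {N₀ O₀ : Type u} [AddCommGroup N₀] [Module S N₀] [AddCommGroup O₀] [Module U O₀]
    {ρ : N →ₛₗ[res p n S] N₀} {ρ' : O →ₛₗ[res p n U] O₀} (hρ : LinearizationBijective ρ) :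
    ∃ (_ : RingHomCompTriple ((res p n S).comp (Wm n f)) (k.hom : S →+* U)
      ((res p n U).comp (Wm n l))) (w : N₀ →ₛₗ[(k.hom : S →+* U)] O₀), (∀ y, w (ρ y) = ρ' (a' y)) ∧
        ∀ x, w (ρ (a x)) = ρ' (a'' x) := by
  obtain ⟨w, hw⟩ := hρ.exists_lift (τ' := (k.hom : S →+* U))
    (ρ'.comp a' : N →ₛₗ[(res p n U).comp (Wm n k)] O₀)
  refine ⟨⟨RingHom.ext fun x => ?_⟩, w, hw, fun x => (hw _).trans (ha ρ' x).symm⟩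
  subst hl
  exact (res_mapW _ _).symm.trans (congrArg _ (mapW_comp p n _ _ x).symm)

/-- Together with `IsResidualBaseChange.comp`, this transfers cancellation and composition of scalar
extensions over the base rings to residual ones, through the induced map `w`. -/
theorem IsResidualBaseChange.of_comp (ha : IsResidualBaseChange a)
    (h : IsResidualComp a a' a'') (hl : l = f ≫ k) (ha'' : IsResidualBaseChange a'') :
    IsResidualBaseChange a' := by
  obtain ⟨O₀, _, _, ρ', hρ'⟩ := LinearizationBijective.exists_extension (res p n U) O
  obtain ⟨N₀, _, _, ρ, hρ⟩ := LinearizationBijective.exists_extension (res p n S) N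
  obtain ⟨_, w, hw, hw'⟩ := h.exists_reduction hl (ρ' := ρ') hρ
  have h₃ : LinearizationBijective w := (ha.comp_linearizationBijective hρ).of_comp
    ((ha''.comp_linearizationBijective hρ').congr rfl fun x => (hw' x).symm)
  exact ⟨O₀, _, _, ρ', hρ', (hρ.comp h₃).congr rfl hw⟩

theorem IsResidualBaseChange.comp (ha : IsResidualBaseChange a)
    (h : IsResidualComp a a' a'') (hl : l = f ≫ k) (ha' : IsResidualBaseChange a') :
    IsResidualBaseChange a'' := by
  obtain ⟨O₀, _, _, ρ', hρ'⟩ := LinearizationBijective.exists_extension (res p n U) O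
  obtain ⟨N₀, _, _, ρ, hρ⟩ := LinearizationBijective.exists_extension (res p n S) N
  obtain ⟨_, w, hw, hw'⟩ := h.exists_reduction hl (ρ' := ρ') hρ
  have h₃ : LinearizationBijective w := hρ.of_comp
    ((ha'.comp_linearizationBijective hρ').congr rfl fun x => (hw x).symm)
  exact ⟨O₀, _, _, ρ', hρ', ((ha.comp_linearizationBijective hρ).comp h₃).congr rfl hw'⟩

end

section Criterion

variable {X Y Z : TDisplay.{u} p n} {m : X ⟶ Y} {m' : Y ⟶ Z} {m'' : X ⟶ Z}

theorem TDisplay.isResidualComp_A (h : m ≫ m' = m'') :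
    IsResidualComp m.mat.A m'.mat.A m''.mat.A := fun ρ x => TDisplay.res_comp_A h ρ x

theorem TDisplay.isResidualComp_D (h : m ≫ m' = m'') :
    IsResidualComp m.mat.D m'.mat.D m''.mat.D := fun ρ x => TDisplay.res_comp_D h ρ x

omit [NeZero n] in
theorem TDisplay.base_comp (h : m ≫ m' = m'') : m''.base = m.base ≫ m'.base :=
  (congrArg TDisplay.Hom.base h).symm

/-- The maps induced on the reductions are mutually inverse, and a semilinear bijection over a ring
isomorphism is a scalar extension. -/
theorem isResidualBaseChange_of_inverse {R S : Alg.{u} p} {f : R ⟶ S} {k : S ⟶ R} {M N : Type u}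
    [AddCommGroup M] [Module (W p n R) M] [AddCommGroup N] [Module (W p n S) N]
    {a : M →ₛₗ[Wm n f] N} {b : N →ₛₗ[Wm n k] M} (hfk : f ≫ k = 𝟙 R) (hkf : k ≫ f = 𝟙 S)
    (hab : IsResidualComp a b (ofLin (LinearMap.id : M →ₗ[W p n R] M)))
    (hba : IsResidualComp b a (ofLin (LinearMap.id : N →ₗ[W p n S] N))) :
    IsResidualBaseChange a := by
  obtain ⟨N₀, _, _, ρ, hρ⟩ := LinearizationBijective.exists_extension (res p n S) N
  obtain ⟨M₀, _, _, ρ', hρ'⟩ := LinearizationBijective.exists_extension (res p n R) M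
  obtain ⟨_, w, hw, hw'⟩ := hab.exists_reduction hfk.symm (ρ' := ρ') hρ
  obtain ⟨_, v, hv, hv'⟩ := hba.exists_reduction hkf.symm (ρ' := ρ) hρ'
  have hf : ∀ x : R, (k.hom : S →+* R) ((f.hom : R →+* S) x) = x := fun x =>
    congrArg (fun q : R ⟶ R => q x) hfk
  have hk : ∀ x : S, (f.hom : R →+* S) ((k.hom : S →+* R) x) = x := fun x =>
    congrArg (fun q : S ⟶ S => q x) hkf
  have hs : Function.Surjective ρ := LinearizationBijective.surjective hρ res_surjective
  have hs' : Function.Surjective ρ' := LinearizationBijective.surjective hρ' res_surjective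
  have hv₀ : LinearizationBijective v := LinearizationBijective.of_bijective
    (Function.bijective_iff_has_inverse.2 ⟨(k.hom : S →+* R), hf, hk⟩)
    (Function.bijective_iff_has_inverse.2 ⟨w, fun x => by
      obtain ⟨x, rfl⟩ := hs' x
      rw [hv, hw']; rfl, fun x => by
      obtain ⟨x, rfl⟩ := hs x
      rw [hw, hv']; rfl⟩)
  exact ⟨N₀, _, _, ρ, hρ, (hρ'.comp hv₀).congr rfl hv⟩

/-- `m` factors through the scalar extension of its source by some `χ` over the identity. By
cancellation the diagonal entries of `χ` are residually bijective, so `χ` is an isomorphism. -/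
theorem TDisplay.IsBaseChange.of_isResidualBaseChange (m : X ⟶ Y)
    (hA : IsResidualBaseChange m.mat.A) (hD : IsResidualBaseChange m.mat.D) :
    TDisplay.IsBaseChange m := by
  obtain ⟨R, X⟩ := X
  obtain ⟨S, Y⟩ := Y
  obtain ⟨X', a, b, ha, hb, h⟩ := exists_scalarExtension m.base X
  have hd : TDisplay.IsBaseChange (diagHom a b h) :=
    .of_isStronglyCocartesian (diagHom_isStronglyCocartesian h ha hb)
  obtain ⟨χ, ⟨hχ, hm⟩, -⟩ := hd.existsUnique m (𝟙 S) (Category.comp_id _).symm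
  have := TDisplay.isIso_of_isResidualBaseChange χ hχ
    (ha.isResidualBaseChange.of_comp (TDisplay.isResidualComp_A hm) (TDisplay.base_comp hm) hA)
    (hb.isResidualBaseChange.of_comp (TDisplay.isResidualComp_D hm) (TDisplay.base_comp hm) hD)
  rw [← hm]
  exact hd.comp (.of_isIso χ)

-- Reduces questions on arbitrary base changes to block diagonal ones, whose four entries can be
-- treated separately. The parameter `f` allows the base to be renamed to a prescribed homomorphism.
omit [NeZero n] in
theorem TDisplay.IsBaseChange.exists_diag (hm : TDisplay.IsBaseChange m) {f : X.R ⟶ Y.R}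
    (hf : m.base = f) : ∃ (X' : Display p n Y.R) (a : X.X.L →ₛₗ[Wm n f] X'.L)
      (b : X.X.T →ₛₗ[Wm n f] X'.T) (_ : LinearizationBijective a)
      (_ : LinearizationBijective b)
      (h : ∀ x, X'.Ψ (a x.1, b x.2) = (a (X.X.Ψ x).1, b (X.X.Ψ x).2)) (χ : ⟨Y.R, X'⟩ ⟶ Y),
      χ.base = 𝟙 Y.R ∧ IsIso χ ∧ diagHom a b h ≫ χ = m := by
  subst hf
  obtain ⟨R, X⟩ := X
  obtain ⟨S, Y⟩ := Y
  obtain ⟨X', a, b, ha, hb, h⟩ := exists_scalarExtension m.base X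
  have hd : TDisplay.IsBaseChange (diagHom a b h) :=
    .of_isStronglyCocartesian (diagHom_isStronglyCocartesian h ha hb)
  obtain ⟨χ, ⟨hχ, e⟩, -⟩ := hd.existsUnique m (𝟙 S) (Category.comp_id _).symm
  have hχ' : TDisplay.IsBaseChange χ := hd.of_comp (by rw [e]; exact hm)
  exact ⟨X', a, b, ha, hb, h, χ, hχ, hχ'.isIso hχ, e⟩

theorem TDisplay.IsBaseChange.isResidualBaseChange (hm : TDisplay.IsBaseChange m) :
    IsResidualBaseChange m.mat.A ∧ IsResidualBaseChange m.mat.D := by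
  obtain ⟨X', a, b, ha, hb, h, χ, hχ, hi, e⟩ := hm.exists_diag rfl
  have h₁ : χ ≫ inv χ = 𝟙 _ := IsIso.hom_inv_id χ
  have h₂ : inv χ ≫ χ = 𝟙 _ := IsIso.inv_hom_id χ
  have h₁' := congrArg TDisplay.Hom.base h₁
  have h₂' := congrArg TDisplay.Hom.base h₂
  exact ⟨ha.isResidualBaseChange.comp (TDisplay.isResidualComp_A e) (TDisplay.base_comp e)
      (isResidualBaseChange_of_inverse h₁' h₂' (TDisplay.isResidualComp_A h₁)
        (TDisplay.isResidualComp_A h₂)),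
    hb.isResidualBaseChange.comp (TDisplay.isResidualComp_D e) (TDisplay.base_comp e)
      (isResidualBaseChange_of_inverse h₁' h₂' (TDisplay.isResidualComp_D h₁)
        (TDisplay.isResidualComp_D h₂))⟩

end Criterion

/-! ### Checking base changes étale locally. -/

section Cover

variable {A : Alg.{u} p} (U : EtaleCover A)

theorem EtaleCover.faithfullyFlat :
    letI (i : U.ι) : Algebra A (U.B i) := ((U.f i).hom : A →+* U.B i).toAlgebra
    Module.FaithfullyFlat A (∀ i, U.B i) := by
  let _ (i : U.ι) : Algebra A (U.B i) := ((U.f i).hom : A →+* U.B i).toAlgebra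
  have := Fintype.ofFinite U.ι
  have (i : U.ι) : Algebra.Etale A (U.B i) := U.etale i
  have (i : U.ι) : Module.Flat A (U.B i) := inferInstance
  refine Module.FaithfullyFlat.of_comap_surjective fun 𝔮 => ?_
  obtain ⟨i, 𝔯, h⟩ := U.surjective 𝔮
  exact ⟨PrimeSpectrum.comap (Pi.evalRingHom _ i) 𝔯, h⟩

/-- Bijectivity of a linear map can be checked on a covering. -/
theorem EtaleCover.bijective {M N : Type u} [AddCommGroup M] [Module A M] [AddCommGroup N]
    [Module A N] (φ : M →ₗ[A] N)
    (h : ∀ i, ∃ (N' : Type u) (_ : AddCommGroup N') (_ : Module (U.B i) N')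
      (v : N →ₛₗ[((U.f i).hom : A →+* U.B i)] N'), LinearizationBijective v ∧
        LinearizationBijective (v.comp φ : M →ₛₗ[((U.f i).hom : A →+* U.B i)] N')) :
    Function.Bijective φ := by
  classical
  let _ (i : U.ι) : Algebra A (U.B i) := ((U.f i).hom : A →+* U.B i).toAlgebra
  have := Fintype.ofFinite U.ι
  have : Module.FaithfullyFlat A (∀ i, U.B i) := U.faithfullyFlat
  -- Over each member of the cover both sides are identified with the scalar extension `N'`, by `v`
  -- on one side and by `v ∘ φ` on the other.
  have key (i : U.ι) : Function.Bijective (LinearMap.lTensor (U.B i) φ) := by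
    obtain ⟨N', _, _, v, hv, hvφ⟩ := h i
    obtain ⟨e, he⟩ := hv.equiv
    obtain ⟨e', he'⟩ := hvφ.equiv
    have : ∀ z, LinearMap.lTensor (U.B i) φ z = e.symm (e' z) := fun z => by
      rw [LinearEquiv.eq_symm_apply]
      induction z with
      | zero => simp
      | add x y hx hy => simp only [map_add, hx, hy]
      | tmul s m => rw [LinearMap.lTensor_tmul, he, he']; rfl
    rw [show (LinearMap.lTensor (U.B i) φ : _ → _) = e.symm ∘ e' from funext this]
    exact e.symm.bijective.comp e'.bijective
  -- The finite product of the members is faithfully flat over `A`, and tensoring with it is the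
  -- product of the tensor products with the factors.
  rw [← Module.FaithfullyFlat.lTensor_bijective_iff_bijective A (∀ i, U.B i)]
  let e (M : Type u) [AddCommGroup M] [Module A M] :
      (∀ i, U.B i) ⊗[A] M ≃ₗ[A] ∀ i, U.B i ⊗[A] M :=
    TensorProduct.comm _ _ _ ≪≫ₗ TensorProduct.piRight A A M _ ≪≫ₗ
      LinearEquiv.piCongrRight fun i => TensorProduct.comm _ _ _
  have he : ∀ z, e N (LinearMap.lTensor _ φ z) = fun i => LinearMap.lTensor _ φ (e M z i) := by
    intro z
    induction z with
    | zero => ext i; simp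
    | add x y hx hy =>
      simp only [map_add, hx, hy]
      funext i
      simp
    | tmul s m => rfl
  rw [show (LinearMap.lTensor (∀ i, U.B i) φ : _ → _) =
    (e N).symm ∘ (Pi.map fun i => LinearMap.lTensor (U.B i) φ) ∘ e M from
      funext fun z => ((e N).eq_symm_apply).2 (he z)]
  exact (e N).symm.bijective.comp ((Function.Bijective.piMap key).comp (e M).bijective)

/-- Residual base change is a statement over `A` and not over `W_n(A)`. It says that `φ`, from the
extension of `M` to `A` into the reduction of `N`, is bijective, and this descends along the étale
cover. -/
theorem EtaleCover.isResidualBaseChange {R : Alg.{u} p} {f : R ⟶ A} {M N : Type u}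
    [AddCommGroup M] [Module (W p n R) M] [AddCommGroup N] [Module (W p n A) N]
    {a : M →ₛₗ[Wm n f] N}
    (h : ∀ i, ∃ (O : Type u) (_ : AddCommGroup O) (_ : Module (W p n (U.B i)) O)
      (a' : N →ₛₗ[Wm n (U.f i)] O) (a'' : M →ₛₗ[Wm n (f ≫ U.f i)] O), IsResidualComp a a' a'' ∧
        IsResidualBaseChange a' ∧ IsResidualBaseChange a'') :
    IsResidualBaseChange a := by
  obtain ⟨N₀, _, _, ρ, hρ⟩ := LinearizationBijective.exists_extension (res p n A) N
  obtain ⟨M₀, _, _, ι, hι⟩ := LinearizationBijective.exists_extension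
    ((res p n A).comp (Wm n f)) M
  obtain ⟨φ, hφ⟩ := hι.exists_lift (τ' := RingHom.id A)
    (ρ.comp a : M →ₛₗ[(res p n A).comp (Wm n f)] N₀)
  refine ⟨N₀, _, _, ρ, hρ, hι.of_unique_lift φ (U.bijective φ fun i => ?_) hφ⟩
  obtain ⟨O, _, _, a', a'', hc, ha', ha''⟩ := h i
  obtain ⟨O₀, _, _, ρ', hρ'⟩ := LinearizationBijective.exists_extension (res p n (U.B i)) O
  obtain ⟨_, w, hw, hw'⟩ := hc.exists_reduction rfl (ρ' := ρ') hρ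
  have h₃ : LinearizationBijective w := hρ.of_comp
    ((ha'.comp_linearizationBijective hρ').congr rfl fun x => (hw x).symm)
  refine ⟨O₀, _, _, w, h₃, hι.of_comp
    ((ha''.comp_linearizationBijective hρ').congr rfl fun x => ?_)⟩
  exact (hw' x).symm.trans (congrArg w (hφ x).symm)

/-- Whether a morphism of displays is a base change can be checked on a covering. -/
theorem TDisplay.IsBaseChange.of_cover {X : TDisplay.{u} p n} {Y : Display p n A}
    (m : X ⟶ ⟨A, Y⟩) (Z : ∀ i, Display p n (U.B i))
    (k : ∀ i, (⟨A, Y⟩ : TDisplay.{u} p n) ⟶ ⟨U.B i, Z i⟩) (hk : ∀ i, (k i).base = U.f i)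
    (h : ∀ i, TDisplay.IsBaseChange (k i)) (h' : ∀ i, TDisplay.IsBaseChange (m ≫ k i)) :
    TDisplay.IsBaseChange m := by
  have e : ∀ i, ∃ (k' : DMatrix (U.f i) Y (Z i)) (m' : DMatrix (m.base ≫ U.f i) X.X (Z i)),
      IsResidualComp m.mat.A k'.A m'.A ∧ IsResidualComp m.mat.D k'.D m'.D ∧
      (IsResidualBaseChange k'.A ∧ IsResidualBaseChange k'.D) ∧
        (IsResidualBaseChange m'.A ∧ IsResidualBaseChange m'.D) := by
    intro i
    rw [← hk i]
    exact ⟨(k i).mat, (m ≫ k i).mat, TDisplay.isResidualComp_A (m := m) (m' := k i) rfl,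
      TDisplay.isResidualComp_D (m := m) (m' := k i) rfl,
      (h i).isResidualBaseChange, (h' i).isResidualBaseChange⟩
  choose k' m' h₁ h₂ h₃ h₄ using e
  exact .of_isResidualBaseChange m
    (U.isResidualBaseChange fun i => ⟨_, _, _, _, _, h₁ i, (h₃ i).1, (h₄ i).1⟩)
    (U.isResidualBaseChange fun i => ⟨_, _, _, _, _, h₂ i, (h₃ i).2, (h₄ i).2⟩)

end Cover

end Residual

/-! ### Gluing elements of projective modules -/

section Glue

variable {p n : ℕ} [Fact p.Prime]

theorem exists_dualBasis (K M : Type*) [CommRing K] [AddCommGroup M] [Module K M]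
    [Module.Finite K M] [Module.Projective K M] :
    ∃ (k : ℕ) (e : Fin k → M →ₗ[K] K) (v : Fin k → M), ∀ x, ∑ j, e j x • v j = x := by
  obtain ⟨k, f, g, -, -, h⟩ := Module.Finite.exists_comp_eq_id_of_projective K M
  refine ⟨k, fun j => LinearMap.proj j ∘ₗ g, fun j => f (Pi.single j 1), fun x => ?_⟩
  have hx : f (g x) = x := LinearMap.congr_fun h x
  conv_rhs => rw [← hx, ← Finset.univ_sum_single (g x), map_sum]
  refine Finset.sum_congr rfl fun j _ => ?_
  rw [← map_smul, ← Pi.single_smul, smul_eq_mul, mul_one]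
  rfl

theorem LinearizationBijective.exists_dualBasis {K K' M N : Type*} [CommRing K] [CommRing K']
    [AddCommGroup M] [AddCommGroup N] [Module K M] [Module K' N] {τ : K →+* K'} {u : M →ₛₗ[τ] N}
    (hu : LinearizationBijective u) (e : M →ₗ[K] K) : ∃ e' : N →ₗ[K'] K', ∀ x, e' (u x) = τ (e x) :=
  hu.exists_lift (τ' := RingHom.id K') (τ.toSemilinearMap.comp e : M →ₛₗ[τ] K')

section TensorI

variable {R S : Alg.{u} p} (f : R ⟶ S) {M N : Type u} [AddCommGroup M] [Module (W p n R) M]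
  [AddCommGroup N] [Module (W p n S) N]

/-- The map `M ⊗ I_{n+1,R} → N ⊗ I_{n+1,S}` induced by a semilinear map `M → N`. -/
noncomputable def mapTI {f : R ⟶ S} (u : M →ₛₗ[Wm n f] N) :
    M ⊗[W p n R] I p n R →ₛₗ[Wm n f] N ⊗[W p n S] I p n S :=
  TensorProduct.map u (mapI p n (f.hom : R →+* S))

@[simp] theorem mapTI_tmul {f : R ⟶ S} (u : M →ₛₗ[Wm n f] N) (t : M) (ω : I p n R) :
    mapTI u (t ⊗ₜ[W p n R] ω) = u t ⊗ₜ[W p n S] mapI p n (f.hom : R →+* S) ω := rfl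

/-- The map `M ⊗ I_{n+1,R} → I_{n+1,R}` induced by a linear form on `M`. -/
noncomputable def formI (e : M →ₗ[W p n R] W p n R) : M ⊗[W p n R] I p n R →ₗ[W p n R] I p n R :=
  (TensorProduct.lid (W p n R) (I p n R)).toLinearMap ∘ₗ LinearMap.rTensor _ e

@[simp] theorem formI_tmul (e : M →ₗ[W p n R] W p n R) (t : M) (ω : I p n R) :
    formI e (t ⊗ₜ[W p n R] ω) = e t • ω := by simp [formI]

theorem formI_mapTI {f : R ⟶ S} {u : M →ₛₗ[Wm n f] N} {e : M →ₗ[W p n R] W p n R}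
    {e' : N →ₗ[W p n S] W p n S} (h : ∀ x, e' (u x) = Wm n f (e x)) (z : M ⊗[W p n R] I p n R) :
    formI e' (mapTI u z) = mapI p n (f.hom : R →+* S) (formI e z) := by
  induction z with
  | zero => simp
  | add x y hx hy => simp only [map_add, hx, hy]
  | tmul t ω => rw [mapTI_tmul, formI_tmul, formI_tmul, h, map_smulₛₗ]

/-- An element of `M ⊗ I_{n+1}` is recovered from its coordinates in `I_{n+1}`. So it can be glued
by gluing elements of `I_{n+1}`. -/
theorem sum_formI {k : ℕ} {e : Fin k → M →ₗ[W p n R] W p n R} {v : Fin k → M}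
    (h : ∀ x, ∑ j, e j x • v j = x) (z : M ⊗[W p n R] I p n R) :
    ∑ j, v j ⊗ₜ[W p n R] formI (e j) z = z := by
  induction z with
  | zero => simp
  | add x y hx hy => simp only [map_add, TensorProduct.tmul_add, Finset.sum_add_distrib, hx, hy]
  | tmul t ω =>
    simp only [formI_tmul, ← TensorProduct.smul_tmul, ← TensorProduct.sum_tmul, h]

end TensorI

variable {A : Alg.{u} p} (U : EtaleCover A) {M : Type u} [AddCommGroup M] [Module (W p n A) M]
  {N : U.ι → Type u} [∀ i, AddCommGroup (N i)] [∀ i, Module (W p n (U.B i)) (N i)]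
  {u : ∀ i, M →ₛₗ[Wm n (U.f i)] N i}

/-- Two semilinear maps exhibit a module as a common scalar extension of two members of a family of
scalar extensions. -/
structure EtaleCover.Overlap (u : ∀ i, M →ₛₗ[Wm n (U.f i)] N i) {i j : U.ι} {E : Alg.{u} p}
    {a : U.B i ⟶ E} {b : U.B j ⟶ E} {O : Type u} [AddCommGroup O] [Module (W p n E) O]
    (α : N i →ₛₗ[Wm n a] O) (β : N j →ₛₗ[Wm n b] O) : Prop where
  base : U.f i ≫ a = U.f j ≫ b
  eq : ∀ y, α (u i y) = β (u j y)
  bijective : LinearizationBijective (α.comp (u i) : M →ₛₗ[Wm n (U.f i ≫ a)] O)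

section

variable {U} {i j : U.ι} {E : Alg.{u} p}
    {a : U.B i ⟶ E} {b : U.B j ⟶ E} {O : Type u} [AddCommGroup O] [Module (W p n E) O]
    {α : N i →ₛₗ[Wm n a] O} {β : N j →ₛₗ[Wm n b] O}

/-- A form on `M` extends to the common scalar extension `O` and restricts there to both extended
forms. Hence the coordinates of compatible elements are compatible. -/
theorem EtaleCover.Overlap.exists_form (h : U.Overlap u α β) (hu : ∀ i, LinearizationBijective (u i))
    {e : M →ₗ[W p n A] W p n A} {e' : ∀ i, N i →ₗ[W p n (U.B i)] W p n (U.B i)}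
    (he' : ∀ i x, e' i (u i x) = Wm n (U.f i) (e x)) :
    ∃ e₀ : O →ₗ[W p n E] W p n E, (∀ x, e₀ (α x) = Wm n a (e' i x)) ∧
      ∀ x, e₀ (β x) = Wm n b (e' j x) := by
  obtain ⟨e₀, he₀⟩ := h.bijective.exists_dualBasis e
  have he₀' : ∀ x, e₀ (α (u i x)) = Wm n (U.f i ≫ a) (e x) := he₀
  refine ⟨e₀, fun x => ?_, fun x => ?_⟩
  · refine LinearMap.congr_fun ((hu i).ext (w := (e₀.comp α : N i →ₛₗ[Wm n a] W p n E))
      (w' := ((Wm n a).toSemilinearMap.comp (e' i) : N i →ₛₗ[Wm n a] W p n E)) fun x => ?_) x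
    change e₀ (α (u i x)) = Wm n a (e' i (u i x))
    rw [he₀', he']
    exact mapW_comp p n _ _ _
  · refine LinearMap.congr_fun ((hu j).ext (w := (e₀.comp β : N j →ₛₗ[Wm n b] W p n E))
      (w' := ((Wm n b).toSemilinearMap.comp (e' j) : N j →ₛₗ[Wm n b] W p n E)) fun x => ?_) x
    change e₀ (β (u j x)) = Wm n b (e' j (u j x))
    rw [← h.eq, he₀', he', h.base]
    exact mapW_comp p n _ _ _

end

variable [Module.Finite (W p n A) M] [Module.Projective (W p n A) M]

theorem EtaleCover.module_ext (hu : ∀ i, LinearizationBijective (u i)) {x y : M}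
    (h : ∀ i, u i x = u i y) : x = y := by
  obtain ⟨k, e, v, hev⟩ := Disp.exists_dualBasis (W p n A) M
  choose e' he' using fun i j => (hu i).exists_dualBasis (e j)
  rw [← hev x, ← hev y]
  refine Finset.sum_congr rfl fun j _ => ?_
  congr 1
  exact separated_W U fun i => by rw [← he', ← he', h]

/-- The coordinates of the `x i` in an extended dual basis are compatible families of Witt vectors
and glue component by component. Finite projectivity of `M` replaces any flatness of `W_n(A) →
W_n(B_i)`. -/
theorem EtaleCover.exists_glue_module (hu : ∀ i, LinearizationBijective (u i)) (x : ∀ i, N i)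
    (hx : ∀ (i j : U.ι) (E : Alg.{u} p) (a : U.B i ⟶ E) (b : U.B j ⟶ E), U.f i ≫ a = U.f j ≫ b →
      ∃ (O : Type u) (_ : AddCommGroup O) (_ : Module (W p n E) O) (α : N i →ₛₗ[Wm n a] O)
        (β : N j →ₛₗ[Wm n b] O), U.Overlap u α β ∧ α (x i) = β (x j)) :
    ∃ y : M, ∀ i, u i y = x i := by
  obtain ⟨k, e, v, hev⟩ := Disp.exists_dualBasis (W p n A) M
  choose e' he' using fun i j => (hu i).exists_dualBasis (e j)
  -- A dual basis of `M` extends to a dual basis of each `N i`.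
  have hsum : ∀ i y, ∑ j, e' i j y • u i (v j) = y := fun i y => by
    have := LinearMap.congr_fun ((hu i).ext (w' := LinearMap.id)
      (w := ∑ j, (e' i j).smulRight (u i (v j))) fun x => ?_) y
    · simpa using this
    · simp only [LinearMap.sum_apply, LinearMap.smulRight_apply, he', LinearMap.id_apply]
      conv_rhs => rw [← hev x, map_sum]
      exact Finset.sum_congr rfl fun j _ => ((u i).map_smulₛₗ _ _).symm
  have key : ∀ j, ∃ c : W p n A, ∀ i, Wm n (U.f i) c = e' i j (x i) := fun j =>
    glue_W U _ fun i i' E a b h => by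
      obtain ⟨O, _, _, α, β, hαβ, hx'⟩ := hx i i' E a b h
      obtain ⟨e₀, h₁, h₂⟩ := hαβ.exists_form hu (fun i => he' i j)
      rw [← h₁, ← h₂, hx']
  choose c hc using key
  refine ⟨∑ j, c j • v j, fun i => ?_⟩
  rw [map_sum, ← hsum i (x i)]
  exact Finset.sum_congr rfl fun j _ => by rw [map_smulₛₗ, hc]

theorem EtaleCover.tensorI_ext (hu : ∀ i, LinearizationBijective (u i))
    {x y : M ⊗[W p n A] I p n A} (h : ∀ i, mapTI (u i) x = mapTI (u i) y) : x = y := by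
  obtain ⟨k, e, v, hev⟩ := Disp.exists_dualBasis (W p n A) M
  choose e' he' using fun i j => (hu i).exists_dualBasis (e j)
  rw [← sum_formI hev x, ← sum_formI hev y]
  refine Finset.sum_congr rfl fun j _ => ?_
  congr 1
  exact separated_I U fun i => by
    rw [← formI_mapTI fun x => he' i j x, ← formI_mapTI fun x => he' i j x, h]

theorem EtaleCover.exists_glue_tensorI (hu : ∀ i, LinearizationBijective (u i))
    (x : ∀ i, N i ⊗[W p n (U.B i)] I p n (U.B i))
    (hx : ∀ (i j : U.ι) (E : Alg.{u} p) (a : U.B i ⟶ E) (b : U.B j ⟶ E), U.f i ≫ a = U.f j ≫ b →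
      ∃ (O : Type u) (_ : AddCommGroup O) (_ : Module (W p n E) O) (α : N i →ₛₗ[Wm n a] O)
        (β : N j →ₛₗ[Wm n b] O), U.Overlap u α β ∧ mapTI α (x i) = mapTI β (x j)) :
    ∃ y : M ⊗[W p n A] I p n A, ∀ i, mapTI (u i) y = x i := by
  obtain ⟨k, e, v, hev⟩ := Disp.exists_dualBasis (W p n A) M
  choose e' he' using fun i j => (hu i).exists_dualBasis (e j)
  have hsum : ∀ i y, ∑ j, e' i j y • u i (v j) = y := fun i y => by
    have := LinearMap.congr_fun ((hu i).ext (w' := LinearMap.id)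
      (w := ∑ j, (e' i j).smulRight (u i (v j))) fun x => ?_) y
    · simpa using this
    · simp only [LinearMap.sum_apply, LinearMap.smulRight_apply, he', LinearMap.id_apply]
      conv_rhs => rw [← hev x, map_sum]
      exact Finset.sum_congr rfl fun j _ => ((u i).map_smulₛₗ _ _).symm
  have key : ∀ j, ∃ c : I p n A, ∀ i, mapI p n ((U.f i).hom : A →+* U.B i) c =
      formI (e' i j) (x i) := fun j =>
    glue_I U _ fun i i' E a b h => by
      obtain ⟨O, _, _, α, β, hαβ, hx'⟩ := hx i i' E a b h
      obtain ⟨e₀, h₁, h₂⟩ := hαβ.exists_form hu (fun i => he' i j)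
      rw [← formI_mapTI h₁, ← formI_mapTI h₂, hx']
  choose c hc using key
  refine ⟨∑ j, v j ⊗ₜ[W p n A] c j, fun i => ?_⟩
  rw [map_sum, ← sum_formI (hsum i) (x i)]
  exact Finset.sum_congr rfl fun j _ => by rw [mapTI_tmul, hc]

end Glue

/-! ### Gluing morphisms of displays -/

section GlueHom

variable {p n : ℕ} [Fact p.Prime]

/-- Compatibility of the induced maps with `Ψ` is checked on the image of `X.L × X.T`, where it is
the compatibility of `a'` and `b'`. -/
theorem exists_diag_factor {R S E : Alg.{u} p} {f : R ⟶ S} {k : S ⟶ E} {l : R ⟶ E}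
    {X : Display p n R} {X' : Display p n S} {X'' : Display p n E}
    {a : X.L →ₛₗ[Wm n f] X'.L} {b : X.T →ₛₗ[Wm n f] X'.T} (ha : LinearizationBijective a)
    (hb : LinearizationBijective b) (h : ∀ x, X'.Ψ (a x.1, b x.2) = (a (X.Ψ x).1, b (X.Ψ x).2))
    (a' : X.L →ₛₗ[Wm n l] X''.L) (b' : X.T →ₛₗ[Wm n l] X''.T)
    (h' : ∀ x, X''.Ψ (a' x.1, b' x.2) = (a' (X.Ψ x).1, b' (X.Ψ x).2)) (hl : l = f ≫ k) :
    ∃ (α : X'.L →ₛₗ[Wm n k] X''.L) (β : X'.T →ₛₗ[Wm n k] X''.T), (∀ x, α (a x) = a' x) ∧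
      (∀ x, β (b x) = b' x) ∧ ∀ x, X''.Ψ (α x.1, β x.2) = (α (X'.Ψ x).1, β (X'.Ψ x).2) := by
  subst hl
  obtain ⟨α, hα⟩ := ha.exists_lift (τ' := Wm n k) a'
  obtain ⟨β, hβ⟩ := hb.exists_lift (τ' := Wm n k) b'
  refine ⟨α, β, hα, hβ, ?_⟩
  let u : (X.L × X.T) →ₛₗ[Wm n f] (X'.L × X'.T) := (DMatrix.diag a b).onP
  have hu : LinearizationBijective u := ha.prod hb (DMatrix.diag_onP a b)
  let v : (X'.L × X'.T) →ₛₗ[Wm n k] (X''.L × X''.T) := (DMatrix.diag α β).onP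
  have hv : ∀ x, v x = (α x.1, β x.2) := DMatrix.diag_onP α β
  intro x
  rw [← hv, ← hv]
  refine hu.addHom_ext (w := X''.Ψ.toAddMonoidHom.comp v.toAddMonoidHom)
    (w' := v.toAddMonoidHom.comp X'.Ψ.toAddMonoidHom) (τ' := (Wm n k).comp (σ p n S))
    (fun c x => ?_) (fun c x => ?_) (fun x => ?_) x
  · change X''.Ψ (v (c • x)) = _ • X''.Ψ (v x)
    rw [map_smulₛₗ, map_smulₛₗ]
    exact congrArg (· • _) (mapW_σ p n _ c).symm
  · change v (X'.Ψ (c • x)) = _ • v (X'.Ψ x)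
    rw [map_smulₛₗ, map_smulₛₗ]
    rfl
  · change X''.Ψ (v (u x)) = v (X'.Ψ (u x))
    have hux : u x = (a x.1, b x.2) := DMatrix.diag_onP a b x
    rw [hux, h, hv, hv, hα, hβ, hα, hβ, h']

theorem evalT_mapTI {R S : Alg.{u} p} {f : R ⟶ S} {M N : Type u} [AddCommGroup M]
    [Module (W p n R) M] [AddCommGroup N] [Module (W p n S) N] (u : M →ₛₗ[Wm n f] N)
    (z : M ⊗[W p n R] I p n R) : evalT N (mapTI u z) = u (evalT M z) := by
  induction z with
  | zero => simp
  | add x y hx hy => simp only [map_add, hx, hy]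
  | tmul t ω =>
    rw [mapTI_tmul, evalT_tmul, evalT_tmul, map_smulₛₗ]
    exact congrArg (· • u t) (toW_mapI p n _ ω)

section Diag

variable {X : TDisplay.{u} p n} {S E : Alg.{u} p} {Y : Display p n S} {Z : Display p n E}
  {k : S ⟶ E} (m : X ⟶ ⟨S, Y⟩) {a : Y.L →ₛₗ[Wm n k] Z.L} {b : Y.T →ₛₗ[Wm n k] Z.T}
  (h : ∀ x, Z.Ψ (a x.1, b x.2) = (a (Y.Ψ x).1, b (Y.Ψ x).2))

theorem comp_diagHom_A (l : X.X.L) : (m ≫ diagHom a b h).mat.A l = a (m.mat.A l) :=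
  add_zero _

theorem comp_diagHom_B (t : X.X.T) : (m ≫ diagHom a b h).mat.B t = a (m.mat.B t) :=
  add_zero _

theorem comp_diagHom_C (l : X.X.L) : (m ≫ diagHom a b h).mat.C l = mapTI b (m.mat.C l) :=
  zero_add _

theorem comp_diagHom_D (t : X.X.T) : (m ≫ diagHom a b h).mat.D t = b (m.mat.D t) := by
  change evalT _ (0 : Z.T ⊗[W p n E] I p n E) + b (m.mat.D t) = _
  rw [map_zero, zero_add]

theorem diagHom_comp_diagHom {R S E : Alg.{u} p} {f : R ⟶ S} {k : S ⟶ E} {l : R ⟶ E}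
    {X : Display p n R} {X' : Display p n S} {X'' : Display p n E}
    {a : X.L →ₛₗ[Wm n f] X'.L} {b : X.T →ₛₗ[Wm n f] X'.T}
    (h : ∀ x, X'.Ψ (a x.1, b x.2) = (a (X.Ψ x).1, b (X.Ψ x).2))
    {a' : X.L →ₛₗ[Wm n l] X''.L} {b' : X.T →ₛₗ[Wm n l] X''.T}
    (h' : ∀ x, X''.Ψ (a' x.1, b' x.2) = (a' (X.Ψ x).1, b' (X.Ψ x).2)) (hl : l = f ≫ k)
    {α : X'.L →ₛₗ[Wm n k] X''.L} {β : X'.T →ₛₗ[Wm n k] X''.T}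
    (h'' : ∀ x, X''.Ψ (α x.1, β x.2) = (α (X'.Ψ x).1, β (X'.Ψ x).2))
    (hα : ∀ x, α (a x) = a' x) (hβ : ∀ x, β (b x) = b' x) :
    diagHom a b h ≫ diagHom α β h'' = diagHom a' b' h' := by
  refine TDisplay.Hom.ext hl.symm
    (DMatrix.heq_of_entries hl.symm _ _ (fun x => ?_) (fun x => ?_) (fun x => ?_) (fun x => ?_))
  · exact (comp_diagHom_A (diagHom a b h) h'' x).trans (hα x)
  · exact (comp_diagHom_B (diagHom a b h) h'' x).trans (map_zero α)
  · exact (comp_diagHom_C (diagHom a b h) h'' x).trans (map_zero (mapTI β))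
  · exact (comp_diagHom_D (diagHom a b h) h'' x).trans (hβ x)

end Diag

/-- Values are glued one element at a time, and semilinearity follows because elements are separated
by their restrictions. -/
theorem exists_semilinear_of_forall {R A : Alg.{u} p} {ι : Type} {B : ι → Alg.{u} p}
    {c : ∀ i, A ⟶ B i} {f : R ⟶ A} {k : ∀ i, R ⟶ B i} (hk : ∀ i, k i = f ≫ c i) {K M : Type*}
    [AddCommGroup K] [Module (W p n R) K] [AddCommGroup M] [Module (W p n A) M] {N : ι → Type*}
    [∀ i, AddCommGroup (N i)] [∀ i, Module (W p n (B i)) (N i)] {u : ∀ i, M →ₛₗ[Wm n (c i)] N i}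
    (hu : ∀ x y, (∀ i, u i x = u i y) → x = y) (g : ∀ i, K →ₛₗ[Wm n (k i)] N i)
    (h : ∀ x, ∃ y, ∀ i, u i y = g i x) : ∃ G : K →ₛₗ[Wm n f] M, ∀ x i, u i (G x) = g i x := by
  choose G hG using h
  refine ⟨⟨⟨G, fun x y => hu _ _ fun i => ?_⟩, fun a x => hu _ _ fun i => ?_⟩, hG⟩
  · rw [map_add, hG, hG, hG, map_add]
  · change u i (G (a • x)) = u i (Wm n f a • G x)
    rw [map_smulₛₗ, hG, hG, map_smulₛₗ]
    exact congrArg (· • g i x) ((congrArg (fun q => Wm n q a) (hk i)).trans (mapW_comp p n _ _ _))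

variable {A : Alg.{u} p} (U : EtaleCover A)

/-- Composition with diagonal matrices acts on each entry alone, so the four entries glue
separately, the entry `C` in `T ⊗ I_{n+1}`. The identities for `F` and `F₁` are then local, those
for `F₁` being needed only on `L`. -/
theorem EtaleCover.exists_glue_diag {X : TDisplay.{u} p n} {Y : Display p n A} (f : X.R ⟶ A)
    {Z : ∀ i, Display p n (U.B i)} {a : ∀ i, Y.L →ₛₗ[Wm n (U.f i)] (Z i).L}
    {b : ∀ i, Y.T →ₛₗ[Wm n (U.f i)] (Z i).T} (ha : ∀ i, LinearizationBijective (a i))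
    (hb : ∀ i, LinearizationBijective (b i))
    (h : ∀ i x, (Z i).Ψ (a i x.1, b i x.2) = (a i (Y.Ψ x).1, b i (Y.Ψ x).2))
    (m : ∀ i, X ⟶ ⟨U.B i, Z i⟩) (hm : ∀ i, (m i).base = f ≫ U.f i)
    (hc : ∀ (i j : U.ι) (E : Alg.{u} p) (s : U.B i ⟶ E) (t : U.B j ⟶ E), U.f i ≫ s = U.f j ≫ t →
      ∃ (O : Display p n E) (α : (Z i).L →ₛₗ[Wm n s] O.L) (β : (Z i).T →ₛₗ[Wm n s] O.T)
        (α' : (Z j).L →ₛₗ[Wm n t] O.L) (β' : (Z j).T →ₛₗ[Wm n t] O.T),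
        U.Overlap a α α' ∧ U.Overlap b β β' ∧ (∀ l, α ((m i).mat.A l) = α' ((m j).mat.A l)) ∧
        (∀ l, α ((m i).mat.B l) = α' ((m j).mat.B l)) ∧
        (∀ l, mapTI β ((m i).mat.C l) = mapTI β' ((m j).mat.C l)) ∧
        ∀ l, β ((m i).mat.D l) = β' ((m j).mat.D l)) :
    ∃ k : X ⟶ ⟨A, Y⟩, k.base = f ∧ ∀ i, k ≫ diagHom (a i) (b i) (h i) = m i := by
  obtain ⟨kA, hA⟩ := exists_semilinear_of_forall hm (fun x y => U.module_ext ha)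
    (fun i => (m i).mat.A) fun l => U.exists_glue_module ha _ fun i j E s t e => by
      obtain ⟨O, α, β, α', β', h₁, h₂, h₃, h₄, h₅, h₆⟩ := hc i j E s t e
      exact ⟨_, _, _, _, _, h₁, h₃ l⟩
  obtain ⟨kB, hB⟩ := exists_semilinear_of_forall hm (fun x y => U.module_ext ha)
    (fun i => (m i).mat.B) fun l => U.exists_glue_module ha _ fun i j E s t e => by
      obtain ⟨O, α, β, α', β', h₁, h₂, h₃, h₄, h₅, h₆⟩ := hc i j E s t e
      exact ⟨_, _, _, _, _, h₁, h₄ l⟩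
  obtain ⟨kC, hC⟩ := exists_semilinear_of_forall hm (fun x y => U.tensorI_ext hb)
    (fun i => (m i).mat.C) fun l => U.exists_glue_tensorI hb _ fun i j E s t e => by
      obtain ⟨O, α, β, α', β', h₁, h₂, h₃, h₄, h₅, h₆⟩ := hc i j E s t e
      exact ⟨_, _, _, _, _, h₂, h₅ l⟩
  obtain ⟨kD, hD⟩ := exists_semilinear_of_forall hm (fun x y => U.module_ext hb)
    (fun i => (m i).mat.D) fun l => U.exists_glue_module hb _ fun i j E s t e => by
      obtain ⟨O, α, β, α', β', h₁, h₂, h₃, h₄, h₅, h₆⟩ := hc i j E s t e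
      exact ⟨_, _, _, _, _, h₂, h₆ l⟩
  let k : DMatrix f X.X Y := ⟨kA, kB, kC, kD⟩
  have hP : ∀ i x, (DMatrix.diag (a i) (b i)).onP (k.onP x) = (m i).mat.onP x := fun i x => by
    rw [DMatrix.diag_onP]
    refine Prod.ext ?_ ?_
    · change a i (kA x.1 + kB x.2) = (m i).mat.A x.1 + (m i).mat.B x.2
      rw [map_add, hA, hB]
    · change b i (evalT _ (kC x.1) + kD x.2) = evalT _ ((m i).mat.C x.1) + (m i).mat.D x.2
      rw [map_add, ← evalT_mapTI, hC, hD]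
  have hQ : ∀ i l, (DMatrix.diag (a i) (b i)).onQ (k.onQ (l, 0)) = (m i).mat.onQ (l, 0) :=
    fun i l => by
      refine Prod.ext ?_ ?_
      · change a i (kA l + kB (evalT _ 0)) + 0 = (m i).mat.A l + (m i).mat.B (evalT _ 0)
        rw [map_zero, map_zero, map_zero, add_zero, add_zero, add_zero, hA]
      · change 0 + mapTI (b i) (kC l + mapTI kD 0) = (m i).mat.C l + mapTI (m i).mat.D 0
        rw [map_zero, map_zero, add_zero, zero_add, add_zero, hC]
  have sep : ∀ x y : Y.L × Y.T, (∀ i, (DMatrix.diag (a i) (b i)).onP x =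
      (DMatrix.diag (a i) (b i)).onP y) → x = y := fun x y hxy => by
    simp only [DMatrix.diag_onP, Prod.mk.injEq] at hxy
    exact Prod.ext (U.module_ext ha fun i => (hxy i).1) (U.module_ext hb fun i => (hxy i).2)
  have cF : ∀ x, k.onP (X.X.F x) = Y.F (k.onP x) := fun x => sep _ _ fun i => by
    rw [hP, DMatrix.diag_comm_F _ _ (h i), hP]
    exact (m i).comm_F x
  have cF₁ : ∀ l, k.onP (X.X.F₁ (l, 0)) = Y.F₁ (k.onQ (l, 0)) := fun l => sep _ _ fun i => by
    rw [hP, DMatrix.diag_comm_F₁ _ _ (h i), hQ]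
    exact (m i).comm_F₁ (l, 0)
  let K : X ⟶ ⟨A, Y⟩ := ⟨f, k, cF, k.comm_F₁_of cF cF₁⟩
  refine ⟨K, rfl, fun i => TDisplay.Hom.ext (hm i).symm
    (DMatrix.heq_of_entries (hm i).symm _ _ (fun x => ?_) (fun x => ?_) (fun x => ?_)
      (fun x => ?_))⟩
  · exact (comp_diagHom_A K (h i) x).trans (hA x i)
  · exact (comp_diagHom_B K (h i) x).trans (hB x i)
  · exact (comp_diagHom_C K (h i) x).trans (hC x i)
  · exact (comp_diagHom_D K (h i) x).trans (hD x i)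

/-- Morphisms into a display glue. -/
theorem EtaleCover.exists_glue_hom {X : TDisplay.{u} p n} {Y : Display p n A} (f : X.R ⟶ A)
    {Z : ∀ i, Display p n (U.B i)} (k : ∀ i, (⟨A, Y⟩ : TDisplay.{u} p n) ⟶ ⟨U.B i, Z i⟩)
    (hk : ∀ i, (k i).base = U.f i) (hk' : ∀ i, TDisplay.IsBaseChange (k i))
    (m : ∀ i, X ⟶ ⟨U.B i, Z i⟩) (hm : ∀ i, (m i).base = f ≫ U.f i)
    (hc : ∀ (i j : U.ι) (E : Alg.{u} p) (s : U.B i ⟶ E) (t : U.B j ⟶ E), U.f i ≫ s = U.f j ≫ t →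
      ∃ (O : Display p n E) (α : (⟨U.B i, Z i⟩ : TDisplay.{u} p n) ⟶ ⟨E, O⟩)
        (β : (⟨U.B j, Z j⟩ : TDisplay.{u} p n) ⟶ ⟨E, O⟩), α.base = s ∧ β.base = t ∧
        TDisplay.IsBaseChange (k i ≫ α) ∧ k i ≫ α = k j ≫ β ∧ m i ≫ α = m j ≫ β) :
    ∃ g : X ⟶ ⟨A, Y⟩, g.base = f ∧ ∀ i, g ≫ k i = m i := by
  -- Each `k i` is replaced by a diagonal base change followed by an isomorphism `χ i`, which is
  -- moved into `m i`.
  choose Z' a b ha hb h χ hχ hi e using fun i => (hk' i).exists_diag (hk i)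
  obtain ⟨g, hg, hg'⟩ := U.exists_glue_diag f ha hb h (fun i => m i ≫ inv (χ i)) (fun i => by
    have h₁ := congrArg TDisplay.Hom.base (IsIso.hom_inv_id (χ i))
    change (χ i).base ≫ (inv (χ i)).base = 𝟙 _ at h₁
    rw [hχ, Category.id_comp] at h₁
    change (m i).base ≫ (inv (χ i)).base = _
    rw [h₁, hm]
    exact Category.comp_id _) (fun i j E s t est => by
    obtain ⟨O, α, β, hα, hβ, hkα, hkαβ, hmαβ⟩ := hc i j E s t est
    have hb₁ : (k i ≫ α).base = U.f i ≫ s := by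
      change (k i).base ≫ α.base = _
      rw [hk, hα]
    -- The display on the overlap is also replaced by a diagonal scalar extension of `Y`. Both
    -- members then map to it by diagonal matrices.
    obtain ⟨O', a', b', ha', hb', h', χ', hχ', _, e'⟩ := hkα.exists_diag hb₁
    obtain ⟨α₁, β₁, hα₁, hβ₁, h₁⟩ := exists_diag_factor (ha i) (hb i) (h i) a' b' h' rfl
    obtain ⟨α₂, β₂, hα₂, hβ₂, h₂⟩ := exists_diag_factor (ha j) (hb j) (h j) a' b' h' est
    have f₁ : diagHom α₁ β₁ h₁ ≫ χ' = χ i ≫ α := by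
      have hd : TDisplay.IsBaseChange (diagHom (a i) (b i) (h i)) :=
        .of_isStronglyCocartesian (diagHom_isStronglyCocartesian (h i) (ha i) (hb i))
      refine hd.hom_ext ?_ ?_
      · change s ≫ χ'.base = (χ i).base ≫ α.base
        rw [hχ, hχ', hα, Category.id_comp]
        exact Category.comp_id _
      · rw [← Category.assoc, diagHom_comp_diagHom (h i) h' rfl h₁ hα₁ hβ₁, e', ← Category.assoc, e]
    have f₂ : diagHom α₂ β₂ h₂ ≫ χ' = χ j ≫ β := by
      have hd : TDisplay.IsBaseChange (diagHom (a j) (b j) (h j)) :=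
        .of_isStronglyCocartesian (diagHom_isStronglyCocartesian (h j) (ha j) (hb j))
      refine hd.hom_ext ?_ ?_
      · change t ≫ χ'.base = (χ j).base ≫ β.base
        rw [hχ, hχ', hβ, Category.id_comp]
        exact Category.comp_id _
      · rw [← Category.assoc, diagHom_comp_diagHom (h j) h' est h₂ hα₂ hβ₂, e', ← Category.assoc, e, hkαβ]
    -- The compatibility of the `m i` survives the passage to diagonal form after cancelling the
    -- isomorphism `χ'`.
    have key : (m i ≫ inv (χ i)) ≫ diagHom α₁ β₁ h₁ = (m j ≫ inv (χ j)) ≫ diagHom α₂ β₂ h₂ := by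
      rw [← cancel_mono χ']
      simp only [Category.assoc, f₁, f₂, IsIso.inv_hom_id_assoc, hmαβ]
    refine ⟨O', α₁, β₁, α₂, β₂, ⟨est, fun y => (hα₁ y).trans (hα₂ y).symm,
      ha'.congr rfl fun y => (hα₁ y).symm⟩, ⟨est, fun y => (hβ₁ y).trans (hβ₂ y).symm,
      hb'.congr rfl fun y => (hβ₁ y).symm⟩, fun l => ?_, fun l => ?_, fun l => ?_, fun l => ?_⟩
    · exact (comp_diagHom_A _ h₁ l).symm.trans
        ((congrArg (fun q => q.mat.A l) key).trans (comp_diagHom_A _ h₂ l))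
    · exact (comp_diagHom_B _ h₁ l).symm.trans
        ((congrArg (fun q => q.mat.B l) key).trans (comp_diagHom_B _ h₂ l))
    · exact (comp_diagHom_C _ h₁ l).symm.trans
        ((congrArg (fun q => q.mat.C l) key).trans (comp_diagHom_C _ h₂ l))
    · exact (comp_diagHom_D _ h₁ l).symm.trans
        ((congrArg (fun q => q.mat.D l) key).trans (comp_diagHom_D _ h₂ l)))
  refine ⟨g, hg, fun i => ?_⟩
  rw [← e i, ← Category.assoc, hg', Category.assoc, IsIso.inv_hom_id, Category.comp_id]

/-- Morphisms into a display are determined locally. -/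
theorem EtaleCover.hom_ext {X : TDisplay.{u} p n} {Y : Display p n A}
    {Z : ∀ i, Display p n (U.B i)} (k : ∀ i, (⟨A, Y⟩ : TDisplay.{u} p n) ⟶ ⟨U.B i, Z i⟩)
    (hk : ∀ i, (k i).base = U.f i) (hk' : ∀ i, TDisplay.IsBaseChange (k i))
    {g g' : X ⟶ ⟨A, Y⟩} (h₀ : g.base = g'.base) (h : ∀ i, g ≫ k i = g' ≫ k i) : g = g' := by
  choose Z' a b ha hb h χ hχ hi e using fun i => (hk' i).exists_diag (hk i)
  have key : ∀ i, g ≫ diagHom (a i) (b i) (h i) = g' ≫ diagHom (a i) (b i) (h i) := fun i => by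
    rw [← cancel_mono (χ i), Category.assoc, Category.assoc, e]
    exact ‹∀ i, g ≫ k i = g' ≫ k i› i
  refine TDisplay.Hom.ext h₀ (DMatrix.heq_of_entries h₀ _ _ (fun l => U.module_ext ha fun i => ?_)
    (fun l => U.module_ext ha fun i => ?_) (fun l => U.tensorI_ext hb fun i => ?_)
    (fun l => U.module_ext hb fun i => ?_))
  · exact (comp_diagHom_A _ (h i) l).symm.trans
      ((congrArg (fun q => q.mat.A l) (key i)).trans (comp_diagHom_A _ (h i) l))
  · exact (comp_diagHom_B _ (h i) l).symm.trans
      ((congrArg (fun q => q.mat.B l) (key i)).trans (comp_diagHom_B _ (h i) l))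
  · exact (comp_diagHom_C _ (h i) l).symm.trans
      ((congrArg (fun q => q.mat.C l) (key i)).trans (comp_diagHom_C _ (h i) l))
  · exact (comp_diagHom_D _ (h i) l).symm.trans
      ((congrArg (fun q => q.mat.D l) (key i)).trans (comp_diagHom_D _ (h i) l))

end GlueHom

/-! ### Morphisms between standard displays -/

section StdFull

variable {p n c d : ℕ} [Fact p.Prime]

section

variable {R S E : Alg.{u} p}

theorem semilinear_eq_sum {f : R ⟶ S} {l : ℕ} {M : Type*} [AddCommGroup M] [Module (W p n S) M]
    (φ : (Fin l → W p n R) →ₛₗ[Wm n f] M) (x : Fin l → W p n R) :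
    φ x = ∑ j, Wm n f (x j) • φ (Pi.single j 1) := by
  conv_lhs => rw [pi_eq_sum_univ' x, map_sum]
  exact Finset.sum_congr rfl fun j _ => φ.map_smulₛₗ _ _

/-- A form of `stdHom_comp` in which the composite base and the product matrix may be any equal
expressions, which avoids rewriting inside dependent types. -/
theorem stdHom_comp' {f : R ⟶ S} {k : S ⟶ E} {l : R ⟶ E} {g : BlockMat p n c d S}
    {g' g'' : BlockMat p n c d E} {Ψ : GL (Fin c ⊕ Fin d) (W p n R)}
    {Ψ' : GL (Fin c ⊕ Fin d) (W p n S)} {Ψ'' : GL (Fin c ⊕ Fin d) (W p n E)} (h h' h'')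
    (hl : l = f ≫ k) (hg : g'' = g' * g.mapMat (k.hom : S →+* E)) :
    stdHom f g Ψ Ψ' h ≫ stdHom k g' Ψ' Ψ'' h' = stdHom l g'' Ψ Ψ'' h'' := by
  subst hl hg
  exact stdHom_comp f k g g' Ψ Ψ' Ψ'' h h' h''

theorem mulVecSemi_single (f : R ⟶ S) {k l : ℕ} (M : Matrix (Fin k) (Fin l) (W p n S)) (i j) :
    mulVecSemi f M (Pi.single j 1 : Fin l → W p n R) i = M i j := by
  have e : (fun i => Wm n f ((Pi.single j 1 : Fin l → W p n R) i)) = Pi.single j 1 :=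
    funext fun i => by rw [Pi.single_apply, Pi.single_apply]; split_ifs <;> simp
  have h : mulVecSemi f M (Pi.single j 1 : Fin l → W p n R) =
      M *ᵥ fun i => Wm n f ((Pi.single j 1 : Fin l → W p n R) i) := rfl
  rw [h, e, Matrix.mulVec_single_one]
  rfl

theorem stdMat_injective {f : R ⟶ S} {g g' : BlockMat p n c d S}
    {Ψ : GL (Fin c ⊕ Fin d) (W p n R)} {Ψ' : GL (Fin c ⊕ Fin d) (W p n S)}
    (h : stdMat f g Ψ Ψ' = stdMat f g' Ψ Ψ') : g = g' := by
  have hA : mulVecSemi f g.A = mulVecSemi f g'.A := congrArg DMatrix.A h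
  have hB : mulVecSemi f g.B = mulVecSemi f g'.B := congrArg DMatrix.B h
  have hD : mulVecSemi f g.D = mulVecSemi f g'.D := congrArg DMatrix.D h
  refine BlockMat.ext ?_ ?_ ?_ ?_ <;> ext1 i j
  · rw [← mulVecSemi_single f g.A, hA, mulVecSemi_single]
  · rw [← mulVecSemi_single f g.B, hB, mulVecSemi_single]
  · have hC : ∀ g₀ : BlockMat p n c d S,
        coordI d ((stdMat f g₀ Ψ Ψ').C (Pi.single j 1 : Fin c → W p n R)) i = g₀.C i j :=
      fun g₀ => by
        rw [coordI_stdMat_C, Finset.sum_eq_single j]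
        · rw [Pi.single_eq_same, map_one, one_smul]
        · intro b _ hb
          rw [Pi.single_eq_of_ne hb, map_zero, zero_smul]
        · simp
    rw [← hC g, ← hC g', h]
  · rw [← mulVecSemi_single f g.D, hD, mulVecSemi_single]

theorem coordI_sum {l : ℕ} (a : Fin l → W p n R)
    (v : Fin l → (Fin d → W p n R) ⊗[W p n R] I p n R) (i : Fin d) :
    coordI d (∑ j, a j • v j) i = ∑ j, a j • coordI d (v j) i := by
  have : (coordI d).toLinearMap (∑ j, a j • v j) = ∑ j, a j • (coordI d).toLinearMap (v j) := by
    rw [map_sum]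
    exact Finset.sum_congr rfl fun j _ => LinearMap.map_smul _ _ _
  refine (congrFun this i).trans ?_
  rw [Finset.sum_apply]
  rfl

theorem exists_eq_stdMat {f : R ⟶ S} {Ψ : GL (Fin c ⊕ Fin d) (W p n R)}
    {Ψ' : GL (Fin c ⊕ Fin d) (W p n S)} (m : DMatrix f (std Ψ) (std Ψ')) :
    ∃ g : BlockMat p n c d S, stdMat f g Ψ Ψ' = m := by
  let e (l : ℕ) (j : Fin l) : Fin l → W p n R := Pi.single j 1
  have col : ∀ {k l : ℕ} (φ : (Fin l → W p n R) →ₛₗ[Wm n f] (Fin k → W p n S)),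
      mulVecSemi f (Matrix.of fun i j => φ (e l j) i) = φ := fun φ => by
    refine LinearMap.ext fun x => ?_
    rw [semilinear_eq_sum φ x]
    funext i
    rw [Finset.sum_apply]
    change ∑ j, φ (e _ j) i * Wm n f (x j) = ∑ j, Wm n f (x j) * φ (e _ j) i
    exact Finset.sum_congr rfl fun j _ => mul_comm _ _
  refine ⟨⟨Matrix.of fun i j => m.A (e c j) i, Matrix.of fun i j => m.B (e d j) i,
    Matrix.of fun i j => coordI d (m.C (e c j)) i, Matrix.of fun i j => m.D (e d j) i⟩,
    DMatrix.ext (col m.A) (col m.B) (LinearMap.ext fun x => (coordI d).injective ?_) (col m.D)⟩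
  funext i
  refine (coordI_stdMat_C _ _ _ _ x i).trans ?_
  rw [semilinear_eq_sum m.C x, coordI_sum]
  rfl

/-- Compatibility with `F₁` alone forces the matrix identity, because `coordF₁` takes every standard
basis vector as a value. -/
theorem stdMat_equation {f : R ⟶ S} {g : BlockMat p n c d S} {Ψ : GL (Fin c ⊕ Fin d) (W p n R)}
    {Ψ' : GL (Fin c ⊕ Fin d) (W p n S)}
    (h : ∀ x, (stdMat f g Ψ Ψ').onP ((std Ψ).F₁ x) = (std Ψ').F₁ ((stdMat f g Ψ Ψ').onQ x)) :
    Ψ'.1 * g.σ₁Mat = g.toMat * Ψ.1.map (Wm n f) := by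
  have key : ∀ x, (Ψ'.1 * g.σ₁Mat) *ᵥ (fun i => Wm n f (coordF₁ x i)) =
      (g.toMat * Ψ.1.map (Wm n f)) *ᵥ (fun i => Wm n f (coordF₁ x i)) := fun x => by
    have hv : (fun i => Wm n f ((Ψ.1 *ᵥ coordF₁ x) i)) =
        Ψ.1.map (Wm n f) *ᵥ fun i => Wm n f (coordF₁ x i) := by
      funext i; exact RingHom.map_mulVec (Wm n f) _ _ i
    have h₁ := (congrArg _ (std_F₁ Ψ x)).symm.trans ((h x).trans (std_F₁ Ψ' _))
    have h₂ := (stdMat_onP f g Ψ Ψ' _).symm.trans h₁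
    rw [coordF₁_onQ, ← splitEquiv_symm, LinearEquiv.symm_apply_apply, hv, Matrix.mulVec_mulVec,
      Matrix.mulVec_mulVec] at h₂
    exact ((splitEquiv (W p n S) c d).injective h₂).symm
  have surj : ∀ j, ∃ x : (Fin c → W p n R) × ((Fin d → W p n R) ⊗[W p n R] I p n R),
      coordF₁ x = Pi.single j 1 := by
    rintro (j | j)
    · refine ⟨(Pi.single j 1, 0), ?_⟩
      funext i
      rcases i with i | i
      · change σ p n R ((Pi.single j 1 : Fin c → W p n R) i) =
          (Pi.single (Sum.inl j) 1 : Fin c ⊕ Fin d → W p n R) (Sum.inl i)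
        by_cases hij : i = j
        · subst hij; simp
        · simp [hij]
      · change σ₁ p n (coordI d 0 i) =
          (Pi.single (Sum.inl j) 1 : Fin c ⊕ Fin d → W p n R) (Sum.inr i)
        rw [LinearEquiv.map_zero, Pi.zero_apply, map_zero]
        simp
    -- The entry is `V(1)`, whose image under `σ₁` is `1`.
    · refine ⟨(0, (coordI d).symm (Pi.single j ((σ₁ p n).symm 1))), ?_⟩
      funext i
      rcases i with i | i
      · simp [coordF₁]
      · change σ₁ p n (coordI d ((coordI d).symm _) i) = _
        rw [LinearEquiv.apply_symm_apply]
        by_cases hij : i = j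
        · subst hij; simp
        · simp [hij]
  ext1 i j
  obtain ⟨x, hx⟩ := surj j
  have := congrFun (key x) i
  rw [hx, show (fun i => Wm n f ((Pi.single j 1 : _ → W p n R) i)) = Pi.single j 1 from
    funext fun i => by rw [Pi.single_apply, Pi.single_apply]; split_ifs <;> simp,
    Matrix.mulVec_single_one, Matrix.mulVec_single_one] at this
  exact this

theorem exists_eq_stdHom {f : R ⟶ S} {Ψ : GL (Fin c ⊕ Fin d) (W p n R)}
    {Ψ' : GL (Fin c ⊕ Fin d) (W p n S)} (m : (⟨R, std Ψ⟩ : TDisplay.{u} p n) ⟶ ⟨S, std Ψ'⟩)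
    (hm : m.base = f) : ∃ g h, stdHom f g Ψ Ψ' h = m := by
  obtain ⟨base, mat, cF, cF₁⟩ := m
  change base = f at hm
  subst hm
  obtain ⟨g, rfl⟩ := exists_eq_stdMat mat
  exact ⟨g, stdMat_equation cF₁, rfl⟩

theorem stdHom_injective {f : R ⟶ S} {g g' : BlockMat p n c d S}
    {Ψ : GL (Fin c ⊕ Fin d) (W p n R)} {Ψ' : GL (Fin c ⊕ Fin d) (W p n S)} {h h'}
    (e : stdHom f g Ψ Ψ' h = stdHom f g' Ψ Ψ' h') : g = g' :=
  stdMat_injective (eq_of_heq (TDisplay.Hom.ext_iff.1 e).2)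

/-- The matrix of the inverse morphism is the inverse block matrix, since composition is the matrix
product and a morphism determines its matrix. -/
theorem exists_unit_eq_stdHom {Ψ Ψ' : GL (Fin c ⊕ Fin d) (W p n S)}
    (m : (⟨S, std Ψ⟩ : TDisplay.{u} p n) ⟶ ⟨S, std Ψ'⟩) (hm : m.base = 𝟙 S) [IsIso m] :
    ∃ (g : (BlockMat p n c d S)ˣ) (h : _), stdHom (𝟙 S) g.1 Ψ Ψ' h = m := by
  have hm' : (inv m).base = 𝟙 S := by
    have := congrArg TDisplay.Hom.base (IsIso.hom_inv_id m)
    change m.base ≫ (inv m).base = 𝟙 S at this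
    rwa [hm, Category.id_comp] at this
  obtain ⟨g, h, hg⟩ := exists_eq_stdHom m hm
  obtain ⟨g', h', hg'⟩ := exists_eq_stdHom (inv m) hm'
  have id_map : ∀ M : Matrix (Fin c ⊕ Fin d) (Fin c ⊕ Fin d) (W p n S),
      M.map (Wm n (𝟙 S)) = M := fun M => by
    ext1 i j
    exact mapW_id p n (M i j)
  have h₁ : ∀ Ψ₀ : GL (Fin c ⊕ Fin d) (W p n S), Ψ₀.1 * (1 : BlockMat p n c d S).σ₁Mat =
      (1 : BlockMat p n c d S).toMat * Ψ₀.1.map (Wm n (𝟙 S)) := fun Ψ₀ => by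
    rw [id_map, BlockMat.σ₁Mat_one, BlockMat.toMat_one, one_mul, mul_one]
  have comp_eq : ∀ {Ψ₁ Ψ₂ : GL (Fin c ⊕ Fin d) (W p n S)} {a b : BlockMat p n c d S} {ha hb},
      stdHom (𝟙 S) a Ψ₁ Ψ₂ ha ≫ stdHom (𝟙 S) b Ψ₂ Ψ₁ hb = 𝟙 _ → b * a = 1 := by
    intro Ψ₁ Ψ₂ a b ha hb e
    have hc : b * a = b * a.mapMat ((𝟙 S : S ⟶ S).hom : S →+* S) :=
      congrArg (b * ·) (BlockMat.mapMat_id a).symm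
    have hba : Ψ₁.1 * (b * a).σ₁Mat = (b * a).toMat * Ψ₁.1.map (Wm n (𝟙 S)) := by
      rw [id_map] at ha hb ⊢
      rw [BlockMat.σ₁Mat_mul, BlockMat.toMat_mul, ← mul_assoc, hb, mul_assoc, ha, mul_assoc]
    rw [stdHom_comp' ha hb hba (Category.comp_id _).symm hc, ← stdHom_one Ψ₁ (h₁ Ψ₁)] at e
    exact stdHom_injective e
  exact ⟨⟨g, g', comp_eq (ha := h') (hb := h) (by rw [hg, hg', IsIso.inv_hom_id]),
    comp_eq (ha := h) (hb := h') (by rw [hg, hg', IsIso.hom_inv_id])⟩, h, hg⟩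

end

end StdFull

/-! ### Trivializations of a display -/

section Trivialization

variable {p n c d : ℕ} [Fact p.Prime]

variable (c d) in
/-- A trivialization over `A` of the truncated display `X`: a base change of `X` to a display given
by a matrix over `W_n(A)`. -/
structure Trivialization (X : TDisplay.{u} p n) (A : Alg.{u} p) where
  /-- The matrix. -/
  Ψ : GL (Fin c ⊕ Fin d) (W p n A)
  /-- The base change. -/
  m : X ⟶ ⟨A, std Ψ⟩
  isBaseChange : TDisplay.IsBaseChange m

theorem stdHom_base {R S : Alg.{u} p} {f : R ⟶ S} {g : BlockMat p n c d S}
    {Ψ : GL (Fin c ⊕ Fin d) (W p n R)} {Ψ' : GL (Fin c ⊕ Fin d) (W p n S)} (h) :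
    (stdHom f g Ψ Ψ' h).base = f := rfl

theorem stdHom_isBaseChange {R S : Alg.{u} p} {f : R ⟶ S} (g : (BlockMat p n c d S)ˣ)
    {Ψ : GL (Fin c ⊕ Fin d) (W p n R)} {Ψ' : GL (Fin c ⊕ Fin d) (W p n S)} (h) :
    TDisplay.IsBaseChange (stdHom f g.1 Ψ Ψ' h) :=
  .of_isStronglyCocartesian (stdHom_isStronglyCocartesian f g Ψ Ψ' h)

/-- The condition that `g` defines a morphism of displays from `Ψ` to `Ψ'`. -/
abbrev IsStdHom {R S : Alg.{u} p} (f : R ⟶ S) (g : BlockMat p n c d S)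
    (Ψ : GL (Fin c ⊕ Fin d) (W p n R)) (Ψ' : GL (Fin c ⊕ Fin d) (W p n S)) : Prop :=
  Ψ'.1 * g.σ₁Mat = g.toMat * Ψ.1.map (Wm n f)

namespace IsStdHom

variable {R S E : Alg.{u} p} {f : R ⟶ S} {k : S ⟶ E} {l : R ⟶ E}

theorem comp {g : BlockMat p n c d S} {g' : BlockMat p n c d E} {Ψ : GL (Fin c ⊕ Fin d) (W p n R)}
    {Ψ' : GL (Fin c ⊕ Fin d) (W p n S)} {Ψ'' : GL (Fin c ⊕ Fin d) (W p n E)}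
    (h : IsStdHom f g Ψ Ψ') (h' : IsStdHom k g' Ψ' Ψ'') (hl : l = f ≫ k) :
    IsStdHom l (g' * g.mapMat (k.hom : S →+* E)) Ψ Ψ'' := by
  subst hl
  have h₁ : (Ψ'.1.map (Wm n k)) * (g.mapMat (k.hom : S →+* E)).σ₁Mat =
      (g.mapMat (k.hom : S →+* E)).toMat * Ψ.1.map (Wm n (f ≫ k)) := by
    have := congrArg (fun M => M.map (Wm n k)) h
    rw [Matrix.map_mul, Matrix.map_mul] at this
    rw [BlockMat.σ₁Mat_mapMat, BlockMat.toMat_mapMat]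
    refine this.trans (congrArg (fun M => g.toMat.map (Wm n k) * M) ?_)
    ext1 i j
    exact (mapW_comp p n _ _ _).symm
  rw [IsStdHom, BlockMat.σ₁Mat_mul, BlockMat.toMat_mul, ← mul_assoc, h', mul_assoc, h₁, mul_assoc]

/-- `σ₁(g)` is invertible, so the target matrix is determined by `g` and the source matrix. -/
theorem eq {g : (BlockMat p n c d S)ˣ} {Ψ : GL (Fin c ⊕ Fin d) (W p n R)}
    {Ψ' Ψ'' : GL (Fin c ⊕ Fin d) (W p n S)} (h : IsStdHom f g.1 Ψ Ψ')
    (h' : IsStdHom f g.1 Ψ Ψ'') : Ψ' = Ψ'' := by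
  have e : Ψ'.1 * g.1.σ₁Mat = Ψ''.1 * g.1.σ₁Mat := h.trans h'.symm
  have u : IsUnit (BlockMat.σ₁MatHom g.1) := g.isUnit.map BlockMat.σ₁MatHom
  exact Units.ext (u.mul_right_cancel e)

theorem map (f : R ⟶ S) (Ψ : GL (Fin c ⊕ Fin d) (W p n R)) :
    IsStdHom f (1 : (BlockMat p n c d S)ˣ).1 Ψ (Matrix.GeneralLinearGroup.map (Wm n f) Ψ) := by
  rw [Units.val_one, IsStdHom, BlockMat.σ₁Mat_one, BlockMat.toMat_one, mul_one, one_mul]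
  rfl

theorem one (Ψ : GL (Fin c ⊕ Fin d) (W p n R)) : IsStdHom (𝟙 R) (1 : (BlockMat p n c d R)ˣ).1 Ψ Ψ := by
  rw [Units.val_one, IsStdHom, BlockMat.σ₁Mat_one, BlockMat.toMat_one, mul_one, one_mul]
  ext1 i j
  exact (mapW_id p n _).symm

theorem smul (g : (displayGSpace.{u} p n c d).G.obj R) (Ψ : (displayGSpace.{u} p n c d).X.obj R) :
    IsStdHom (𝟙 R) (Units.val (α := BlockMat p n c d R) g) Ψ (g • Ψ) :=
  displayGSpace_hom_eq (y := ⟨R, g • Ψ⟩) (x := ⟨R, Ψ⟩)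
    { base := 𝟙 R
      g := g
      smul_eq := by rw [Functor.map_id_apply] } g rfl Ψ _ rfl rfl

end IsStdHom

namespace Trivialization

variable {X : TDisplay.{u} p n} {A B E : Alg.{u} p}

/-- The base ring homomorphism. -/
def base (x : Trivialization c d X A) : X.R ⟶ A := x.m.base

/-- The trivialization obtained from a given one by a change of base and of coordinates. -/
noncomputable def move (x : Trivialization c d X A) (f : A ⟶ B) (g : (BlockMat p n c d B)ˣ)
    (Ψ' : GL (Fin c ⊕ Fin d) (W p n B)) (h : IsStdHom f g.1 x.Ψ Ψ') : Trivialization c d X B where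
  Ψ := Ψ'
  m := x.m ≫ stdHom f g.1 x.Ψ Ψ' h
  isBaseChange := x.isBaseChange.comp (stdHom_isBaseChange g h)

theorem move_congr (x : Trivialization c d X A) {f f' : A ⟶ B} {g g' : (BlockMat p n c d B)ˣ}
    {Ψ₁ Ψ₂ : GL (Fin c ⊕ Fin d) (W p n B)} (h₁ : IsStdHom f g.1 x.Ψ Ψ₁)
    (h₂ : IsStdHom f' g'.1 x.Ψ Ψ₂) (hf : f = f') (hg : g = g') :
    x.move f g Ψ₁ h₁ = x.move f' g' Ψ₂ h₂ := by
  subst hf hg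
  obtain rfl := h₁.eq h₂
  rfl

theorem move_move (x : Trivialization c d X A) {f : A ⟶ B} {f' : B ⟶ E} {f'' : A ⟶ E}
    {g : (BlockMat p n c d B)ˣ} {g' g'' : (BlockMat p n c d E)ˣ}
    {Ψ₁ : GL (Fin c ⊕ Fin d) (W p n B)} {Ψ₂ Ψ₃ : GL (Fin c ⊕ Fin d) (W p n E)}
    (h₁ : IsStdHom f g.1 x.Ψ Ψ₁) (h₂ : IsStdHom f' g'.1 Ψ₁ Ψ₂) (h₃ : IsStdHom f'' g''.1 x.Ψ Ψ₃)
    (hf : f'' = f ≫ f') (hg : g''.1 = g'.1 * g.1.mapMat (f'.hom : B →+* E)) :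
    (x.move f g Ψ₁ h₁).move f' g' Ψ₂ h₂ = x.move f'' g'' Ψ₃ h₃ := by
  have h₄ : IsStdHom f'' g''.1 x.Ψ Ψ₂ := hg ▸ h₁.comp h₂ hf
  obtain rfl := h₃.eq h₄
  have e : stdHom f g.1 x.Ψ Ψ₁ h₁ ≫ stdHom f' g'.1 Ψ₁ Ψ₃ h₂ = stdHom f'' g''.1 x.Ψ Ψ₃ h₃ :=
    stdHom_comp' _ _ _ hf hg
  simp only [move, Category.assoc, e]

theorem move_one (x : Trivialization c d X A) (h) : x.move (𝟙 A) 1 x.Ψ h = x := by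
  have e : stdHom (𝟙 A) (1 : (BlockMat p n c d A)ˣ).1 x.Ψ x.Ψ h = 𝟙 _ := stdHom_one x.Ψ h
  simp only [move, e, Category.comp_id]

theorem eq_of_move {x : Trivialization c d X A} {y : Trivialization c d X B} {f : A ⟶ E}
    {f' : B ⟶ E} {g g' : (BlockMat p n c d E)ˣ} {Ψ₁ Ψ₂ : GL (Fin c ⊕ Fin d) (W p n E)}
    {h₁ : IsStdHom f g.1 x.Ψ Ψ₁} {h₂ : IsStdHom f' g'.1 y.Ψ Ψ₂}
    (e : x.move f g Ψ₁ h₁ = y.move f' g' Ψ₂ h₂) : ∃ h₂' : IsStdHom f' g'.1 y.Ψ Ψ₁,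
      x.m ≫ stdHom f g.1 x.Ψ Ψ₁ h₁ = y.m ≫ stdHom f' g'.1 y.Ψ Ψ₁ h₂' := by
  have hΨ : Ψ₁ = Ψ₂ := congrArg Trivialization.Ψ e
  subst hΨ
  refine ⟨h₂, ?_⟩
  simp only [move, mk.injEq, heq_eq_eq, true_and] at e
  exact e

theorem move_eq {x : Trivialization c d X A} {y : Trivialization c d X B} {f : A ⟶ B}
    {g : (BlockMat p n c d B)ˣ} (h : IsStdHom f g.1 x.Ψ y.Ψ)
    (e : x.m ≫ stdHom f g.1 x.Ψ y.Ψ h = y.m) : x.move f g y.Ψ h = y := by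
  simp only [move, e]

theorem mul_mapMat_one (g : BlockMat p n c d B) (f : A ⟶ B) :
    g = g * (1 : (BlockMat p n c d A)ˣ).1.mapMat (f.hom : A →+* B) := by
  have h : (1 : BlockMat p n c d A).mapMat (f.hom : A →+* B) = 1 :=
    map_one (BlockMat.mapMatHom (f.hom : A →+* B))
  rw [Units.val_one, h, mul_one]

theorem isBaseChange_comp_stdHom (x : Trivialization c d X A) {f : A ⟶ B}
    {g : (BlockMat p n c d B)ˣ} {Ψ' : GL (Fin c ⊕ Fin d) (W p n B)} (h : IsStdHom f g.1 x.Ψ Ψ') :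
    TDisplay.IsBaseChange (x.m ≫ stdHom f g.1 x.Ψ Ψ' h) :=
  x.isBaseChange.comp (stdHom_isBaseChange g h)

theorem base_comp_stdHom (x : Trivialization c d X A) {f : A ⟶ B}
    {g : (BlockMat p n c d B)ˣ} {Ψ' : GL (Fin c ⊕ Fin d) (W p n B)} (h : IsStdHom f g.1 x.Ψ Ψ') :
    (x.m ≫ stdHom f g.1 x.Ψ Ψ' h).base = x.base ≫ f := rfl

/-- The base change of `x` along `f` and `y` are two base changes of `X` to the same ring, so they
differ by an isomorphism over the identity. Such an isomorphism is given by an invertible block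
matrix. -/
theorem exists_isStdHom (x : Trivialization c d X A) (y : Trivialization c d X B) {f : A ⟶ B}
    (hf : y.base = x.base ≫ f) :
    ∃ (g : (BlockMat p n c d B)ˣ) (h : IsStdHom f g.1 x.Ψ y.Ψ),
      x.m ≫ stdHom f g.1 x.Ψ y.Ψ h = y.m := by
  obtain ⟨Ψ₁, h₁⟩ : ∃ Ψ₁, IsStdHom f (1 : (BlockMat p n c d B)ˣ).1 x.Ψ Ψ₁ :=
    ⟨_, IsStdHom.map f x.Ψ⟩
  have hd := x.isBaseChange_comp_stdHom h₁
  have hb : y.m.base = (x.m ≫ stdHom f (1 : (BlockMat p n c d B)ˣ).1 x.Ψ Ψ₁ h₁).base ≫ 𝟙 B := by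
    rw [base_comp_stdHom]
    exact hf.trans (Category.comp_id (x.base ≫ f)).symm
  obtain ⟨χ, ⟨hχ, e⟩, -⟩ := hd.existsUnique y.m (𝟙 B) hb
  have hχ' : TDisplay.IsBaseChange χ := hd.of_comp (by
    rw [e]; exact y.isBaseChange)
  have := hχ'.isIso hχ
  obtain ⟨g, h, rfl⟩ := exists_unit_eq_stdHom χ hχ
  have hg := mul_mapMat_one g.1 (𝟙 B)
  have h' : IsStdHom f (g.1 * (1 : (BlockMat p n c d B)ˣ).1.mapMat ((𝟙 B : B ⟶ B).hom : B →+* B))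
      x.Ψ y.Ψ := h₁.comp h (Category.comp_id f).symm
  rw [← hg] at h'
  refine ⟨g, h', ?_⟩
  rw [← e, Category.assoc, stdHom_comp' h₁ h h' (Category.comp_id f).symm hg]

theorem isStdHom_unique (x : Trivialization c d X A) (y : Trivialization c d X B) {f : A ⟶ B}
    {g g' : (BlockMat p n c d B)ˣ} {h : IsStdHom f g.1 x.Ψ y.Ψ} {h' : IsStdHom f g'.1 x.Ψ y.Ψ}
    (e : x.move f g y.Ψ h = y) (e' : x.move f g' y.Ψ h' = y) : g = g' := by
  obtain ⟨h₃, e₃⟩ := eq_of_move (e.trans e'.symm)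
  exact Units.ext (stdHom_injective (x.isBaseChange.hom_ext
    ((stdHom_base h).trans (stdHom_base h₃).symm) e₃))

theorem existsUnique_move (x : Trivialization c d X A) (y : Trivialization c d X B) {f : A ⟶ B}
    (hf : y.base = x.base ≫ f) :
    ∃! g : (BlockMat p n c d B)ˣ, ∃ h : IsStdHom f g.1 x.Ψ y.Ψ, x.move f g y.Ψ h = y := by
  obtain ⟨g, h, e⟩ := exists_isStdHom x y hf
  refine ⟨g, ⟨h, move_eq h e⟩, ?_⟩
  rintro g₁ ⟨h₁, e₁⟩
  exact isStdHom_unique x y e₁ (move_eq h e)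

end Trivialization

end Trivialization

/-! ### The torsor of trivializations of a display -/

section Torsor

variable {p n c d : ℕ} [Fact p.Prime] [NeZero n]

-- Ring homomorphisms out of `R` are the second components of the trivial torsor `G × Spec R`, which
-- is already known to be a sheaf. The group component and the matrix are taken to be `1`.
omit [NeZero n] in
theorem EtaleCover.exists_glue_base (p n c d : ℕ) [Fact p.Prime] {R A : Alg.{u} p}
    (U : EtaleCover A) (k : ∀ i, R ⟶ U.B i)
    (hk : ∀ (i j : U.ι) (E : Alg.{u} p) (a : U.B i ⟶ E) (b : U.B j ⟶ E),
      U.f i ≫ a = U.f j ≫ b → k i ≫ a = k j ≫ b) :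
    ∃ f : R ⟶ A, ∀ i, f ≫ U.f i = k i := by
  obtain ⟨y, hy, -⟩ := (PrequotientObj.trivialTorsor (𝒢 := displayGSpace p n c d)
    (isEtaleSheaf_Gfun p n c d) ⟨R, (1 : GL (Fin c ⊕ Fin d) (W p n R))⟩).isSheaf A U
    (fun i => (1, k i)) fun i j E a b h => Prod.ext
      ((map_one ((displayGSpace p n c d).G.map a).hom).trans
        (map_one ((displayGSpace p n c d).G.map b).hom).symm) (hk i j E a b h)
  exact ⟨y.2, fun i => congrArg Prod.snd (hy i)⟩

omit [NeZero n] in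
theorem EtaleCover.base_ext {R A : Alg.{u} p} (U : EtaleCover A) {f f' : R ⟶ A}
    (h : ∀ i, f ≫ U.f i = f' ≫ U.f i) : f = f' := by
  ext r
  exact separated_glue U fun i => congrArg (fun q : R ⟶ U.B i => q r) (h i)

omit [NeZero n] in
theorem EtaleCover.GL_ext {A : Alg.{u} p} (U : EtaleCover A) {Ψ Ψ' : GL (Fin c ⊕ Fin d) (W p n A)}
    (h : ∀ i, Matrix.GeneralLinearGroup.map (Wm n (U.f i)) Ψ =
      Matrix.GeneralLinearGroup.map (Wm n (U.f i)) Ψ') : Ψ = Ψ' := by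
  refine Units.ext ?_
  ext1 k l
  exact separated_W U fun i => congrFun (congrFun (congrArg (fun q : GL (Fin c ⊕ Fin d) _ => q.1) (h i)) k) l

omit [NeZero n] in
theorem EtaleCover.exists_glue_GL {A : Alg.{u} p} (U : EtaleCover A)
    (Ψ : ∀ i, GL (Fin c ⊕ Fin d) (W p n (U.B i)))
    (h : ∀ (i j : U.ι) (E : Alg.{u} p) (a : U.B i ⟶ E) (b : U.B j ⟶ E),
      U.f i ≫ a = U.f j ≫ b → Matrix.GeneralLinearGroup.map (Wm n a) (Ψ i) =
        Matrix.GeneralLinearGroup.map (Wm n b) (Ψ j)) :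
    ∃ Ψ₀ : GL (Fin c ⊕ Fin d) (W p n A),
      ∀ i, Matrix.GeneralLinearGroup.map (Wm n (U.f i)) Ψ₀ = Ψ i := by
  choose y hy using fun k l => glue_W U (fun i => (Ψ i).1 k l) (fun i j E a b e =>
    congrFun (congrFun (congrArg (fun q : GL (Fin c ⊕ Fin d) _ => q.1) (h i j E a b e)) k) l)
  let N (i : U.ι) : Matrix (Fin c ⊕ Fin d) (Fin c ⊕ Fin d) (W p n (U.B i)) := (Ψ i)⁻¹.1
  choose z hz using fun k l => glue_W U (fun i => N i k l) (fun i j E a b e => by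
    have := congrArg (fun q => q⁻¹) (h i j E a b e)
    simp only [← map_inv] at this
    exact congrFun (congrFun (congrArg (fun q : GL (Fin c ⊕ Fin d) _ => q.1) this) k) l)
  have ext : ∀ M N : Matrix (Fin c ⊕ Fin d) (Fin c ⊕ Fin d) (W p n A),
      (∀ i, M.map (Wm n (U.f i)) = N.map (Wm n (U.f i))) → M = N := fun M N e => by
    ext1 k l
    exact separated_W U fun i => congrFun (congrFun (e i) k) l
  have hy' : ∀ i, (Matrix.of y).map (Wm n (U.f i)) = (Ψ i).1 := fun i => by
    ext1 k l
    exact hy k l i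
  have hz' : ∀ i, (Matrix.of z).map (Wm n (U.f i)) = N i := fun i => by
    ext1 k l
    exact hz k l i
  refine ⟨⟨Matrix.of y, Matrix.of z, ext _ _ fun i => ?_, ext _ _ fun i => ?_⟩,
    fun i => Units.ext (hy' i)⟩
  · rw [Matrix.map_mul, hy', hz', Matrix.map_one _ (map_zero _) (map_one _)]
    exact (Ψ i).mul_inv
  · rw [Matrix.map_mul, hy', hz', Matrix.map_one _ (map_zero _) (map_one _)]
    exact (Ψ i).inv_mul

namespace Trivialization

variable {X : TDisplay.{u} p n} {A B E : Alg.{u} p}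

/-- Base change of a trivialization. -/
noncomputable def map (f : A ⟶ B) (x : Trivialization c d X A) : Trivialization c d X B :=
  x.move f 1 _ (IsStdHom.map f x.Ψ)

omit [NeZero n] in
theorem base_map (f : A ⟶ B) (x : Trivialization c d X A) : (x.map f).base = x.base ≫ f := rfl

omit [NeZero n] in
theorem map_id (x : Trivialization c d X A) : x.map (𝟙 A) = x :=
  (move_congr x (IsStdHom.map (𝟙 A) x.Ψ) (IsStdHom.one x.Ψ) rfl rfl).trans (move_one x _)

omit [NeZero n] in
theorem map_comp (f : A ⟶ B) (g : B ⟶ E) (x : Trivialization c d X A) :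
    x.map (f ≫ g) = (x.map f).map g :=
  (move_move x (IsStdHom.map f x.Ψ) (IsStdHom.map g _) (IsStdHom.map (f ≫ g) x.Ψ) rfl
    (mul_mapMat_one _ _)).symm

variable (c d X) in
/-- The presheaf of trivializations. -/
noncomputable def presheaf : Alg.{u} p ⥤ Type u where
  obj A := Trivialization c d X A
  map f := TypeCat.ofHom (map f)
  map_id A := by
    refine ConcreteCategory.hom_ext _ _ fun x => ?_
    exact map_id x
  map_comp f g := by
    refine ConcreteCategory.hom_ext _ _ fun x => ?_
    exact map_comp f g x

-- The type of the morphism depends on the matrix, so a trivialization is rebuilt over an equal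
-- matrix before morphisms are compared.
omit [NeZero n] in
theorem eq_of_Ψ_eq {x : Trivialization c d X A} {Ψ : GL (Fin c ⊕ Fin d) (W p n A)}
    (h : x.Ψ = Ψ) : ∃ (m : X ⟶ ⟨A, std Ψ⟩) (hm : TDisplay.IsBaseChange m), x = ⟨Ψ, m, hm⟩ := by
  subst h
  exact ⟨x.m, x.isBaseChange, rfl⟩

omit [NeZero n] in
theorem map_mk {Ψ : GL (Fin c ⊕ Fin d) (W p n A)} {m : X ⟶ ⟨A, std Ψ⟩} {hm} {f : A ⟶ B}
    {m' : X ⟶ ⟨B, std (Matrix.GeneralLinearGroup.map (Wm n f) Ψ)⟩} {hm'}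
    (e : m ≫ stdHom f (1 : (BlockMat p n c d B)ˣ).1 Ψ _ (IsStdHom.map f Ψ) = m') :
    (⟨Ψ, m, hm⟩ : Trivialization c d X A).map f = ⟨_, m', hm'⟩ := by
  subst e
  rfl

omit [NeZero n] in
theorem map_injective (U : EtaleCover A) {x y : Trivialization c d X A}
    (h : ∀ i, x.map (U.f i) = y.map (U.f i)) : x = y := by
  have hb : x.base = y.base := U.base_ext fun i => congrArg base (h i)
  have hΨ : x.Ψ = y.Ψ := U.GL_ext fun i => congrArg Trivialization.Ψ (h i)
  obtain ⟨Ψ, m, hm⟩ := x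
  obtain ⟨Ψ', m', hm'⟩ := y
  change Ψ = Ψ' at hΨ
  subst hΨ
  have e : m = m' := by
    refine U.hom_ext (fun i => stdHom (U.f i) (1 : (BlockMat p n c d (U.B i))ˣ).1 Ψ _
      (IsStdHom.map (U.f i) Ψ)) (fun i => stdHom_base _) (fun i => stdHom_isBaseChange 1 _) hb
      fun i => ?_
    obtain ⟨_, e⟩ := eq_of_move (h i)
    exact e
  subst e
  rfl

/-- The base homomorphism, the matrix and the morphism glue in turn, and the glued morphism is a
base change because this is local on the cover. -/
theorem exists_glue (U : EtaleCover A) (x : ∀ i, Trivialization c d X (U.B i))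
    (hx : ∀ (i j : U.ι) (E : Alg.{u} p) (a : U.B i ⟶ E) (b : U.B j ⟶ E),
      U.f i ≫ a = U.f j ≫ b → (x i).map a = (x j).map b) :
    ∃ y : Trivialization c d X A, ∀ i, y.map (U.f i) = x i := by
  obtain ⟨f, hf⟩ := U.exists_glue_base p n c d (fun i => (x i).base)
    fun i j E a b h => congrArg base (hx i j E a b h)
  obtain ⟨Ψ, hΨ⟩ := U.exists_glue_GL (fun i => (x i).Ψ)
    fun i j E a b h => congrArg Trivialization.Ψ (hx i j E a b h)
  choose m hm e using fun i => eq_of_Ψ_eq (hΨ i).symm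
  obtain rfl : x = fun i => ⟨_, m i, hm i⟩ := funext e
  obtain ⟨k, hkd⟩ : ∃ k : ∀ i, (⟨A, std Ψ⟩ : TDisplay.{u} p n) ⟶ ⟨U.B i, std _⟩, ∀ i,
      k i = stdHom (U.f i) (1 : (BlockMat p n c d (U.B i))ˣ).1 Ψ _ (IsStdHom.map (U.f i) Ψ) :=
    ⟨_, fun i => rfl⟩
  have hk : ∀ i, TDisplay.IsBaseChange (k i) := fun i => hkd i ▸ stdHom_isBaseChange 1 _
  have hkb : ∀ i, (k i).base = U.f i := fun i => by rw [hkd, stdHom_base]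
  obtain ⟨g, hg, hg'⟩ := U.exists_glue_hom f k hkb hk m
    (fun i => (hf i).symm) (fun i j E s t est => by
      obtain ⟨h', e'⟩ := eq_of_move (hx i j E s t est)
      -- Both ways of restricting to the overlap are the morphism with matrix `1` along the common
      -- composite.
      have h₀ : IsStdHom (U.f i ≫ s) (1 : (BlockMat p n c d E)ˣ).1 Ψ
          (Matrix.GeneralLinearGroup.map (Wm n s)
            (Matrix.GeneralLinearGroup.map (Wm n (U.f i)) Ψ)) := by
        have := (IsStdHom.map (U.f i) Ψ).comp (IsStdHom.map s
          (Matrix.GeneralLinearGroup.map (Wm n (U.f i)) Ψ)) rfl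
        rwa [← mul_mapMat_one] at this
      refine ⟨std _, stdHom s (1 : (BlockMat p n c d E)ˣ).1 _ _ (IsStdHom.map s _),
        stdHom t (1 : (BlockMat p n c d E)ˣ).1 _ _ h', stdHom_base _, stdHom_base _,
        (hk i).comp (stdHom_isBaseChange 1 _), ?_, e'⟩
      rw [hkd, hkd, stdHom_comp' (IsStdHom.map (U.f i) Ψ) (IsStdHom.map s _) h₀ rfl (mul_mapMat_one _ _),
        stdHom_comp' (IsStdHom.map (U.f j) Ψ) h' h₀ est (mul_mapMat_one _ _)])
  refine ⟨⟨Ψ, g, .of_cover U g _ k hkb hk fun i => ?_⟩, fun i => ?_⟩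
  · rw [hg']
    exact hm i
  · refine map_mk ?_
    rw [← hkd, hg']

theorem presheaf_isEtaleSheaf : IsEtaleSheaf (presheaf c d X) := by
  intro A U (x : ∀ i, Trivialization c d X (U.B i)) hx
  obtain ⟨y, hy⟩ := exists_glue U x hx
  refine ⟨y, hy, fun (z : Trivialization c d X A) hz => map_injective U fun i => ?_⟩
  exact (hz i).trans (hy i).symm

end Trivialization

end Torsor

/-! ### Pullback of étale covers -/

section CoverPullback

/-- The fibre over `𝔮` is the residue field tensored with the faithfully flat product, hence
nonzero. So one of its finitely many factors is nonzero, and a maximal ideal of it gives the point.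
-/
theorem exists_mem_range_comap_includeLeft {R A : Type u} [CommRing R] [CommRing A] [Algebra R A]
    {ι : Type} [Finite ι] (B : ι → Type u) [∀ i, CommRing (B i)] [∀ i, Algebra R (B i)]
    [Module.FaithfullyFlat R (∀ i, B i)] (𝔮 : PrimeSpectrum A) :
    ∃ i, 𝔮 ∈ Set.range (PrimeSpectrum.comap
      (Algebra.TensorProduct.includeLeftRingHom : A →+* A ⊗[R] B i)) := by
  classical
  have := Fintype.ofFinite ι
  let k := 𝔮.asIdeal.ResidueField
  have h₁ : Nontrivial (k ⊗[R] (∀ i, B i)) := Module.FaithfullyFlat.rTensor_nontrivial R _ k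
  have h₂ : Nontrivial (∀ i, k ⊗[R] B i) :=
    (TensorProduct.piRight R R k B).symm.toEquiv.nontrivial
  obtain ⟨i, hi⟩ : ∃ i, Nontrivial (k ⊗[R] B i) := by
    by_contra! h
    exact not_subsingleton (∀ i, k ⊗[R] B i) inferInstance
  obtain ⟨m, hm⟩ := Ideal.exists_maximal (k ⊗[R] B i)
  let φ : A ⊗[R] B i →ₐ[R] k ⊗[R] B i :=
    Algebra.TensorProduct.map (IsScalarTower.toAlgHom R A k) (AlgHom.id R (B i))
  refine ⟨i, PrimeSpectrum.comap φ.toRingHom ⟨m, hm.isPrime⟩, ?_⟩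
  have e : φ.toRingHom.comp (Algebra.TensorProduct.includeLeftRingHom : A →+* A ⊗[R] B i) =
      (Algebra.TensorProduct.includeLeftRingHom : k →+* k ⊗[R] B i).comp (algebraMap A k) := by
    ext a
    simp [φ]
  rw [← PrimeSpectrum.comap_comp_apply, e, PrimeSpectrum.comap_comp_apply]
  have key : ∀ x : PrimeSpectrum k, PrimeSpectrum.comap (algebraMap A k) x = 𝔮 := fun x => by
    have hx : x.asIdeal = RingHom.ker (RingHom.id k) := by
      have := x.2
      rw [Ideal.eq_bot_of_prime x.asIdeal]
      exact ((RingHom.injective_iff_ker_eq_bot _).1 Function.injective_id).symm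
    ext a
    rw [PrimeSpectrum.comap_asIdeal, hx, Ideal.mem_comap, RingHom.mem_ker, RingHom.id_apply,
      Ideal.algebraMap_residueField_eq_zero]
  exact key _

namespace EtaleCover

variable {p : ℕ} [Fact p.Prime] {R A : Alg.{u} p} (U : EtaleCover R) (a : R ⟶ A)

theorem exists_pullback :
    ∃ V : EtaleCover A, ∀ i, ∃ (j : U.ι) (t : U.B j ⟶ V.B i), a ≫ V.f i = U.f j ≫ t := by
  let _ (i : U.ι) : Algebra R (U.B i) := ((U.f i).hom : R →+* U.B i).toAlgebra
  let _ : Algebra R A := (a.hom : R →+* A).toAlgebra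
  have (i : U.ι) : Algebra.Etale R (U.B i) := U.etale i
  have : Module.FaithfullyFlat R (∀ i, U.B i) := U.faithfullyFlat
  have : IsScalarTower (ZMod p) R A :=
    IsScalarTower.of_algebraMap_eq fun r => (a.hom.commutes r).symm
  have (i : U.ι) : IsScalarTower (ZMod p) R (U.B i) :=
    IsScalarTower.of_algebraMap_eq fun r => ((U.f i).hom.commutes r).symm
  refine ⟨⟨U.ι, fun i => CommAlgCat.of (ZMod p) (A ⊗[R] U.B i), fun i => CommAlgCat.ofHom
    (Algebra.TensorProduct.includeLeft (R := R) (S := ZMod p)), fun i => ?_,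
    fun 𝔮 => exists_mem_range_comap_includeLeft _ 𝔮⟩,
    fun i => ⟨i, CommAlgCat.ofHom
      ((Algebra.TensorProduct.includeRight (R := R)).restrictScalars (ZMod p)), ?_⟩⟩
  · have : Algebra.Etale A (A ⊗[R] U.B i) := inferInstance
    exact (RingHom.etale_algebraMap (R := A) (S := A ⊗[R] U.B i)).2 this
  · ext r
    exact ((Algebra.TensorProduct.includeLeft (R := R) (S := R) (A := A)
            (B := U.B i)).commutes r).trans ((Algebra.TensorProduct.includeRight (R := R)
            (A := A) (B := U.B i)).commutes r).symm

end EtaleCover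

end CoverPullback

/-! ### The group action on trivializations, and full faithfulness for the torsors. -/

section TorsorObject

variable {p n c d : ℕ} [Fact p.Prime]

namespace Trivialization

variable {X Y Z : TDisplay.{u} p n} {A B E : Alg.{u} p}

/-- The action of `g` on matrices. -/
noncomputable abbrev actΨ (g : (displayGSpace.{u} p n c d).G.obj A)
    (Ψ : (displayGSpace.{u} p n c d).X.obj A) : GL (Fin c ⊕ Fin d) (W p n A) := g • Ψ

noncomputable instance : MulAction ((displayGSpace.{u} p n c d).G.obj A) (Trivialization c d X A) where
  smul g x := x.move (𝟙 A) g (actΨ g x.Ψ)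
    (IsStdHom.smul g x.Ψ)
  one_smul x := (move_congr x (IsStdHom.smul 1 x.Ψ) (IsStdHom.one x.Ψ) rfl rfl).trans
    (move_one x _)
  mul_smul g g' x := by
    refine (move_move x (IsStdHom.smul g' x.Ψ) (IsStdHom.smul g _) (IsStdHom.smul (g * g') x.Ψ)
      (Category.comp_id _).symm ?_).symm
    exact congrArg (fun q : BlockMat p n c d A => (Units.val (α := BlockMat p n c d A) g) * q)
      (BlockMat.mapMat_id _).symm

/-- Every move is a base change followed by the action of a group element. A map commuting with both
therefore commutes with all moves. -/
theorem move_eq_smul (x : Trivialization c d X A) {f : A ⟶ B}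
    {g : (displayGSpace.{u} p n c d).G.obj B} {Ψ : GL (Fin c ⊕ Fin d) (W p n B)}
    (h : IsStdHom f (Units.val (α := BlockMat p n c d B) g) x.Ψ Ψ) :
    x.move f g Ψ h = g • x.map f :=
  (move_move x (IsStdHom.map f x.Ψ) (IsStdHom.smul g _) h (Category.comp_id _).symm
    (mul_mapMat_one _ _)).symm

theorem map_smul (f : A ⟶ B) (g : (displayGSpace.{u} p n c d).G.obj A)
    (x : Trivialization c d X A) :
    (g • x).map f = (displayGSpace.{u} p n c d).G.map f g • x.map f := by
  obtain ⟨g', hg'⟩ : ∃ g' : (BlockMat p n c d B)ˣ, g' = (displayGSpace.{u} p n c d).G.map f g :=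
    ⟨_, rfl⟩
  have e : g'.1 = (1 : (BlockMat p n c d B)ˣ).1 *
      (Units.val (α := BlockMat p n c d A) g).mapMat (f.hom : A →+* B) := by
    rw [hg', Units.val_one, one_mul]
    rfl
  have h := (IsStdHom.smul g x.Ψ).comp (IsStdHom.map f (actΨ g x.Ψ)) (Category.id_comp f).symm
  rw [← e] at h
  refine (move_move x (IsStdHom.smul g x.Ψ) (IsStdHom.map f (actΨ g x.Ψ)) h
    (Category.id_comp _).symm e).trans ?_
  rw [← hg']
  exact move_eq_smul x h

theorem existsUnique_smul (x y : Trivialization c d X A) (h : x.base = y.base) :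
    ∃! g : (displayGSpace.{u} p n c d).G.obj A, g • x = y := by
  obtain ⟨g, ⟨hg, e⟩, hu⟩ := existsUnique_move x y (f := 𝟙 A) (by rw [h, Category.comp_id])
  have key : ∀ g' : (displayGSpace.{u} p n c d).G.obj A, g' • x = y ↔
      ∃ h : IsStdHom (𝟙 A) (Units.val (α := BlockMat p n c d A) g') x.Ψ y.Ψ,
        x.move (𝟙 A) g' y.Ψ h = y := by
    refine fun g' => ⟨fun e' => ?_, ?_⟩
    · have hΨ : actΨ g' x.Ψ = y.Ψ :=
        congrArg Trivialization.Ψ e'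
      have h₁ : IsStdHom (𝟙 A) (Units.val (α := BlockMat p n c d A) g') x.Ψ y.Ψ := by
        rw [← hΨ]
        exact IsStdHom.smul g' x.Ψ
      exact ⟨h₁, (move_congr x h₁ (IsStdHom.smul g' x.Ψ) rfl rfl).trans e'⟩
    · rintro ⟨h₁, e'⟩
      exact (move_congr x (IsStdHom.smul g' x.Ψ) h₁ rfl rfl).trans e'
  exact ⟨g, (key g).2 ⟨hg, e⟩, fun g' e' => hu g' ((key g').1 e')⟩

variable (c d X) in
/-- The display has trivializations étale locally. -/
def LocallyNonempty : Prop :=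
  ∃ U : EtaleCover X.R, ∀ i, ∃ x : Trivialization c d X (U.B i), x.base = U.f i

variable (c d X) in
/-- The torsor of trivializations of a display. -/
noncomputable def torsor [NeZero n] (hX : LocallyNonempty c d X) :
    QuotientObj (displayGSpace.{u} p n c d) where
  R := X.R
  P := presheaf c d X
  isSheaf := presheaf_isEtaleSheaf
  π {A} (x : Trivialization c d X A) := x.base
  π_map a x := base_map a x
  action A := inferInstanceAs
    (MulAction ((displayGSpace.{u} p n c d).G.obj A) (Trivialization c d X A))
  map_smul a g x := map_smul a g x
  π_smul {A} _ (x : Trivialization c d X A) := Category.comp_id x.base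
  existsUnique_smul x y h := existsUnique_smul x y h
  locally_nonempty := hX
  φ {A} (x : Trivialization c d X A) := x.Ψ
  φ_map _ _ := rfl
  φ_smul _ _ := rfl

/-- Composition of a trivialization with a base change of displays. -/
noncomputable def pullback {m : X ⟶ Y} (hm : TDisplay.IsBaseChange m) (x : Trivialization c d Y A) :
    Trivialization c d X A :=
  ⟨x.Ψ, m ≫ x.m, hm.comp x.isBaseChange⟩

theorem pullback_eq {m : X ⟶ Y} (hm : TDisplay.IsBaseChange m) {x : Trivialization c d Y A}
    {k : X ⟶ ⟨A, std x.Ψ⟩} {hk} (e : k = m ≫ x.m) :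
    (⟨x.Ψ, k, hk⟩ : Trivialization c d X A) = x.pullback hm := by
  subst e
  rfl

theorem pullback_move {m : X ⟶ Y} (hm : TDisplay.IsBaseChange m) (x : Trivialization c d Y A)
    {f : A ⟶ B} {g : (BlockMat p n c d B)ˣ} {Ψ : GL (Fin c ⊕ Fin d) (W p n B)}
    (h : IsStdHom f g.1 x.Ψ Ψ) :
    (x.move f g Ψ h).pullback hm = (x.pullback hm).move f g Ψ h := by
  simp only [pullback, move, Category.assoc]

/-- The map of torsors induced by a base change of displays. -/
noncomputable def torsorMap [NeZero n] {m : X ⟶ Y} (hm : TDisplay.IsBaseChange m)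
    (hX : LocallyNonempty c d X) (hY : LocallyNonempty c d Y) :
    torsor c d Y hY ⟶ torsor c d X hX :=
  { base := m.base
    map := fun _ x => pullback hm x
    naturality := fun a x => pullback_move hm x (IsStdHom.map a _)
    map_smul := fun g x => pullback_move hm x (IsStdHom.smul g _)
    π_map := fun _ => rfl
    φ_map := fun _ => rfl }

/-- `Y` has trivializations locally, and a morphism into `Y` is determined by its composites with
them. -/
theorem torsorMap_injective [NeZero n] {m m' : X ⟶ Y} {hm : TDisplay.IsBaseChange m}
    {hm' : TDisplay.IsBaseChange m'} {hX : LocallyNonempty c d X} {hY : LocallyNonempty c d Y}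
    (h : torsorMap hm hX hY = torsorMap hm' hX hY) : m = m' := by
  obtain ⟨U, hU⟩ := id hY
  choose x hx using hU
  refine U.hom_ext (fun i => (x i).m) hx (fun i => (x i).isBaseChange)
    (congrArg QuotientObj.Hom.base h) fun i => ?_
  have e : (x i).pullback hm = (x i).pullback hm' :=
    congrFun (congrFun (congrArg QuotientObj.Hom.map h) (U.B i)) (x i)
  simp only [pullback, mk.injEq, heq_eq_eq, true_and] at e
  exact e

/-- `η` turns a local trivialization of `Y` into one of `X` with the same matrix, that is, into a
morphism from `X` to the same standard display. These morphisms agree on overlaps because `η`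
commutes with base change and with the group, so they glue to a morphism `X ⟶ Y`. -/
theorem torsorMap_surjective [NeZero n] {hX : LocallyNonempty c d X} {hY : LocallyNonempty c d Y}
    (η : torsor c d Y hY ⟶ torsor c d X hX) :
    ∃ (m : X ⟶ Y) (hm : TDisplay.IsBaseChange m), torsorMap hm hX hY = η := by
  obtain ⟨R, Y⟩ := Y
  obtain ⟨U, hU⟩ := id hY
  choose x hx using hU
  let y (A : Alg.{u} p) (x : Trivialization c d ⟨R, Y⟩ A) : Trivialization c d X A := η.map A x
  have hΨ : ∀ A x, (y A x).Ψ = x.Ψ := fun A x => η.φ_map x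
  have hb : ∀ A x, (y A x).base = η.base ≫ x.base := fun A x => η.π_map x
  have hmove : ∀ {A B : Alg.{u} p} (x : Trivialization c d ⟨R, Y⟩ A) {f : A ⟶ B}
      {g : (BlockMat p n c d B)ˣ} {Ψ : GL (Fin c ⊕ Fin d) (W p n B)} (h : IsStdHom f g.1 x.Ψ Ψ)
      (h' : IsStdHom f g.1 (y A x).Ψ Ψ), y B (x.move f g Ψ h) = (y A x).move f g Ψ h' :=
    fun {A B} x {f g Ψ} h h' => by
      rw [move_eq_smul x h, move_eq_smul (y A x) h']
      exact (η.map_smul _ _).trans (congrArg _ (η.naturality f x))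
  choose m hm e using fun (A : Alg.{u} p) (x : Trivialization c d ⟨R, Y⟩ A) =>
    eq_of_Ψ_eq (hΨ A x)
  -- On an overlap, the group element relating two trivializations of `Y` also relates their images
  -- under `η`.
  have hcomm : ∀ {A B E : Alg.{u} p} (x : Trivialization c d ⟨R, Y⟩ A)
      (x' : Trivialization c d ⟨R, Y⟩ B) (s : A ⟶ E) (t : B ⟶ E), x.base ≫ s = x'.base ≫ t →
      ∃ (Ψ : GL (Fin c ⊕ Fin d) (W p n E)) (g : (BlockMat p n c d E)ˣ)
        (h : IsStdHom s g.1 x.Ψ Ψ) (h' : IsStdHom t (1 : (BlockMat p n c d E)ˣ).1 x'.Ψ Ψ),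
        x.m ≫ stdHom s g.1 x.Ψ Ψ h = x'.m ≫ stdHom t (1 : (BlockMat p n c d E)ˣ).1 x'.Ψ Ψ h' ∧
        m A x ≫ stdHom s g.1 x.Ψ Ψ h =
          m B x' ≫ stdHom t (1 : (BlockMat p n c d E)ˣ).1 x'.Ψ Ψ h' := by
    intro A B E x x' s t hst
    obtain ⟨g, ⟨hg, e₁⟩, -⟩ := existsUnique_move x (x'.map t) (f := s) hst.symm
    refine ⟨_, g, hg, IsStdHom.map t x'.Ψ, (eq_of_move e₁).2, ?_⟩
    have e₂ := congrArg (y E) e₁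
    rw [hmove x hg (by rw [hΨ]; exact hg)] at e₂
    replace e₂ := e₂.trans (hmove x' (IsStdHom.map t x'.Ψ) (by rw [hΨ]; exact IsStdHom.map t x'.Ψ))
    simp only [e] at e₂
    exact (eq_of_move e₂).2
  have hmb : ∀ A x, (m A x).base = η.base ≫ x.base := fun A x => by
    have h₁ := congrArg base (e A x)
    exact h₁.symm.trans (hb A x)
  obtain ⟨k, hk, hk'⟩ := U.exists_glue_hom η.base (fun i => (x i).m) hx
    (fun i => (x i).isBaseChange) (fun i => m _ (x i)) (fun i => by rw [hmb, hx]; rfl)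
    (fun i j E s t hst => by
      obtain ⟨Ψ, g, h, h', e₁, e₂⟩ := hcomm (x i) (x j) s t (by rw [hx, hx, hst])
      exact ⟨std Ψ, _, _, stdHom_base h, stdHom_base h', isBaseChange_comp_stdHom (x i) h, e₁, e₂⟩)
  have hkB : TDisplay.IsBaseChange k := .of_cover U k _ (fun i => (x i).m) hx
    (fun i => (x i).isBaseChange) fun i => by
      rw [hk']
      exact hm _ _
  refine ⟨k, hkB, QuotientObj.Hom.ext hk ?_⟩
  funext A (z : Trivialization c d ⟨R, Y⟩ A)
  -- Agreement of `η` with the map induced by `k` propagates along the action and along base change.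
  -- It holds for the `x j`, and every trivialization is locally a translate of a base change of
  -- some `x j`.
  have hyz : ∀ {A : Alg.{u} p} (g : (displayGSpace.{u} p n c d).G.obj A)
      (z : Trivialization c d ⟨R, Y⟩ A), y A z = z.pullback hkB →
      y A (g • z) = (g • z).pullback hkB := fun g z h =>
    (η.map_smul g z).trans ((congrArg (fun w => g • w) h).trans
      (pullback_move hkB z (IsStdHom.smul g _)).symm)
  have hyz' : ∀ {A B : Alg.{u} p} (f : A ⟶ B) (z : Trivialization c d ⟨R, Y⟩ A),
      y A z = z.pullback hkB → y B (z.map f) = (z.map f).pullback hkB := fun f z h =>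
    (η.naturality f z).trans ((congrArg (fun w => Trivialization.map f w) h).trans
      (pullback_move hkB z (IsStdHom.map f _)).symm)
  obtain ⟨V, hV⟩ := U.exists_pullback z.base
  refine map_injective V fun i => ?_
  obtain ⟨j, t, ht⟩ := hV i
  refine (pullback_move hkB z (IsStdHom.map (V.f i) _)).symm.trans
    (Eq.trans ?_ (η.naturality (V.f i) z))
  obtain ⟨g, hg, -⟩ := existsUnique_smul ((x j).map t)
    (z.map (V.f i)) ((congrArg (fun q => q ≫ t) (hx j)).trans ht.symm)
  change (z.map (V.f i)).pullback hkB = y _ (z.map (V.f i))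
  rw [← hg]
  refine (hyz _ _ (hyz' _ _ ?_)).symm
  rw [e]
  exact pullback_eq hkB (hk' j).symm

end Trivialization

end TorsorObject

/-! ### Displays are trivial étale locally -/

section LocalTriviality

theorem LinearizationBijective.rankAtStalk_eq {K S M N : Type u} [CommRing K] [CommRing S]
    [AddCommGroup M] [AddCommGroup N] [Module K M] [Module S N] [Module.Finite K M]
    [Module.Projective K M] {τ : K →+* S} {u : M →ₛₗ[τ] N} (hu : LinearizationBijective u)
    (𝔮 : PrimeSpectrum S) :
    Module.rankAtStalk N 𝔮 = Module.rankAtStalk M (PrimeSpectrum.comap τ 𝔮) := by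
  let _ : Algebra K S := τ.toAlgebra
  let _ : Module K N := Module.compHom N τ
  have _ : IsScalarTower K S N := ⟨fun r s x => mul_smul (τ r) s x⟩
  exact Module.rankAtStalk_isBaseChange (R := K) (S := S) hu 𝔮

theorem exists_linearizationBijective_tensor {K S : Type u} [CommRing K] [CommRing S]
    [i : Algebra K S] (M : Type u) [AddCommGroup M] [Module K M] :
    ∃ u : M →ₛₗ[algebraMap K S] S ⊗[K] M, LinearizationBijective u := by
  -- The tensor product uses the given algebra structure, while the linearization uses
  -- `τ.toAlgebra`. The claim is first proved when the two are identified.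
  have key : ∀ (i : Algebra K S) (τ : K →+* S), i = τ.toAlgebra →
      ∃ u : M →ₛₗ[τ] S ⊗[K] M, LinearizationBijective u := by
    rintro _ τ rfl
    let _ : Algebra K S := τ.toAlgebra
    let u : M →ₛₗ[τ] S ⊗[K] M :=
      { toFun := fun x => 1 ⊗ₜ x
        map_add' := fun x y => TensorProduct.tmul_add _ _ _
        map_smul' := fun a x => by
          rw [TensorProduct.tmul_smul, TensorProduct.smul_tmul', TensorProduct.smul_tmul']
          rfl }
    exact ⟨u, .of_equiv (LinearEquiv.refl S _) fun x => rfl⟩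
  exact key i _ (Algebra.algebra_ext _ _ fun _ => rfl)

/-- A finitely generated projective module of constant rank is free locally on the base. -/
theorem exists_linearizationBijective_pi {K : Type u} [CommRing K] (M : Type u) [AddCommGroup M]
    [Module K M] [Module.Finite K M] [Module.Projective K M] {r : ℕ}
    (h : ∀ 𝔮 : PrimeSpectrum K, Module.rankAtStalk M 𝔮 = r) (𝔮 : PrimeSpectrum K) :
    ∃ g ∉ 𝔮.asIdeal, ∀ (S : Type u) [CommRing S] (τ : K →+* S), IsUnit (τ g) →
      ∃ a : M →ₛₗ[τ] (Fin r → S), LinearizationBijective a := by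
  obtain ⟨g, hg, hfree⟩ := Module.Free.away_of_finite_of_flat_of_rankAtStalk_constant M 𝔮.asIdeal
    fun m _ => (h _).trans (h 𝔮).symm
  refine ⟨g, hg, fun S _ τ hτ => ?_⟩
  let K' := Localization.Away g
  let e : LocalizedModule.Away g M ≃ₗ[K'] K' ⊗[K] M :=
    LocalizedModule.equivTensorProduct (Submonoid.powers g) M
  have : Module.Free K' (K' ⊗[K] M) := Module.Free.of_equiv e
  -- If the localization were zero, a power of `g` would vanish and `g` would lie in the prime.
  -- Nontriviality provides a prime of `K'` at which the rank of the free module is read off.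
  have : Nontrivial K' := by
    by_contra hK
    rw [not_nontrivial_iff_subsingleton,
      IsLocalization.subsingleton_iff (M := Submonoid.powers g)] at hK
    obtain ⟨k, hk⟩ := hK
    exact hg (𝔮.2.mem_of_pow_mem k (by
      rw [show g ^ k = 0 from hk]
      exact zero_mem _))
  obtain ⟨u, hu⟩ := exists_linearizationBijective_tensor (K := K) (S := K') M
  have hr : Module.finrank K' (K' ⊗[K] M) = r := by
    obtain ⟨𝔯⟩ : Nonempty (PrimeSpectrum K') := inferInstance
    rw [← h (PrimeSpectrum.comap (algebraMap K K') 𝔯), ← hu.rankAtStalk_eq,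
      Module.rankAtStalk_eq_finrank_of_free]
    rfl
  let b : Module.Basis (Fin r) K' (K' ⊗[K] M) := Module.finBasisOfFinrankEq _ _ hr
  let τ' : K' →+* S := IsLocalization.Away.lift g hτ
  have t : RingHomCompTriple (algebraMap K K') τ' τ := ⟨IsLocalization.Away.lift_comp g hτ⟩
  let v : (K' ⊗[K] M) →ₛₗ[τ'] (Fin r → S) :=
    { toFun := fun x i => τ' (b.repr x i)
      map_add' := fun x y => by ext i; simp
      map_smul' := fun a x => by ext i; simp }
  have hv : LinearizationBijective v := by
    refine linearizationBijective_of_basis v b (Pi.basisFun S (Fin r)) fun i => ?_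
    ext j
    simp only [v, LinearMap.coe_mk, AddHom.coe_mk, Module.Basis.repr_self, Pi.basisFun_apply,
      Finsupp.single_apply, Pi.single_apply]
    simp only [eq_comm (a := i)]
    split_ifs <;> simp
  exact ⟨v.comp u, hu.comp hv⟩

variable {p n c d : ℕ} [Fact p.Prime]

/-- Both `Ψ'` and the standard map for the matrix `1` are scalar extensions along `σ` of the same
module. They differ by a linear automorphism, whose matrix is `Ψ`. -/
theorem exists_eq_stdΨ {R : Type u} [CommRing R] [Algebra (ZMod p) R]
    {Ψ' : ((Fin c → W p n R) × (Fin d → W p n R)) →ₛₗ[σ p n R]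
      ((Fin c → W p n R) × (Fin d → W p n R))} (h : LinearizationBijective Ψ') :
    ∃ Ψ : GL (Fin c ⊕ Fin d) (W p n R), stdΨ Ψ.1 = Ψ' := by
  have h₁ : LinearizationBijective
      (stdΨ (1 : Matrix (Fin c ⊕ Fin d) (Fin c ⊕ Fin d) (W p n R))) :=
    (std (1 : GL (Fin c ⊕ Fin d) (W p n R))).bijective_Ψ
  obtain ⟨e, he⟩ := h₁.exists_lift (τ' := RingHom.id _) Ψ'
  let e₁ := LinearEquiv.ofBijective e (h₁.bijective_of_comp h e he)
  let e₂ := ((splitEquiv (W p n R) c d).trans e₁).trans (splitEquiv (W p n R) c d).symm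
  let Ψ : GL (Fin c ⊕ Fin d) (W p n R) := Units.map
    (LinearMap.toMatrixAlgEquiv' (R := W p n R) (n := Fin c ⊕ Fin d)).toRingEquiv.toRingHom
    (LinearMap.GeneralLinearGroup.ofLinearEquiv e₂)
  refine ⟨Ψ, LinearMap.ext fun x => ?_⟩
  have hΨ : ∀ y, Ψ.1 *ᵥ y = e₂ y := fun y => LinearMap.toMatrix'_mulVec e₂.toLinearMap y
  rw [stdΨ_apply, hΨ, ← he, stdΨ_apply, Matrix.one_mulVec]
  exact LinearEquiv.apply_symm_apply _ _

/-- A base change of the modules of a display to free modules gives a trivialization. -/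
theorem exists_trivialization {X : TDisplay.{u} p n} {B : Alg.{u} p} {f : X.R ⟶ B}
    {a : X.X.L →ₛₗ[Wm n f] (Fin c → W p n B)} {b : X.X.T →ₛₗ[Wm n f] (Fin d → W p n B)}
    (ha : LinearizationBijective a) (hb : LinearizationBijective b) :
    ∃ x : Trivialization c d X B, x.base = f := by
  obtain ⟨Ψ', hΨ', h⟩ := exists_extend_Ψ ha hb
  obtain ⟨Ψ, rfl⟩ := exists_eq_stdΨ hΨ'
  exact ⟨⟨Ψ, diagHom (X' := std Ψ) a b h,
    .of_isStronglyCocartesian (diagHom_isStronglyCocartesian h ha hb)⟩, rfl⟩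

theorem locallyNonempty [NeZero n] (X : TDisplay.{u} p n)
    (hL : ∀ 𝔮 : PrimeSpectrum (W p n X.R), Module.rankAtStalk X.X.L 𝔮 = c)
    (hT : ∀ 𝔮 : PrimeSpectrum (W p n X.R), Module.rankAtStalk X.X.T 𝔮 = d) :
    Trivialization.LocallyNonempty c d X := by
  -- The elements `r` such that the display is trivial over the localization of the base at `r`.
  -- They generate the unit ideal, and finitely many of them form the cover.
  let s : Set X.R := {r | ∃ x : Trivialization c d X (CommAlgCat.of (ZMod p) (Localization.Away r)),
    x.base = CommAlgCat.ofHom (IsScalarTower.toAlgHom (ZMod p) X.R (Localization.Away r))}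
  have hs : ∀ 𝔮 : PrimeSpectrum X.R, ∃ r ∈ s, r ∉ 𝔮.asIdeal := by
    intro 𝔮
    obtain ⟨g₁, hg₁, h₁⟩ := exists_linearizationBijective_pi X.X.L hL
      (PrimeSpectrum.comap (res p n X.R) 𝔮)
    obtain ⟨g₂, hg₂, h₂⟩ := exists_linearizationBijective_pi X.X.T hT
      (PrimeSpectrum.comap (res p n X.R) 𝔮)
    refine ⟨res p n X.R (g₁ * g₂), ?_, ?_⟩
    · let B : Alg.{u} p := CommAlgCat.of (ZMod p) (Localization.Away (res p n X.R (g₁ * g₂)))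
      let f : X.R ⟶ B := CommAlgCat.ofHom (IsScalarTower.toAlgHom (ZMod p) X.R
        (Localization.Away (res p n X.R (g₁ * g₂))))
      -- Only the residue of `g₁ * g₂` is inverted in the base. The element itself becomes a unit of
      -- the Witt vectors since the kernel of the reduction is nilpotent.
      have hu : IsUnit (Wm n f (g₁ * g₂)) := by
        refine isUnit_of_isUnit_res ?_
        rw [res_mapW]
        exact IsLocalization.Away.algebraMap_isUnit (res p n X.R (g₁ * g₂))
      have hu' : IsUnit (Wm n f g₁ * Wm n f g₂) := map_mul (Wm n f) g₁ g₂ ▸ hu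
      obtain ⟨a, ha⟩ := h₁ _ (Wm n f) (isUnit_of_mul_isUnit_left hu')
      obtain ⟨b, hb⟩ := h₂ _ (Wm n f) (isUnit_of_mul_isUnit_right hu')
      exact exists_trivialization ha hb
    · exact fun h => (𝔮.comap (res p n X.R)).2.mul_notMem hg₁ hg₂ h
  have hspan : Ideal.span s = ⊤ := by
    by_contra hne
    obtain ⟨m, hm, hle⟩ := Ideal.exists_le_maximal _ hne
    obtain ⟨r, hr, hrm⟩ := hs ⟨m, hm.isPrime⟩
    exact hrm (hle (Ideal.subset_span hr))
  obtain ⟨t, hts, ht⟩ := (Ideal.span_eq_top_iff_finite s).1 hspan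
  let e := t.equivFin.symm
  refine ⟨⟨Fin t.card, fun i => CommAlgCat.of (ZMod p) (Localization.Away (e i).1),
    fun i => CommAlgCat.ofHom (IsScalarTower.toAlgHom (ZMod p) X.R (Localization.Away (e i).1)),
    fun i => ?_, fun 𝔮 => ?_⟩, fun i => hts (e i).2⟩
  · exact (RingHom.etale_algebraMap (R := X.R) (S := Localization.Away (e i).1)).2
      (Algebra.Etale.of_isLocalizationAway (e i).1)
  · obtain ⟨r, hr, hrm⟩ : ∃ r ∈ t, r ∉ 𝔮.asIdeal := by
      by_contra! h
      exact 𝔮.2.ne_top (top_le_iff.1 (ht ▸ Ideal.span_le.2 h))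
    refine ⟨e.symm ⟨r, hr⟩, ?_⟩
    have := PrimeSpectrum.localization_away_comap_range (Localization.Away r) r
    have h𝔮 : 𝔮 ∈ Set.range (PrimeSpectrum.comap (algebraMap X.R (Localization.Away r))) := by
      rw [this]; exact hrm
    have er : (e (e.symm ⟨r, hr⟩)).1 = r := by rw [Equiv.apply_symm_apply]
    rw [← er] at h𝔮
    exact h𝔮

end LocalTriviality

/-! ### Morphisms of torsors -/

namespace QuotientObj

variable {p : ℕ} [Fact p.Prime] {𝒢 : GSpace.{u} p} {P Q : QuotientObj 𝒢}

theorem ext_of_cover (P : QuotientObj 𝒢) {A : Alg.{u} p} (U : EtaleCover A) {x y : P.P.obj A}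
    (h : ∀ i, P.P.map (U.f i) x = P.P.map (U.f i) y) : x = y := by
  obtain ⟨_, -, hu⟩ := P.isSheaf A U (fun i => P.P.map (U.f i) y) fun i j E a b e => by
    rw [← Functor.map_comp_apply, ← Functor.map_comp_apply, e]
  exact (hu x h).trans (hu y fun i => rfl).symm

theorem Hom.injective (m : P ⟶ Q) [IsIso (Hom.base m)] (A : Alg.{u} p) :
    Function.Injective (Hom.map m A) := by
  intro x y h
  have hπ : P.π x = P.π y := by
    rw [← cancel_epi (Hom.base m), ← Hom.π_map m, ← Hom.π_map m, h]
  obtain ⟨g, rfl, -⟩ := P.existsUnique_smul x y hπ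
  rw [Hom.map_smul m] at h
  have hg : g = 1 := (Q.existsUnique_smul (Hom.map m A x) (Hom.map m A x) rfl).unique h.symm
    (one_smul _ _)
  rw [hg, one_smul]

/-- Over a cover trivializing `P`, the image of a section of `P` is translated to `y` by the group.
The preimages found locally glue because the map is injective. -/
theorem Hom.surjective (m : P ⟶ Q) [IsIso (Hom.base m)] (A : Alg.{u} p) :
    Function.Surjective (Hom.map m A) := by
  intro y
  obtain ⟨U, hU⟩ := P.locally_nonempty
  obtain ⟨V, hV⟩ := U.exists_pullback (inv (Hom.base m) ≫ Q.π y)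
  have key : ∀ i, ∃ x : P.P.obj (V.B i), Hom.map m _ x = Q.P.map (V.f i) y := by
    intro i
    obtain ⟨j, t, ht⟩ := hV i
    obtain ⟨s, hs⟩ := hU j
    obtain ⟨g, hg, -⟩ := Q.existsUnique_smul (Hom.map m _ (P.P.map t s)) (Q.P.map (V.f i) y) (by
      rw [Hom.π_map m, P.π_map, Q.π_map, hs, ← ht, Category.assoc, IsIso.hom_inv_id_assoc])
    exact ⟨g • P.P.map t s, by rw [Hom.map_smul m, hg]⟩
  choose x hx using key
  obtain ⟨z, hz, -⟩ := P.isSheaf A V x fun i j E a b e => by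
    apply Hom.injective m
    rw [Hom.naturality m, Hom.naturality m, hx, hx, ← Functor.map_comp_apply,
      ← Functor.map_comp_apply, e]
  refine ⟨z, Q.ext_of_cover V fun i => ?_⟩
  rw [← Hom.naturality m, hz, hx]

/-- A morphism of torsors over an isomorphism of the bases is an isomorphism. -/
theorem Hom.isIso (m : P ⟶ Q) [IsIso (Hom.base m)] : IsIso m := by
  have hb : ∀ A, Function.Bijective (Hom.map m A) := fun A => ⟨Hom.injective m A, Hom.surjective m A⟩
  choose k hk hk' using fun A => Function.bijective_iff_has_inverse.1 (hb A)
  let m' : Q ⟶ P :=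
    { base := inv (Hom.base m)
      map := k
      naturality := fun {A B} a x => (hb B).1 (by
        rw [hk', Hom.naturality m, hk'])
      map_smul := fun {A} g x => (hb A).1 (by rw [hk', Hom.map_smul m, hk'])
      π_map := fun {A} x => by
        rw [← cancel_epi (Hom.base m), ← Hom.π_map m, hk', IsIso.hom_inv_id_assoc]
      φ_map := fun {A} x => by rw [← Hom.φ_map m, hk'] }
  exact ⟨m', Hom.ext (IsIso.inv_hom_id _) (funext fun A => funext (hk A)),
    Hom.ext (IsIso.hom_inv_id _) (funext fun A => funext (hk' A))⟩

/-! ### Morphisms of torsors from equality of cocycles. -/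

section Cocycle

variable (U : EtaleCover P.R) (s : ∀ i, P.P.obj (U.B i)) (t : ∀ i, Q.P.obj (U.B i))

/-- The sections `x` and `y` have the same coordinates with respect to `s` and `t`. -/
def SameCoord {A : Alg.{u} p} (x : P.P.obj A) (y : Q.P.obj A) : Prop :=
  ∀ (j : U.ι) (E : Alg.{u} p) (e : A ⟶ E) (a : U.B j ⟶ E) (g : 𝒢.G.obj E),
    g • P.P.map a (s j) = P.P.map e x → g • Q.P.map a (t j) = Q.P.map e y

variable {U s t} {A B : Alg.{u} p} {x : P.P.obj A} {y : Q.P.obj A}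

theorem SameCoord.map (h : SameCoord U s t x y) (f : A ⟶ B) :
    SameCoord U s t (P.P.map f x) (Q.P.map f y) := fun j E e a g hg => by
  rw [← Functor.map_comp_apply] at hg ⊢
  exact h j E (f ≫ e) a g hg

theorem SameCoord.smul (h : SameCoord U s t x y) (k : 𝒢.G.obj A) :
    SameCoord U s t (k • x) (k • y) := fun j E e a g hg => by
  rw [P.map_smul, ← inv_smul_eq_iff, smul_smul] at hg
  rw [Q.map_smul, ← inv_smul_eq_iff, smul_smul]
  exact h j E e a _ hg

/-- The relation is tested over arbitrary rings under `A`, so the cover is pulled back to the test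
ring. -/
theorem SameCoord.of_cover (V : EtaleCover A)
    (h : ∀ i, SameCoord U s t (P.P.map (V.f i) x) (Q.P.map (V.f i) y)) : SameCoord U s t x y := by
  intro j E e a g hg
  obtain ⟨V', hV'⟩ := V.exists_pullback e
  refine Q.ext_of_cover V' fun i => ?_
  obtain ⟨k, b, hb⟩ := hV' i
  have := h k j (V'.B i) b (a ≫ V'.f i) (𝒢.G.map (V'.f i) g) (by
    rw [← Functor.map_comp_apply, ← hb, Functor.map_comp_apply, Functor.map_comp_apply,
      ← P.map_smul, hg])
  rw [← Functor.map_comp_apply, ← hb, Functor.map_comp_apply, Functor.map_comp_apply,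
      ← Q.map_smul] at this
  exact this

theorem exists_local (hs : ∀ i, P.π (s i) = U.f i) (x : P.P.obj A) :
    ∃ V : EtaleCover A, ∀ i, ∃ (j : U.ι) (a : U.B j ⟶ V.B i) (g : 𝒢.G.obj (V.B i)),
      g • P.P.map a (s j) = P.P.map (V.f i) x := by
  obtain ⟨V, hV⟩ := U.exists_pullback (P.π x)
  refine ⟨V, fun i => ?_⟩
  obtain ⟨j, a, ha⟩ := hV i
  obtain ⟨g, hg, -⟩ := P.existsUnique_smul (P.P.map a (s j)) (P.P.map (V.f i) x) (by
    rw [P.π_map, P.π_map, hs, ha])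
  exact ⟨j, a, g, hg⟩

theorem SameCoord.unique (hs : ∀ i, P.π (s i) = U.f i) {y' : Q.P.obj A}
    (h : SameCoord U s t x y) (h' : SameCoord U s t x y') : y = y' := by
  obtain ⟨V, hV⟩ := exists_local hs x
  refine Q.ext_of_cover V fun i => ?_
  obtain ⟨j, a, g, hg⟩ := hV i
  exact (h j _ _ a g hg).symm.trans (h' j _ _ a g hg)

/-- Locally `x` is a translate `g • s j`, so its image has to be `g • t j`. The hypothesis `hst`
says exactly that this does not depend on `g` and `j`, so the local images glue. -/
theorem exists_sameCoord (hs : ∀ i, P.π (s i) = U.f i)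
    (hst : ∀ (i j : U.ι) (E : Alg.{u} p) (a : U.B i ⟶ E) (b : U.B j ⟶ E) (g : 𝒢.G.obj E),
      g • P.P.map a (s i) = P.P.map b (s j) → g • Q.P.map a (t i) = Q.P.map b (t j))
    (x : P.P.obj A) : ∃ y : Q.P.obj A, SameCoord U s t x y := by
  obtain ⟨V, hV⟩ := exists_local hs x
  choose j a g hg using hV
  have key : ∀ i, SameCoord U s t (P.P.map (V.f i) x) (g i • Q.P.map (a i) (t (j i))) := by
    intro i
    rw [← hg]
    refine SameCoord.smul (fun j' E e a' g' h => ?_) (g i)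
    rw [← Functor.map_comp_apply] at h ⊢
    exact hst _ _ _ _ _ _ h
  obtain ⟨y, hy, -⟩ := Q.isSheaf A V _ fun i i' E b b' e => by
    refine SameCoord.unique hs ((key i).map b) ?_
    rw [← Functor.map_comp_apply, e, Functor.map_comp_apply]
    exact (key i').map b'
  refine ⟨y, .of_cover V fun i => ?_⟩
  rw [hy]
  exact key i

/-- Torsors with the same cocycle are isomorphic. -/
theorem exists_hom_of_cocycle (r : Q.R ⟶ P.R) (hs : ∀ i, P.π (s i) = U.f i)
    (ht : ∀ i, Q.π (t i) = r ≫ U.f i) (hφ : ∀ i, Q.φ (t i) = P.φ (s i))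
    (hst : ∀ (i j : U.ι) (E : Alg.{u} p) (a : U.B i ⟶ E) (b : U.B j ⟶ E) (g : 𝒢.G.obj E),
      g • P.P.map a (s i) = P.P.map b (s j) → g • Q.P.map a (t i) = Q.P.map b (t j))
    (hb : ∀ {R A : Alg.{u} p} (V : EtaleCover A) {f f' : R ⟶ A},
      (∀ i, f ≫ V.f i = f' ≫ V.f i) → f = f')
    (hX : ∀ {A : Alg.{u} p} (V : EtaleCover A) {x y : 𝒢.X.obj A},
      (∀ i, 𝒢.X.map (V.f i) x = 𝒢.X.map (V.f i) y) → x = y) :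
    ∃ m : P ⟶ Q, Hom.base m = r := by
  choose k hk using fun A (x : P.P.obj A) => exists_sameCoord hs hst x
  refine ⟨{ base := r
            map := k
            naturality := fun {A B} a x => ((hk B _).unique hs ((hk A x).map a))
            map_smul := fun {A} g x => (hk A _).unique hs ((hk A x).smul g)
            π_map := fun {A} x => ?_
            φ_map := fun {A} x => ?_ }, rfl⟩
  -- Compatibility with the maps to the base and to `X` is checked on a cover where `x` is a
  -- translate of a section. The hypotheses `hb` and `hX` supply the separatedness.
  · obtain ⟨V, hV⟩ := exists_local hs x
    refine hb V fun i => ?_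
    obtain ⟨j, a, g, hg⟩ := hV i
    rw [← Q.π_map, ← hk A x j _ _ a g hg, Category.assoc, ← P.π_map, ← hg, Q.π_smul, P.π_smul,
      P.π_map, Q.π_map, hs, ht, Category.assoc]
  · obtain ⟨V, hV⟩ := exists_local hs x
    refine hX V fun i => ?_
    obtain ⟨j, a, g, hg⟩ := hV i
    rw [← Q.φ_map, ← hk A x j _ _ a g hg, ← P.φ_map, ← hg, Q.φ_smul, P.φ_smul, P.φ_map, Q.φ_map,
      hφ]

end Cocycle

end QuotientObj

/-! ### Inverting fully faithful, essentially surjective functors over a base. -/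

section BasedEquivalence

universe v₁ u₁ v₂ u₂ v₃ u₃

variable {𝒮 : Type*} [Category 𝒮] {𝒳 : BasedCategory.{v₁, u₁} 𝒮} {𝒴 : BasedCategory.{v₂, u₂} 𝒮}

theorem isHomLift_id_of_eq {y y' : 𝒴.obj} {e : y ⟶ y'} {R R' : 𝒮} (h : R = R')
    (he : 𝒴.p.IsHomLift (𝟙 R) e) : 𝒴.p.IsHomLift (𝟙 R') e := by
  subst h
  exact he

/-- A fully faithful functor of based categories that is essentially surjective on fibres is an
equivalence. -/
theorem exists_based_inverse (F : BasedFunctor 𝒳 𝒴) [F.toFunctor.Full] [F.toFunctor.Faithful]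
    (h : ∀ y, ∃ (x : 𝒳.obj) (e : F.obj x ≅ y), 𝒴.p.IsHomLift (𝟙 (𝒴.p.obj y)) e.hom) :
    ∃ G : BasedFunctor 𝒴 𝒳, Nonempty (G.comp F ≅ BasedFunctor.id _) ∧
      Nonempty (F.comp G ≅ BasedFunctor.id _) := by
  choose x e he using h
  have hx : ∀ y, 𝒳.p.obj (x y) = 𝒴.p.obj y := fun y =>
    (F.w_obj (x y)).symm.trans (IsHomLift.domain_eq 𝒴.p (𝟙 (𝒴.p.obj y)) (e y).hom)
  let G : BasedFunctor 𝒴 𝒳 :=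
    { obj := x
      map := fun {y y'} m => F.preimage ((e y).hom ≫ m ≫ (e y').inv)
      map_id := fun y => F.map_injective (by simp)
      map_comp := fun m m' => F.map_injective (by simp)
      w := by
        refine CategoryTheory.Functor.ext hx fun y y' m => ?_
        -- Conjugating by the vertical isomorphisms `e` does not change the image of `m` in the
        -- base, so the inverse commutes with the projections.
        have h₁ : 𝒴.p.IsHomLift (𝟙 _ ≫ 𝒴.p.map m ≫ 𝟙 _) ((e y).hom ≫ m ≫ (e y').inv) :=
          inferInstance
        rw [Category.comp_id, Category.id_comp, ← F.map_preimage ((e y).hom ≫ m ≫ (e y').inv)] at h₁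
        have h₂ := F.isHomLift_map (𝒴.p.map m) (F.preimage ((e y).hom ≫ m ≫ (e y').inv))
        exact IsHomLift.fac' 𝒳.p (𝒴.p.map m) _ }
  have hG : ∀ {y y'} (m : y ⟶ y'), F.map (G.map m) = (e y).hom ≫ m ≫ (e y').inv := fun m =>
    F.map_preimage _
  have hcancel : ∀ {y y'} (m : y ⟶ y'), ((e y).hom ≫ m ≫ (e y').inv) ≫ (e y').hom = (e y).hom ≫ m :=
    fun m => by simp
  refine ⟨G, ⟨BasedNatIso.mkNatIso (NatIso.ofComponents e fun m => ?_) fun y => he y⟩,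
    ⟨BasedNatIso.mkNatIso (NatIso.ofComponents (fun y => F.preimageIso (e (F.obj y)))
      fun m => F.map_injective ?_) fun y => ?_⟩⟩
  · exact (congrArg (fun q => q ≫ _) (hG m)).trans (hcancel m)
  · refine (F.map_comp (G.map (F.map m)) (F.preimage (e (F.obj _)).hom)).trans
      (Eq.trans ?_ (F.map_comp (F.preimage (e (F.obj _)).hom) m).symm)
    rw [hG, F.map_preimage, F.map_preimage]
    exact hcancel _
  · have h₁ := isHomLift_id_of_eq (F.w_obj y) (he (F.obj y))
    rw [← F.map_preimage (e (F.obj y)).hom] at h₁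
    exact F.isHomLift_map _ (F.preimage (e (F.obj y)).hom)

/-- Whiskering `P ≅ S ⋙ F` with `G` and cancelling `F ⋙ G` gives `P ⋙ G ≅ S`. It is used with `F`
the functor from displays to torsors, `P` the canonical functor from the quotient prestack, and `S`
the functor of standard displays. -/
theorem exists_based_iso_of_inverse {𝒵 : BasedCategory.{v₃, u₃} 𝒮} {F : BasedFunctor 𝒳 𝒴}
    {G : BasedFunctor 𝒴 𝒳} (γ : F.comp G ≅ BasedFunctor.id _) {P : BasedFunctor 𝒵 𝒴}
    {S : BasedFunctor 𝒵 𝒳} (β : P.toFunctor ≅ S.toFunctor ⋙ F.toFunctor)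
    (hβ : ∀ x, 𝒴.p.IsHomLift (𝟙 (𝒵.p.obj x)) (β.hom.app x)) : Nonempty (P.comp G ≅ S) := by
  let γ' : F.toFunctor ⋙ G.toFunctor ≅ 𝟭 𝒳.obj := (BasedNatTrans.forgetful 𝒳 𝒳).mapIso γ
  refine ⟨BasedNatIso.mkNatIso (Functor.isoWhiskerRight β G.toFunctor ≪≫
    (Functor.associator S.toFunctor F.toFunctor G.toFunctor) ≪≫
      Functor.isoWhiskerLeft S.toFunctor γ' ≪≫ S.toFunctor.rightUnitor) fun x => ?_⟩
  have h₁ : 𝒳.p.IsHomLift (𝟙 (𝒵.p.obj x)) (G.map (β.hom.app x)) :=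
    have := hβ x
    G.preserves_isHomLift _ _
  have h₂ : 𝒳.p.IsHomLift (𝟙 (𝒵.p.obj x)) (γ'.hom.app (S.obj x)) :=
    isHomLift_id_of_eq (S.w_obj x) (BasedNatTrans.app_isHomLift γ.hom (S.obj x))
  have e : (Functor.isoWhiskerRight β G.toFunctor ≪≫
    (Functor.associator S.toFunctor F.toFunctor G.toFunctor) ≪≫
      Functor.isoWhiskerLeft S.toFunctor γ' ≪≫ S.toFunctor.rightUnitor).hom.app x =
      G.map (β.hom.app x) ≫ γ'.hom.app (S.obj x) :=
    congrArg (fun q => G.map (β.hom.app x) ≫ q) ((Category.id_comp _).trans (Category.comp_id _))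
  have h₃ : 𝒳.p.IsHomLift (𝟙 (𝒵.p.obj x)) (G.map (β.hom.app x) ≫ γ'.hom.app (S.obj x)) :=
    inferInstance
  rw [← e] at h₃
  exact h₃

end BasedEquivalence

/-! ### The functor from displays to torsors -/

namespace Trivialization

variable {p n c d : ℕ} [Fact p.Prime] {X Y Z : TDisplay.{u} p n} {A : Alg.{u} p}

theorem pullback_id (h : TDisplay.IsBaseChange (𝟙 X)) (x : Trivialization c d X A) :
    x.pullback h = x := by
  simp only [pullback, Category.id_comp]

theorem pullback_comp {m : X ⟶ Y} {m' : Y ⟶ Z} (h : TDisplay.IsBaseChange m)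
    (h' : TDisplay.IsBaseChange m') (h'' : TDisplay.IsBaseChange (m ≫ m'))
    (x : Trivialization c d Z A) : x.pullback h'' = (x.pullback h').pullback h := by
  simp only [pullback, Category.assoc]

end Trivialization

section DispToQuotient

variable (p n h d : ℕ) [Fact p.Prime] [NeZero n]

theorem DispObj.locallyNonempty (X : DispObj.{u} p n h d) :
    Trivialization.LocallyNonempty (h - d) d X.X := by
  refine Disp.locallyNonempty X.X (fun 𝔮 => ?_) X.rank_dim
  have h₁ := X.rank_height 𝔮
  have h₂ := X.rank_dim 𝔮
  rw [Module.rankAtStalk_prod, Pi.add_apply] at h₁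
  omega

/-- The functor that sends a display to its torsor of trivializations. -/
noncomputable def torsorFunctor : BasedFunctor (dispStack.{u} p n h d)
    (quotientStack (displayGSpace.{u} p n (h - d) d)) where
  obj (X : DispObj p n h d) := Trivialization.torsor (h - d) d X.X (X.locallyNonempty p n h d)
  map {Y X : DispObj p n h d} m := Trivialization.torsorMap m.2 _ _
  map_id (X : DispObj p n h d) := QuotientObj.Hom.ext rfl (by
    funext A (x : Trivialization (h - d) d X.X A)
    exact Trivialization.pullback_id (.of_isIso (𝟙 X.X)) x)
  map_comp {Z Y X : DispObj p n h d} m m' := QuotientObj.Hom.ext rfl (by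
    funext A (x : Trivialization (h - d) d Z.X A)
    exact Trivialization.pullback_comp m'.2 m.2 (m ≫ m').2 x)
  w := rfl

instance : (torsorFunctor.{u} p n h d).toFunctor.Faithful where
  map_injective {_ _} m m' e :=
    Subtype.ext (Trivialization.torsorMap_injective (c := h - d) (d := d) (hm := m.2) (hm' := m'.2) e)

instance : (torsorFunctor.{u} p n h d).toFunctor.Full where
  map_surjective η := by
    obtain ⟨m, hm, e⟩ := Trivialization.torsorMap_surjective (c := h - d) (d := d) η
    exact ⟨⟨m, hm⟩, e⟩

end DispToQuotient

/-! ### The torsor of the display of a matrix is trivial. -/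

section Standard

variable {p n c d : ℕ} [Fact p.Prime] [NeZero n]

/-- The tautological trivialization of the display of a matrix. -/
noncomputable def Trivialization.std {R : Alg.{u} p} (Ψ : GL (Fin c ⊕ Fin d) (W p n R)) :
    Trivialization c d ⟨R, Disp.std Ψ⟩ R :=
  ⟨Ψ, 𝟙 _, .of_isIso _⟩

/-- The trivialization of a torsor given by a section. -/
def QuotientObj.ofSection {𝒢 : GSpace.{u} p} (hG : IsEtaleSheaf (𝒢.G ⋙ forget GrpCat.{u}))
    {x : PrequotientObj 𝒢} {P : QuotientObj 𝒢} (s : P.P.obj x.R) (b : P.R ⟶ x.R) (hs : P.π s = b)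
    (hφ : P.φ s = x.x) : PrequotientObj.trivialTorsor hG x ⟶ P :=
  { base := b
    map := fun A z => z.1 • P.P.map z.2 s
    naturality := fun a z => by
      rw [P.map_smul, ← Functor.map_comp_apply]
      rfl
    map_smul := fun g z => mul_smul g z.1 _
    π_map := fun z => by
      rw [P.π_smul, P.π_map, hs]
      rfl
    φ_map := fun z => by
      rw [P.φ_smul, P.φ_map, hφ]
      rfl }

end Standard

section Comparison

variable (p n h d : ℕ) [Fact p.Prime] [NeZero n] (hd : d ≤ h)

/-- The comparison of the trivial torsor and the torsor of trivializations of the display of a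
matrix. -/
noncomputable def standardHom (x : PrequotientObj (displayGSpace.{u} p n (h - d) d)) :
    PrequotientObj.trivialTorsor (isEtaleSheaf_Gfun p n (h - d) d) x ⟶
      (torsorFunctor.{u} p n h d).obj ((stdFunctor.{u} p n h d hd).obj x) :=
  QuotientObj.ofSection (isEtaleSheaf_Gfun p n (h - d) d)
    (P := Trivialization.torsor (h - d) d ((stdFunctor.{u} p n h d hd).obj x).X _)
    (Trivialization.std (c := h - d) (d := d) x.x : Trivialization (h - d) d _ _)
    (𝟙 x.R) rfl rfl

theorem standardHom_isIso (x : PrequotientObj (displayGSpace.{u} p n (h - d) d)) :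
    IsIso (standardHom p n h d hd x) := by
  have : IsIso (QuotientObj.Hom.base (standardHom p n h d hd x)) :=
    inferInstanceAs (IsIso (𝟙 x.R))
  exact QuotientObj.Hom.isIso _

/-- By equivariance everything reduces to the tautological trivializations. The one of `y`, composed
with the morphism with matrix `g`, is `g` applied to the base change of the one of `x`. -/
theorem standardHom_naturality {y x : PrequotientObj (displayGSpace.{u} p n (h - d) d)} (m : y ⟶ x) :
    ((prequotientToQuotient (displayGSpace.{u} p n (h - d) d)
      (isEtaleSheaf_Gfun p n (h - d) d)).map m : PrequotientObj.trivialTorsor _ y ⟶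
        PrequotientObj.trivialTorsor _ x) ≫ standardHom p n h d hd x =
      standardHom p n h d hd y ≫
        (torsorFunctor.{u} p n h d).map ((stdFunctor.{u} p n h d hd).map m) := by
  refine QuotientObj.Hom.ext ?_ ?_
  · exact (Category.id_comp _).trans (Category.comp_id _).symm
  funext A (z : (displayGSpace.{u} p n (h - d) d).G.obj A × (y.R ⟶ A))
  let x₀ : Trivialization (h - d) d ⟨x.R, std (c := h - d) (d := d) x.x⟩ x.R := .std x.x
  let y₀ : Trivialization (h - d) d ⟨y.R, std (c := h - d) (d := d) y.x⟩ y.R := .std y.x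
  let m₀ := ((stdFunctor.{u} p n h d hd).map m)
  let g : (displayGSpace.{u} p n (h - d) d).G.obj y.R := m.g
  have hm : IsStdHom m.base (Units.val (α := BlockMat p n (h - d) d y.R) g) x₀.Ψ y₀.Ψ :=
    displayGSpace_hom_eq m m.g rfl x.x y.x rfl rfl
  have e : y₀.pullback m₀.2 = g • x₀.map m.base := by
    rw [← Trivialization.move_eq_smul x₀ hm]
    refine (Trivialization.pullback_eq (x := y₀) m₀.2 ?_).symm
    exact (Category.id_comp _).trans (Category.comp_id _).symm
  change (z.1 * (displayGSpace.{u} p n (h - d) d).G.map z.2 g) • x₀.map (m.base ≫ z.2) =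
    (z.1 • y₀.map z.2).pullback m₀.2
  have h₁ : (z.1 • y₀.map z.2).pullback m₀.2 = z.1 • (y₀.pullback m₀.2).map z.2 :=
    (Trivialization.pullback_move m₀.2 _ (IsStdHom.smul z.1 _)).trans
      (congrArg (fun w => z.1 • w) (Trivialization.pullback_move m₀.2 y₀ (IsStdHom.map z.2 _)))
  rw [h₁, e]
  refine (mul_smul z.1 _ _).trans (congrArg (fun w => z.1 • w) ?_)
  exact (congrArg (fun w => _ • w) (Trivialization.map_comp m.base z.2 x₀)).trans
    (Trivialization.map_smul z.2 g (x₀.map m.base)).symm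

/-- The functor from displays to torsors sends the display of a matrix to the trivial torsor. -/
theorem exists_standard_iso :
    ∃ β : (prequotientToQuotient (displayGSpace.{u} p n (h - d) d)
        (isEtaleSheaf_Gfun p n (h - d) d)).toFunctor ≅
      (stdFunctor.{u} p n h d hd).toFunctor ⋙ (torsorFunctor.{u} p n h d).toFunctor,
    ∀ x, (quotientStack _).p.IsHomLift (𝟙 ((prequotient _).p.obj x)) (β.hom.app x) := by
  exact ⟨NatIso.ofComponents
    (fun x => @asIso _ _ _ _ (standardHom p n h d hd x) (standardHom_isIso p n h d hd x))
    fun m => standardHom_naturality p n h d hd m, fun x => IsHomLift.of_fac _ _ _ rfl rfl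
      ((Category.id_comp _).trans (Category.comp_id _)).symm⟩

end Comparison

/-! ### Descent of modules given by cocycles -/

section Descent

/-- Finiteness and flatness descend, so only finite presentation is missing. The kernel of a
surjection from a free module becomes a direct summand of a free module over `B`, hence finite,
hence is finite over `R`. -/
theorem projective_of_faithfullyFlat (R B N : Type*) [CommRing R] [CommRing B] [Algebra R B]
    [Module.FaithfullyFlat R B] [AddCommGroup N] [Module R N] [Module.Finite B (B ⊗[R] N)]
    [Module.Projective B (B ⊗[R] N)] : Module.Finite R N ∧ Module.Projective R N := by
  have hN : Module.Finite R N := .of_finite_tensorProduct_of_faithfullyFlat B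
  have : Module.Flat R N := .of_flat_tensorProduct R N B
  obtain ⟨k, φ, hφ⟩ := Module.Finite.exists_fin' R N
  let K := LinearMap.ker φ
  have hsurj : Function.Surjective (φ.baseChange B) := LinearMap.lTensor_surjective B hφ
  obtain ⟨s, hs⟩ := Module.projective_lifting_property (φ.baseChange B) LinearMap.id hsurj
  have hex : Function.Exact (K.subtype.lTensor B) (φ.lTensor B) :=
    Module.Flat.lTensor_exact B (LinearMap.exact_subtype_ker_map φ)
  have hinj : Function.Injective (K.subtype.lTensor B) :=
    Module.Flat.lTensor_preserves_injective_linearMap _ K.injective_subtype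
  let e : B ⊗[R] (Fin k → R) →ₗ[B] B ⊗[R] (Fin k → R) := LinearMap.id - s ∘ₗ φ.baseChange B
  have he : ∀ x, ∃ y, K.subtype.baseChange B y = e x := fun x => by
    refine (hex (e x)).1 ?_
    change φ.baseChange B (x - s (φ.baseChange B x)) = 0
    rw [map_sub]
    exact sub_eq_zero.2 (LinearMap.congr_fun hs (φ.baseChange B x)).symm
  have hinj' : Function.Injective (K.subtype.baseChange B) := hinj
  let r : B ⊗[R] (Fin k → R) →ₗ[B] B ⊗[R] K :=
    (LinearEquiv.ofInjective _ hinj').symm.toLinearMap ∘ₗ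
      e.codRestrict (LinearMap.range (K.subtype.baseChange B)) he
  have hr : Function.Surjective r := fun y => by
    refine ⟨K.subtype.baseChange B y, hinj' ?_⟩
    have h₁ : φ.baseChange B (K.subtype.baseChange B y) = 0 := (hex _).2 ⟨y, rfl⟩
    have h₂ : ∀ z, K.subtype.baseChange B (r z) = e z := fun z =>
      congrArg Subtype.val (LinearEquiv.apply_symm_apply
        (LinearEquiv.ofInjective (K.subtype.baseChange B) hinj')
        (e.codRestrict (LinearMap.range (K.subtype.baseChange B)) he z))
    rw [h₂]
    change _ - s (φ.baseChange B _) = _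
    rw [h₁, map_zero, sub_zero]
    rfl
  have : Module.Finite B (B ⊗[R] K) := .of_surjective r hr
  have hK : Module.Finite R K := .of_finite_tensorProduct_of_faithfullyFlat B
  have : Module.FinitePresentation R N :=
    Module.finitePresentation_of_surjective φ hφ (Module.Finite.iff_fg.1 hK)
  exact ⟨hN, Module.Flat.projective_of_finitePresentation⟩

variable {p : ℕ} [Fact p.Prime] {R B : Alg.{u} p}

/-- A cocycle with values in matrices along `R → B`. -/
structure Cocycle (f : R ⟶ B) (ι : Type) [Fintype ι] [DecidableEq ι] where
  /-- The matrices. -/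
  M : ∀ {E : Alg.{u} p} (a b : B ⟶ E), f ≫ a = f ≫ b → Matrix ι ι E
  map : ∀ {E E' : Alg.{u} p} (a b : B ⟶ E) (h : f ≫ a = f ≫ b) (k : E ⟶ E')
    (h' : f ≫ a ≫ k = f ≫ b ≫ k) (i j), k (M a b h i j) = M (a ≫ k) (b ≫ k) h' i j
  mul : ∀ {E : Alg.{u} p} (a b c : B ⟶ E) (h : f ≫ a = f ≫ b) (h' : f ≫ b = f ≫ c),
    M b c h' * M a b h = M a c (h.trans h')
  one : ∀ {E : Alg.{u} p} (a : B ⟶ E), M a a rfl = 1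

namespace Cocycle

variable {f : R ⟶ B} {ι : Type} [Fintype ι] [DecidableEq ι] (C : Cocycle f ι)

theorem M_congr {E : Alg.{u} p} {a b a' b' : B ⟶ E} (h : f ≫ a = f ≫ b) (ha : a = a')
    (hb : b = b') (h' : f ≫ a' = f ≫ b') : C.M a b h = C.M a' b' h' := by
  subst ha hb; rfl

/-- Vectors that descend. -/
def Invariant (x : ι → B) : Prop :=
  ∀ (E : Alg.{u} p) (a b : B ⟶ E) (h : f ≫ a = f ≫ b), (fun i => b (x i)) = C.M a b h *ᵥ fun i => a (x i)

/-- Descent of the free module twisted by a cocycle. -/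
theorem exists_descent (hf : (f.hom : R →+* B).FaithfullyFlat) :
    ∃ (N : Type u) (_ : AddCommGroup N) (_ : Module R N) (u : N →ₛₗ[(f.hom : R →+* B)] (ι → B)),
      Module.Finite R N ∧ Module.Projective R N ∧ LinearizationBijective u ∧
        ∀ x, C.Invariant x ↔ ∃ y, u y = x := by
  let _ : Algebra R B := (f.hom : R →+* B).toAlgebra
  have : Module.FaithfullyFlat R B := hf
  have : IsScalarTower (ZMod p) R B :=
    IsScalarTower.of_algebraMap_eq fun r => (f.hom.commutes r).symm
  -- `B ⊗ B` is the universal overlap: any pair `a`, `b` agreeing on `R` factors through it, so the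
  -- single matrix `G` determines the cocycle.
  let p₁ : B ⟶ CommAlgCat.of (ZMod p) (B ⊗[R] B) :=
    CommAlgCat.ofHom (Algebra.TensorProduct.includeLeft (R := R) (S := ZMod p))
  let p₂ : B ⟶ CommAlgCat.of (ZMod p) (B ⊗[R] B) :=
    CommAlgCat.ofHom ((Algebra.TensorProduct.includeRight (R := R)).restrictScalars (ZMod p))
  have h₁₂ : f ≫ p₁ = f ≫ p₂ := by
    ext r
    exact ((Algebra.TensorProduct.includeLeft (R := R) (S := R) (A := B)
            (B := B)).commutes r).trans ((Algebra.TensorProduct.includeRight (R := R)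
            (A := B) (B := B)).commutes r).symm
  have hl (x : B) : p₁ x = x ⊗ₜ 1 := rfl
  have hr (x : B) : p₂ x = 1 ⊗ₜ x := rfl
  obtain ⟨G, hG⟩ : ∃ G : Matrix ι ι (B ⊗[R] B), G = C.M p₁ p₂ h₁₂ := ⟨_, rfl⟩
  -- Along the multiplication `B ⊗ B → B` the matrix `G` becomes the identity.
  have hmul : ∀ x : ι → B, (fun i => Algebra.TensorProduct.lmul' (S := B) R
      ((G *ᵥ fun j => x j ⊗ₜ[R] (1 : B)) i)) = x := by
    intro x
    obtain ⟨m, hm⟩ : ∃ m : CommAlgCat.of (ZMod p) (B ⊗[R] B) ⟶ B,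
        ∀ z, m z = Algebra.TensorProduct.lmul' (S := B) R z :=
      ⟨CommAlgCat.ofHom ((Algebra.TensorProduct.lmul' (S := B) R).restrictScalars (ZMod p)),
        fun _ => rfl⟩
    have e₁ : p₁ ≫ m = 𝟙 B := by
      ext z; exact (hm _).trans ((Algebra.TensorProduct.lmul'_apply_tmul z 1).trans (mul_one z))
    have e₂ : p₂ ≫ m = 𝟙 B := by
      ext z; exact (hm _).trans ((Algebra.TensorProduct.lmul'_apply_tmul 1 z).trans (one_mul z))
    have hm1 : ∀ i j, m (G i j) = (1 : Matrix ι ι B) i j := by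
      intro i j
      rw [hG, C.map _ _ _ m (by rw [e₁, e₂]), C.M_congr _ e₁ e₂ rfl, C.one]
    funext i
    rw [← hm]
    simp only [Matrix.mulVec, dotProduct, map_sum, map_mul, hm1]
    have : ∀ j, m (x j ⊗ₜ[R] (1 : B)) = x j := fun j => congrArg (fun q : B ⟶ B => q (x j)) e₁
    simp only [this, Matrix.one_apply, ite_mul, one_mul, zero_mul, Finset.sum_ite_eq,
      Finset.mem_univ, if_true]
  -- The descended module is the kernel of `θ`, the vectors with `1 ⊗ x = G (x ⊗ 1)`.
  let θ : (ι → B) →ₗ[R] (ι → B ⊗[R] B) :=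
    { toFun := fun x => (fun i => 1 ⊗ₜ x i) - G *ᵥ fun j => x j ⊗ₜ 1
      map_add' := fun x y => by
        funext i
        simp only [Pi.add_apply, Pi.sub_apply, TensorProduct.tmul_add, TensorProduct.add_tmul,
          Matrix.mulVec, dotProduct, mul_add, Finset.sum_add_distrib]
        ring
      map_smul' := fun r x => by
        funext i
        have h (j) : (r • x j) ⊗ₜ[R] (1 : B) = r • x j ⊗ₜ[R] (1 : B) :=
          (TensorProduct.smul_tmul' r (x j) (1 : B)).symm
        simp only [Pi.smul_apply, Pi.sub_apply, TensorProduct.tmul_smul, smul_sub, h,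
          Matrix.mulVec, dotProduct, mul_smul_comm, Finset.smul_sum, RingHom.id_apply] }
  have hθ : ∀ x i, θ x i = 1 ⊗ₜ x i - ∑ j, G i j * (x j ⊗ₜ 1) := fun _ _ => rfl
  let N := LinearMap.ker θ
  have hN : ∀ x, C.Invariant x ↔ x ∈ N := by
    intro x
    refine ⟨fun hx => ?_, fun hx E a b hab => ?_⟩
    · have := hx _ p₁ p₂ h₁₂
      rw [← hG] at this
      exact LinearMap.mem_ker.2 (sub_eq_zero.2 this)
    · let _ : Algebra R E := ((f ≫ a).hom : R →+* E).toAlgebra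
      let a' : B →ₐ[R] E := { (a.hom : B →+* E) with commutes' := fun r => rfl }
      let b' : B →ₐ[R] E :=
        { (b.hom : B →+* E) with
          commutes' := fun r => (congrArg (fun q : R ⟶ E => q r) hab).symm }
      have : IsScalarTower (ZMod p) R E :=
        IsScalarTower.of_algebraMap_eq fun r => ((f ≫ a).hom.commutes r).symm
      obtain ⟨m, hm⟩ : ∃ m : CommAlgCat.of (ZMod p) (B ⊗[R] B) ⟶ E,
          ∀ z, m z = Algebra.TensorProduct.productMap a' b' z :=
        ⟨CommAlgCat.ofHom ((Algebra.TensorProduct.productMap a' b').restrictScalars (ZMod p)),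
          fun _ => rfl⟩
      have e₁ : p₁ ≫ m = a := by
        ext z
        exact (hm _).trans (Algebra.TensorProduct.productMap_left_apply a' b' z)
      have e₂ : p₂ ≫ m = b := by
        ext z
        exact (hm _).trans (Algebra.TensorProduct.productMap_right_apply a' b' z)
      have hmG : ∀ i j, m (G i j) = C.M a b hab i j := by
        intro i j
        rw [hG, C.map _ _ _ m (by rw [e₁, e₂, hab]), C.M_congr _ e₁ e₂ hab]
      have ha : ∀ z, a z = m (z ⊗ₜ[R] (1 : B)) := fun z =>
        (congrArg (fun q : B ⟶ E => q z) e₁).symm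
      have hb : ∀ z, b z = m ((1 : B) ⊗ₜ[R] z) := fun z =>
        (congrArg (fun q : B ⟶ E => q z) e₂).symm
      funext i
      have := congrArg m (sub_eq_zero.1 ((hθ x i).symm.trans (congrFun (LinearMap.mem_ker.1 hx) i)))
      simp only [map_sum, map_mul, hmG, ← ha, ← hb] at this
      exact this
  let u : N →ₛₗ[(f.hom : R →+* B)] (ι → B) :=
    { toFun := fun y => y.1, map_add' := fun _ _ => rfl, map_smul' := fun r y => by
        funext i
        exact Algebra.smul_def r (y.1 i) }
  let π : B ⊗[R] (ι → B) ≃ₗ[B] (ι → B ⊗[R] B) := TensorProduct.piRight R B B fun _ => B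
  have hπ : ∀ (b : B) (x : ι → B) (i : ι), π (b ⊗ₜ x) i = b ⊗ₜ x i := fun _ _ _ => rfl
  let μ : B ⊗[R] (ι → B) →ₗ[B] (ι → B) := 
    LinearMap.pi fun i => (Algebra.TensorProduct.lmul'' R (S := B)).toLinearMap ∘ₗ
      LinearMap.proj i ∘ₗ π.toLinearMap
  have hμ : ∀ w i, μ w i = Algebra.TensorProduct.lmul' (S := B) R (π w i) := fun _ _ => rfl
  have hinj : Function.Injective (N.subtype.lTensor B) :=
    Module.Flat.lTensor_preserves_injective_linearMap _ N.injective_subtype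
  have hex : Function.Exact (N.subtype.lTensor B) (θ.lTensor B) :=
    Module.Flat.lTensor_exact B (LinearMap.exact_subtype_ker_map θ)
  -- On `B ⊗ N` an element is recovered from its image under the multiplication map `μ`. This gives
  -- the injectivity of `B ⊗ N → B^ι`.
  have hker : ∀ w : B ⊗[R] N, π (N.subtype.baseChange B w) =
      G *ᵥ fun j => μ (N.subtype.baseChange B w) j ⊗ₜ 1 := by
    intro w
    induction w with
    | zero => 
      rw [map_zero, map_zero, map_zero]
      funext i
      simp [Matrix.mulVec, dotProduct]
    | add x y hx hy =>
      rw [map_add, map_add, map_add, hx, hy, ← Matrix.mulVec_add]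
      congr 1
      funext j
      exact (TensorProduct.add_tmul _ _ _).symm
    | tmul b y =>
      funext i
      have h₀ := sub_eq_zero.1 ((hθ y.1 i).symm.trans (congrFun (LinearMap.mem_ker.1 y.2) i))
      have h₁ : ∀ j, μ (N.subtype.baseChange B (b ⊗ₜ y)) j = b * y.1 j := fun j => by
        rw [hμ]
        exact Algebra.TensorProduct.lmul'_apply_tmul _ _
      simp only [Matrix.mulVec, dotProduct, h₁]
      calc b ⊗ₜ[R] y.1 i = (b ⊗ₜ[R] (1 : B)) * ((1 : B) ⊗ₜ[R] y.1 i) := by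
            rw [Algebra.TensorProduct.tmul_mul_tmul, mul_one, one_mul]
        _ = _ := by
          rw [h₀, Finset.mul_sum]
          refine Finset.sum_congr rfl fun j _ => ?_
          rw [mul_left_comm, Algebra.TensorProduct.tmul_mul_tmul, mul_one]
  let π' : B ⊗[R] (ι → B ⊗[R] B) ≃ₗ[B] (ι → B ⊗[R] (B ⊗[R] B)) :=
    TensorProduct.piRight R B B fun _ => B ⊗[R] B
  let r₁₂ : CommAlgCat.of (ZMod p) (B ⊗[R] B) ⟶ CommAlgCat.of (ZMod p) (B ⊗[R] (B ⊗[R] B)) :=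
    CommAlgCat.ofHom ((Algebra.TensorProduct.map (AlgHom.id R B)
      (Algebra.TensorProduct.includeLeft (S := R))).restrictScalars (ZMod p))
  let r₁₃ : CommAlgCat.of (ZMod p) (B ⊗[R] B) ⟶ CommAlgCat.of (ZMod p) (B ⊗[R] (B ⊗[R] B)) :=
    CommAlgCat.ofHom ((Algebra.TensorProduct.map (AlgHom.id R B)
      Algebra.TensorProduct.includeRight).restrictScalars (ZMod p))
  let r₂₃ : CommAlgCat.of (ZMod p) (B ⊗[R] B) ⟶ CommAlgCat.of (ZMod p) (B ⊗[R] (B ⊗[R] B)) :=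
    CommAlgCat.ofHom ((Algebra.TensorProduct.includeRight (R := R)).restrictScalars (ZMod p))
  have h_r₁₂ (x y : B) : r₁₂ (x ⊗ₜ[R] y) = x ⊗ₜ (y ⊗ₜ 1) := rfl
  have h_r₁₃ (x y : B) : r₁₃ (x ⊗ₜ[R] y) = x ⊗ₜ (1 ⊗ₜ y) := rfl
  have h_r₂₃ (z) : r₂₃ z = 1 ⊗ₜ z := rfl
  have hΘ : ∀ w i, π' (θ.lTensor B w) i = r₁₃ (π w i) - ∑ j, r₂₃ (G i j) * r₁₂ (π w j) := by
    intro w i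
    induction w with
    | zero => simp
    | add x y hx hy =>
      simp only [map_add, Pi.add_apply, hx, hy, mul_add, Finset.sum_add_distrib]
      ring
    | tmul b x =>
      simp only [hπ, h_r₁₂, h_r₁₃, h_r₂₃]
      change b ⊗ₜ[R] (θ x i) = _
      rw [hθ, TensorProduct.tmul_sub, TensorProduct.tmul_sum]
      refine congrArg₂ _ rfl (Finset.sum_congr rfl fun j _ => ?_)
      exact (congrArg₂ _ (one_mul b).symm rfl).trans
        (Algebra.TensorProduct.tmul_mul_tmul (1 : B) b (G i j) (x j ⊗ₜ[R] 1)).symm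
  -- The preimage of `x` is `G (x ⊗ 1)`. The cocycle identity in the triple tensor product places it
  -- in the kernel of `B ⊗ θ`, which is `B ⊗ N` by flatness.
  have hrange : ∀ x : ι → B, ∃ w : B ⊗[R] N, μ (N.subtype.baseChange B w) = x := by
    intro x
    obtain ⟨v, hv⟩ := π.surjective (G *ᵥ fun j => x j ⊗ₜ[R] (1 : B))
    have hv₀ : θ.lTensor B v = 0 := by
      refine π'.map_eq_zero_iff.1 (funext fun i => ?_)
      have hGx : ∀ j, π v j = ∑ k, G j k * p₁ (x k) := fun j => congrFun hv j
      rw [hΘ, hGx]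
      simp only [hGx, map_sum, map_mul]
      have e₁ : p₁ ≫ r₁₃ = p₁ ≫ r₁₂ := rfl
      have e₂ : p₂ ≫ r₁₂ = p₁ ≫ r₂₃ := rfl
      have e₃ : p₂ ≫ r₁₃ = p₂ ≫ r₂₃ := rfl
      have t (r : CommAlgCat.of (ZMod p) (B ⊗[R] B) ⟶
          CommAlgCat.of (ZMod p) (B ⊗[R] (B ⊗[R] B))) : f ≫ p₁ ≫ r = f ≫ p₂ ≫ r := by
        rw [← Category.assoc, h₁₂, Category.assoc]
      have hm (r : CommAlgCat.of (ZMod p) (B ⊗[R] B) ⟶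
          CommAlgCat.of (ZMod p) (B ⊗[R] (B ⊗[R] B))) (i j) :
          r (G i j) = C.M (p₁ ≫ r) (p₂ ≫ r) (t r) i j := by rw [hG, C.map]
      have t₁ := t r₁₂
      have t₂ : f ≫ p₂ ≫ r₁₂ = f ≫ p₂ ≫ r₂₃ := t r₂₃
      have hprod : C.M _ _ t₂ * C.M _ _ t₁ = C.M _ _ (t r₁₃) := C.mul _ _ _ _ _
      have h₁₃ (k) : r₁₃ (G i k) = ∑ j, r₂₃ (G i j) * r₁₂ (G j k) := by
        rw [hm, ← hprod, Matrix.mul_apply]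
        exact Finset.sum_congr rfl fun j _ => congrArg₂ _
          ((hm r₂₃ i j).trans (congrFun (congrFun (C.M_congr _ e₂.symm rfl t₂) i) j)).symm
          (hm r₁₂ j k).symm
      have hx (k) : r₁₃ (p₁ (x k)) = r₁₂ (p₁ (x k)) := rfl
      simp only [h₁₃, hx, Finset.mul_sum, Finset.sum_mul, mul_assoc]
      rw [Finset.sum_comm, sub_self]
      rfl
    obtain ⟨w, hw⟩ := (hex v).1 hv₀
    have hw' : N.subtype.baseChange B w = v := hw
    refine ⟨w, ?_⟩
    rw [hw']
    exact (funext fun i => by rw [hμ, hv]).trans (hmul x)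
  let e : B ⊗[R] N ≃ₗ[B] (ι → B) := LinearEquiv.ofBijective (μ ∘ₗ N.subtype.baseChange B) ⟨by
    rw [← LinearMap.ker_eq_bot, LinearMap.ker_eq_bot']
    intro w hw
    have h₀ : π (N.subtype.baseChange B w) = 0 := by
      rw [hker w]
      have : μ (N.subtype.baseChange B w) = 0 := hw
      rw [this]
      funext i
      simp [Matrix.mulVec, dotProduct]
    exact hinj ((π.map_eq_zero_iff.1 h₀).trans (map_zero _).symm), hrange⟩
  have he : ∀ y, e (1 ⊗ₜ y) = u y := fun y => by
    funext i
    have h₀ : e (1 ⊗ₜ y) i = Algebra.TensorProduct.lmul' (S := B) R (1 ⊗ₜ[R] y.1 i) := rfl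
    rw [h₀, Algebra.TensorProduct.lmul'_apply_tmul, one_mul]
    rfl
  have : Module.Finite B (B ⊗[R] N) := .equiv e.symm
  have : Module.Projective B (B ⊗[R] N) := .of_equiv e.symm
  obtain ⟨h₁, h₂⟩ := projective_of_faithfullyFlat R B N
  exact ⟨N, inferInstance, inferInstance, u, h₁, h₂, LinearizationBijective.of_equiv e he,
    fun x => (hN x).trans ⟨fun h => ⟨⟨x, h⟩, rfl⟩, fun ⟨y, hy⟩ => hy ▸ y.2⟩⟩

end Cocycle

end Descent

/-! ### Cocycles are locally trivial -/

section Coboundary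

variable {p : ℕ} [Fact p.Prime] {R B : Alg.{u} p} {f : R ⟶ B}

/-- It suffices to test `t` on the two maps `B → B ⊗ B`, whose equalizer is `R` by faithfully flat
descent. -/
theorem exists_of_invariant (hf : (f.hom : R →+* B).FaithfullyFlat) (t : B)
    (ht : ∀ (E : Alg.{u} p) (a b : B ⟶ E), f ≫ a = f ≫ b → b t = a t) : ∃ r, f r = t := by
  let _ : Algebra R B := (f.hom : R →+* B).toAlgebra
  have : Module.FaithfullyFlat R B := hf
  have : IsScalarTower (ZMod p) R B :=
    IsScalarTower.of_algebraMap_eq fun r => (f.hom.commutes r).symm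
  refine (Algebra.IsEffective.of_faithfullyFlat (R := R) (S := B) t).1 ?_
  rw [Algebra.TensorProduct.includeLeftSubRight_apply, sub_eq_zero]
  exact (ht (CommAlgCat.of (ZMod p) (B ⊗[R] B))
    (CommAlgCat.ofHom (Algebra.TensorProduct.includeLeft (R := R) (S := ZMod p)))
    (CommAlgCat.ofHom ((Algebra.TensorProduct.includeRight (R := R)).restrictScalars (ZMod p)))
    (by
      ext a
      exact ((Algebra.TensorProduct.includeLeft (R := R) (S := R) (A := B)
        (B := B)).commutes a).trans ((Algebra.TensorProduct.includeRight (R := R)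
        (A := B) (B := B)).commutes a).symm)).symm

namespace Cocycle

variable {ι : Type} [Fintype ι] [DecidableEq ι] (C : Cocycle f ι)

/-- A cocycle with values in vectors, twisted by a cocycle with values in matrices, is a
coboundary. -/
theorem exists_eq_sub (hf : (f.hom : R →+* B).FaithfullyFlat)
    (z : ∀ {E : Alg.{u} p} (a b : B ⟶ E), f ≫ a = f ≫ b → ι → E)
    (hmap : ∀ {E E' : Alg.{u} p} (a b : B ⟶ E) (h : f ≫ a = f ≫ b) (k : E ⟶ E')
      (h' : f ≫ a ≫ k = f ≫ b ≫ k) (i), k (z a b h i) = z (a ≫ k) (b ≫ k) h' i)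
    (hmul : ∀ {E : Alg.{u} p} (a b c : B ⟶ E) (h : f ≫ a = f ≫ b) (h' : f ≫ b = f ≫ c),
      z a c (h.trans h') = z b c h' + C.M b c h' *ᵥ z a b h) :
    ∃ y : ι → B, ∀ (E : Alg.{u} p) (a b : B ⟶ E) (h : f ≫ a = f ≫ b),
      z a b h = (fun i => b (y i)) - C.M a b h *ᵥ fun i => a (y i) := by
  -- The vector cocycle is encoded as an extension `(C, z; 0, 1)` of the trivial cocycle by `C`. A
  -- splitting is an invariant vector with last coordinate `1`.
  let C' : Cocycle f (ι ⊕ Unit) :=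
    { M := fun {E} a b h => Matrix.fromBlocks (C.M a b h) (Matrix.of fun i _ => z a b h i) 0 1
      map := fun a b h k h' i j => by
        rcases i with i | i <;> rcases j with j | j
        · exact C.map a b h k h' i j
        · exact hmap a b h k h' i
        · exact map_zero _
        · exact map_one _
      mul := fun a b c h h' => by
        rw [Matrix.fromBlocks_multiply]
        simp only [Matrix.mul_zero, add_zero, Matrix.zero_mul, Matrix.mul_one, zero_add, C.mul]
        congr 1
        ext i j
        rw [hmul a b c h h', add_comm]
        rfl
      one := fun a => by
        have h := hmul a a a rfl rfl
        rw [C.one, Matrix.one_mulVec, left_eq_add] at h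
        rw [C.one, h]
        exact Matrix.fromBlocks_one }
  obtain ⟨N, _, _, u, -, -, hu, hinv⟩ := C'.exists_descent hf
  have hsplit : ∀ x, C'.Invariant x → ∀ (E : Alg.{u} p) (a b : B ⟶ E) (h : f ≫ a = f ≫ b),
      b (x (.inr ())) = a (x (.inr ())) ∧ ∀ i, b (x (.inl i)) =
        (C.M a b h *ᵥ fun j => a (x (.inl j))) i + z a b h i * a (x (.inr ())) := by
    intro x hx E a b h
    have h₀ := hx E a b h
    refine ⟨?_, fun i => ?_⟩
    · have := congrFun h₀ (.inr ())
      simpa [C', Matrix.mulVec, dotProduct] using this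
    · have := congrFun h₀ (.inl i)
      simpa [C', Matrix.mulVec, dotProduct] using this
  let _ : Algebra R B := (f.hom : R →+* B).toAlgebra
  have : Module.FaithfullyFlat R B := hf
  have hr : ∀ y : N, ∃ r, f r = u y (.inr ()) := fun y =>
    exists_of_invariant hf _ fun E a b h => (hsplit _ ((hinv _).2 ⟨y, rfl⟩) E a b h).1
  let J : Ideal R :=
    { carrier := {r | ∃ y : N, f r = u y (.inr ())}
      add_mem' := by
        rintro r s ⟨y, hy⟩ ⟨y', hy'⟩
        exact ⟨y + y', by rw [map_add, map_add, hy, hy']; rfl⟩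
      zero_mem' := ⟨0, by rw [map_zero, map_zero]; rfl⟩
      smul_mem' := by
        rintro r s ⟨y, hy⟩
        refine ⟨r • y, ?_⟩
        rw [LinearMap.map_smulₛₗ, smul_eq_mul, map_mul, hy]
        rfl }
  -- The last coordinates of invariant vectors form an ideal of `R`. Invariant vectors span over
  -- `B`, so this ideal generates the unit ideal of `B`, and faithful flatness makes it the unit
  -- ideal of `R`.
  have hJ : J = ⊤ := by
    have h₁ : J.map (algebraMap R B) = ⊤ := by
      rw [Ideal.eq_top_iff_one]
      have h₂ : ∀ x ∈ Submodule.span B (Set.range u), x (.inr ()) ∈ J.map (algebraMap R B) := by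
        intro x hx
        induction hx using Submodule.span_induction with
        | mem x hx =>
          obtain ⟨y, rfl⟩ := hx
          obtain ⟨r, hr⟩ := hr y
          rw [← hr]
          exact Ideal.mem_map_of_mem (algebraMap R B) ⟨y, hr⟩
        | zero => exact zero_mem _
        | add x y _ _ hx hy => exact add_mem hx hy
        | smul r x _ hx => exact Ideal.mul_mem_left _ _ hx
      exact h₂ (fun _ => 1) (hu.span_range ▸ Submodule.mem_top)
    rw [← Ideal.comap_map_eq_self_of_faithfullyFlat (B := B) J, h₁, Ideal.comap_top]
  obtain ⟨y, hy⟩ : (1 : R) ∈ J := hJ ▸ Submodule.mem_top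
  refine ⟨fun i => u y (.inl i), fun E a b h => funext fun i => ?_⟩
  have h₁ := (hsplit _ ((hinv _).2 ⟨y, rfl⟩) E a b h).2 i
  rw [← hy, map_one, map_one, mul_one] at h₁
  exact (eq_sub_iff_add_eq'.2 h₁.symm)

end Cocycle

variable (f) in
/-- An additive functor on `𝔽_p`-algebras with a descent datum along `f`. -/
structure Twist where
  /-- The functor. -/
  Q : Alg.{u} p → Type u
  [group : ∀ E, AddCommGroup (Q E)]
  /-- The functor on maps. -/
  map : ∀ {E E' : Alg.{u} p}, (E ⟶ E') → Q E →+ Q E'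
  map_comp : ∀ {E E' E'' : Alg.{u} p} (k : E ⟶ E') (k' : E' ⟶ E'') (x : Q E),
    map k' (map k x) = map (k ≫ k') x
  /-- The descent datum. -/
  act : ∀ {E : Alg.{u} p} (a b : B ⟶ E), f ≫ a = f ≫ b → Q E →+ Q E
  act_map : ∀ {E E' : Alg.{u} p} (a b : B ⟶ E) (h : f ≫ a = f ≫ b) (k : E ⟶ E')
    (h' : f ≫ a ≫ k = f ≫ b ≫ k) (x), map k (act a b h x) = act (a ≫ k) (b ≫ k) h' (map k x)
  act_mul : ∀ {E : Alg.{u} p} (a b c : B ⟶ E) (h : f ≫ a = f ≫ b) (h' : f ≫ b = f ≫ c) (x),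
    act b c h' (act a b h x) = act a c (h.trans h') x

attribute [instance] Twist.group

namespace Twist

variable (𝒬 : Twist f)

/-- The failure of `v` to descend. -/
def defect (v : 𝒬.Q B) {E : Alg.{u} p} (a b : B ⟶ E) (h : f ≫ a = f ≫ b) : 𝒬.Q E :=
  𝒬.map b v - 𝒬.act a b h (𝒬.map a v)

theorem defect_sub (v w : 𝒬.Q B) {E : Alg.{u} p} (a b : B ⟶ E) (h : f ≫ a = f ≫ b) :
    𝒬.defect (v - w) a b h = 𝒬.defect v a b h - 𝒬.defect w a b h := by
  simp only [defect, map_sub]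
  abel

/-- If the defect of `v` lies in a subgroup `Fil` with a map to the vectors over the base that
transforms the descent datum into a cocycle, then the defect can be moved into the kernel of this
map by changing `v` by an element of `Fil`. -/
theorem exists_correction {ι : Type} [Fintype ι] [DecidableEq ι] (C : Cocycle f ι)
    (hf : (f.hom : R →+* B).FaithfullyFlat) (Fil : ∀ E, AddSubgroup (𝒬.Q E))
    (coef : ∀ {E}, 𝒬.Q E → ι → E)
    (coef_add : ∀ {E} (x y : 𝒬.Q E), x ∈ Fil E → y ∈ Fil E → coef (x + y) = coef x + coef y)
    (coef_map : ∀ {E E'} (k : E ⟶ E') (x : 𝒬.Q E), coef (𝒬.map k x) = fun i => k (coef x i))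
    (coef_surjective : ∀ y : ι → B, ∃ w ∈ Fil B, coef w = y)
    (map_mem : ∀ {E E'} (k : E ⟶ E') (x : 𝒬.Q E), x ∈ Fil E → 𝒬.map k x ∈ Fil E')
    (act_mem : ∀ {E} (a b : B ⟶ E) (h : f ≫ a = f ≫ b) (x : 𝒬.Q E), x ∈ Fil E →
      𝒬.act a b h x ∈ Fil E)
    (coef_act : ∀ {E} (a b : B ⟶ E) (h : f ≫ a = f ≫ b) (x : 𝒬.Q E), x ∈ Fil E →
      coef (𝒬.act a b h x) = C.M a b h *ᵥ coef x)
    (v : 𝒬.Q B) (hv : ∀ {E : Alg.{u} p} (a b : B ⟶ E) (h : f ≫ a = f ≫ b),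
      𝒬.defect v a b h ∈ Fil E) :
    ∃ w ∈ Fil B, ∀ {E : Alg.{u} p} (a b : B ⟶ E) (h : f ≫ a = f ≫ b),
      𝒬.defect (v - w) a b h ∈ Fil E ∧ coef (𝒬.defect (v - w) a b h) = 0 := by
  have coef_sub : ∀ {E} (x y : 𝒬.Q E), x ∈ Fil E → y ∈ Fil E →
      coef (x - y) = coef x - coef y := fun x y hx hy => by
    rw [eq_sub_iff_add_eq, ← coef_add _ _ (sub_mem hx hy) hy, sub_add_cancel]
  -- The leading coefficient of the defect is a 1-cocycle twisted by `C`, hence the coboundary of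
  -- some `y`. An element of `Fil B` with coefficient `y` is the correction.
  obtain ⟨y, hy⟩ := C.exists_eq_sub hf (fun {E} a b h => coef (𝒬.defect v a b h))
    (fun a b h k h' i => by
      have : 𝒬.map k (𝒬.defect v a b h) = 𝒬.defect v (a ≫ k) (b ≫ k) h' := by
        rw [defect, map_sub, 𝒬.act_map a b h k h', 𝒬.map_comp, 𝒬.map_comp]
        rfl
      rw [← this, coef_map])
    (fun a b c h h' => by
      rw [← coef_act b c h' _ (hv a b h), ← coef_add _ _ (hv b c h') (act_mem _ _ _ _ (hv a b h))]
      congr 1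
      simp only [defect, map_sub, 𝒬.act_mul]
      abel)
  obtain ⟨w, hw, rfl⟩ := coef_surjective y
  have hd : ∀ {E : Alg.{u} p} (a b : B ⟶ E) (h : f ≫ a = f ≫ b), 𝒬.defect w a b h ∈ Fil E :=
    fun a b h => sub_mem (map_mem b w hw) (act_mem a b h _ (map_mem a w hw))
  refine ⟨w, hw, fun {E} a b h => ?_⟩
  rw [defect_sub]
  refine ⟨sub_mem (hv a b h) (hd a b h), ?_⟩
  rw [coef_sub _ _ (hv a b h) (hd a b h), hy E a b h, defect,
    coef_sub _ _ (map_mem b w hw) (act_mem a b h _ (map_mem a w hw)),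
    coef_act _ _ _ _ (map_mem a w hw), coef_map, coef_map, sub_self]

end Twist

end Coboundary

/-! ### Lifting sections of twisted modules along the filtration -/

section Lifting

variable {p n : ℕ} [Fact p.Prime] [NeZero n] {R B : Alg.{u} p} {f : R ⟶ B}

section Cocycle

variable {ι : Type} [Fintype ι] [DecidableEq ι]

theorem frob_pow_apply {E : Type*} [CommRing E] [Algebra (ZMod p) E] (k : ℕ) (x : E) :
    ((frob p E) ^ k : E →+* E) x = x ^ p ^ k := by
  induction k with
  | zero => simp
  | succ k ih =>
    rw [pow_succ', pow_succ, pow_mul]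
    exact congrArg (frob p E) ih

/-- The image of a cocycle under a power of the Frobenius. -/
def Cocycle.frobPow (C : Cocycle f ι) (k : ℕ) : Cocycle f ι where
  M {E} a b h := (C.M a b h).map ((frob p E) ^ k : E →+* E)
  map a b h l h' i j := by
    simp only [Matrix.map_apply, frob_pow_apply, map_pow, C.map a b h l h']
  mul a b c h h' := by rw [← C.mul a b c h h', Matrix.map_mul]
  one a := by rw [C.one, Matrix.map_one _ (map_zero _) (map_one _)]

/-- On the `k`-th graded piece a matrix acts through the `k`-th Frobenius power of its residue, by
the formulas for leading components of sums and products. -/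
theorem coeff_mulVec_of_mem_vfil {E : Type*} [CommRing E] [Algebra (ZMod p) E]
    (M : Matrix ι ι (W p n E)) {k : ℕ} (hk : k < n)
    {x : ι → W p n E} (hx : ∀ i, x i ∈ vfil p n E k) (i : ι) :
    ((M *ᵥ x) i).coeff ⟨k, hk⟩ =
      (((M.map (res p n E)).map ((frob p E) ^ k : E →+* E)) *ᵥ
        fun j => (x j).coeff ⟨k, hk⟩) i := by
  have hs : ∀ s : Finset ι, (∑ j ∈ s, M i j * x j).coeff ⟨k, hk⟩ =
      ∑ j ∈ s, (M i j * x j).coeff ⟨k, hk⟩ := by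
    classical
    intro s
    induction s using Finset.induction_on with
    | empty => exact TruncatedWittVector.coeff_zero (p := p) n E _
    | insert j s hj ih =>
      rw [Finset.sum_insert hj, Finset.sum_insert hj, ← ih]
      exact coeff_add_of_mem_vfil (Ideal.mul_mem_left _ _ (hx j))
        (sum_mem fun l _ => Ideal.mul_mem_left _ _ (hx l)) _ rfl
  refine (hs _).trans (Finset.sum_congr rfl fun j _ => ?_)
  rw [coeff_mul_of_mem_vfil _ (hx j) _ rfl]
  exact congrArg (· * _) (frob_pow_apply k (res p n E (M i j))).symm

end Cocycle

/-- A descent datum on vectors over `W_n` that is triangular for a filtration. -/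
structure TriangularTwist (f : R ⟶ B) (n : ℕ) [NeZero n] (ι ι' : Type) [Fintype ι] [DecidableEq ι]
    [Fintype ι'] [DecidableEq ι'] where
  /-- The first diagonal entry. -/
  A : ∀ {E : Alg.{u} p} (a b : B ⟶ E), f ≫ a = f ≫ b → Matrix ι ι (W p n E)
  /-- The second diagonal entry. -/
  D : ∀ {E : Alg.{u} p} (a b : B ⟶ E), f ≫ a = f ≫ b → Matrix ι' ι' (W p n E)
  /-- The upper right entry. -/
  β : ∀ {E : Alg.{u} p} (a b : B ⟶ E), f ≫ a = f ≫ b → (ι' → W p n E) →+ (ι → W p n E)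
  /-- The lower left entry. -/
  κ : ∀ {E : Alg.{u} p} (a b : B ⟶ E), f ≫ a = f ≫ b → (ι → W p n E) →+ (ι' → W p n E)
  β_mem : ∀ {E : Alg.{u} p} (a b : B ⟶ E) (h : f ≫ a = f ≫ b) (k : ℕ) (y : ι' → W p n E),
    (∀ i, y i ∈ vfil p n E k) → ∀ i, β a b h y i ∈ vfil p n E k
  κ_mem : ∀ {E : Alg.{u} p} (a b : B ⟶ E) (h : f ≫ a = f ≫ b) (k : ℕ) (x : ι → W p n E),
    (∀ i, x i ∈ vfil p n E k) → ∀ i, κ a b h x i ∈ vfil p n E (k + 1)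
  /-- The cocycle given by the residues of the first diagonal entry. -/
  CA : Cocycle f ι
  /-- The cocycle given by the residues of the second diagonal entry. -/
  CD : Cocycle f ι'
  CA_eq : ∀ {E : Alg.{u} p} (a b : B ⟶ E) (h : f ≫ a = f ≫ b),
    CA.M a b h = (A a b h).map (res p n E)
  CD_eq : ∀ {E : Alg.{u} p} (a b : B ⟶ E) (h : f ≫ a = f ≫ b),
    CD.M a b h = (D a b h).map (res p n E)
  /-- The descent datum. -/
  act : ∀ {E : Alg.{u} p} (a b : B ⟶ E), f ≫ a = f ≫ b →
    (ι → W p n E) × (ι' → W p n E) →+ (ι → W p n E) × (ι' → W p n E)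
  act_apply : ∀ {E : Alg.{u} p} (a b : B ⟶ E) (h : f ≫ a = f ≫ b) (x),
    act a b h x = (A a b h *ᵥ x.1 + β a b h x.2, κ a b h x.1 + D a b h *ᵥ x.2)
  act_map : ∀ {E E' : Alg.{u} p} (a b : B ⟶ E) (h : f ≫ a = f ≫ b) (k : E ⟶ E')
    (h' : f ≫ a ≫ k = f ≫ b ≫ k) (x),
    ((fun i => Wm n k ((act a b h x).1 i), fun i => Wm n k ((act a b h x).2 i)) : _ × _) =
      act (a ≫ k) (b ≫ k) h' (fun i => Wm n k (x.1 i), fun i => Wm n k (x.2 i))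
  act_mul : ∀ {E : Alg.{u} p} (a b c : B ⟶ E) (h : f ≫ a = f ≫ b) (h' : f ≫ b = f ≫ c) (x),
    act b c h' (act a b h x) = act a c (h.trans h') x

omit [NeZero n] in
theorem mulVec_mem_vfil {ι ι' : Type} [Fintype ι'] {E : Type*} [CommRing E] [Algebra (ZMod p) E]
    (M : Matrix ι ι' (W p n E)) {k : ℕ} {x : ι' → W p n E} (hx : ∀ i, x i ∈ vfil p n E k) (i : ι) :
    (M *ᵥ x) i ∈ vfil p n E k :=
  sum_mem fun j _ => Ideal.mul_mem_left _ _ (hx j)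

omit [NeZero n] in
theorem Wm_mem_vfil {E E' : Alg.{u} p} (k : E ⟶ E') {l : ℕ} {x : W p n E}
    (hx : x ∈ vfil p n E l) : Wm n k x ∈ vfil p n E' l := by
  rw [mem_vfil] at hx ⊢
  intro i hi
  rw [coeff_mapW, hx i hi, map_zero]

namespace TriangularTwist

variable {ι ι' : Type} [Fintype ι] [DecidableEq ι] [Fintype ι'] [DecidableEq ι']
  (𝒯 : TriangularTwist f n ι ι')

/-- The underlying additive functor with descent datum. -/
noncomputable def twist : Twist f where
  Q E := (ι → W p n E) × (ι' → W p n E)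
  map k := ((Wm n k).toAddMonoidHom.compLeft ι).prodMap ((Wm n k).toAddMonoidHom.compLeft ι')
  map_comp {E E' E''} k k' x := by
    refine Prod.ext (funext fun i => ?_) (funext fun i => ?_)
    · exact (mapW_comp p n (k'.hom : E' →+* E'') (k.hom : E →+* E') (x.1 i)).symm
    · exact (mapW_comp p n (k'.hom : E' →+* E'') (k.hom : E →+* E') (x.2 i)).symm
  act := 𝒯.act
  act_map := 𝒯.act_map
  act_mul := 𝒯.act_mul

variable (p n ι ι') in
/-- The filtration. -/
noncomputable def fil (k l : ℕ) (E : Alg.{u} p) : AddSubgroup ((ι → W p n E) × (ι' → W p n E)) where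
  carrier := {x | (∀ i, x.1 i ∈ vfil p n E k) ∧ ∀ i, x.2 i ∈ vfil p n E l}
  add_mem' hx hy := ⟨fun i => add_mem (hx.1 i) (hy.1 i), fun i => add_mem (hx.2 i) (hy.2 i)⟩
  zero_mem' := ⟨fun _ => zero_mem _, fun _ => zero_mem _⟩
  neg_mem' hx := ⟨fun i => neg_mem (hx.1 i), fun i => neg_mem (hx.2 i)⟩

theorem map_mem {E E' : Alg.{u} p} (k : E ⟶ E') {l m : ℕ} (x : (ι → W p n E) × (ι' → W p n E))
    (hx : x ∈ fil p n ι ι' l m E) : 𝒯.twist.map k x ∈ fil p n ι ι' l m E' :=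
  ⟨fun i => Wm_mem_vfil k (hx.1 i), fun i => Wm_mem_vfil k (hx.2 i)⟩

/-- The conditions on `l` and `m` single out the refined filtration `(k, k) ⊇ (k, k+1) ⊇ (k+1,
k+1)`. Since `β` keeps and `κ` raises the index, each of these steps is stable, and only one
diagonal entry acts on each quotient. -/
theorem act_mem {E : Alg.{u} p} (a b : B ⟶ E) (h : f ≫ a = f ≫ b) {l m : ℕ} (hlm : l ≤ m)
    (hml : m ≤ l + 1) (x : (ι → W p n E) × (ι' → W p n E))
    (hx : x ∈ fil p n ι ι' l m E) : 𝒯.act a b h x ∈ fil p n ι ι' l m E := by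
  rw [act_apply]
  exact ⟨fun i => add_mem (mulVec_mem_vfil _ hx.1 i)
      (vfil_antitone hlm (𝒯.β_mem a b h m _ hx.2 i)),
    fun i => add_mem (vfil_antitone hml (𝒯.κ_mem a b h l _ hx.1 i)) (mulVec_mem_vfil _ hx.2 i)⟩

omit [NeZero n] in
/-- A vector supported in one Witt component. -/
theorem exists_mem_vfil_coeff {E : Type*} [CommRing E] {k : ℕ} (hk : k < n) (r : E) :
    ∃ x ∈ vfil p n E k, x.coeff ⟨k, hk⟩ = r := by
  refine ⟨TruncatedWittVector.mk p fun i => if i.1 = k then r else 0, ?_, ?_⟩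
  · rw [mem_vfil]
    intro i hi
    rw [TruncatedWittVector.coeff_mk, if_neg hi.ne]
  · rw [TruncatedWittVector.coeff_mk, if_pos rfl]

/-- On the quotient of `(k, k+1)` by `(k+1, k+1)` only the `k`-th component of the first factor
survives. The contribution of `β` starts in degree `k+1`, so the action is the Frobenius power of
`CA`. -/
theorem exists_correction_fst (hf : (f.hom : R →+* B).FaithfullyFlat) {k : ℕ} (hk : k < n)
    (v : (ι → W p n B) × (ι' → W p n B))
    (hv : ∀ {E : Alg.{u} p} (a b : B ⟶ E) (h : f ≫ a = f ≫ b),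
      𝒯.twist.defect v a b h ∈ fil p n ι ι' k (k + 1) E) :
    ∃ w ∈ fil p n ι ι' k (k + 1) B, ∀ {E : Alg.{u} p} (a b : B ⟶ E) (h : f ≫ a = f ≫ b),
      𝒯.twist.defect (v - w) a b h ∈ fil p n ι ι' (k + 1) (k + 1) E := by
  obtain ⟨w, hw, h⟩ := 𝒯.twist.exists_correction (𝒯.CA.frobPow k) hf
    (fil p n ι ι' k (k + 1)) (fun {E} (x : (ι → W p n E) × (ι' → W p n E)) i =>
      (x.1 i).coeff ⟨k, hk⟩)
    (fun x y hx hy => funext fun i => coeff_add_of_mem_vfil (hx.1 i) (hy.1 i) _ rfl)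
    (fun l x => funext fun i => coeff_mapW p n _ (x.1 i) _)
    (fun y => by
      choose x hx hx' using fun i => exists_mem_vfil_coeff (p := p) hk (y i)
      exact ⟨(x, 0), ⟨hx, fun _ => zero_mem _⟩, funext hx'⟩)
    (fun l x hx => 𝒯.map_mem l x hx) (fun a b h => 𝒯.act_mem a b h (Nat.le_succ k) le_rfl)
    (fun a b h x hx => by
      have e : 𝒯.twist.act a b h x =
        (𝒯.A a b h *ᵥ x.1 + 𝒯.β a b h x.2, 𝒯.κ a b h x.1 + 𝒯.D a b h *ᵥ x.2) :=
        𝒯.act_apply a b h x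
      funext i
      have h₁ := coeff_add_of_mem_vfil (mulVec_mem_vfil (𝒯.A a b h) hx.1 i)
        (vfil_antitone (Nat.le_succ k) (𝒯.β_mem a b h _ _ hx.2 i)) ⟨k, hk⟩ rfl
      have h₂ := mem_vfil.1 (𝒯.β_mem a b h _ _ hx.2 i) ⟨k, hk⟩ (Nat.lt_succ_self k)
      rw [e]
      refine h₁.trans ?_
      rw [h₂, add_zero, coeff_mulVec_of_mem_vfil _ hk hx.1]
      change _ = (((𝒯.CA.M a b h).map _) *ᵥ _) i
      rw [𝒯.CA_eq])
    v hv
  refine ⟨w, hw, fun a b hab => ?_⟩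
  obtain ⟨h₁, h₂⟩ := h a b hab
  refine ⟨fun i => mem_vfil_succ.2 ⟨h₁.1 i, fun j hj => ?_⟩, h₁.2⟩
  obtain rfl : j = ⟨k, hk⟩ := Fin.ext hj
  exact congrFun h₂ i

/-- On the quotient of `(k, k)` by `(k, k+1)` only the second factor survives, because `κ` raises
the filtration degree. -/
theorem exists_correction_snd (hf : (f.hom : R →+* B).FaithfullyFlat) {k : ℕ} (hk : k < n)
    (v : (ι → W p n B) × (ι' → W p n B))
    (hv : ∀ {E : Alg.{u} p} (a b : B ⟶ E) (h : f ≫ a = f ≫ b),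
      𝒯.twist.defect v a b h ∈ fil p n ι ι' k k E) :
    ∃ w ∈ fil p n ι ι' k k B, ∀ {E : Alg.{u} p} (a b : B ⟶ E) (h : f ≫ a = f ≫ b),
      𝒯.twist.defect (v - w) a b h ∈ fil p n ι ι' k (k + 1) E := by
  obtain ⟨w, hw, h⟩ := 𝒯.twist.exists_correction (𝒯.CD.frobPow k) hf
    (fil p n ι ι' k k) (fun {E} (x : (ι → W p n E) × (ι' → W p n E)) i =>
      (x.2 i).coeff ⟨k, hk⟩)
    (fun x y hx hy => funext fun i => coeff_add_of_mem_vfil (hx.2 i) (hy.2 i) _ rfl)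
    (fun l x => funext fun i => coeff_mapW p n _ (x.2 i) _)
    (fun y => by
      choose x hx hx' using fun i => exists_mem_vfil_coeff (p := p) hk (y i)
      exact ⟨(0, x), ⟨fun _ => zero_mem _, hx⟩, funext hx'⟩)
    (fun l x hx => 𝒯.map_mem l x hx) (fun a b h => 𝒯.act_mem a b h le_rfl (Nat.le_succ k))
    (fun a b h x hx => by
      have e : 𝒯.twist.act a b h x =
        (𝒯.A a b h *ᵥ x.1 + 𝒯.β a b h x.2, 𝒯.κ a b h x.1 + 𝒯.D a b h *ᵥ x.2) :=
        𝒯.act_apply a b h x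
      funext i
      have h₁ := coeff_add_of_mem_vfil
        (vfil_antitone (Nat.le_succ k) (𝒯.κ_mem a b h _ _ hx.1 i))
        (mulVec_mem_vfil (𝒯.D a b h) hx.2 i) ⟨k, hk⟩ rfl
      have h₂ := mem_vfil.1 (𝒯.κ_mem a b h _ _ hx.1 i) ⟨k, hk⟩ (Nat.lt_succ_self k)
      rw [e]
      refine h₁.trans ?_
      rw [h₂, zero_add, coeff_mulVec_of_mem_vfil _ hk hx.2]
      change _ = (((𝒯.CD.M a b h).map _) *ᵥ _) i
      rw [𝒯.CD_eq])
    v hv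
  refine ⟨w, hw, fun a b hab => ?_⟩
  obtain ⟨h₁, h₂⟩ := h a b hab
  refine ⟨h₁.1, fun i => mem_vfil_succ.2 ⟨h₁.2 i, fun j hj => ?_⟩⟩
  obtain rfl : j = ⟨k, hk⟩ := Fin.ext hj
  exact congrFun h₂ i

omit [NeZero n] [Fintype ι] [DecidableEq ι] [Fintype ι'] [DecidableEq ι'] in
theorem fil_antitone {k l k' l' : ℕ} (hk : k ≤ k') (hl : l ≤ l') (E : Alg.{u} p) :
    fil p n ι ι' k' l' E ≤ fil p n ι ι' k l E :=
  fun _ hx => ⟨fun i => vfil_antitone hk (hx.1 i), fun i => vfil_antitone hl (hx.2 i)⟩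

/-- A vector whose second component descends modulo the augmentation ideal can be changed by a
vector whose second component vanishes modulo the augmentation ideal so that it descends. -/
theorem exists_invariant (hf : (f.hom : R →+* B).FaithfullyFlat)
    (v : (ι → W p n B) × (ι' → W p n B))
    (hv : ∀ {E : Alg.{u} p} (a b : B ⟶ E) (h : f ≫ a = f ≫ b),
      𝒯.twist.defect v a b h ∈ fil p n ι ι' 0 1 E) :
    ∃ v' : (ι → W p n B) × (ι' → W p n B),
      (∀ i, v'.2 i - v.2 i ∈ vfil p n B 1) ∧
      ∀ {E : Alg.{u} p} (a b : B ⟶ E) (h : f ≫ a = f ≫ b), 𝒯.twist.defect v' a b h = 0 := by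
  -- All corrections stay in filtration `(0, 1)`, so the second component never changes modulo the
  -- augmentation ideal. The case `k = 0` is the hypothesis on `v`.
  have key : ∀ k ≤ n, ∃ w ∈ fil p n ι ι' 0 1 B,
      ∀ {E : Alg.{u} p} (a b : B ⟶ E) (h : f ≫ a = f ≫ b),
        𝒯.twist.defect (v - w) a b h ∈ fil p n ι ι' k (k + 1) E := by
    intro k
    induction k with
    | zero => exact fun _ => ⟨0, zero_mem _, fun a b h => by rw [sub_zero]; exact hv a b h⟩
    | succ k ih =>
      intro hk
      obtain ⟨w₁, hw₁, h₁⟩ := ih (by omega)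
      obtain ⟨w₂, hw₂, h₂⟩ := 𝒯.exists_correction_fst hf (k := k) (by omega) _ h₁
      -- In the last step no Witt component of the second factor remains: the `n`-th filtration step
      -- is zero.
      rcases (by omega : k + 1 < n ∨ k + 1 = n) with hk' | hk'
      · obtain ⟨w₃, hw₃, h₃⟩ := 𝒯.exists_correction_snd hf hk' _ h₂
        refine ⟨w₁ + w₂ + w₃, add_mem (add_mem hw₁ (fil_antitone (Nat.zero_le _) (by omega) _ hw₂))
          (fil_antitone (Nat.zero_le _) (by omega) _ hw₃), fun a b h => ?_⟩
        rw [← sub_sub, ← sub_sub]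
        exact h₃ a b h
      · refine ⟨w₁ + w₂, add_mem hw₁ (fil_antitone (Nat.zero_le _) (by omega) _ hw₂),
          fun a b h => ?_⟩
        rw [← sub_sub]
        have := h₂ a b h
        refine ⟨this.1, fun i => ?_⟩
        have h₀ := this.2 i
        rw [hk', vfil_self, Ideal.mem_bot] at h₀
        rw [h₀]
        exact zero_mem _
  obtain ⟨w, hw, h⟩ := key n le_rfl
  refine ⟨v - w, fun i => ?_, fun a b hab => ?_⟩
  · have : (v - w).2 i - v.2 i = - w.2 i := by
      rw [Prod.snd_sub, Pi.sub_apply]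
      ring
    rw [this]
    exact neg_mem (hw.2 i)
  · have h₀ := h a b hab
    refine Prod.ext (funext fun i => ?_) (funext fun i => ?_)
    · have := h₀.1 i
      rwa [vfil_self, Ideal.mem_bot] at this
    · have := vfil_antitone (Nat.le_succ n) (h₀.2 i)
      rwa [vfil_self, Ideal.mem_bot] at this

end TriangularTwist

end Lifting

/-! ### Lifting modules and maps -/

section LiftModules

/-- Vectors over `K` are the scalar extension of vectors over `A`. -/
theorem exists_linearizationBijective_fin {A K : Type u} [CommRing A] [CommRing K] (ε : A →+* K)
    (k : ℕ) : ∃ ρ : (Fin k → A) →ₛₗ[ε] (Fin k → K),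
      LinearizationBijective ρ ∧ ∀ x i, ρ x i = ε (x i) := by
  refine ⟨{ toFun := fun x i => ε (x i)
            map_add' := fun x y => funext fun i => map_add ε _ _
            map_smul' := fun a x => funext fun i => map_mul ε _ _ }, ?_, fun _ _ => rfl⟩
  let _ : Algebra A K := ε.toAlgebra
  refine LinearizationBijective.of_equiv
    ((TensorProduct.piRight A K K (fun _ : Fin k => A)).trans
      (LinearEquiv.piCongrRight fun _ => TensorProduct.AlgebraTensorModule.rid A K K)) fun x => ?_
  funext i
  exact (Algebra.smul_def (x i) (1 : K)).trans (mul_one _)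

/-- Finite projective modules lift along surjections with nilpotent kernel. -/
theorem exists_projective_lift {A K N : Type u} [CommRing A] [CommRing K] (ε : A →+* K)
    (hε : Function.Surjective ε) {m : ℕ} (hm : RingHom.ker ε ^ m = ⊥) [AddCommGroup N] [Module K N]
    [Module.Finite K N] [Module.Projective K N] :
    ∃ (L : Type u) (_ : AddCommGroup L) (_ : Module A L) (ρ : L →ₛₗ[ε] N),
      Module.Finite A L ∧ Module.Projective A L ∧ LinearizationBijective ρ := by
  obtain ⟨k, φ, hφ⟩ := Module.Finite.exists_fin' K N
  obtain ⟨s, hs⟩ := Module.projective_lifting_property φ LinearMap.id hφ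
  have hs' : ∀ y, φ (s y) = y := LinearMap.congr_fun hs
  let e : Matrix (Fin k) (Fin k) K := LinearMap.toMatrix' (s ∘ₗ φ)
  have he : ∀ x, e *ᵥ x = s (φ x) := fun x => LinearMap.toMatrix'_mulVec (s ∘ₗ φ) x
  have hee : IsIdempotentElem e := by
    refine (LinearMap.toMatrix'_mul (s ∘ₗ φ) (s ∘ₗ φ)).symm.trans (congrArg _ ?_)
    exact LinearMap.ext fun x => congrArg s (hs' _)
  let M : Matrix (Fin k) (Fin k) A →+* Matrix (Fin k) (Fin k) K := RingHom.mapMatrix ε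
  -- A matrix with entries in the kernel has its `m`-th power with entries in the `m`-th power of
  -- that ideal, hence zero. So idempotent matrices lift.
  have hM : ∀ x : Matrix (Fin k) (Fin k) A, x ∈ RingHom.ker M → IsNilpotent x := fun x hx => by
    have hx₀ : M x = 0 := (RingHom.mem_ker).1 hx
    have hx' : ∀ i j, x i j ∈ RingHom.ker ε := fun i j => congrFun (congrFun hx₀ i) j
    have : ∀ l i j, (x ^ l) i j ∈ RingHom.ker ε ^ l := by
      intro l
      induction l with
      | zero => exact fun i j => by rw [pow_zero, Ideal.one_eq_top]; exact Submodule.mem_top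
      | succ l ih =>
        intro i j
        rw [pow_succ, pow_succ, Matrix.mul_apply]
        exact sum_mem fun r _ => Ideal.mul_mem_mul (ih i r) (hx' r j)
    refine ⟨m, ?_⟩
    ext1 i j
    have := this m i j
    rwa [hm, Ideal.mem_bot] at this
  choose r hr using fun i j => hε (e i j)
  obtain ⟨e', hee', he'⟩ := exists_isIdempotentElem_eq_of_ker_isNilpotent M hM e
    ⟨Matrix.of r, by ext1 i j; exact hr i j⟩ hee
  let θ : (Fin k → A) →ₗ[A] (Fin k → A) := Matrix.toLin' e'
  have hθ : ∀ x, θ (θ x) = θ x := fun x => by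
    have := congrArg (fun M => M *ᵥ x) hee'
    simpa only [θ, Matrix.toLin'_apply, Matrix.mulVec_mulVec] using this
  obtain ⟨ρ₀, hρ₀, hρ₀'⟩ := exists_linearizationBijective_fin ε k
  have hρθ : ∀ x, ρ₀ (θ x) = s (φ (ρ₀ x)) := fun x => by
    rw [← he, ← he']
    funext i
    have : ρ₀ x = fun i => ε (x i) := funext (hρ₀' x)
    rw [hρ₀', this]
    exact RingHom.map_mulVec ε e' x i
  let L := LinearMap.range θ
  let q : (Fin k → A) →ₗ[A] L := θ.rangeRestrict
  have hq : ∀ l : L, q l.1 = l := by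
    rintro ⟨_, x, rfl⟩
    exact Subtype.ext (hθ x)
  have hL : Module.Projective A L := Module.Projective.of_split L.subtype q (LinearMap.ext hq)
  have hL' : Module.Finite A L := inferInstance
  let ψ : L →ₛₗ[ε] N := φ.comp (ρ₀.comp L.subtype)
  obtain ⟨N', _, _, v, hv⟩ := LinearizationBijective.exists_extension ε L
  -- The reduction of the lifted summand is compared with `N` through an abstract scalar extension
  -- `N'`. The map `e₁` has inverse `q' ∘ s`, both identities being checked on generators.
  obtain ⟨e₁, he₁⟩ := hv.exists_lift (τ' := RingHom.id K) ψ
  obtain ⟨q', hq'⟩ := hρ₀.exists_lift (τ' := RingHom.id K) (v.comp q : (Fin k → A) →ₛₗ[ε] N')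
  have h₁ : ∀ x, e₁ (q' x) = φ x := LinearMap.congr_fun (hρ₀.ext (w := e₁ ∘ₗ q') (w' := φ)
    fun x => by
      rw [LinearMap.comp_apply, hq']
      refine (he₁ (q x)).trans ?_
      change φ (ρ₀ (θ x)) = φ (ρ₀ x)
      rw [hρθ, hs'])
  have h₂ : ∀ y, q' (s (e₁ y)) = y := LinearMap.congr_fun
    (hv.ext (w := q' ∘ₗ s ∘ₗ e₁) (w' := LinearMap.id) fun l => by
      change q' (s (e₁ (v l))) = v l
      rw [he₁]
      change q' (s (φ (ρ₀ l.1))) = v l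
      rw [← hρθ, hq']
      change v (q (θ l.1)) = v l
      have : θ l.1 = l.1 := congrArg Subtype.val (hq l)
      rw [this, hq])
  exact ⟨L, inferInstance, inferInstance, ψ, hL', hL, hv.of_unique_lift e₁
    ⟨Function.LeftInverse.injective (g := q' ∘ s) h₂, fun y => ⟨q' (s y), (h₁ _).trans (hs' y)⟩⟩ he₁⟩

/-- A semilinear map from a finite projective module lifts along a surjection. -/
theorem exists_semilinear_lift {A S K T V N : Type u} [CommRing A] [CommRing S] [CommRing K]
    [AddCommGroup T] [Module A T] [Module.Finite A T] [Module.Projective A T] [AddCommGroup V]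
    [Module S V] [AddCommGroup N] [Module K N] {τ : A →+* S} {ε : S →+* K} (π : V →ₛₗ[ε] N)
    (ρ : T →ₛₗ[ε.comp τ] N) (P : AddSubgroup V) (hP : ∀ a, ∀ v ∈ P, τ a • v ∈ P)
    (hπ : ∀ t, ∃ v ∈ P, π v = ρ t) :
    ∃ l : T →ₛₗ[τ] V, (∀ t, l t ∈ P) ∧ ∀ t, π (l t) = ρ t := by
  -- The lift is the sum of `τ (e j t) • w j` for a dual basis and lifts `w j` of its vectors. Its
  -- values stay in `P`, which only has to be stable under scalars from `A`.
  obtain ⟨k, e, v, hev⟩ := exists_dualBasis A T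
  choose w hwP hw using fun j => hπ (v j)
  refine ⟨{ toFun := fun t => ∑ j, τ (e j t) • w j
            map_add' := fun x y => by
              simp only [map_add, add_smul, Finset.sum_add_distrib]
            map_smul' := fun a x => by
              simp only [map_smul, smul_eq_mul, map_mul, mul_smul, Finset.smul_sum] },
    fun t => by
      change ∑ j, τ (e j t) • w j ∈ P
      exact P.sum_mem fun j _ => hP (e j t) _ (hwP j), fun t => ?_⟩
  change π (∑ j, τ (e j t) • w j) = ρ t
  conv_rhs => rw [← hev t]
  rw [map_sum, map_sum]
  refine Finset.sum_congr rfl fun j _ => ?_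
  rw [map_smulₛₗ, map_smulₛₗ, hw]
  rfl

/-- A semilinear map exhibits a scalar extension if it does so after reduction. -/
theorem linearizationBijective_of_comp {A S K T N N₀ : Type u} [CommRing A] [CommRing S]
    [CommRing K] [AddCommGroup T] [Module A T] [Module.Finite A T] [Module.Projective A T]
    [AddCommGroup N] [Module S N] [Module.Finite S N] [Module.Projective S N] [AddCommGroup N₀]
    [Module K N₀] {τ : A →+* S} {ε : S →+* K} (hε : Function.Surjective ε)
    (hJ : RingHom.ker ε ≤ Ideal.jacobson ⊥) {ρ : N →ₛₗ[ε] N₀} (hρ : LinearizationBijective ρ)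
    (D : T →ₛₗ[τ] N) (r : T →ₛₗ[ε.comp τ] N₀) (hr : LinearizationBijective r)
    (hD : ∀ t, ρ (D t) = r t) : LinearizationBijective D := by
  obtain ⟨T', _, _, v, hv⟩ := LinearizationBijective.exists_extension τ T
  have := hv.finite
  have := hv.projective
  obtain ⟨e, he⟩ := hv.exists_lift (τ' := RingHom.id S) D
  have t : RingHomCompTriple τ ε (ε.comp τ) := ⟨rfl⟩
  refine hv.of_unique_lift e (bijective_of_linearizationBijective_comp hε hJ hρ e ?_) he
  refine hv.of_comp (τ'' := ε.comp τ) ?_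
  have h : ((ρ.comp e : T' →ₛₗ[ε] N₀).comp v : T →ₛₗ[ε.comp τ] N₀) = r :=
    LinearMap.ext fun x => (congrArg ρ (he x)).trans (hD x)
  rw [h]
  exact hr

end LiftModules

/-! ### Cocycles of block matrices -/

section BlockAction

namespace BlockMat

variable {p n c d : ℕ} [Fact p.Prime] {R S : Type u} [CommRing R] [Algebra (ZMod p) R] [CommRing S]
  [Algebra (ZMod p) S]

/-- The action of a block matrix on `W_n(R)^c ⊕ W_n(R)^d`. -/
noncomputable def actP (g : BlockMat p n c d R) :
    (Fin c → W p n R) × (Fin d → W p n R) →ₗ[W p n R] (Fin c → W p n R) × (Fin d → W p n R) where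
  toFun x := (g.A *ᵥ x.1 + g.B *ᵥ x.2, g.C.map (toW p n) *ᵥ x.1 + g.D *ᵥ x.2)
  map_add' x y := by
    simp only [Prod.fst_add, Prod.snd_add, Matrix.mulVec_add, Prod.mk_add_mk]
    congr 1 <;> abel
  map_smul' a x := by
    simp only [Prod.smul_fst, Prod.smul_snd, Matrix.mulVec_smul, Prod.smul_mk, smul_add,
      RingHom.id_apply]

theorem actP_apply (g : BlockMat p n c d R) (x) :
    g.actP x = (g.A *ᵥ x.1 + g.B *ᵥ x.2, g.C.map (toW p n) *ᵥ x.1 + g.D *ᵥ x.2) := rfl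

theorem toMat_mulVec (g : BlockMat p n c d R) (x : (Fin c → W p n R) × (Fin d → W p n R)) :
    g.toMat *ᵥ Sum.elim x.1 x.2 = Sum.elim (g.actP x).1 (g.actP x).2 :=
  Matrix.fromBlocks_mulVec _ _ _ _ _

theorem sum_elim_injective {α β γ : Type*} {x y : (α → γ) × (β → γ)}
    (h : Sum.elim x.1 x.2 = Sum.elim y.1 y.2) : x = y :=
  Prod.ext (funext fun i => congrFun h (.inl i)) (funext fun i => congrFun h (.inr i))

theorem actP_mul (g g' : BlockMat p n c d R) (x) : (g * g').actP x = g.actP (g'.actP x) := by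
  apply sum_elim_injective
  rw [← toMat_mulVec, ← toMat_mulVec, ← toMat_mulVec, toMat_mul, Matrix.mulVec_mulVec]

theorem actP_one (x) : (1 : BlockMat p n c d R).actP x = x := by
  apply sum_elim_injective
  rw [← toMat_mulVec, toMat_one, Matrix.one_mulVec]

/-- The map on `W_n(R)^c ⊕ W_n(R)^d` induced by a ring homomorphism. -/
noncomputable def mapP (f : R →+* S) : (Fin c → W p n R) × (Fin d → W p n R) →ₛₗ[mapW p n f]
    (Fin c → W p n S) × (Fin d → W p n S) where
  toFun x := (fun i => mapW p n f (x.1 i), fun i => mapW p n f (x.2 i))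
  map_add' _ _ := Prod.ext (funext fun _ => map_add _ _ _) (funext fun _ => map_add _ _ _)
  map_smul' _ _ := Prod.ext (funext fun _ => map_mul _ _ _) (funext fun _ => map_mul _ _ _)

theorem mapP_actP (f : R →+* S) (g : BlockMat p n c d R) (x) :
    mapP f (g.actP x) = (g.mapMat f).actP (mapP f x) := by
  have h {k l : ℕ} (M : Matrix (Fin k) (Fin l) (W p n R)) (x : Fin l → W p n R) (i : Fin k) :
      mapW p n f ((M *ᵥ x) i) = (M.map (mapW p n f) *ᵥ fun j => mapW p n f (x j)) i :=
    RingHom.map_mulVec _ _ _ _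
  have hC : (g.mapMat f).C.map (toW p n) = (g.C.map (toW p n)).map (mapW p n f) := by
    ext1 i j
    exact toW_mapI p n f _
  refine Prod.ext (funext fun i => ?_) (funext fun i => ?_)
  · exact (map_add (mapW p n f) _ _).trans (congrArg₂ _ (h _ _ _) (h _ _ _))
  · rw [actP_apply (g.mapMat f), hC]
    exact (map_add (mapW p n f) _ _).trans (congrArg₂ _ (h _ _ _) (h _ _ _))

/-- The action of a block matrix on `W_n(R)^c ⊕ I_{n+1,R}^d`. -/
noncomputable def actQ (g : BlockMat p n c d R) :
    (Fin c → W p n R) × (Fin d → I p n R) →ₗ[W p n R] (Fin c → W p n R) × (Fin d → I p n R) where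
  toFun x := (g.A *ᵥ x.1 + g.B *ᵥ (fun i => toW p n (x.2 i)),
    fun i => ∑ j, x.1 j • g.C i j + ∑ j, g.D i j • x.2 j)
  map_add' x y := by
    have : (fun i => toW p n ((x + y).2 i)) = (fun i => toW p n (x.2 i)) + fun i => toW p n (y.2 i) :=
      funext fun i => map_add _ _ _
    rw [this]
    refine Prod.ext ?_ (funext fun i => ?_)
    · simp only [Prod.fst_add, Matrix.mulVec_add]
      abel
    · simp only [Prod.fst_add, Prod.snd_add, Pi.add_apply, add_smul, smul_add,
        Finset.sum_add_distrib]
      abel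
  map_smul' a x := by
    have : (fun i => toW p n ((a • x).2 i)) = a • fun i => toW p n (x.2 i) :=
      funext fun i => (toW p n).map_smul a (x.2 i)
    rw [this]
    refine Prod.ext ?_ (funext fun i => ?_)
    · simp only [Prod.smul_fst, Matrix.mulVec_smul, smul_add, RingHom.id_apply]
    · simp only [Prod.smul_fst, Prod.smul_snd, Pi.smul_apply, smul_eq_mul, mul_smul, smul_add,
        Finset.smul_sum, RingHom.id_apply, smul_comm a]

theorem actQ_apply (g : BlockMat p n c d R) (x) :
    g.actQ x = (g.A *ᵥ x.1 + g.B *ᵥ (fun i => toW p n (x.2 i)),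
      fun i => ∑ j, x.1 j • g.C i j + ∑ j, g.D i j • x.2 j) := rfl

theorem toW_actQ (g : BlockMat p n c d R) (x) (i : Fin d) :
    toW p n ((g.actQ x).2 i) =
      (g.C.map (toW p n) *ᵥ x.1 + g.D *ᵥ fun i => toW p n (x.2 i)) i := by
  rw [actQ_apply]
  simp only [map_add, map_sum, map_smul, smul_eq_mul, Pi.add_apply, Matrix.mulVec, dotProduct,
    Matrix.map_apply, mul_comm]

theorem σ₁_actQ (g : BlockMat p n c d R) (x) (i : Fin d) :
    σ₁ p n ((g.actQ x).2 i) = (g.C.map (σ₁ p n) *ᵥ (fun i => σ p n R (x.1 i)) +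
      g.D.map (σ p n R) *ᵥ fun i => σ₁ p n (x.2 i)) i := by
  rw [actQ_apply]
  simp only [map_add, map_sum, σ₁_smul, Pi.add_apply, Matrix.mulVec, dotProduct,
    Matrix.map_apply, mul_comm]

theorem toMat_mulVec_actQ (g : BlockMat p n c d R) (x : (Fin c → W p n R) × (Fin d → I p n R)) :
    g.toMat *ᵥ Sum.elim x.1 (fun i => toW p n (x.2 i)) =
      Sum.elim (g.actQ x).1 (fun i => toW p n ((g.actQ x).2 i)) := by
  rw [show (fun i => toW p n ((g.actQ x).2 i)) = _ from funext (toW_actQ g x)]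
  exact Matrix.fromBlocks_mulVec _ _ _ _ _

theorem σ₁Mat_mulVec_actQ (g : BlockMat p n c d R) (x : (Fin c → W p n R) × (Fin d → I p n R)) :
    g.σ₁Mat *ᵥ Sum.elim (fun i => σ p n R (x.1 i)) (fun i => σ₁ p n (x.2 i)) =
      Sum.elim (fun i => σ p n R ((g.actQ x).1 i)) (fun i => σ₁ p n ((g.actQ x).2 i)) := by
  rw [show (fun i => σ₁ p n ((g.actQ x).2 i)) = _ from funext (σ₁_actQ g x)]
  refine (Matrix.fromBlocks_mulVec _ _ _ _ _).trans (congrArg₂ _ (funext fun i => ?_) rfl)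
  have h (M : Matrix (Fin c) (Fin d) (W p n R)) (x : Fin d → I p n R) :
      (((p : W p n R) • M.map (σ p n R)) *ᵥ fun i => σ₁ p n (x i)) i =
        σ p n R ((M *ᵥ fun i => toW p n (x i)) i) := by
    simp only [Matrix.mulVec, dotProduct, Matrix.smul_apply, Matrix.map_apply, map_sum, map_mul,
      σ_toW, smul_eq_mul]
    exact Finset.sum_congr rfl fun j _ => by ring
  exact (congrArg₂ _ (RingHom.map_mulVec (σ p n R) g.A x.1 i).symm (h g.B x.2)).trans
    (map_add (σ p n R) _ _).symm

/-- The component in `W_n` is read off from the ordinary action of `toMat`, and the one in `I_{n+1}`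
from that of `σ₁Mat` since `σ₁` is bijective. Both assignments are multiplicative. -/
theorem actQ_mul (g g' : BlockMat p n c d R) (x) : (g * g').actQ x = g.actQ (g'.actQ x) := by
  have h₁ := toMat_mulVec_actQ (g * g') x
  have h₂ := σ₁Mat_mulVec_actQ (g * g') x
  rw [toMat_mul, ← Matrix.mulVec_mulVec, toMat_mulVec_actQ, toMat_mulVec_actQ] at h₁
  rw [σ₁Mat_mul, ← Matrix.mulVec_mulVec, σ₁Mat_mulVec_actQ, σ₁Mat_mulVec_actQ] at h₂
  exact Prod.ext (funext fun i => (congrFun h₁ (.inl i)).symm)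
    (funext fun i => (σ₁ p n).injective (congrFun h₂ (.inr i)).symm)

theorem actQ_one (x) : (1 : BlockMat p n c d R).actQ x = x := by
  have h₁ := toMat_mulVec_actQ (1 : BlockMat p n c d R) x
  have h₂ := σ₁Mat_mulVec_actQ (1 : BlockMat p n c d R) x
  rw [toMat_one, Matrix.one_mulVec] at h₁
  rw [σ₁Mat_one, Matrix.one_mulVec] at h₂
  exact Prod.ext (funext fun i => (congrFun h₁ (.inl i)).symm)
    (funext fun i => (σ₁ p n).injective (congrFun h₂ (.inr i)).symm)

/-- The map on `W_n(R)^c ⊕ I_{n+1,R}^d` induced by a ring homomorphism. -/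
noncomputable def mapQ (f : R →+* S) : (Fin c → W p n R) × (Fin d → I p n R) →ₛₗ[mapW p n f]
    (Fin c → W p n S) × (Fin d → I p n S) where
  toFun x := (fun i => mapW p n f (x.1 i), fun i => mapI p n f (x.2 i))
  map_add' _ _ := Prod.ext (funext fun _ => map_add _ _ _) (funext fun _ => map_add _ _ _)
  map_smul' a x := Prod.ext (funext fun _ => map_mul _ _ _) (funext fun i => (mapI p n f).map_smulₛₗ a (x.2 i))

theorem mapQ_actQ (f : R →+* S) (g : BlockMat p n c d R) (x) :
    mapQ f (g.actQ x) = (g.mapMat f).actQ (mapQ f x) := by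
  have h {k l : ℕ} (M : Matrix (Fin k) (Fin l) (W p n R)) (x : Fin l → W p n R) (i : Fin k) :
      mapW p n f ((M *ᵥ x) i) = (M.map (mapW p n f) *ᵥ fun j => mapW p n f (x j)) i :=
    RingHom.map_mulVec _ _ _ _
  refine Prod.ext (funext fun i => ?_) (funext fun i => ?_)
  · refine (map_add (mapW p n f) _ _).trans (congrArg₂ _ (h _ _ _) ((h _ _ _).trans ?_))
    have : (fun j => mapW p n f (toW p n (x.2 j))) = fun j => toW p n ((mapQ f x).2 j) :=
      funext fun j => (toW_mapI p n f (x.2 j)).symm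
    rw [this]
    rfl
  · change mapI p n f (∑ j, x.1 j • g.C i j + ∑ j, g.D i j • x.2 j) = _
    rw [map_add, map_sum, map_sum]
    exact congrArg₂ _ (Finset.sum_congr rfl fun j _ => (mapI p n f).map_smulₛₗ (x.1 j) (g.C i j))
      (Finset.sum_congr rfl fun j _ => (mapI p n f).map_smulₛₗ (g.D i j) (x.2 j))

/-- The block matrix `(1, b; 0, 1)`. -/
noncomputable def upper (b : Matrix (Fin c) (Fin d) (W p n R)) : BlockMat p n c d R := ⟨1, b, 0, 1⟩

/-- The block matrix `(1, 0; k, 1)`. -/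
noncomputable def lower (k : Matrix (Fin d) (Fin c) (I p n R)) : BlockMat p n c d R := ⟨1, 0, k, 1⟩

theorem actP_upper (b : Matrix (Fin c) (Fin d) (W p n R)) (x) :
    (upper b).actP x = (x.1 + b *ᵥ x.2, x.2) := by
  refine Prod.ext ?_ ?_
  · exact congrArg (· + _) (Matrix.one_mulVec x.1)
  · change (0 : Matrix (Fin d) (Fin c) (I p n R)).map (toW p n) *ᵥ x.1 +
      (1 : Matrix (Fin d) (Fin d) (W p n R)) *ᵥ x.2 = x.2
    rw [Matrix.map_zero _ (map_zero _), Matrix.zero_mulVec, Matrix.one_mulVec, zero_add]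

theorem actQ_upper_inl (b : Matrix (Fin c) (Fin d) (W p n R)) (l : Fin c → W p n R) :
    (upper b).actQ (l, 0) = (l, 0) := by
  refine Prod.ext ?_ (funext fun i => ?_)
  · change (1 : Matrix (Fin c) (Fin c) (W p n R)) *ᵥ l + b *ᵥ (fun i => toW p n (0 : I p n R)) = l
    rw [map_zero, Matrix.one_mulVec]
    exact (congrArg (l + ·) (Matrix.mulVec_zero b)).trans (add_zero l)
  · change ∑ j, l j • (0 : I p n R) + ∑ j, (1 : Matrix (Fin d) (Fin d) (W p n R)) i j • (0 : I p n R)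
      = 0
    simp

theorem actQ_lower (k : Matrix (Fin d) (Fin c) (I p n R)) (x) :
    (lower k).actQ x = (x.1, fun i => ∑ j, x.1 j • k i j + x.2 i) := by
  refine Prod.ext ?_ (funext fun i => ?_)
  · change (1 : Matrix (Fin c) (Fin c) (W p n R)) *ᵥ x.1 +
      (0 : Matrix (Fin c) (Fin d) (W p n R)) *ᵥ _ = x.1
    rw [Matrix.one_mulVec, Matrix.zero_mulVec, add_zero]
  · refine congrArg (∑ j, x.1 j • k i j + ·) ?_
    change ∑ j, (1 : Matrix (Fin d) (Fin d) (W p n R)) i j • x.2 j = x.2 i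
    simp [Matrix.one_apply]

theorem upper_mul_upper (b b' : Matrix (Fin c) (Fin d) (W p n R)) :
    upper b * upper b' = upper (b + b') := by
  refine BlockMat.ext ?_ ?_ ?_ ?_
  · change (1 : Matrix (Fin c) (Fin c) (W p n R)) * 1 +
      b * (0 : Matrix (Fin d) (Fin c) (I p n R)).map (toW p n) = 1
    rw [Matrix.map_zero _ (map_zero _), Matrix.mul_zero, mul_one, add_zero]
  · change (1 : Matrix (Fin c) (Fin c) (W p n R)) * b' + b * (1 : Matrix (Fin d) (Fin d) _) = b + b'
    rw [Matrix.one_mul, Matrix.mul_one, add_comm]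
  · ext1 i j
    rw [mul_C_apply]
    simp [upper]
  · change (0 : Matrix (Fin d) (Fin c) (I p n R)).map (toW p n) * b' +
      (1 : Matrix (Fin d) (Fin d) (W p n R)) * 1 = 1
    rw [Matrix.map_zero _ (map_zero _), Matrix.zero_mul, mul_one, zero_add]

theorem lower_mul_lower (k k' : Matrix (Fin d) (Fin c) (I p n R)) :
    lower k * lower k' = lower (k + k') := by
  refine BlockMat.ext ?_ ?_ ?_ ?_
  · change (1 : Matrix (Fin c) (Fin c) (W p n R)) * 1 +
      (0 : Matrix (Fin c) (Fin d) _) * k'.map (toW p n) = 1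
    rw [Matrix.zero_mul, mul_one, add_zero]
  · change (1 : Matrix (Fin c) (Fin c) (W p n R)) * (0 : Matrix (Fin c) (Fin d) _) +
      (0 : Matrix (Fin c) (Fin d) _) * (1 : Matrix (Fin d) (Fin d) _) = 0
    rw [Matrix.mul_zero, Matrix.zero_mul, add_zero]
  · ext1 i j
    rw [mul_C_apply]
    simp [lower, Matrix.one_apply]
  · change k.map (toW p n) * (0 : Matrix (Fin c) (Fin d) _) +
      (1 : Matrix (Fin d) (Fin d) (W p n R)) * 1 = 1
    rw [Matrix.mul_zero, mul_one, zero_add]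

theorem upper_zero : upper (0 : Matrix (Fin c) (Fin d) (W p n R)) = 1 := rfl

theorem lower_zero : lower (0 : Matrix (Fin d) (Fin c) (I p n R)) = 1 := rfl

/-- `(1, b; 0, 1)` as a unit. -/
noncomputable def upperUnit (b : Matrix (Fin c) (Fin d) (W p n R)) : (BlockMat p n c d R)ˣ where
  val := upper b
  inv := upper (-b)
  val_inv := by rw [upper_mul_upper, add_neg_cancel, upper_zero]
  inv_val := by rw [upper_mul_upper, neg_add_cancel, upper_zero]

/-- `(1, 0; k, 1)` as a unit. -/
noncomputable def lowerUnit (k : Matrix (Fin d) (Fin c) (I p n R)) : (BlockMat p n c d R)ˣ where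
  val := lower k
  inv := lower (-k)
  val_inv := by rw [lower_mul_lower, add_neg_cancel, lower_zero]
  inv_val := by rw [lower_mul_lower, neg_add_cancel, lower_zero]

end BlockMat

end BlockAction

/-! ### Cocycles of block matrices and the vectors that descend for them. -/

section BlockCocycle

variable {p n c d : ℕ} [Fact p.Prime] [NeZero n] {R B : Alg.{u} p} {f : R ⟶ B}

/-- A cocycle with values in block matrices along `R → B`. -/
structure BlockCocycle (f : R ⟶ B) (n c d : ℕ) where
  /-- The block matrices. -/
  g : ∀ {E : Alg.{u} p} (a b : B ⟶ E), f ≫ a = f ≫ b → BlockMat p n c d E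
  map : ∀ {E E' : Alg.{u} p} (a b : B ⟶ E) (h : f ≫ a = f ≫ b) (k : E ⟶ E')
    (h' : f ≫ a ≫ k = f ≫ b ≫ k), (g a b h).mapMat (k.hom : E →+* E') = g (a ≫ k) (b ≫ k) h'
  mul : ∀ {E : Alg.{u} p} (a b c : B ⟶ E) (h : f ≫ a = f ≫ b) (h' : f ≫ b = f ≫ c),
    g b c h' * g a b h = g a c (h.trans h')
  one : ∀ {E : Alg.{u} p} (a : B ⟶ E), g a a rfl = 1

theorem res_map_toW {E : Type*} [CommRing E] [Algebra (ZMod p) E] {k l : ℕ}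
    (M : Matrix (Fin k) (Fin l) (I p n E)) : (M.map (toW p n)).map (res p n E) = 0 := by
  ext1 i j
  exact res_toW _

omit [NeZero n] in
theorem σ_mem_vfil {E : Type*} [CommRing E] [Algebra (ZMod p) E] {k : ℕ} {x : W p n E}
    (hx : x ∈ vfil p n E k) : σ p n E x ∈ vfil p n E k := by
  rw [mem_vfil] at hx ⊢
  intro i hi
  rw [σ, coeff_mapW, hx i hi, map_zero]

-- The Verschiebung shifts components by one. For vectors in `W_n^c ⊕ I_{n+1}^d`, this makes the
-- passage from `I_{n+1}^d` to `W_n^c` raise the filtration.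
omit [NeZero n] in
theorem toW_VEquiv_mem_vfil {E : Type*} [CommRing E] [Algebra (ZMod p) E] {k : ℕ} {x : W p n E}
    (hx : x ∈ vfil p n E k) : toW p n (VEquiv p n x) ∈ vfil p n E (k + 1) := by
  rw [mem_vfil] at hx ⊢
  intro i hi
  change (trunc p n (V p n x)).coeff i = 0
  rw [TruncatedWittVector.coeff_truncate]
  obtain ⟨i, hin⟩ := i
  cases i with
  | zero => exact coeff_V_zero p n x
  | succ i =>
    exact (coeff_V_succ p n x ⟨i, by omega⟩).trans (hx _ (by simpa using hi))

namespace BlockCocycle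

variable (𝒢 : BlockCocycle f n c d)

/-- The residues of the upper left blocks. -/
noncomputable def residueA : Cocycle f (Fin c) where
  M {E} a b h := (𝒢.g a b h).A.map (res p n E)
  map a b h k h' i j := by
    rw [← 𝒢.map a b h k h']
    exact (res_mapW _ _).symm
  mul a b c h h' := by
    rw [← 𝒢.mul a b c h h']
    change _ = ((𝒢.g b c h').A * (𝒢.g a b h).A +
      (𝒢.g b c h').B * (𝒢.g a b h).C.map (toW p n)).map (res p n _)
    rw [Matrix.map_add _ (map_add _), Matrix.map_mul, Matrix.map_mul, res_map_toW, Matrix.mul_zero,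
      add_zero]
  one a := by
    rw [𝒢.one]
    exact Matrix.map_one _ (map_zero _) (map_one _)

/-- The residues of the lower right blocks. -/
noncomputable def residueD : Cocycle f (Fin d) where
  M {E} a b h := (𝒢.g a b h).D.map (res p n E)
  map a b h k h' i j := by
    rw [← 𝒢.map a b h k h']
    exact (res_mapW _ _).symm
  mul a b c h h' := by
    rw [← 𝒢.mul a b c h h']
    change _ = ((𝒢.g b c h').C.map (toW p n) * (𝒢.g a b h).B +
      (𝒢.g b c h').D * (𝒢.g a b h).D).map (res p n _)
    rw [Matrix.map_add _ (map_add _), Matrix.map_mul, Matrix.map_mul, res_map_toW, Matrix.zero_mul,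
      zero_add]
  one a := by
    rw [𝒢.one]
    exact Matrix.map_one _ (map_zero _) (map_one _)

/-- The descent datum on `W_n^c ⊕ W_n^d`. -/
noncomputable def twistP : TriangularTwist f n (Fin c) (Fin d) where
  A a b h := (𝒢.g a b h).A
  D a b h := (𝒢.g a b h).D
  β a b h := (Matrix.mulVecLin (𝒢.g a b h).B).toAddMonoidHom
  κ a b h := (Matrix.mulVecLin ((𝒢.g a b h).C.map (toW p n))).toAddMonoidHom
  β_mem a b h k y hy i := mulVec_mem_vfil _ hy i
  -- The entries of the lower left block have zero residue, so multiplication by them raises the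
  -- filtration degree by one.
  κ_mem a b h k x hx i := by
    change ∑ j, toW p n ((𝒢.g a b h).C i j) * x j ∈ _
    exact sum_mem fun j _ => mul_mem_vfil_succ (RingHom.mem_ker.2 (res_toW _)) (hx j)
  CA := 𝒢.residueA
  CD := 𝒢.residueD
  CA_eq _ _ _ := rfl
  CD_eq _ _ _ := rfl
  act a b h := (𝒢.g a b h).actP.toAddMonoidHom
  act_apply _ _ _ _ := rfl
  act_map a b h k h' x := by
    refine (BlockMat.mapP_actP _ _ x).trans ?_
    rw [𝒢.map a b h k h']
    rfl
  act_mul a b c h h' x := by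
    refine (BlockMat.actP_mul _ _ x).symm.trans ?_
    rw [𝒢.mul]
    rfl

variable (p n c d) in
/-- Coordinates on `W_n^c ⊕ I_{n+1}^d`. -/
noncomputable def swapσ₁ (E : Type u) [CommRing E] [Algebra (ZMod p) E] :
    (Fin d → W p n E) × (Fin c → W p n E) ≃+ (Fin c → W p n E) × (Fin d → I p n E) where
  toFun x := (x.2, fun i => VEquiv p n (x.1 i))
  invFun x := (fun i => σ₁ p n (x.2 i), x.1)
  left_inv _ := Prod.ext (funext fun _ => (VEquiv p n).symm_apply_apply _) rfl
  right_inv _ := Prod.ext rfl (funext fun _ => (VEquiv p n).apply_symm_apply _)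
  map_add' _ _ := Prod.ext rfl (funext fun _ => map_add (VEquiv p n) _ _)

omit [NeZero n] in
theorem swapσ₁_map {E E' : Alg.{u} p} (k : E ⟶ E') (x : (Fin d → W p n E) × (Fin c → W p n E)) :
    swapσ₁ p n c d E' (fun i => Wm n k (x.1 i), fun i => Wm n k (x.2 i)) =
      BlockMat.mapQ (k.hom : E →+* E') (swapσ₁ p n c d E x) :=
  Prod.ext rfl (funext fun i => Subtype.ext (mapW_V p n _ (x.1 i)).symm)

/-- The descent datum on `W_n^c ⊕ I_{n+1}^d`. -/
noncomputable def twistQ : TriangularTwist f n (Fin d) (Fin c) where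
  -- In `σ₁`-coordinates on `I_{n+1}^d` the lower right block acts through `σ(D)`, and its residue
  -- cocycle acquires one Frobenius. The two factors change places because now the upper right block
  -- is the one that raises the filtration.
  A {E} a b h := (𝒢.g a b h).D.map (σ p n E)
  D a b h := (𝒢.g a b h).A
  β {E} a b h :=
    { toFun := fun l => (𝒢.g a b h).C.map (σ₁ p n) *ᵥ fun i => σ p n E (l i)
      map_zero' := by
        simp only [Pi.zero_apply, map_zero]
        exact Matrix.mulVec_zero _
      map_add' := fun x y => by
        simp only [Pi.add_apply, map_add]
        exact Matrix.mulVec_add _ _ _ }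
  κ {E} a b h :=
    { toFun := fun y => (𝒢.g a b h).B *ᵥ fun i => toW p n (VEquiv p n (y i))
      map_zero' := by
        simp only [Pi.zero_apply, map_zero]
        exact Matrix.mulVec_zero _
      map_add' := fun x y => by
        simp only [Pi.add_apply, map_add]
        exact Matrix.mulVec_add _ _ _ }
  β_mem a b h k y hy i := mulVec_mem_vfil _ (fun j => σ_mem_vfil (hy j)) i
  κ_mem a b h k x hx i := mulVec_mem_vfil _ (fun j => toW_VEquiv_mem_vfil (hx j)) i
  CA := 𝒢.residueD.frobPow 1
  CD := 𝒢.residueA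
  CA_eq {E} a b h := by
    ext1 i j
    refine (frob_pow_apply 1 _).trans ?_
    rw [pow_one]
    exact (res_mapW (frob p E) _).symm
  CD_eq _ _ _ := rfl
  act {E} a b h := ((swapσ₁ p n c d E).symm.toAddMonoidHom.comp
    (𝒢.g a b h).actQ.toAddMonoidHom).comp (swapσ₁ p n c d E).toAddMonoidHom
  act_apply {E} a b h x := by
    refine Prod.ext (funext fun i => ?_) ?_
    · refine (BlockMat.σ₁_actQ _ _ i).trans ((add_comm _ _).trans ?_)
      refine congrArg₂ _ ?_ rfl
      refine congrArg (fun v => (_ *ᵥ v) i) (funext fun j => ?_)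
      exact (VEquiv p n).symm_apply_apply _
    · exact add_comm _ _
  act_map {E E'} a b h k h' x := by
    refine (swapσ₁ p n c d E').injective ?_
    rw [swapσ₁_map]
    change BlockMat.mapQ _ (swapσ₁ p n c d E ((swapσ₁ p n c d E).symm _)) =
      swapσ₁ p n c d E' ((swapσ₁ p n c d E').symm _)
    rw [AddEquiv.apply_symm_apply, AddEquiv.apply_symm_apply]
    refine (BlockMat.mapQ_actQ _ _ _).trans ?_
    rw [𝒢.map a b h k h']
    exact congrArg _ (swapσ₁_map k x).symm
  act_mul {E} a b c' h h' x := by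
    refine congrArg (swapσ₁ p n c d E).symm ?_
    change (𝒢.g b c' h').actQ (swapσ₁ p n c d E ((swapσ₁ p n c d E).symm _)) = _
    rw [AddEquiv.apply_symm_apply]
    refine (BlockMat.actQ_mul _ _ _).symm.trans ?_
    rw [𝒢.mul]
    rfl

/-- Vectors with values in `W_n^c ⊕ W_n^d` that descend. -/
def InvariantP (v : (Fin c → W p n B) × (Fin d → W p n B)) : Prop :=
  ∀ (E : Alg.{u} p) (a b : B ⟶ E) (h : f ≫ a = f ≫ b),
    BlockMat.mapP (b.hom : B →+* E) v = (𝒢.g a b h).actP (BlockMat.mapP (a.hom : B →+* E) v)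

/-- Vectors with values in `W_n^c ⊕ I_{n+1}^d` that descend. -/
def InvariantQ (v : (Fin c → W p n B) × (Fin d → I p n B)) : Prop :=
  ∀ (E : Alg.{u} p) (a b : B ⟶ E) (h : f ≫ a = f ≫ b),
    BlockMat.mapQ (b.hom : B →+* E) v = (𝒢.g a b h).actQ (BlockMat.mapQ (a.hom : B →+* E) v)

/-- Any lift of `t`, completed by zero, has a defect whose second component reduces to zero because
`t` is invariant for the residue cocycle. It can then be corrected without changing its residue. -/
theorem exists_invariantP (hf : (f.hom : R →+* B).FaithfullyFlat) (t : Fin d → B)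
    (ht : 𝒢.residueD.Invariant t) : ∃ v, 𝒢.InvariantP v ∧ ∀ i, res p n B (v.2 i) = t i := by
  choose t' ht' using fun i => res_surjective (p := p) (n := n) (t i)
  obtain ⟨v, hv, h⟩ := 𝒢.twistP.exists_invariant hf (0, t') fun {E} a b h =>
    ⟨fun i => mem_vfil.2 fun j hj => absurd hj (Nat.not_lt_zero _), fun i => by
      rw [← ker_res, RingHom.mem_ker]
      have e : (𝒢.twistP.twist.defect (0, t') a b h).2 i =
        Wm n b (t' i) - (((𝒢.g a b h).C.map (toW p n) *ᵥ fun j => Wm n a 0) i +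
          ((𝒢.g a b h).D *ᵥ fun j => Wm n a (t' j)) i) := rfl
      have h₁ : (((𝒢.g a b h).C.map (toW p n) *ᵥ fun j => Wm n a 0) i) = 0 := by
        simp only [map_zero]
        exact congrFun (Matrix.mulVec_zero _) i
      have h₂ : res p n E (((𝒢.g a b h).D *ᵥ fun j => Wm n a (t' j)) i) =
          (𝒢.residueD.M a b h *ᵥ fun j => a (t j)) i := by
        refine (RingHom.map_mulVec (res p n E) _ _ i).trans ?_
        refine congrArg (fun v => (_ *ᵥ v) i) (funext fun j => ?_)
        exact (res_mapW _ _).trans (congrArg a (ht' j))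
      rw [e, h₁, zero_add, map_sub, h₂, ← ht E a b h]
      exact sub_eq_zero.2 ((res_mapW _ _).trans (congrArg b (ht' i)))⟩
  refine ⟨v, fun E a b h' => sub_eq_zero.1 (h a b h'), fun i => ?_⟩
  have := hv i
  rw [← ker_res, RingHom.mem_ker, map_sub, sub_eq_zero] at this
  exact this.trans (ht' i)

theorem exists_invariantQ (hf : (f.hom : R →+* B).FaithfullyFlat) (l : Fin c → B)
    (hl : 𝒢.residueA.Invariant l) : ∃ v, 𝒢.InvariantQ v ∧ ∀ i, res p n B (v.1 i) = l i := by
  choose l' hl' using fun i => res_surjective (p := p) (n := n) (l i)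
  obtain ⟨v, hv, h⟩ := 𝒢.twistQ.exists_invariant hf (0, l') fun {E} a b h =>
    ⟨fun i => mem_vfil.2 fun j hj => absurd hj (Nat.not_lt_zero _), fun i => by
      rw [← ker_res, RingHom.mem_ker]
      have e : (𝒢.twistQ.twist.defect (0, l') a b h).2 i =
        Wm n b (l' i) - (((𝒢.g a b h).A *ᵥ fun j => Wm n a (l' j)) i +
          ((𝒢.g a b h).B *ᵥ fun j => toW p n (VEquiv p n (Wm n a 0))) i) := rfl
      have h₁ : ((𝒢.g a b h).B *ᵥ fun j => toW p n (VEquiv p n (Wm n a 0))) i = 0 := by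
        simp only [map_zero]
        exact congrFun (Matrix.mulVec_zero _) i
      have h₂ : res p n E (((𝒢.g a b h).A *ᵥ fun j => Wm n a (l' j)) i) =
          (𝒢.residueA.M a b h *ᵥ fun j => a (l j)) i := by
        refine (RingHom.map_mulVec (res p n E) _ _ i).trans ?_
        refine congrArg (fun v => (_ *ᵥ v) i) (funext fun j => ?_)
        exact (res_mapW _ _).trans (congrArg a (hl' j))
      rw [e, h₁, add_zero, map_sub, h₂, ← hl E a b h]
      exact sub_eq_zero.2 ((res_mapW _ _).trans (congrArg b (hl' i)))⟩
  refine ⟨swapσ₁ p n c d B v, fun E a b h' => ?_, fun i => ?_⟩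
  · have h₀ := congrArg (swapσ₁ p n c d E) (sub_eq_zero.1 (h a b h'))
    refine (swapσ₁_map b v).symm.trans (h₀.trans ?_)
    change swapσ₁ p n c d E ((swapσ₁ p n c d E).symm _) = _
    rw [AddEquiv.apply_symm_apply]
    exact congrArg _ (swapσ₁_map a v)
  · have := hv i
    rw [← ker_res, RingHom.mem_ker, map_sub, sub_eq_zero] at this
    exact this.trans (hl' i)

end BlockCocycle

end BlockCocycle

/-! ### Making a cocycle of block matrices block diagonal. -/

section Diagonalization

variable {p n c d : ℕ} [Fact p.Prime] [NeZero n] {R B : Alg.{u} p} {f : R ⟶ B}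

omit [NeZero n] in
theorem BlockMat.actP_lower {K : Type u} [CommRing K] [Algebra (ZMod p) K]
    (k : Matrix (Fin d) (Fin c) (I p n K)) (x) :
    (lower k).actP x = (x.1, k.map (toW p n) *ᵥ x.1 + x.2) := by
  refine Prod.ext ?_ ?_
  · change (1 : Matrix (Fin c) (Fin c) (W p n K)) *ᵥ x.1 +
      (0 : Matrix (Fin c) (Fin d) (W p n K)) *ᵥ x.2 = x.1
    rw [Matrix.one_mulVec, Matrix.zero_mulVec, add_zero]
  · exact congrArg (k.map (toW p n) *ᵥ x.1 + ·) (Matrix.one_mulVec x.2)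

-- Scalars from `W_n(R)` have the same image under both maps to the overlap. Hence the vectors that
-- descend form a `W_n(R)`-module.
omit [NeZero n] in
theorem Wm_Wm_eq {E : Alg.{u} p} {a b : B ⟶ E} (h : f ≫ a = f ≫ b) (r : W p n R) :
    Wm n b (Wm n f r) = Wm n a (Wm n f r) := by
  have e : ∀ k : B ⟶ E, Wm n k (Wm n f r) = Wm n (f ≫ k) r := fun k =>
    (mapW_comp p n (k.hom : B →+* E) (f.hom : R →+* B) r).symm
  rw [e, e, h]

namespace BlockCocycle

variable (𝒢 : BlockCocycle f n c d)

/-- The group of vectors with values in `W_n^c ⊕ W_n^d` that descend. -/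
noncomputable def invariantsP : AddSubgroup ((Fin c → W p n B) × (Fin d → W p n B)) where
  carrier := {v | 𝒢.InvariantP v}
  add_mem' {v w} hv hw E a b h := by rw [map_add, map_add, map_add, hv E a b h, hw E a b h]
  zero_mem' _ a b h := by rw [map_zero, map_zero, map_zero]
  neg_mem' {v} hv E a b h := by rw [map_neg, map_neg, map_neg, hv E a b h]

/-- The group of vectors with values in `W_n^c ⊕ I_{n+1}^d` that descend. -/
noncomputable def invariantsQ : AddSubgroup ((Fin c → W p n B) × (Fin d → I p n B)) where
  carrier := {v | 𝒢.InvariantQ v}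
  add_mem' {v w} hv hw E a b h := by rw [map_add, map_add, map_add, hv E a b h, hw E a b h]
  zero_mem' _ a b h := by rw [map_zero, map_zero, map_zero]
  neg_mem' {v} hv E a b h := by rw [map_neg, map_neg, map_neg, hv E a b h]

omit [NeZero n] in
theorem smul_mem_invariantsP (r : W p n R) (v) (hv : v ∈ 𝒢.invariantsP) :
    Wm n f r • v ∈ 𝒢.invariantsP := fun E a b h => by
  rw [LinearMap.map_smulₛₗ, LinearMap.map_smulₛₗ, LinearMap.map_smul, hv E a b h]
  exact congrArg (· • _) (Wm_Wm_eq h r)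

omit [NeZero n] in
theorem smul_mem_invariantsQ (r : W p n R) (v) (hv : v ∈ 𝒢.invariantsQ) :
    Wm n f r • v ∈ 𝒢.invariantsQ := fun E a b h => by
  rw [LinearMap.map_smulₛₗ, LinearMap.map_smulₛₗ, LinearMap.map_smul, hv E a b h]
  exact congrArg (· • _) (Wm_Wm_eq h r)

/-- The first column of a matrix that diagonalizes the cocycle. -/
theorem exists_column_fst (hf : (f.hom : R →+* B).FaithfullyFlat) :
    ∃ (L : Type u) (_ : AddCommGroup L) (_ : Module (W p n R) L)
      (l : L →ₛₗ[Wm n f] (Fin c → W p n B) × (Fin d → I p n B))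
      (A : L →ₛₗ[Wm n f] (Fin c → W p n B)), Module.Finite (W p n R) L ∧
      Module.Projective (W p n R) L ∧ LinearizationBijective A ∧ (∀ x, (l x).1 = A x) ∧
      ∀ x, 𝒢.InvariantQ (l x) := by
  -- The residue cocycle descends to `L₀` over `R`, which lifts to `L` over `W_n(R)`. As `L` is
  -- projective, its map to `B^c` lifts to a map into the vectors that descend.
  obtain ⟨L₀, _, _, u, _, _, hu, hinv⟩ := 𝒢.residueA.exists_descent hf
  obtain ⟨L, _, _, ρ, hL, hL', hρ⟩ := exists_projective_lift (res p n R) res_surjective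
    (ker_res_pow) (N := L₀)
  have t : RingHomCompTriple (res p n R) (f.hom : R →+* B) ((res p n B).comp (Wm n f)) :=
    ⟨RingHom.ext fun x => (res_mapW _ x).symm⟩
  obtain ⟨q, hq, hq'⟩ := exists_linearizationBijective_fin (res p n B) c
  obtain ⟨l, hl, hl'⟩ := exists_semilinear_lift (τ := Wm n f) (ε := res p n B)
    (q.comp (LinearMap.fst (W p n B) (Fin c → W p n B) (Fin d → I p n B)))
    (u.comp ρ : L →ₛₗ[(res p n B).comp (Wm n f)] (Fin c → B)) 𝒢.invariantsQ
    𝒢.smul_mem_invariantsQ fun x => by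
      obtain ⟨v, hv, h⟩ := 𝒢.exists_invariantQ hf (u (ρ x)) ((hinv _).2 ⟨_, rfl⟩)
      exact ⟨v, hv, funext fun i => (hq' _ i).trans (h i)⟩
  refine ⟨L, inferInstance, inferInstance, l,
    (LinearMap.fst (W p n B) (Fin c → W p n B) (Fin d → I p n B)).comp l, hL, hL', ?_,
    fun _ => rfl, hl⟩
  exact linearizationBijective_of_comp res_surjective ker_res_le_jacobson hq _
    (u.comp ρ : L →ₛₗ[(res p n B).comp (Wm n f)] (Fin c → B)) (hρ.comp hu) hl'

/-- The second column of a matrix that diagonalizes the cocycle. -/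
theorem exists_column_snd (hf : (f.hom : R →+* B).FaithfullyFlat)
    (k : Matrix (Fin d) (Fin c) (I p n B)) :
    ∃ (T : Type u) (_ : AddCommGroup T) (_ : Module (W p n R) T)
      (t : T →ₛₗ[Wm n f] (Fin c → W p n B) × (Fin d → W p n B))
      (D : T →ₛₗ[Wm n f] (Fin d → W p n B)), Module.Finite (W p n R) T ∧
      Module.Projective (W p n R) T ∧ LinearizationBijective D ∧ (∀ x, (t x).2 = D x) ∧
      ∀ x, 𝒢.InvariantP ((BlockMat.lower k).actP (t x)) := by
  obtain ⟨T₀, _, _, u, _, _, hu, hinv⟩ := 𝒢.residueD.exists_descent hf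
  obtain ⟨T, _, _, ρ, hT, hT', hρ⟩ := exists_projective_lift (res p n R) res_surjective
    (ker_res_pow) (N := T₀)
  have t : RingHomCompTriple (res p n R) (f.hom : R →+* B) ((res p n B).comp (Wm n f)) :=
    ⟨RingHom.ext fun x => (res_mapW _ x).symm⟩
  obtain ⟨q, hq, hq'⟩ := exists_linearizationBijective_fin (res p n B) d
  obtain ⟨l, hl, hl'⟩ := exists_semilinear_lift (τ := Wm n f) (ε := res p n B)
    (q.comp (LinearMap.snd (W p n B) (Fin c → W p n B) (Fin d → W p n B)))
    (u.comp ρ : T →ₛₗ[(res p n B).comp (Wm n f)] (Fin d → B)) 𝒢.invariantsP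
    𝒢.smul_mem_invariantsP fun x => by
      obtain ⟨v, hv, h⟩ := 𝒢.exists_invariantP hf (u (ρ x)) ((hinv _).2 ⟨_, rfl⟩)
      exact ⟨v, hv, funext fun i => (hq' _ i).trans (h i)⟩
  -- The descending vectors are multiplied by `(1, 0; -k, 1)`, so that `(1, 0; k, 1)` takes them
  -- back. The second component changes only in the kernel of the reduction, as `k` has entries in
  -- `I_{n+1}`, so it remains a scalar extension.
  refine ⟨T, inferInstance, inferInstance, (BlockMat.lower (-k)).actP.comp l,
    (LinearMap.snd (W p n B) (Fin c → W p n B) (Fin d → W p n B)).comp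
      ((BlockMat.lower (-k)).actP.comp l), hT, hT', ?_, fun _ => rfl, fun x => ?_⟩
  · refine linearizationBijective_of_comp res_surjective ker_res_le_jacobson hq _
      (u.comp ρ : T →ₛₗ[(res p n B).comp (Wm n f)] (Fin d → B)) (hρ.comp hu) fun x => ?_
    rw [← hl']
    funext i
    refine (hq' _ i).trans (Eq.trans ?_ (hq' _ i).symm)
    change res p n B (((BlockMat.lower (-k)).actP (l x)).2 i) = res p n B ((l x).2 i)
    rw [BlockMat.actP_lower]
    change res p n B (((-k).map (toW p n) *ᵥ (l x).1) i + (l x).2 i) = _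
    rw [map_add, add_eq_right]
    refine (RingHom.map_mulVec (res p n B) _ _ i).trans ?_
    have : ∀ v, (((-k).map (toW p n)).map (res p n B) *ᵥ v) i = 0 := fun v => by
      rw [res_map_toW, Matrix.zero_mulVec]
      rfl
    exact this _
  · change 𝒢.InvariantP ((BlockMat.lower k).actP ((BlockMat.lower (-k)).actP (l x)))
    rw [← BlockMat.actP_mul, BlockMat.lower_mul_lower, add_neg_cancel, BlockMat.lower_zero,
      BlockMat.actP_one]
    exact hl x

/-- A cocycle of block matrices becomes block diagonal after a change of coordinates, and the
diagonal blocks are given by finite projective modules over `W_n(R)`. -/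
theorem exists_diagonalization (hf : (f.hom : R →+* B).FaithfullyFlat) :
    ∃ (L : Type u) (_ : AddCommGroup L) (_ : Module (W p n R) L)
      (T : Type u) (_ : AddCommGroup T) (_ : Module (W p n R) T)
      (A : L →ₛₗ[Wm n f] (Fin c → W p n B)) (D : T →ₛₗ[Wm n f] (Fin d → W p n B))
      (γ : (BlockMat p n c d B)ˣ), Module.Finite (W p n R) L ∧ Module.Projective (W p n R) L ∧
      Module.Finite (W p n R) T ∧ Module.Projective (W p n R) T ∧
      LinearizationBijective A ∧ LinearizationBijective D ∧
      (∀ l, 𝒢.InvariantQ (γ.1.actQ (A l, 0))) ∧ ∀ t, 𝒢.InvariantP (γ.1.actP (0, D t)) := by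
  obtain ⟨L, _, _, l, A, hL, hL', hA, hl, hlinv⟩ := 𝒢.exists_column_fst hf
  -- Since `A` is a scalar extension, the second component of `l` is a linear function of the first,
  -- given by a matrix `k`. Thus `l` is `(A, 0)` multiplied by the lower triangular matrix of `k`.
  obtain ⟨κ, hκ⟩ := hA.exists_lift (τ' := RingHom.id (W p n B))
    ((LinearMap.snd (W p n B) (Fin c → W p n B) (Fin d → I p n B)).comp l)
  let k : Matrix (Fin d) (Fin c) (I p n B) :=
    Matrix.of fun i j => κ (fun j' => if j = j' then 1 else 0) i
  have hk : ∀ x i, ∑ j, x j • k i j = κ x i := fun x i => by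
    rw [κ.pi_apply_eq_sum_univ x, Finset.sum_apply]
    rfl
  obtain ⟨T, _, _, t, D, hT, hT', hD, ht, htinv⟩ := 𝒢.exists_column_snd hf k
  -- In the same way `t` is `(0, D)` multiplied by an upper triangular matrix, which fixes `(A, 0)`.
  -- The product of the two triangular matrices therefore carries both columns.
  obtain ⟨β, hβ⟩ := hD.exists_lift (τ' := RingHom.id (W p n B))
    ((LinearMap.fst (W p n B) (Fin c → W p n B) (Fin d → W p n B)).comp t)
  let b : Matrix (Fin c) (Fin d) (W p n B) := LinearMap.toMatrix' β
  have hb : ∀ x, b *ᵥ x = β x := fun x => LinearMap.toMatrix'_mulVec β x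
  refine ⟨L, inferInstance, inferInstance, T, inferInstance, inferInstance, A, D,
    BlockMat.lowerUnit k * BlockMat.upperUnit b, hL, hL', hT, hT', hA, hD, fun x => ?_, fun x => ?_⟩
  · have e : ((BlockMat.lowerUnit k * BlockMat.upperUnit b).1).actQ (A x, 0) = l x := by
      refine (BlockMat.actQ_mul (BlockMat.lower k) (BlockMat.upper b) _).trans ?_
      rw [BlockMat.actQ_upper_inl, BlockMat.actQ_lower]
      refine Prod.ext (hl x).symm (funext fun i => ?_)
      change ∑ j, A x j • k i j + 0 = _
      rw [add_zero, hk, hκ]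
      rfl
    rw [e]
    exact hlinv x
  · have e : ((BlockMat.lowerUnit k * BlockMat.upperUnit b).1).actP (0, D x) =
        (BlockMat.lower k).actP (t x) := by
      refine (BlockMat.actP_mul (BlockMat.lower k) (BlockMat.upper b) _).trans (congrArg _ ?_)
      rw [BlockMat.actP_upper]
      refine Prod.ext ?_ (ht x).symm
      change 0 + b *ᵥ D x = _
      rw [zero_add, hb, hβ]
      rfl
    rw [e]
    exact htinv x

end BlockCocycle

omit [NeZero n] in
/-- A block matrix that preserves the components of semilinear scalar extensions is block
diagonal. -/
theorem BlockMat.eq_diag {E : Alg.{u} p} {k k' : R ⟶ E} {L T : Type u} [AddCommGroup L]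
    [Module (W p n R) L] [AddCommGroup T] [Module (W p n R) T]
    {A : L →ₛₗ[Wm n k] (Fin c → W p n E)} {D : T →ₛₗ[Wm n k] (Fin d → W p n E)}
    (hA : LinearizationBijective A) (hD : LinearizationBijective D)
    {A' : L →ₛₗ[Wm n k'] (Fin c → W p n E)} {D' : T →ₛₗ[Wm n k'] (Fin d → W p n E)}
    (δ : BlockMat p n c d E) (hQ : ∀ l, δ.actQ (A l, 0) = (A' l, 0))
    (hP : ∀ t, δ.actP (0, D t) = (0, D' t)) :
    δ.B = 0 ∧ δ.C = 0 ∧ (∀ l, δ.A *ᵥ A l = A' l) ∧ ∀ t, δ.D *ᵥ D t = D' t := by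
  have hP₁ : ∀ t, δ.B *ᵥ D t = 0 := fun t => by
    have := congrArg Prod.fst (hP t)
    simpa [actP_apply] using this
  have hP₂ : ∀ t, δ.D *ᵥ D t = D' t := fun t => by
    have := congrArg Prod.snd (hP t)
    simpa [actP_apply] using this
  have hQ₁ : ∀ l, δ.A *ᵥ A l = A' l := fun l => by
    have := congrArg Prod.fst (hQ l)
    simp only [actQ_apply, Pi.zero_apply, map_zero] at this
    rwa [show (fun _ : Fin d => (0 : W p n E)) = 0 from rfl, Matrix.mulVec_zero, add_zero] at this
  have hQ₂ : ∀ l i, ∑ j, A l j • δ.C i j = 0 := fun l i => by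
    have := congrFun (congrArg Prod.snd (hQ l)) i
    simpa [actQ_apply] using this
  refine ⟨?_, ?_, hQ₁, hP₂⟩
  · have h : ∀ x, Matrix.mulVecLin δ.B x = 0 := LinearMap.congr_fun (hD.ext (w := Matrix.mulVecLin δ.B) (w' := 0) hP₁)
    ext1 i j
    have := congrFun (h (Pi.single j 1)) i
    simpa using this
  · ext1 i j
    let w : (Fin c → W p n E) →ₗ[W p n E] I p n E :=
      ∑ j, (LinearMap.proj (R := W p n E) (φ := fun _ : Fin c => W p n E) j).smulRight (δ.C i j)
    have h : ∀ x, w x = 0 := LinearMap.congr_fun (hA.ext (w := w) (w' := 0) fun l => by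
      simpa [w] using hQ₂ l i)
    have := h (Pi.single j 1)
    simpa [w, Pi.single_apply] using this

end Diagonalization

/-! ### Descent of displays with block diagonal cocycles -/

section DescentDisplay

variable {p n c d : ℕ} [Fact p.Prime] [NeZero n] {R B : Alg.{u} p} {f : R ⟶ B}

/-- Bijectivity of a linear map over `W_n(R)` can be checked on a covering. -/
theorem EtaleCover.bijective_W (U : EtaleCover R) {M N : Type u} [AddCommGroup M]
    [Module (W p n R) M] [Module.Finite (W p n R) M] [Module.Projective (W p n R) M]
    [AddCommGroup N] [Module (W p n R) N] [Module.Finite (W p n R) N]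
    [Module.Projective (W p n R) N] (φ : M →ₗ[W p n R] N)
    (h : ∀ i, ∃ (N' : Type u) (_ : AddCommGroup N') (_ : Module (W p n (U.B i)) N')
      (v : N →ₛₗ[Wm n (U.f i)] N'), LinearizationBijective v ∧
        LinearizationBijective (v.comp φ : M →ₛₗ[Wm n (U.f i)] N')) :
    Function.Bijective φ := by
  obtain ⟨M₀, _, _, μ, hμ⟩ := LinearizationBijective.exists_extension (res p n R) M
  obtain ⟨N₀, _, _, ν, hν⟩ := LinearizationBijective.exists_extension (res p n R) N
  obtain ⟨e, he⟩ := hμ.exists_lift (τ' := RingHom.id R) (ν.comp φ : M →ₛₗ[res p n R] N₀)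
  -- By Nakayama it suffices to treat the reduction over `R`, where the étale cover is faithfully
  -- flat. The scalar extensions over `W_n(U.B i)` induce scalar extensions between the reductions.
  have hbij : Function.Bijective e := by
    refine U.bijective e fun i => ?_
    obtain ⟨N', _, _, v, hv, hvφ⟩ := h i
    obtain ⟨N'₀, _, _, ν', hν'⟩ := LinearizationBijective.exists_extension (res p n (U.B i)) N'
    have t₁ : RingHomCompTriple (Wm n (U.f i)) (res p n (U.B i))
      (((U.f i).hom : R →+* U.B i).comp (res p n R)) := ⟨RingHom.ext fun x => res_mapW _ x⟩
    have t₂ : RingHomCompTriple (res p n R) ((U.f i).hom : R →+* U.B i)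
      (((U.f i).hom : R →+* U.B i).comp (res p n R)) := ⟨rfl⟩
    obtain ⟨w, hw⟩ := hν.exists_lift (τ' := ((U.f i).hom : R →+* U.B i))
      (ν'.comp v : N →ₛₗ[((U.f i).hom : R →+* U.B i).comp (res p n R)] N'₀)
    have hw' : LinearizationBijective w := by
      refine hν.of_comp (τ'' := ((U.f i).hom : R →+* U.B i).comp (res p n R)) ?_
      rw [show (w.comp ν : N →ₛₗ[((U.f i).hom : R →+* U.B i).comp (res p n R)] N'₀) = ν'.comp v
        from LinearMap.ext hw]
      exact hv.comp hν'
    refine ⟨N'₀, _, _, w, hw', ?_⟩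
    refine hμ.of_comp (τ'' := ((U.f i).hom : R →+* U.B i).comp (res p n R)) ?_
    have h₀ : LinearizationBijective (ν'.comp (v.comp φ : M →ₛₗ[Wm n (U.f i)] N') :
      M →ₛₗ[((U.f i).hom : R →+* U.B i).comp (res p n R)] N'₀) := hvφ.comp hν'
    convert h₀ using 1
    exact LinearMap.ext fun x => (congrArg w (he x)).trans (hw (φ x))
  refine bijective_of_linearizationBijective_comp res_surjective ker_res_le_jacobson hν φ ?_
  exact hμ.of_unique_lift e hbij he

omit [NeZero n] in
theorem BlockMat.linearizationBijective_mapP {E : Alg.{u} p} (k : B ⟶ E) :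
    LinearizationBijective (BlockMat.mapP (p := p) (n := n) (c := c) (d := d) (k.hom : B →+* E)) := by
  obtain ⟨u, hu, hu'⟩ := exists_linearizationBijective_fin (Wm n k) c
  obtain ⟨v, hv, hv'⟩ := exists_linearizationBijective_fin (Wm n k) d
  exact hu.prod hv fun x => Prod.ext (funext fun i => (hu' _ i).symm)
    (funext fun i => (hv' _ i).symm)

omit [NeZero n] in
theorem elim_stdΨ {E : Type u} [CommRing E] [Algebra (ZMod p) E]
    (Ψ : Matrix (Fin c ⊕ Fin d) (Fin c ⊕ Fin d) (W p n E))
    (x : (Fin c → W p n E) × (Fin d → W p n E)) :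
    Sum.elim (stdΨ Ψ x).1 (stdΨ Ψ x).2 = Ψ *ᵥ fun i => σ p n E (Sum.elim x.1 x.2 i) :=
  funext fun i => by rcases i with i | i <;> rfl

omit [NeZero n] in
theorem mapP_stdΨ {E : Alg.{u} p} (k : B ⟶ E)
    (Ψ : Matrix (Fin c ⊕ Fin d) (Fin c ⊕ Fin d) (W p n B))
    (x : (Fin c → W p n B) × (Fin d → W p n B)) :
    BlockMat.mapP (k.hom : B →+* E) (stdΨ Ψ x) =
      stdΨ (Ψ.map (Wm n k)) (BlockMat.mapP (k.hom : B →+* E) x) := by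
  apply BlockMat.sum_elim_injective
  rw [elim_stdΨ]
  have h₁ : Sum.elim (BlockMat.mapP (k.hom : B →+* E) (stdΨ Ψ x)).1
      (BlockMat.mapP (k.hom : B →+* E) (stdΨ Ψ x)).2 =
        fun i => Wm n k (Sum.elim (stdΨ Ψ x).1 (stdΨ Ψ x).2 i) :=
    funext fun i => by rcases i with i | i <;> rfl
  rw [h₁, elim_stdΨ]
  funext i
  refine (RingHom.map_mulVec (Wm n k) _ _ i).trans ?_
  refine congrArg (fun v => (_ *ᵥ v) i) (funext fun j => ?_)
  rcases j with j | j <;> exact mapW_σ p n _ _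

omit [NeZero n] in
/-- For block diagonal `δ`, the map `Ψ` is compatible with the action of `δ`. -/
theorem actP_stdΨ {E : Alg.{u} p} {δ : BlockMat p n c d E} (hB : δ.B = 0) (hC : δ.C = 0)
    {Ψ Ψ' : Matrix (Fin c ⊕ Fin d) (Fin c ⊕ Fin d) (W p n E)}
    (h : Ψ' * δ.σ₁Mat = δ.toMat * Ψ) (x) : δ.actP (stdΨ Ψ x) = stdΨ Ψ' (δ.actP x) := by
  -- The blocks on which `σ₁Mat` differs from entrywise `σ` both vanish.
  have e : δ.σ₁Mat = δ.toMat.map (σ p n E) := by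
    rw [BlockMat.σ₁Mat, BlockMat.toMat, Matrix.fromBlocks_map, hB, hC,
      Matrix.map_zero _ (map_zero _), smul_zero, Matrix.map_zero _ (map_zero _),
      Matrix.map_zero _ (map_zero _), Matrix.map_zero _ (map_zero _)]
  apply BlockMat.sum_elim_injective
  rw [← BlockMat.toMat_mulVec, elim_stdΨ, elim_stdΨ, ← BlockMat.toMat_mulVec,
    Matrix.mulVec_mulVec, ← h, ← Matrix.mulVec_mulVec, e]
  refine congrArg _ (funext fun i => ?_)
  exact (RingHom.map_mulVec (σ p n E) δ.toMat _ i).symm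

/-- The cover by a single surjective étale morphism. -/
abbrev EtaleCover.single (f : R ⟶ B) (hf : (f.hom : R →+* B).Etale)
    (hf' : ∀ 𝔮 : PrimeSpectrum R, 𝔮 ∈ Set.range (PrimeSpectrum.comap (f.hom : R →+* B))) :
    EtaleCover R where
  ι := Unit
  B _ := B
  f _ := f
  etale _ := hf
  surjective 𝔮 := ⟨(), hf' 𝔮⟩

section Single

variable {M N : Type u} [AddCommGroup M] [Module (W p n R) M] [Module.Finite (W p n R) M]
  [Module.Projective (W p n R) M] [AddCommGroup N] [Module (W p n B) N]
  (hf : (f.hom : R →+* B).Etale)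
  (hf' : ∀ 𝔮 : PrimeSpectrum R, 𝔮 ∈ Set.range (PrimeSpectrum.comap (f.hom : R →+* B)))
  {u : M →ₛₗ[Wm n f] N} (hu : LinearizationBijective u)

include hf hf' hu

omit [NeZero n] in
theorem injective_of_etale {x y : M} (h : u x = u y) : x = y := by
  exact (EtaleCover.single f hf hf').module_ext (N := fun _ => N) (u := fun _ => u) (fun _ => hu) fun _ => h

omit [NeZero n] in
theorem exists_glue_of_etale (x : N)
    (hx : ∀ (E : Alg.{u} p) (a b : B ⟶ E), f ≫ a = f ≫ b →
      ∃ (O : Type u) (_ : AddCommGroup O) (_ : Module (W p n E) O) (α : N →ₛₗ[Wm n a] O)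
        (β : N →ₛₗ[Wm n b] O), (∀ y, α (u y) = β (u y)) ∧
          LinearizationBijective (α.comp u : M →ₛₗ[Wm n (f ≫ a)] O) ∧ α x = β x) :
    ∃ y, u y = x := by
  obtain ⟨y, hy⟩ := (EtaleCover.single f hf hf').exists_glue_module (N := fun _ => N) (u := fun _ => u) (fun _ => hu)
    (fun _ => x) fun _ _ E a b h => by
      obtain ⟨O, i₁, i₂, α, β, h₁, h₂, h₃⟩ := hx E a b h
      exact ⟨O, i₁, i₂, α, β, ⟨h, h₁, h₂⟩, h₃⟩
  exact ⟨y, hy ()⟩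

theorem bijective_of_etale {M' : Type u} [AddCommGroup M'] [Module (W p n R) M']
    [Module.Finite (W p n R) M'] [Module.Projective (W p n R) M'] (φ : M' →ₗ[W p n R] M)
    (h : LinearizationBijective (u.comp φ : M' →ₛₗ[Wm n f] N)) : Function.Bijective φ :=
  (EtaleCover.single f hf hf').bijective_W φ fun _ => ⟨N, _, _, u, hu, h⟩

end Single

/-- A block diagonal cocycle that is compatible with `Ψ` defines a display. -/
theorem exists_descent_stdΨ (hf : (f.hom : R →+* B).Etale)
    (hf' : ∀ 𝔮 : PrimeSpectrum R, 𝔮 ∈ Set.range (PrimeSpectrum.comap (f.hom : R →+* B)))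
    {L T : Type u} [AddCommGroup L] [Module (W p n R) L] [AddCommGroup T] [Module (W p n R) T]
    [Module.Finite (W p n R) L] [Module.Projective (W p n R) L]
    [Module.Finite (W p n R) T] [Module.Projective (W p n R) T]
    {A : L →ₛₗ[Wm n f] (Fin c → W p n B)} {D : T →ₛₗ[Wm n f] (Fin d → W p n B)}
    (hA : LinearizationBijective A) (hD : LinearizationBijective D)
    (Ψ : GL (Fin c ⊕ Fin d) (W p n B))
    (H : ∀ (E : Alg.{u} p) (a b : B ⟶ E), f ≫ a = f ≫ b → ∃ δ : BlockMat p n c d E,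
      δ.B = 0 ∧ δ.C = 0 ∧ (∀ l t, δ.actP (BlockMat.mapP (a.hom : B →+* E) (A l, D t)) =
        BlockMat.mapP (b.hom : B →+* E) (A l, D t)) ∧
      Ψ.1.map (Wm n b) * δ.σ₁Mat = δ.toMat * Ψ.1.map (Wm n a)) :
    ∃ Ψ' : (L × T) →ₛₗ[σ p n R] (L × T), LinearizationBijective Ψ' ∧
      ∀ x, stdΨ Ψ.1 (A x.1, D x.2) = (A (Ψ' x).1, D (Ψ' x).2) := by
  let u : (L × T) →ₛₗ[Wm n f] (Fin c → W p n B) × (Fin d → W p n B) :=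
    { toFun := fun x => (A x.1, D x.2)
      map_add' := fun x y => by simp
      map_smul' := fun r x => by simp }
  have hu : LinearizationBijective u := hA.prod hD fun _ => rfl
  -- `Ψ` commutes with the block diagonal descent data, so it maps vectors that descend to vectors
  -- that descend.
  have key : ∀ x, ∃ y, u y = stdΨ Ψ.1 (u x) := by
    intro x
    refine exists_glue_of_etale hf hf' hu (stdΨ Ψ.1 (u x)) fun E a b h => ?_
    obtain ⟨δ, hB, hC, hδ, hΨ⟩ := H E b a h.symm
    let ma : (Fin c → W p n B) × (Fin d → W p n B) →ₛₗ[Wm n a]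
      (Fin c → W p n E) × (Fin d → W p n E) := BlockMat.mapP (a.hom : B →+* E)
    let mb : (Fin c → W p n B) × (Fin d → W p n B) →ₛₗ[Wm n b]
      (Fin c → W p n E) × (Fin d → W p n E) := BlockMat.mapP (b.hom : B →+* E)
    have e : ∀ y, δ.actP (mb (u y)) = ma (u y) := fun y => hδ y.1 y.2
    refine ⟨(Fin c → W p n E) × (Fin d → W p n E), inferInstance, inferInstance,
      ma, δ.actP.comp mb, fun y => (e y).symm,
      hu.comp (BlockMat.linearizationBijective_mapP a), ?_⟩
    change BlockMat.mapP (a.hom : B →+* E) _ = δ.actP (BlockMat.mapP (b.hom : B →+* E) _)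
    rw [mapP_stdΨ, mapP_stdΨ, actP_stdΨ hB hC hΨ]
    exact congrArg (stdΨ _) (e x).symm
  choose g hg using key
  have hinj : ∀ x y, u x = u y → x = y := fun x y h => injective_of_etale hf hf' hu h
  let Ψ' : (L × T) →ₛₗ[σ p n R] (L × T) :=
    { toFun := g
      map_add' := fun x y => hinj _ _ (by rw [hg, map_add, map_add, map_add, hg, hg])
      map_smul' := fun r x => hinj _ _ (by
        rw [hg, map_smulₛₗ, map_smulₛₗ, map_smulₛₗ, hg]
        exact congrArg (· • _) (mapW_σ p n _ r).symm) }
  have hΨ' : ∀ x, u (Ψ' x) = stdΨ Ψ.1 (u x) := hg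
  refine ⟨Ψ', ?_, fun x => (hΨ' x).symm⟩
  -- Bijectivity of the linearization is checked after extension to `W_n(B)`, where `Ψ'` becomes the
  -- map of an invertible matrix.
  obtain ⟨M', _, _, v, hv⟩ := LinearizationBijective.exists_extension (σ p n R) (L × T)
  have := hv.finite
  have := hv.projective
  obtain ⟨e, he⟩ := hv.exists_lift (τ' := RingHom.id _) Ψ'
  have t₁ : RingHomCompTriple (σ p n R) (Wm n f) ((Wm n f).comp (σ p n R)) := ⟨rfl⟩
  have t₂ : RingHomCompTriple (Wm n f) (σ p n B) ((Wm n f).comp (σ p n R)) :=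
    ⟨RingHom.ext fun x => (mapW_σ p n _ x).symm⟩
  refine hv.of_unique_lift e (bijective_of_etale hf hf' hu e ?_) he
  refine hv.of_comp (τ' := Wm n f) (τ'' := (Wm n f).comp (σ p n R)) ?_
  have h₀ : LinearizationBijective ((stdΨ Ψ.1).comp u :
    (L × T) →ₛₗ[(Wm n f).comp (σ p n R)] _) := hu.comp (std Ψ).bijective_Ψ
  convert h₀ using 1
  exact LinearMap.ext fun x => (congrArg u (he x)).trans (hΨ' x)

/-- The members of a finite cover are replaced by their product, so that the cocycle lives along a
single homomorphism. -/
theorem QuotientObj.exists_section {𝒢 : GSpace.{u} p} (P : QuotientObj 𝒢) :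
    ∃ (B : Alg.{u} p) (f : P.R ⟶ B) (s : P.P.obj B), (f.hom : P.R →+* B).Etale ∧
      (∀ 𝔮 : PrimeSpectrum P.R, 𝔮 ∈ Set.range (PrimeSpectrum.comap (f.hom : P.R →+* B))) ∧
      P.π s = f := by
  classical
  obtain ⟨U, hU⟩ := P.locally_nonempty
  choose x hx using hU
  have := Fintype.ofFinite U.ι
  let alg (i : U.ι) : Algebra P.R (U.B i) := ((U.f i).hom : P.R →+* U.B i).toAlgebra
  have (i : U.ι) : IsScalarTower (ZMod p) P.R (U.B i) :=
    IsScalarTower.of_algebraMap_eq fun r => ((U.f i).hom.commutes r).symm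
  have (i : U.ι) : Algebra.Etale P.R (U.B i) := U.etale i
  let B : Alg.{u} p := CommAlgCat.of (ZMod p) (∀ i, U.B i)
  let f : P.R ⟶ B := CommAlgCat.ofHom (IsScalarTower.toAlgHom (ZMod p) P.R (∀ i, U.B i))
  let q (i : U.ι) : B ⟶ U.B i := CommAlgCat.ofHom (Pi.evalAlgHom (ZMod p) (fun i => U.B i) i)
  have hfq (i : U.ι) : f ≫ q i = U.f i := rfl
  have hq (i : U.ι) : ((q i).hom : B →+* U.B i).Etale := by
    let _ : Algebra (∀ i, U.B i) (U.B i) := (Pi.evalRingHom (fun i => U.B i) i).toAlgebra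
    have _ : IsScalarTower P.R (∀ i, U.B i) (U.B i) := IsScalarTower.of_algebraMap_eq fun _ => rfl
    have : Algebra.Etale (∀ i, U.B i) (U.B i) := Algebra.Etale.of_restrictScalars P.R _ _
    exact this
  let V : EtaleCover B :=
    { ι := U.ι
      B := U.B
      f := q
      etale := hq
      surjective := fun 𝔮 => by
        obtain ⟨i, 𝔯, h⟩ := PrimeSpectrum.exists_comap_evalRingHom_eq 𝔮
        exact ⟨i, 𝔯, h⟩ }
  -- The zero ring has the empty cover, so a sheaf has at most one section over it. This handles the
  -- overlaps of different factors of the product, over which `0 = 1`.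
  have hsub (E : Alg.{u} p) (hE : Subsingleton E) (y z : P.P.obj E) : y = z := by
    let W : EtaleCover E :=
      { ι := Empty
        B := Empty.elim
        f := fun i => i.elim
        etale := fun i => i.elim
        surjective := fun 𝔮 => (𝔮.2.ne_top (Subsingleton.elim _ _)).elim }
    exact (P.isSheaf E W (fun i => i.elim) fun i => i.elim).unique (fun i => i.elim)
      fun i => i.elim
  obtain ⟨s, hs, -⟩ := P.isSheaf B V x fun i j E a b h => by
    by_cases hij : i = j
    · subst hij
      have hab : a = b := by
        ext y
        have h₁ : a ((Pi.single i y : ∀ i, U.B i) i) = b ((Pi.single i y : ∀ i, U.B i) i) :=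
          congrArg (fun k : B ⟶ E => k (Pi.single i y : ∀ i, U.B i)) h
        rwa [Pi.single_eq_same] at h₁
      rw [hab]
    · refine hsub E (subsingleton_of_zero_eq_one ?_) _ _
      have h₂ : a ((Pi.single i 1 : ∀ i, U.B i) i) = b ((Pi.single i 1 : ∀ i, U.B i) j) :=
        congrArg (fun k : B ⟶ E => k (Pi.single i 1 : ∀ i, U.B i)) h
      rw [Pi.single_eq_same, Pi.single_eq_of_ne (Ne.symm hij)] at h₂
      exact ((map_one a.hom).symm.trans (h₂.trans (map_zero b.hom))).symm
  refine ⟨B, f, s, ?_, fun 𝔮 => ?_, V.base_ext fun i => ?_⟩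
  · have : Algebra.Etale P.R (∀ i, U.B i) := inferInstance
    exact this
  · obtain ⟨i, 𝔯, h⟩ := U.surjective 𝔮
    exact ⟨PrimeSpectrum.comap (Pi.evalRingHom _ i) 𝔯, h⟩
  · exact (P.π_map (q i) s).symm.trans ((congrArg P.π (hs i)).trans (hx i))

end DescentDisplay

/-! ### Sections of torsors with block diagonal cocycles -/

section NormalizedSection

variable {p n c d : ℕ} [Fact p.Prime] [NeZero n]

namespace QuotientObj

variable {B E : Alg.{u} p}

section General

variable {𝒢 : GSpace.{u} p} (P : QuotientObj 𝒢) {f : P.R ⟶ B} {s : P.P.obj B} (hs : P.π s = f)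

include hs in
theorem exists_transition {a b : B ⟶ E} (h : f ≫ a = f ≫ b) :
    ∃! g : 𝒢.G.obj E, g • P.P.map a s = P.P.map b s :=
  P.existsUnique_smul _ _ (by rw [P.π_map, P.π_map, hs, h])

/-- The element of the group that relates the two pullbacks of a section. -/
noncomputable def transition {a b : B ⟶ E} (h : f ≫ a = f ≫ b) : 𝒢.G.obj E :=
  (P.exists_transition hs h).choose

theorem transition_smul {a b : B ⟶ E} (h : f ≫ a = f ≫ b) :
    P.transition hs h • P.P.map a s = P.P.map b s :=
  (P.exists_transition hs h).choose_spec.1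

theorem eq_transition {a b : B ⟶ E} (h : f ≫ a = f ≫ b) {g : 𝒢.G.obj E}
    (hg : g • P.P.map a s = P.P.map b s) : g = P.transition hs h :=
  (P.exists_transition hs h).unique hg (P.transition_smul hs h)

theorem map_transition {E' : Alg.{u} p} {a b : B ⟶ E} (h : f ≫ a = f ≫ b) (k : E ⟶ E')
    (h' : f ≫ a ≫ k = f ≫ b ≫ k) :
    𝒢.G.map k (P.transition hs h) = P.transition hs h' := by
  refine P.eq_transition hs h' ?_
  rw [P.P.map_comp, P.P.map_comp]
  exact (P.map_smul k _ _).symm.trans (congrArg (P.P.map k) (P.transition_smul hs h))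

end General

variable (P : QuotientObj (displayGSpace.{u} p n c d)) {f : P.R ⟶ B} {s : P.P.obj B}
  (hs : P.π s = f)

omit [NeZero n] in
/-- The cocycle defined by a section of a torsor. -/
noncomputable def cocycle : BlockCocycle f n c d where
  g _ _ h := Units.val (α := BlockMat p n c d _) (P.transition hs h)
  map _ _ h k h' := congrArg (Units.val (α := BlockMat p n c d _)) (P.map_transition hs h k h')
  mul a b c h h' := congrArg (Units.val (α := BlockMat p n _ d _))
    (P.eq_transition hs (h.trans h') (g := P.transition hs h' * P.transition hs h) (by
      rw [mul_smul, P.transition_smul, P.transition_smul]))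
  one a := congrArg (Units.val (α := BlockMat p n c d _))
    (P.eq_transition hs rfl (g := 1) (one_smul _ _)).symm

end QuotientObj

namespace BlockCocycle

variable {R B E : Alg.{u} p} {f : R ⟶ B}

-- The relation `hδ` says that `δ` is the cocycle conjugated by `γ`, so it relates the two pullbacks
-- of `v` exactly as the cocycle relates those of `γ v`.
omit [NeZero n] in
theorem actP_of_invariantP (𝒢 : BlockCocycle f n c d) {γ : BlockMat p n c d B} {v}
    (hv : 𝒢.InvariantP (γ.actP v)) {a b : B ⟶ E} (h : f ≫ a = f ≫ b) {δ : BlockMat p n c d E}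
    {β : (BlockMat p n c d E)ˣ} (hβ : β.1 = γ.mapMat (b.hom : B →+* E))
    (hδ : γ.mapMat (b.hom : B →+* E) * δ = 𝒢.g a b h * γ.mapMat (a.hom : B →+* E)) :
    δ.actP (BlockMat.mapP (a.hom : B →+* E) v) = BlockMat.mapP (b.hom : B →+* E) v := by
  have key := hv E a b h
  rw [BlockMat.mapP_actP, BlockMat.mapP_actP, ← BlockMat.actP_mul, ← hδ, BlockMat.actP_mul,
    ← hβ] at key
  have := congrArg β⁻¹.1.actP key
  rw [← BlockMat.actP_mul, ← BlockMat.actP_mul, Units.inv_mul, BlockMat.actP_one,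
    BlockMat.actP_one] at this
  exact this.symm

omit [NeZero n] in
theorem actQ_of_invariantQ (𝒢 : BlockCocycle f n c d) {γ : BlockMat p n c d B} {v}
    (hv : 𝒢.InvariantQ (γ.actQ v)) {a b : B ⟶ E} (h : f ≫ a = f ≫ b) {δ : BlockMat p n c d E}
    {β : (BlockMat p n c d E)ˣ} (hβ : β.1 = γ.mapMat (b.hom : B →+* E))
    (hδ : γ.mapMat (b.hom : B →+* E) * δ = 𝒢.g a b h * γ.mapMat (a.hom : B →+* E)) :
    δ.actQ (BlockMat.mapQ (a.hom : B →+* E) v) = BlockMat.mapQ (b.hom : B →+* E) v := by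
  have key := hv E a b h
  rw [BlockMat.mapQ_actQ, BlockMat.mapQ_actQ, ← BlockMat.actQ_mul, ← hδ, BlockMat.actQ_mul,
    ← hβ] at key
  have := congrArg β⁻¹.1.actQ key
  rw [← BlockMat.actQ_mul, ← BlockMat.actQ_mul, Units.inv_mul, BlockMat.actQ_one,
    BlockMat.actQ_one] at this
  exact this.symm

end BlockCocycle

/-- A block matrix that maps one pair of scalar extensions diagonally to another one. -/
structure BlockMat.IsDiagonal {R B E : Alg.{u} p} {f : R ⟶ B} {L T : Type u} [AddCommGroup L]
    [Module (W p n R) L] [AddCommGroup T] [Module (W p n R) T]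
    (A : L →ₛₗ[Wm n f] (Fin c → W p n B)) (D : T →ₛₗ[Wm n f] (Fin d → W p n B))
    (a b : B ⟶ E) (δ : BlockMat p n c d E) : Prop where
  B_eq : δ.B = 0
  C_eq : δ.C = 0
  A_eq : ∀ l, (δ.A *ᵥ fun i => Wm n a (A l i)) = fun i => Wm n b (A l i)
  D_eq : ∀ t, (δ.D *ᵥ fun i => Wm n a (D t i)) = fun i => Wm n b (D t i)

omit [NeZero n] in
theorem exists_linearizationBijective_comp {R B E : Alg.{u} p} {f : R ⟶ B} {k : ℕ} {L : Type u}
    [AddCommGroup L] [Module (W p n R) L] {A : L →ₛₗ[Wm n f] (Fin k → W p n B)}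
    (hA : LinearizationBijective A) (a : B ⟶ E) :
    ∃ A' : L →ₛₗ[Wm n (f ≫ a)] (Fin k → W p n E), LinearizationBijective A' ∧
      ∀ l, A' l = fun i => Wm n a (A l i) := by
  obtain ⟨u, hu, hu'⟩ := exists_linearizationBijective_fin (Wm n a) k
  exact ⟨u.comp A, hA.comp hu, fun l => funext fun i => hu' _ i⟩

/-- The given section is changed by the inverse of the matrix that diagonalizes its cocycle, and the
new transition elements are the conjugated ones. They preserve both columns and are therefore block
diagonal. -/
theorem exists_normalized_section (P : QuotientObj (displayGSpace.{u} p n c d)) {B : Alg.{u} p}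
    {f : P.R ⟶ B} (hf : (f.hom : P.R →+* B).FaithfullyFlat) {s : P.P.obj B} (hs : P.π s = f) :
    ∃ (L : Type u) (_ : AddCommGroup L) (_ : Module (W p n P.R) L)
      (T : Type u) (_ : AddCommGroup T) (_ : Module (W p n P.R) T)
      (A : L →ₛₗ[Wm n f] (Fin c → W p n B)) (D : T →ₛₗ[Wm n f] (Fin d → W p n B))
      (t : P.P.obj B), Module.Finite (W p n P.R) L ∧ Module.Projective (W p n P.R) L ∧
      Module.Finite (W p n P.R) T ∧ Module.Projective (W p n P.R) T ∧
      LinearizationBijective A ∧ LinearizationBijective D ∧ P.π t = f ∧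
      ∀ (E : Alg.{u} p) (a b : B ⟶ E), f ≫ a = f ≫ b → ∀ g : (displayGSpace.{u} p n c d).G.obj E,
        g • P.P.map a t = P.P.map b t →
          BlockMat.IsDiagonal A D a b (Units.val (α := BlockMat p n c d E) g) := by
  obtain ⟨L, i₁, i₂, T, i₃, i₄, A, D, γ, hL, hL', hT, hT', hA, hD, hQ, hP⟩ :=
    (P.cocycle hs).exists_diagonalization hf
  obtain ⟨γ', hγ'⟩ : ∃ γ' : (displayGSpace.{u} p n c d).G.obj B, γ' = γ := ⟨_, rfl⟩
  refine ⟨L, i₁, i₂, T, i₃, i₄, A, D, γ'⁻¹ • s, hL, hL', hT, hT', hA, hD,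
    (P.π_smul _ _).trans hs, fun E a b h g hg => ?_⟩
  have e : P.P.map a s = (displayGSpace.{u} p n c d).G.map a γ' • P.P.map a (γ'⁻¹ • s) := by
    rw [← P.map_smul, smul_inv_smul]
  have e' : (displayGSpace.{u} p n c d).G.map b γ' • P.P.map b (γ'⁻¹ • s) = P.P.map b s := by
    rw [← P.map_smul, smul_inv_smul]
  have key : (displayGSpace.{u} p n c d).G.map b γ' * g =
      P.transition hs h * (displayGSpace.{u} p n c d).G.map a γ' := by
    rw [← mul_inv_eq_iff_eq_mul]
    refine P.eq_transition hs h ?_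
    rw [mul_smul, mul_smul, e, inv_smul_smul, hg, e']
  have key' : γ.1.mapMat (b.hom : B →+* E) * Units.val (α := BlockMat p n c d E) g =
      (P.cocycle hs).g a b h * γ.1.mapMat (a.hom : B →+* E) := by
    subst hγ'
    exact congrArg (Units.val (α := BlockMat p n c d E)) key
  obtain ⟨β, hβ⟩ : ∃ β : (BlockMat p n c d E)ˣ, β.1 = γ.1.mapMat (b.hom : B →+* E) :=
    ⟨Units.map (BlockMat.mapMatHom (b.hom : B →+* E)) γ, rfl⟩
  obtain ⟨Aa, hAa, hAa'⟩ := exists_linearizationBijective_comp hA a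
  obtain ⟨Da, hDa, hDa'⟩ := exists_linearizationBijective_comp hD a
  obtain ⟨Ab, hAb, hAb'⟩ := exists_linearizationBijective_comp hA b
  obtain ⟨Db, hDb, hDb'⟩ := exists_linearizationBijective_comp hD b
  obtain ⟨h₁, h₂, h₃, h₄⟩ := BlockMat.eq_diag hAa hDa (A' := Ab) (D' := Db)
    (Units.val (α := BlockMat p n c d E) g)
    (fun l => by
      have := (P.cocycle hs).actQ_of_invariantQ (hQ l) h hβ key'
      rw [hAa', hAb']
      refine Eq.trans (congrArg _ ?_) (this.trans ?_) <;>
      exact Prod.ext rfl (funext fun i => by simp [BlockMat.mapQ]))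
    (fun t => by
      have := (P.cocycle hs).actP_of_invariantP (hP t) h hβ key'
      rw [hDa', hDb']
      refine Eq.trans (congrArg _ ?_) (this.trans ?_) <;>
      exact Prod.ext (funext fun i => by simp [BlockMat.mapP]) rfl)
  exact ⟨h₁, h₂, fun l => by rw [← hAa', h₃, hAb'], fun t => by rw [← hDa', h₄, hDb']⟩

end NormalizedSection

/-! ### Effective descent for displays -/

section EffectiveDescent

variable {p n c d : ℕ} [Fact p.Prime]

theorem TDisplay.Hom.ext_mat {X Y : TDisplay.{u} p n} {m m' : TDisplay.Hom X Y}
    (hf : m.base = m'.base) (hA : ∀ x, m.mat.A x = m'.mat.A x) (hB : ∀ x, m.mat.B x = m'.mat.B x)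
    (hC : ∀ x, m.mat.C x = m'.mat.C x) (hD : ∀ x, m.mat.D x = m'.mat.D x) : m = m' := by
  obtain ⟨f, M, h₁, h₂⟩ := m
  obtain ⟨f', M', h₁', h₂'⟩ := m'
  change f = f' at hf
  subst hf
  exact TDisplay.Hom.ext rfl (heq_of_eq (DMatrix.ext (LinearMap.ext hA) (LinearMap.ext hB)
    (LinearMap.ext hC) (LinearMap.ext hD)))

theorem stdMat_C_apply {R S : Alg.{u} p} (f : R ⟶ S) (g : BlockMat p n c d S)
    (Ψ : GL (Fin c ⊕ Fin d) (W p n R)) (Ψ' : GL (Fin c ⊕ Fin d) (W p n S)) (hg : g.C = 0)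
    (l : Fin c → W p n R) : (stdMat f g Ψ Ψ').C l = 0 := by
  refine (coordI d).injective (funext fun i => ?_)
  rw [coordI_stdMat_C, hg, LinearEquiv.map_zero]
  exact Finset.sum_eq_zero fun j _ => smul_zero _

/-- All matrices involved are block diagonal, so the comparison reduces to `δ` carrying the
pullbacks of `A` and `D` along `a` to those along `b`. -/
theorem diagHom_comp_stdHom_eq {R B E : Alg.{u} p} {f : R ⟶ B} {X : Display p n R}
    {Ψ : GL (Fin c ⊕ Fin d) (W p n B)} {A : X.L →ₛₗ[Wm n f] (Fin c → W p n B)}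
    {D : X.T →ₛₗ[Wm n f] (Fin d → W p n B)}
    (h : ∀ x, (std Ψ).Ψ (A x.1, D x.2) = (A (X.Ψ x).1, D (X.Ψ x).2)) {a b : B ⟶ E}
    (hab : f ≫ a = f ≫ b) {δ : BlockMat p n c d E} (hδ : BlockMat.IsDiagonal A D a b δ)
    {Ψ' : GL (Fin c ⊕ Fin d) (W p n E)} (h₁ : IsStdHom a δ Ψ Ψ') (h₂ : IsStdHom b 1 Ψ Ψ') :
    diagHom (X' := std Ψ) A D h ≫ stdHom a δ Ψ Ψ' h₁ =
      diagHom (X' := std Ψ) A D h ≫ stdHom b 1 Ψ Ψ' h₂ := by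
  have hC : ∀ l, (stdMat a δ Ψ Ψ').C l = 0 := stdMat_C_apply a δ Ψ Ψ' hδ.C_eq
  have hC' : ∀ l, (stdMat b 1 Ψ Ψ').C l = 0 := stdMat_C_apply b 1 Ψ Ψ' rfl
  refine TDisplay.Hom.ext_mat hab (fun l => ?_) (fun t => ?_) (fun l => ?_) (fun t => ?_)
  · change (stdMat a δ Ψ Ψ').A (A l) + (stdMat a δ Ψ Ψ').B (evalT _ 0) =
      (stdMat b 1 Ψ Ψ').A (A l) + (stdMat b 1 Ψ Ψ').B (evalT _ 0)
    rw [map_zero, map_zero, map_zero, add_zero, add_zero]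
    exact (hδ.A_eq l).trans (Matrix.one_mulVec _).symm
  · change (stdMat a δ Ψ Ψ').A 0 + δ.B *ᵥ _ =
      (stdMat b 1 Ψ Ψ').A 0 + (0 : Matrix (Fin c) (Fin d) (W p n E)) *ᵥ _
    rw [map_zero, map_zero, hδ.B_eq]
    exact congrArg (_ + ·) ((Matrix.zero_mulVec _).trans (Matrix.zero_mulVec _).symm)
  · change (stdMat a δ Ψ Ψ').C (A l) + (stdMat a δ Ψ Ψ').DI 0 =
      (stdMat b 1 Ψ Ψ').C (A l) + (stdMat b 1 Ψ Ψ').DI 0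
    rw [map_zero, map_zero, hC, hC']
  · change evalT _ ((stdMat a δ Ψ Ψ').C 0) + (stdMat a δ Ψ Ψ').D (D t) =
      evalT _ ((stdMat b 1 Ψ Ψ').C 0) + (stdMat b 1 Ψ Ψ').D (D t)
    rw [map_zero, map_zero, map_zero]
    exact congrArg (_ + ·) ((hδ.D_eq t).trans (Matrix.one_mulVec _).symm)

/-- `δ` is thus also the transition element of the trivialization given by `A` and `D`. The morphism
is compared by `HEq` because its type depends on the matrix of `x`. -/
theorem smul_map_of_isDiagonal {R B E : Alg.{u} p} {f : R ⟶ B} {X : Display p n R}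
    {Ψ : GL (Fin c ⊕ Fin d) (W p n B)} {A : X.L →ₛₗ[Wm n f] (Fin c → W p n B)}
    {D : X.T →ₛₗ[Wm n f] (Fin d → W p n B)}
    (h : ∀ x, (std Ψ).Ψ (A x.1, D x.2) = (A (X.Ψ x).1, D (X.Ψ x).2)) {a b : B ⟶ E}
    (hab : f ≫ a = f ≫ b) (δ : (displayGSpace.{u} p n c d).G.obj E)
    (hδ : BlockMat.IsDiagonal A D a b (Units.val (α := BlockMat p n c d E) δ))
    (hΨ : IsStdHom a (Units.val (α := BlockMat p n c d E) δ) Ψ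
      (Matrix.GeneralLinearGroup.map (Wm n b) Ψ))
    (x : Trivialization c d ⟨R, X⟩ B) (hx : x.Ψ = Ψ) (hx' : HEq x.m (diagHom (X' := std Ψ) A D h)) :
    δ • x.map a = x.map b := by
  obtain ⟨Ψ₀, m, hm⟩ := x
  change Ψ₀ = Ψ at hx
  subst hx
  have hm' : m = diagHom (X' := std Ψ₀) A D h := eq_of_heq hx'
  have e : m ≫ stdHom a (Units.val (α := BlockMat p n c d E) δ) Ψ₀ _ hΨ =
      m ≫ stdHom b 1 Ψ₀ _ (IsStdHom.map b Ψ₀) := by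
    rw [hm']
    exact diagHom_comp_stdHom_eq h hab hδ hΨ (IsStdHom.map b Ψ₀)
  refine (Trivialization.move_eq_smul ⟨Ψ₀, m, hm⟩ hΨ).symm.trans ?_
  simp only [Trivialization.move, Trivialization.map, e]
  rfl

/-- The primes of `W_n(R)` are those of `R`, as the kernel of the reduction is nil, so surjectivity
on spectra passes from `R → B` to Witt vectors. -/
theorem comap_Wm_surjective [NeZero n] {R B : Alg.{u} p} {f : R ⟶ B}
    (hf : ∀ 𝔮 : PrimeSpectrum R, 𝔮 ∈ Set.range (PrimeSpectrum.comap (f.hom : R →+* B)))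
    (𝔮 : PrimeSpectrum (W p n R)) : ∃ 𝔯, PrimeSpectrum.comap (Wm n f) 𝔯 = 𝔮 := by
  have h : 𝔮 ∈ Set.range (PrimeSpectrum.comap (res p n R)) := by
    rw [range_comap_of_surjective _ _ res_surjective]
    exact fun x hx => 𝔮.2.mem_of_pow_mem _
      ((isNilpotent_of_mem_ker_res hx).choose_spec ▸ 𝔮.asIdeal.zero_mem)
  obtain ⟨𝔮', rfl⟩ := h
  obtain ⟨𝔯, rfl⟩ := hf 𝔮'
  refine ⟨PrimeSpectrum.comap (res p n B) 𝔯, ?_⟩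
  rw [← PrimeSpectrum.comap_comp_apply, ← PrimeSpectrum.comap_comp_apply]
  exact congrArg (fun q => PrimeSpectrum.comap q 𝔯) (RingHom.ext fun x => res_mapW _ x)

theorem rankAtStalk_of_linearizationBijective [NeZero n] {R B : Alg.{u} p} {f : R ⟶ B}
    (hf : ∀ 𝔮 : PrimeSpectrum R, 𝔮 ∈ Set.range (PrimeSpectrum.comap (f.hom : R →+* B)))
    {k : ℕ} {L : Type u} [AddCommGroup L] [Module (W p n R) L] [Module.Finite (W p n R) L]
    [Module.Projective (W p n R) L] {A : L →ₛₗ[Wm n f] (Fin k → W p n B)}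
    (hA : LinearizationBijective A) (𝔮 : PrimeSpectrum (W p n R)) :
    Module.rankAtStalk L 𝔮 = k := by
  obtain ⟨𝔯, rfl⟩ := comap_Wm_surjective hf 𝔮
  rw [← hA.rankAtStalk_eq, rankAtStalk_fun]

theorem BlockMat.IsDiagonal.actP_eq {R B E : Alg.{u} p} {f : R ⟶ B} {L T : Type u} [AddCommGroup L]
    [Module (W p n R) L] [AddCommGroup T] [Module (W p n R) T]
    {A : L →ₛₗ[Wm n f] (Fin c → W p n B)} {D : T →ₛₗ[Wm n f] (Fin d → W p n B)}
    {a b : B ⟶ E} {δ : BlockMat p n c d E} (h : BlockMat.IsDiagonal A D a b δ) (l t) :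
    δ.actP (BlockMat.mapP (a.hom : B →+* E) (A l, D t)) =
      BlockMat.mapP (b.hom : B →+* E) (A l, D t) := by
  have e : δ.C.map (toW p n) = 0 := by
    rw [h.C_eq]
    exact Matrix.map_zero _ (map_zero _)
  rw [BlockMat.actP_apply, h.B_eq, e, Matrix.zero_mulVec, Matrix.zero_mulVec, add_zero, zero_add]
  exact Prod.ext (h.A_eq l) (h.D_eq t)

/-- Torsors under the group of block matrices with an equivariant map are torsors of
trivializations of displays. -/
theorem exists_display_of_torsor (p n h d : ℕ) [Fact p.Prime] [NeZero n] (hd : d ≤ h)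
    (P : QuotientObj (displayGSpace.{u} p n (h - d) d)) :
    ∃ (X : Display p n P.R) (h₁ : ∀ 𝔮 : PrimeSpectrum (W p n P.R),
        Module.rankAtStalk (X.L × X.T) 𝔮 = h)
      (h₂ : ∀ 𝔮 : PrimeSpectrum (W p n P.R), Module.rankAtStalk X.T 𝔮 = d)
      (m : (torsorFunctor.{u} p n h d).obj (⟨⟨P.R, X⟩, h₁, h₂⟩ : DispObj p n h d) ⟶ P),
      QuotientObj.Hom.base m = 𝟙 P.R := by
  obtain ⟨B, f, s, hf, hf', hs⟩ := P.exists_section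
  have hff : (f.hom : P.R →+* B).FaithfullyFlat := by
    let _ : Algebra P.R B := (f.hom : P.R →+* B).toAlgebra
    have : Algebra.Etale P.R B := hf
    have : Module.Flat P.R B := inferInstance
    exact Module.FaithfullyFlat.of_comap_surjective fun 𝔮 => hf' 𝔮
  obtain ⟨L, _, _, T, _, _, A, D, t, _, _, _, _, hA, hD, ht, hdiag⟩ :=
    exists_normalized_section P hff hs
  obtain ⟨Ψ, hΨ⟩ : ∃ Ψ : GL (Fin (h - d) ⊕ Fin d) (W p n B), P.φ t = Ψ := ⟨_, rfl⟩
  -- By equivariance of the map to `X`, the transition element carries the pullback of `Ψ` along `a`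
  -- to the pullback along `b`.
  have hstd : ∀ (E : Alg.{u} p) (a b : B ⟶ E) (hab : f ≫ a = f ≫ b),
      IsStdHom a (Units.val (α := BlockMat p n (h - d) d E) (P.transition ht hab)) Ψ
        (Matrix.GeneralLinearGroup.map (Wm n b) Ψ) := fun E a b hab =>
    displayGSpace_hom_eq
      (y := ⟨E, (displayGSpace.{u} p n (h - d) d).X.map b Ψ⟩) (x := ⟨B, Ψ⟩)
      { base := a
        g := P.transition ht hab
        smul_eq := by
          rw [← hΨ, ← P.φ_map, ← P.φ_map, ← P.φ_smul, P.transition_smul] } _ rfl Ψ _ rfl rfl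
  obtain ⟨Ψ', hΨ', hcompat⟩ := exists_descent_stdΨ hf hf' hA hD Ψ fun E a b hab =>
    have h₁ := hdiag E a b hab _ (P.transition_smul ht hab)
    ⟨_, h₁.B_eq, h₁.C_eq, h₁.actP_eq, hstd E a b hab⟩
  let X : Display p n P.R := { L := L, T := T, Ψ := Ψ', bijective_Ψ := hΨ' }
  have hT : ∀ 𝔮 : PrimeSpectrum (W p n P.R), Module.rankAtStalk X.T 𝔮 = d :=
    rankAtStalk_of_linearizationBijective hf' hD
  have hLT : ∀ 𝔮 : PrimeSpectrum (W p n P.R), Module.rankAtStalk (X.L × X.T) 𝔮 = h := fun 𝔮 => by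
    rw [Module.rankAtStalk_prod, Pi.add_apply, hT,
      show Module.rankAtStalk X.L 𝔮 = h - d from rankAtStalk_of_linearizationBijective hf' hA 𝔮]
    exact Nat.sub_add_cancel hd
  let x : Trivialization (h - d) d ⟨P.R, X⟩ B :=
    ⟨Ψ, diagHom (X := X) (X' := std Ψ) A D hcompat,
      .of_isStronglyCocartesian (diagHom_isStronglyCocartesian (X := X) (X' := std Ψ) hcompat hA hD)⟩
  refine ⟨X, hLT, hT, ?_⟩
  refine QuotientObj.exists_hom_of_cocycle (U := EtaleCover.single f hf hf')
    (P := Trivialization.torsor (h - d) d ⟨P.R, X⟩ _) (Q := P) (s := fun _ => x) (t := fun _ => t)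
    (𝟙 P.R) (fun _ => rfl) (fun _ => ht.trans (Category.id_comp _).symm) (fun _ => hΨ)
    (fun _ _ E a b g hg => ?_) (fun V _ _ => V.base_ext) (fun V _ _ => V.GL_ext)
  have hab : f ≫ a = f ≫ b := congrArg Trivialization.base hg
  -- The transition element of `t` also relates the two pullbacks of `x`. By simple transitivity it
  -- equals `g`, so the two torsors have the same cocycle.
  have e := smul_map_of_isDiagonal (X := X) hcompat hab (P.transition ht hab)
    (hdiag E a b hab _ (P.transition_smul ht hab)) (hstd E a b hab) x rfl HEq.rfl
  have hg' : g = P.transition ht hab :=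
    (Trivialization.existsUnique_smul (x.map a) (x.map b) hab).unique hg e
  rw [hg']
  exact P.transition_smul ht hab

end EffectiveDescent

end Disp

theorem mainTheorem12 (p : ℕ) [Fact p.Prime] (n h d : ℕ) (hn : 1 ≤ n) (hd : d ≤ h) :
    ∃ (Φ : BasedFunctor (Disp.quotientStack (Disp.displayGSpace.{u} p n (h - d) d))
        (Disp.dispStack.{u} p n h d))
      (Φ' : BasedFunctor (Disp.dispStack.{u} p n h d)
        (Disp.quotientStack (Disp.displayGSpace.{u} p n (h - d) d))),
      Nonempty (Φ.comp Φ' ≅ BasedFunctor.id _) ∧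
      Nonempty (Φ'.comp Φ ≅ BasedFunctor.id _) ∧
      Nonempty ((Disp.prequotientToQuotient (Disp.displayGSpace.{u} p n (h - d) d)
        (Disp.isEtaleSheaf_Gfun p n (h - d) d)).comp Φ ≅ Disp.stdFunctor p n h d hd) := by
  have : NeZero n := ⟨by omega⟩
  -- Φ is constructed as an inverse of the functor of trivializations. Over each torsor the required
  -- isomorphism comes from effective descent, a morphism of torsors over the identity being
  -- invertible.
  obtain ⟨Φ, h₁, h₂⟩ := Disp.exists_based_inverse (Disp.torsorFunctor.{u} p n h d) fun P => by
    obtain ⟨X, h₁, h₂, m, hm⟩ := Disp.exists_display_of_torsor p n h d hd P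
    have : IsIso (Disp.QuotientObj.Hom.base m) := by
      rw [hm]
      exact inferInstanceAs (IsIso (𝟙 P.R))
    have := Disp.QuotientObj.Hom.isIso m
    refine ⟨(⟨⟨P.R, X⟩, h₁, h₂⟩ : Disp.DispObj p n h d), @asIso _ _ _ _ m this, ?_⟩
    refine IsHomLift.of_fac _ _ _ rfl rfl ?_
    exact ((Category.id_comp _).trans
      ((Category.comp_id _).trans (congrArg Quiver.Hom.op hm))).symm
  refine ⟨Φ, Disp.torsorFunctor p n h d, h₁, h₂, ?_⟩
  obtain ⟨β, hβ⟩ := Disp.exists_standard_iso p n h d hd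
  obtain ⟨γ⟩ := h₂
  exact Disp.exists_based_iso_of_inverse γ β hβ
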